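/- Conventions. Let $\mathbb{K}$ be a field of characteristic $0$. A parameter $\mathbb{K}$-algebra is a complete noetherian local commutative $\mathbb{K}$-algebra $(R,\mathfrak m)$ with $R/\mathfrak m=\mathbb{K}$; put $R_i:=R/\mathfrak m^{i+1}$. Homomorphisms of parameter algebras are $\mathbb{K}$-algebra homomorphisms. Let $C$ be a commutative $\mathbb{K}$-algebra. An associative (resp. Poisson) $R$-deformation of $C$ is a flat, $\mathfrak m$-adically complete associative unital $R$-algebra (resp. commutative $R$-algebra with an $R$-bilinear Poisson bracket) $A$, together with an isomorphism of $\mathbb{K}$-algebras (resp. of Poisson algebras, $C$ having the zero bracket) $\psi:\mathbb{K}\otimes_R A\to C$. Likewise, for a sheaf $\mathcal O$ of commutative $\mathbb{K}$-algebras on a space $Y$, an associative (resp. Poisson) $R$-deformation of $\mathcal O$ is a sheaf $\mathcal A$ of associative (resp. Poisson) $R$-algebras on $Y$ with flat stalks such that $\mathcal A\to\varprojlim_i (R_i\otimes_R\mathcal A)$ is an isomorphism of sheaves, together with an isomorphism $\psi:\mathbb{K}\otimes_R\mathcal A\to\mathcal O$ of sheaves of $\mathbb{K}$-algebras (resp.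 of Poisson algebras). Gauge transformations are $R$-algebra (resp. Poisson $R$-algebra) isomorphisms commuting with the augmentations $\psi$. A crossed groupoid consists of a groupoid (objects and $1$-morphisms), a group $\mathrm{IG}(x)$ of $2$-morphisms for each object $x$, an action (the twisting) $\mathrm{IG}(x)\to\mathrm{IG}(y)$ of the $1$-morphisms $g:x\to y$ by group isomorphisms, and group homomorphisms (the feedback) from $\mathrm{IG}(x)$ to the automorphism group of $x$, which are compatible with the twisting and satisfy the Peiffer identity. A morphism of crossed groupoids is a functor together with compatible group homomorphisms on the groups of $2$-morphisms; it is an equivalence if the functor is an equivalence of groupoids and the homomorphisms of groups of $2$-morphisms are all bijective. $\mathsf{AssDef}(R,C)$ (resp. $\mathsf{PoisDef}(R,C)$) has as objects the associative (resp. Poisson) $R$-deformations of $C$ and as $1$-morphisms the gauge transformations. Its groups of $2$-morphisms are $\mathrm{IG}(A)=\exp(\mathfrak m A)$, the pronilpotent group of the Lie algebra $\mathfrak m A$ (with the commutator, resp. the Poisson bracket), that is, the set $\mathfrak mA$ with the Baker–Campbell–Hausdorff product. The twisting by $g$ is the restriction of $g$ to $\mathfrak mA$, and the feedback is $\exp(\alpha)\mapsto\exp(\operatorname{ad}\alpha)$.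 $\mathsf{AssDef}(R,\mathcal O)$ and $\mathsf{PoisDef}(R,\mathcal O)$ are defined in the same way, with $\mathrm{IG}(\mathcal A)=\Gamma(Y,\exp(\mathfrak m\mathcal A))$. For a homomorphism $R\to R'$ of parameter algebras, base change is $A\mapsto R'\hat\otimes_R A:=\varprojlim_i (R'_i\otimes_R A)$ and $\mathcal A\mapsto R'\hat\otimes_R\mathcal A:=\varprojlim_i (R'_i\otimes_R\mathcal A)$. Theorem. Let $X$ be a smooth algebraic variety over $\mathbb{K}$ (an integral separated smooth $\mathbb{K}$-scheme of finite type), $U\subseteq X$ an affine open set, $C:=\Gamma(U,\mathcal O_X)$, and $R$ a parameter $\mathbb{K}$-algebra. Then: (1) $\mathsf{AssDef}(R,\mathcal O_U)$, $\mathsf{AssDef}(R,C)$, $\mathsf{PoisDef}(R,\mathcal O_U)$ and $\mathsf{PoisDef}(R,C)$ are crossed groupoids. (2) If $\mathcal A$ is an associative (resp. Poisson) $R$-deformation of $\mathcal O_U$, then $\Gamma(U,\mathcal A)$ is an associative (resp. Poisson) $R$-deformation of $C$ and $\Gamma(U,\mathfrak m\mathcal A)=\mathfrak m\,\Gamma(U,\mathcal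 A)$. The resulting morphisms $$\Gamma(U,-):\mathsf{AssDef}(R,\mathcal O_U)\to\mathsf{AssDef}(R,C),\qquad \Gamma(U,-):\mathsf{PoisDef}(R,\mathcal O_U)\to\mathsf{PoisDef}(R,C)$$ are equivalences of crossed groupoids. In particular they are equivalences of groupoids on the $1$-truncations. (3) These equivalences commute with homomorphisms of parameter algebras: for every homomorphism $R\to R'$ of parameter $\mathbb{K}$-algebras, base change takes $R$-deformations of $\mathcal O_U$ (resp. of $C$) to $R'$-deformations and defines morphisms of crossed groupoids, and the canonical maps $R'\hat\otimes_R\Gamma(U,\mathcal A)\to\Gamma(U,R'\hat\otimes_R\mathcal A)$ are gauge transformations which form a natural isomorphism of morphisms of crossed groupoids $$(R'\hat\otimes_R -)\circ\Gamma(U,-)\;\cong\;\Gamma(U,-)\circ(R'\hat\otimes_R -),$$ compatible with $1$-morphisms and with $2$-morphisms, in the associative and in the Poisson case. -/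

import Mathlib

open CategoryTheory TopologicalSpace Opposite
open scoped TensorProduct

universe u

noncomputable section

namespace YDef

/-! ### Crossed groupoids -/

/-- The data of a crossed groupoid: a groupoid `G₁` (the `1`-truncation, bundled as the groupoid
structure on `Ob`), a totally disconnected groupoid `G₂` on the same objects (the family of
automorphism groups `IG x`), the twisting `IG x → IG y` along `g : x ⟶ y`, and the feedback
`D : IG x → G₁(x)`. The axioms are in `IsCrossedGroupoid`. -/
structure PreCrossedGroupoid where
  Ob : Type (u + 1)
  [groupoid : Groupoid.{u} Ob]
  IG : Ob → Type u
  one : ∀ x, IG x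
  mul : ∀ {x}, IG x → IG x → IG x
  inv : ∀ {x}, IG x → IG x
  twist : ∀ {x y : Ob}, (x ⟶ y) → IG x → IG y
  feedback : ∀ {x : Ob}, IG x → (x ⟶ x)

attribute [instance] PreCrossedGroupoid.groupoid

/-- The axioms of a crossed groupoid. The composition `g ∘ f` is written `f ≫ g`. -/
structure PreCrossedGroupoid.IsCrossedGroupoid (G : PreCrossedGroupoid.{u}) : Prop where
  mul_assoc : ∀ {x} (a b c : G.IG x), G.mul (G.mul a b) c = G.mul a (G.mul b c)
  one_mul : ∀ {x} (a : G.IG x), G.mul (G.one x) a = a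
  mul_one : ∀ {x} (a : G.IG x), G.mul a (G.one x) = a
  inv_mul : ∀ {x} (a : G.IG x), G.mul (G.inv a) a = G.one x
  twist_mul : ∀ {x y} (g : x ⟶ y) (a b : G.IG x),
    G.twist g (G.mul a b) = G.mul (G.twist g a) (G.twist g b)
  twist_id : ∀ {x} (a : G.IG x), G.twist (𝟙 x) a = a
  twist_comp : ∀ {x y z} (f : x ⟶ y) (g : y ⟶ z) (a : G.IG x),
    G.twist (f ≫ g) a = G.twist g (G.twist f a)
  feedback_one : ∀ x, G.feedback (G.one x) = 𝟙 x
  feedback_mul : ∀ {x} (a b : G.IG x), G.feedback (G.mul a b) = G.feedback b ≫ G.feedback a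
  feedback_twist : ∀ {x y} (g : x ⟶ y) (a : G.IG x),
    G.feedback (G.twist g a) = Groupoid.inv g ≫ G.feedback a ≫ g
  twist_feedback : ∀ {x} (a b : G.IG x),
    G.twist (G.feedback a) b = G.mul (G.mul a b) (G.inv a)

/-- A pair of maps on `1`-morphisms (a functor) and on `2`-morphisms, equal on objects. -/
structure PreCrossedGroupoid.Map (G H : PreCrossedGroupoid.{u}) where
  functor : G.Ob ⥤ H.Ob
  map₂ : ∀ {x : G.Ob}, G.IG x → H.IG (functor.obj x)

namespace PreCrossedGroupoid.Map

variable {G H J : PreCrossedGroupoid.{u}}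

/-- `Φ` is a morphism of crossed groupoids. -/
structure IsMorphism (Φ : Map G H) : Prop where
  map₂_mul : ∀ {x} (a b : G.IG x), Φ.map₂ (G.mul a b) = H.mul (Φ.map₂ a) (Φ.map₂ b)
  map₂_twist : ∀ {x y} (g : x ⟶ y) (a : G.IG x),
    Φ.map₂ (G.twist g a) = H.twist (Φ.functor.map g) (Φ.map₂ a)
  map_feedback : ∀ {x} (a : G.IG x), Φ.functor.map (G.feedback a) = H.feedback (Φ.map₂ a)

/-- `Φ` is an equivalence of crossed groupoids: a morphism which is an equivalence on the
`1`-truncations and bijective on the groups of `2`-morphisms. -/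
structure IsEquivalence (Φ : Map G H) : Prop extends Φ.IsMorphism where
  isEquivalence : Φ.functor.IsEquivalence
  bijective_map₂ : ∀ x, Function.Bijective (Φ.map₂ (x := x))

/-- Composition, first `Φ` and then `Ψ`. -/
def comp (Φ : Map G H) (Ψ : Map H J) : Map G J where
  functor := Φ.functor ⋙ Ψ.functor
  map₂ a := Ψ.map₂ (Φ.map₂ a)

/-- A natural isomorphism between morphisms of crossed groupoids: a family of `1`-morphisms of
`H`, natural with respect to the `1`-morphisms of `G` and compatible with `2`-morphisms. -/
structure NatIso (Φ Ψ : Map G H) where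
  iso : Φ.functor ≅ Ψ.functor
  twist : ∀ {x} (a : G.IG x), H.twist (iso.hom.app x) (Φ.map₂ a) = Ψ.map₂ a

end PreCrossedGroupoid.Map

/-! ### Parameter algebras -/

local notation "𝔪" => IsLocalRing.maximalIdeal
local notation "𝕜" => IsLocalRing.ResidueField

/-- A parameter `K`-algebra: a complete noetherian local `K`-algebra with residue field `K`. -/
class ParameterAlgebra (K R : Type u) [Field K] [CommRing R] [Algebra K R] [IsLocalRing R] :
    Prop where
  isNoetherianRing : IsNoetherianRing R
  isAdicComplete : IsAdicComplete (𝔪 R) R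
  bijective_residue : Function.Bijective (algebraMap K (𝕜 R))

/-! ### Convergence with respect to a filtration, exponentials and the BCH series -/

section Filtration

variable {R A : Type u} [CommRing R] [AddCommGroup A] [Module R A]

/-- The series `∑ t i` converges to `z` for the topology defined by the filtration `F`. -/
def HasFiltSum (F : ℕ → Submodule R A) (t : ℕ → A) (z : A) : Prop :=
  ∀ n, ∃ N, ∀ k ≥ N, z - ∑ i ∈ Finset.range k, t i ∈ F n

open Classical in
/-- The sum of a convergent series. -/
def filtSum (F : ℕ → Submodule R A) (t : ℕ → A) : A :=
  if h : ∃ z, HasFiltSum F t z then h.choose else 0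

/-- A separated complete filtration. -/
structure IsCompleteFilt (F : ℕ → Submodule R A) : Prop where
  antitone : Antitone F
  sep : ∀ a, (∀ n, a ∈ F n) → a = 0
  complete : ∀ s : ℕ → A, (∀ n, s (n + 1) - s n ∈ F n) → ∃ z, ∀ n, z - s n ∈ F n

variable {F : ℕ → Submodule R A}

theorem HasFiltSum.unique (hF : IsCompleteFilt F) {t : ℕ → A} {z w : A}
    (hz : HasFiltSum F t z) (hw : HasFiltSum F t w) : z = w := by
  rw [← sub_eq_zero]
  refine hF.sep _ fun n => ?_
  obtain ⟨N, hN⟩ := hz n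
  obtain ⟨M, hM⟩ := hw n
  have := (F n).sub_mem (hN (max N M) (le_max_left _ _)) (hM (max N M) (le_max_right _ _))
  simpa using this

theorem exists_hasFiltSum (hF : IsCompleteFilt F) {t : ℕ → A} (ht : ∀ n, t n ∈ F n) :
    ∃ z, ∀ k, z - ∑ i ∈ Finset.range k, t i ∈ F k :=
  hF.complete (fun k => ∑ i ∈ Finset.range k, t i) fun n => by
    simpa [Finset.sum_range_succ] using ht n

theorem hasFiltSum_of_forall (hF : IsCompleteFilt F) {t : ℕ → A} {z : A}
    (h : ∀ k, z - ∑ i ∈ Finset.range k, t i ∈ F k) : HasFiltSum F t z :=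
  fun n => ⟨n, fun k hk => hF.antitone hk (h k)⟩

theorem filtSum_spec (hF : IsCompleteFilt F) {t : ℕ → A} (ht : ∀ n, t n ∈ F n) (k : ℕ) :
    filtSum F t - ∑ i ∈ Finset.range k, t i ∈ F k := by
  obtain ⟨z, hz⟩ := exists_hasFiltSum hF ht
  have hz' := hasFiltSum_of_forall hF hz
  have : filtSum F t = z := by
    have h : ∃ z, HasFiltSum F t z := ⟨z, hz'⟩
    rw [filtSum, dif_pos h]
    exact HasFiltSum.unique hF h.choose_spec hz'
  rw [this]
  exact hz k

theorem filtSum_eq (hF : IsCompleteFilt F) {t : ℕ → A} (ht : ∀ n, t n ∈ F n) {z : A}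
    (hz : ∀ k, z - ∑ i ∈ Finset.range k, t i ∈ F k) : filtSum F t = z :=
  HasFiltSum.unique hF (hasFiltSum_of_forall hF (filtSum_spec hF ht)) (hasFiltSum_of_forall hF hz)

/-- A bracket adapted to a separated complete filtration. -/
structure IsFiltBracket (F : ℕ → Submodule R A) (br : A →ₗ[R] A →ₗ[R] A) : Prop
    extends IsCompleteFilt F where
  bracket_mem : ∀ {i j a b}, a ∈ F i → b ∈ F j → br a b ∈ F (i + j)
  mem_zero : ∀ a, a ∈ F 0

variable (K : Type u) [Field K] [Algebra K R]

/-- The iterated bracket `[a₁, [a₂, [..., aₙ]]]`. -/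
def lieWord (br : A →ₗ[R] A →ₗ[R] A) : List A → A
  | [] => 0
  | [a] => a
  | a :: b :: l => br a (lieWord br (b :: l))

open Classical in
/-- The degree `n` part of the Baker-Campbell-Hausdorff series `log (exp x * exp y)`, in Dynkin's
form: the sum over `k ≥ 1` and over `(r₁, s₁), …, (rₖ, sₖ)` with `rᵢ + sᵢ > 0` and
`∑ (rᵢ + sᵢ) = n` of
`(-1) ^ (k - 1) / (k * n * ∏ rᵢ! sᵢ!) * [x, …, x, y, …, y, …, x, …, x, y, …, y]`
(`r₁` times `x`, then `s₁` times `y`, …, the iterated bracket being nested to the right). -/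
def bchTerm (br : A →ₗ[R] A →ₗ[R] A) (x y : A) (n : ℕ) : A :=
  ∑ k ∈ Finset.Icc 1 n,
    ∑ p ∈ (Fintype.piFinset fun _ : Fin k =>
        Finset.range (n + 1) ×ˢ Finset.range (n + 1)).filter
        fun p => (∀ i, 0 < (p i).1 + (p i).2) ∧ ∑ i, ((p i).1 + (p i).2) = n,
      algebraMap K R ((-1) ^ (k - 1) /
          ((k : K) * n * ∏ i, (((p i).1.factorial : K) * ((p i).2.factorial : K)))) •
        lieWord br ((List.ofFn p).flatMap fun q => List.replicate q.1 x ++ List.replicate q.2 y)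

/-- The product of the pronilpotent group `exp`: `exp x * exp y = exp (bch x y)`. -/
def bch (F : ℕ → Submodule R A) (br : A →ₗ[R] A →ₗ[R] A) (x y : A) : A :=
  filtSum F (bchTerm K br x y)

/-- The `i`-th term `(1 / i!) ad(α)^i (a)` of `exp (ad α) (a)`. -/
def expAdTerm (br : A →ₗ[R] A →ₗ[R] A) (α a : A) (i : ℕ) : A :=
  algebraMap K R ((i.factorial : K)⁻¹) • (fun b => br α b)^[i] a

/-- `exp (ad α) (a) = ∑ (1 / i!) ad(α)^i (a)`. -/
def expAd (F : ℕ → Submodule R A) (br : A →ₗ[R] A →ₗ[R] A) (α a : A) : A :=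
  filtSum F (expAdTerm K br α a)

variable {br : A →ₗ[R] A →ₗ[R] A}

theorem lieWord_mem (hF : IsFiltBracket F br) :
    ∀ l : List A, (∀ a ∈ l, a ∈ F 1) → lieWord br l ∈ F l.length
  | [], _ => (F 0).zero_mem
  | [a], h => h a (by simp)
  | a :: b :: l, h => by
      have h1 := lieWord_mem hF (b :: l) fun c hc => h c (List.mem_cons_of_mem _ hc)
      have := hF.bracket_mem (h a (by simp)) h1
      rw [add_comm] at this
      exact this

theorem bchTerm_mem (hF : IsFiltBracket F br) {x y : A} (hx : x ∈ F 1) (hy : y ∈ F 1) (n : ℕ) :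
    bchTerm K br x y n ∈ F n := by
  refine Submodule.sum_mem _ fun k _ => Submodule.sum_mem _ fun p hp => Submodule.smul_mem _ _ ?_
  have hl : ((List.ofFn p).flatMap fun q =>
      List.replicate q.1 x ++ List.replicate q.2 y).length = n := by
    rw [List.length_flatMap]
    simp only [List.length_append, List.length_replicate, List.map_ofFn, List.sum_ofFn]
    exact (Finset.mem_filter.1 hp).2.2
  have := lieWord_mem hF ((List.ofFn p).flatMap fun q =>
      List.replicate q.1 x ++ List.replicate q.2 y) (by
    intro a ha
    simp only [List.mem_flatMap, List.mem_append, List.mem_replicate] at ha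
    obtain ⟨q, -, h | h⟩ := ha
    · rw [h.2]; exact hx
    · rw [h.2]; exact hy)
  rwa [hl] at this

theorem bch_mem (hF : IsFiltBracket F br) {x y : A} (hx : x ∈ F 1) (hy : y ∈ F 1) :
    bch K F br x y ∈ F 1 := by
  have := filtSum_spec hF.toIsCompleteFilt (bchTerm_mem K hF hx hy) 1
  rw [bch]
  simpa [bchTerm] using this

theorem expAdTerm_mem (hF : IsFiltBracket F br) {α : A} (hα : α ∈ F 1) {a : A} (n : ℕ) :
    expAdTerm K br α a n ∈ F n := by
  refine Submodule.smul_mem _ _ ?_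
  induction n with
  | zero => exact hF.mem_zero _
  | succ n ih =>
    rw [Function.iterate_succ_apply', add_comm]
    exact hF.bracket_mem hα ih

theorem expAd_spec (hF : IsFiltBracket F br) {α : A} (hα : α ∈ F 1) (a : A) (k : ℕ) :
    expAd K F br α a - ∑ i ∈ Finset.range k, expAdTerm K br α a i ∈ F k :=
  filtSum_spec hF.toIsCompleteFilt (expAdTerm_mem K hF hα) k

theorem expAd_eq (hF : IsFiltBracket F br) {α : A} (hα : α ∈ F 1) {a z : A}
    (hz : ∀ k, z - ∑ i ∈ Finset.range k, expAdTerm K br α a i ∈ F k) : expAd K F br α a = z :=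
  filtSum_eq hF.toIsCompleteFilt (expAdTerm_mem K hF hα) hz

theorem expAd_sub_mem (hF : IsFiltBracket F br) {α : A} (hα : α ∈ F 1) (a : A) :
    expAd K F br α a - a ∈ F 1 := by
  simpa [expAdTerm] using expAd_spec K hF hα a 1

theorem expAd_add (hF : IsFiltBracket F br) {α : A} (hα : α ∈ F 1) (a b : A) :
    expAd K F br α (a + b) = expAd K F br α a + expAd K F br α b := by
  refine expAd_eq K hF hα fun k => ?_
  have h : ∀ i, expAdTerm K br α (a + b) i = expAdTerm K br α a i + expAdTerm K br α b i := by
    intro i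
    simp only [expAdTerm, iterate_map_add, smul_add]
  simp only [h, Finset.sum_add_distrib]
  convert (F k).add_mem (expAd_spec K hF hα a k) (expAd_spec K hF hα b k) using 1
  abel

theorem expAd_smul (hF : IsFiltBracket F br) {α : A} (hα : α ∈ F 1) (r : R) (a : A) :
    expAd K F br α (r • a) = r • expAd K F br α a := by
  refine expAd_eq K hF hα fun k => ?_
  have h : ∀ i, expAdTerm K br α (r • a) i = r • expAdTerm K br α a i := by
    intro i
    have : (fun b => br α b)^[i] (r • a) = r • (fun b => br α b)^[i] a := by
      induction i with
      | zero => rfl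
      | succ n ih => rw [Function.iterate_succ_apply', ih, map_smul, Function.iterate_succ_apply']
    rw [expAdTerm, expAdTerm, this, smul_comm]
  simp only [h, ← Finset.smul_sum, ← smul_sub]
  exact (F k).smul_mem _ (expAd_spec K hF hα a k)

theorem expAd_map {A' : Type u} [AddCommGroup A'] [Module R A'] {F' : ℕ → Submodule R A'}
    {br' : A' →ₗ[R] A' →ₗ[R] A'} (hF : IsFiltBracket F br) (hF' : IsFiltBracket F' br')
    (φ : A →ₗ[R] A') (hφ : ∀ {n a}, a ∈ F n → φ a ∈ F' n)
    (hbr : ∀ a b, φ (br a b) = br' (φ a) (φ b)) {α : A} (hα : α ∈ F 1) (a : A) :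
    φ (expAd K F br α a) = expAd K F' br' (φ α) (φ a) := by
  refine (expAd_eq K hF' (hφ hα) fun k => ?_).symm
  have h : ∀ i, φ (expAdTerm K br α a i) = expAdTerm K br' (φ α) (φ a) i := by
    intro i
    have : φ ((fun b => br α b)^[i] a) = (fun b => br' (φ α) b)^[i] (φ a) := by
      induction i with
      | zero => rfl
      | succ n ih => rw [Function.iterate_succ_apply', hbr, ih, Function.iterate_succ_apply']
    rw [expAdTerm, expAdTerm, map_smul, this]
  have := hφ (expAd_spec K hF hα a k)
  rw [map_sub, map_sum] at this
  simpa only [h] using this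

variable [CharZero K]

theorem iterate_leibniz (B : A →ₗ[R] A →ₗ[R] A) (D : A →ₗ[R] A)
    (hD : ∀ a b, D (B a b) = B (D a) b + B a (D b)) (a b : A) (n : ℕ) :
    (fun c => D c)^[n] (B a b) = ∑ p ∈ Finset.HasAntidiagonal.antidiagonal n,
      n.choose p.1 • B ((fun c => D c)^[p.1] a) ((fun c => D c)^[p.2] b) := by
  induction n with
  | zero => simp
  | succ n ih =>
    rw [Finset.sum_antidiagonal_choose_succ_nsmul
      (M := A) (fun i j => B ((fun c => D c)^[i] a) ((fun c => D c)^[j] b)) n]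
    rw [Function.iterate_succ_apply', ih, map_sum, ← Finset.sum_add_distrib]
    refine Finset.sum_congr rfl fun p hp => ?_
    rw [map_nsmul, hD, smul_add, add_comm, Function.iterate_succ_apply',
      Function.iterate_succ_apply']
    have : n.choose p.2 = n.choose p.1 := Nat.choose_symm_of_eq_add
      (by rw [← Finset.HasAntidiagonal.mem_antidiagonal.1 hp, add_comm])
    simp only [this]

theorem sum_antidiagonal_sub_mem (T : ℕ → ℕ → A) (k : ℕ) (hF : Antitone F)
    (hT : ∀ i j, T i j ∈ F (i + j)) :
    (∑ i ∈ Finset.range k, ∑ j ∈ Finset.range k, T i j) -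
      ∑ n ∈ Finset.range k, ∑ p ∈ Finset.HasAntidiagonal.antidiagonal n, T p.1 p.2 ∈ F k := by
  rw [← Finset.sum_product', Finset.sum_sigma']
  have : ∑ x ∈ (Finset.range k).sigma fun n => Finset.HasAntidiagonal.antidiagonal n, T x.2.1 x.2.2 =
      ∑ q ∈ (Finset.range k ×ˢ Finset.range k).filter (fun q => q.1 + q.2 < k), T q.1 q.2 := by
    refine Finset.sum_bij' (fun x _ => x.2) (fun q _ => ⟨q.1 + q.2, q⟩) ?_ ?_ ?_ ?_ ?_
    · rintro ⟨n, i, j⟩ h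
      simp only [Finset.mem_sigma, Finset.mem_range, Finset.HasAntidiagonal.mem_antidiagonal] at h
      simp only [Finset.mem_filter, Finset.mem_product, Finset.mem_range]
      omega
    · rintro ⟨i, j⟩ h
      simp only [Finset.mem_filter, Finset.mem_product, Finset.mem_range] at h
      exact Finset.mem_sigma.2 ⟨Finset.mem_range.2 h.2,
        Finset.HasAntidiagonal.mem_antidiagonal.2 rfl⟩
    · rintro ⟨n, i, j⟩ h
      simp only [Finset.mem_sigma, Finset.mem_range, Finset.HasAntidiagonal.mem_antidiagonal] at h
      obtain ⟨-, rfl⟩ := h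
      rfl
    · intros; rfl
    · intros; rfl
  rw [this, ← Finset.sum_filter_add_sum_filter_not (Finset.range k ×ˢ Finset.range k)
    (fun q => q.1 + q.2 < k), add_sub_cancel_left]
  refine Submodule.sum_mem _ fun q hq => hF ?_ (hT q.1 q.2)
  exact not_lt.1 (Finset.mem_filter.1 hq).2

theorem expAd_bilin (hF : IsFiltBracket F br) {α : A} (hα : α ∈ F 1) (B : A →ₗ[R] A →ₗ[R] A)
    (hB : ∀ {i j a b}, a ∈ F i → b ∈ F j → B a b ∈ F (i + j))
    (hD : ∀ a b, br α (B a b) = B (br α a) b + B a (br α b)) (a b : A) :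
    expAd K F br α (B a b) = B (expAd K F br α a) (expAd K F br α b) := by
  refine expAd_eq K hF hα fun k => ?_
  set S := ∑ i ∈ Finset.range k, expAdTerm K br α a i with hS
  set T := ∑ i ∈ Finset.range k, expAdTerm K br α b i with hT
  have h1 : B (expAd K F br α a) (expAd K F br α b) - B S T ∈ F k := by
    have e : B (expAd K F br α a) (expAd K F br α b) - B S T =
        B (expAd K F br α a - S) (expAd K F br α b) + B S (expAd K F br α b - T) := by
      simp
    rw [e]
    refine (F k).add_mem (hB (expAd_spec K hF hα a k) (hF.mem_zero _)) ?_
    have := hB (hF.mem_zero S) (expAd_spec K hF hα b k)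
    rwa [zero_add] at this
  have h2 : ∀ n, expAdTerm K br α (B a b) n = ∑ p ∈ Finset.HasAntidiagonal.antidiagonal n,
      B (expAdTerm K br α a p.1) (expAdTerm K br α b p.2) := by
    intro n
    rw [expAdTerm, iterate_leibniz B (br α) hD, Finset.smul_sum]
    refine Finset.sum_congr rfl fun p hp => ?_
    rw [Finset.HasAntidiagonal.mem_antidiagonal] at hp
    simp only [expAdTerm, map_smul, LinearMap.smul_apply, ← mul_smul, ← map_mul,
      ← Nat.cast_smul_eq_nsmul R]
    congr 1
    rw [← map_natCast (algebraMap K R), ← map_mul, ← hp, Nat.choose_symm_add, Nat.add_choose,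
      Nat.cast_div (Nat.factorial_mul_factorial_dvd_factorial_add _ _)
        (by simp [Nat.factorial_ne_zero])]
    have h3 : ((p.1 + p.2).factorial : K) ≠ 0 := by exact_mod_cast Nat.factorial_ne_zero _
    have h4 : (p.1.factorial : K) ≠ 0 := by exact_mod_cast Nat.factorial_ne_zero _
    have h5 : (p.2.factorial : K) ≠ 0 := by exact_mod_cast Nat.factorial_ne_zero _
    congr 1
    push_cast
    field_simp
  have h6 : B S T - ∑ n ∈ Finset.range k, expAdTerm K br α (B a b) n ∈ F k := by
    simp only [h2, hS, hT, map_sum, LinearMap.sum_apply]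
    exact Finset.sum_comm (s := Finset.range k) (t := Finset.range k)
      (f := fun i j => B (expAdTerm K br α a i) (expAdTerm K br α b j)) ▸
      sum_antidiagonal_sub_mem (fun i j => B (expAdTerm K br α a i) (expAdTerm K br α b j)) k
        hF.antitone fun i j => hB (expAdTerm_mem K hF hα i) (expAdTerm_mem K hF hα j)
  simpa using (F k).add_mem h1 h6

theorem expAd_neg_expAd (hF : IsFiltBracket F br) {α : A} (hα : α ∈ F 1) (a : A) :
    expAd K F br (-α) (expAd K F br α a) = a := by
  have hα' : -α ∈ F 1 := (F 1).neg_mem hα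
  refine expAd_eq K hF hα' fun k => ?_
  have hm : ∀ (m : ℕ) {c : A}, c ∈ F k → expAdTerm K br (-α) c m ∈ F k := by
    intro m c hc
    refine Submodule.smul_mem _ _ ?_
    induction m with
    | zero => exact hc
    | succ n ih =>
      rw [Function.iterate_succ_apply']
      exact hF.antitone (by omega) (hF.bracket_mem hα' ih)
  have hlin : ∀ (m : ℕ) (c d : A), expAdTerm K br (-α) (c - d) m =
      expAdTerm K br (-α) c m - expAdTerm K br (-α) d m := by
    intro m c d
    simp only [expAdTerm, iterate_map_sub, smul_sub]
  have hsum : ∀ (m : ℕ) (s : Finset ℕ) (f : ℕ → A), expAdTerm K br (-α) (∑ i ∈ s, f i) m =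
      ∑ i ∈ s, expAdTerm K br (-α) (f i) m := by
    intro m s f
    have : ∀ c, expAdTerm K br (-α) c m =
        (algebraMap K R ((m.factorial : K)⁻¹) • (br (-α)) ^ m) c := by
      intro c
      simp [expAdTerm, Module.End.pow_apply]
      rfl
    simp only [this, map_sum]
  have h1 : (∑ i ∈ Finset.range k, expAdTerm K br (-α) (expAd K F br α a) i) -
      ∑ i ∈ Finset.range k, ∑ j ∈ Finset.range k, expAdTerm K br (-α) (expAdTerm K br α a j) i
        ∈ F k := by
    simp only [← hsum, ← Finset.sum_sub_distrib, ← hlin]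
    exact Submodule.sum_mem _ fun i _ => hm i (expAd_spec K hF hα a k)
  have hit : ∀ (i : ℕ) (c : A), (fun b => br (-α) b)^[i] c =
      algebraMap K R ((-1) ^ i) • (fun b => br α b)^[i] c := by
    intro i c
    induction i with
    | zero => simp
    | succ n ih =>
      rw [Function.iterate_succ_apply', ih, Function.iterate_succ_apply', pow_succ]
      simp
  have hsm : ∀ (i : ℕ) (r : R) (c : A), (fun b => br α b)^[i] (r • c) =
      r • (fun b => br α b)^[i] c := by
    intro i r c
    induction i with
    | zero => rfl
    | succ n ih => rw [Function.iterate_succ_apply', ih, map_smul, Function.iterate_succ_apply']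
  have hT : ∀ i j, expAdTerm K br (-α) (expAdTerm K br α a j) i ∈ F (i + j) := by
    intro i j
    refine Submodule.smul_mem _ _ ?_
    induction i with
    | zero => simpa using expAdTerm_mem K hF hα j
    | succ n ih =>
      rw [Function.iterate_succ_apply', show n + 1 + j = 1 + (n + j) by omega]
      exact hF.bracket_mem hα' ih
  have h2 := sum_antidiagonal_sub_mem
    (fun i j => expAdTerm K br (-α) (expAdTerm K br α a j) i) k hF.antitone hT
  have h3 : ∀ n, ∑ p ∈ Finset.HasAntidiagonal.antidiagonal n,
      expAdTerm K br (-α) (expAdTerm K br α a p.2) p.1 = if n = 0 then a else 0 := by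
    intro n
    have e : ∀ p ∈ Finset.HasAntidiagonal.antidiagonal n, expAdTerm K br (-α) (expAdTerm K br α a p.2) p.1 =
        algebraMap K R ((n.factorial : K)⁻¹ * ((-1) ^ p.1 * (n.choose p.1 : K))) •
          (fun b => br α b)^[n] a := by
      intro p hp
      rw [Finset.HasAntidiagonal.mem_antidiagonal] at hp
      rw [expAdTerm, expAdTerm, hit, hsm, ← Function.iterate_add_apply, hp]
      simp only [← mul_smul, ← map_mul]
      congr 2
      rw [← hp, Nat.choose_symm_add, Nat.add_choose, Nat.cast_div (Nat.factorial_mul_factorial_dvd_factorial_add _ _)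
        (by simp [Nat.factorial_ne_zero])]
      have h3 : ((p.1 + p.2).factorial : K) ≠ 0 := by exact_mod_cast Nat.factorial_ne_zero _
      have h4 : (p.1.factorial : K) ≠ 0 := by exact_mod_cast Nat.factorial_ne_zero _
      have h5 : (p.2.factorial : K) ≠ 0 := by exact_mod_cast Nat.factorial_ne_zero _
      push_cast
      field_simp
    rw [Finset.sum_congr rfl e, ← Finset.sum_smul, ← map_sum, ← Finset.mul_sum,
      Finset.Nat.sum_antidiagonal_eq_sum_range_succ
        (fun i _ => (-1 : K) ^ i * (n.choose i : K)) n]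
    have h7 := congrArg (Int.cast : ℤ → K) (Int.alternating_sum_range_choose (n := n))
    push_cast at h7
    rw [h7]
    split_ifs with hn
    · subst hn; simp
    · simp
  simp only [h3] at h2
  have h4 : (∑ n ∈ Finset.range k, if n = 0 then a else 0) - a ∈ F k := by
    rcases k with _ | k
    · exact hF.mem_zero _
    · simp
  have := (F k).add_mem ((F k).add_mem h1 h2) h4
  rw [← neg_sub]
  refine (F k).neg_mem ?_
  convert this using 1
  abel

end Filtration

/-! ### Homomorphisms of parameter algebras -/

theorem algebraMap_mem_maximalIdeal (K R R' : Type u) [Field K] [CommRing R] [Algebra K R]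
    [IsLocalRing R] [CommRing R'] [Algebra K R'] [IsLocalRing R'] [ParameterAlgebra K R']
    [Algebra R R'] [IsScalarTower K R R'] {r : R} (hr : r ∈ 𝔪 R) : algebraMap R R' r ∈ 𝔪 R' := by
  obtain ⟨c, hc⟩ := (ParameterAlgebra.bijective_residue (K := K) (R := R')).2
    (IsLocalRing.residue R' (algebraMap R R' r))
  have h1 : algebraMap R R' (r - algebraMap K R c) ∈ 𝔪 R' := by
    rw [map_sub, ← IsScalarTower.algebraMap_apply]
    rw [← IsLocalRing.residue_eq_zero_iff, map_sub, sub_eq_zero, ← hc]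
    rfl
  rcases eq_or_ne c 0 with rfl | h
  · simpa using h1
  · exfalso
    have h2 : IsUnit (algebraMap K R c) := (IsUnit.mk0 c h).map _
    have h3 : IsUnit (r - algebraMap K R c) := by
      by_contra h4
      have := (𝔪 R).sub_mem hr ((IsLocalRing.mem_maximalIdeal _).2 h4)
      rw [sub_sub_cancel] at this
      exact (IsLocalRing.mem_maximalIdeal _).1 this h2
    exact (IsLocalRing.mem_maximalIdeal _).1 h1 (h3.map _)

section Parameter

variable (K R R' : Type u) [Field K] [CommRing R] [Algebra K R] [IsLocalRing R]
  [CommRing R'] [Algebra K R'] [IsLocalRing R'] [ParameterAlgebra K R']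
  [Algebra R R'] [IsScalarTower K R R']

/-- The map induced on residue fields by `R → R'`. -/
def residueMap : 𝕜 R →ₐ[R] 𝕜 R' :=
  Ideal.Quotient.liftₐ (𝔪 R) (Algebra.ofId R (𝕜 R')) fun r hr => by
    rw [Algebra.ofId_apply, IsScalarTower.algebraMap_apply R R' (𝕜 R')]
    exact (IsLocalRing.residue_eq_zero_iff _).2 (algebraMap_mem_maximalIdeal K R R' hr)

theorem residueMap_bijective : Function.Bijective (residueMap K R R') := by
  refine ⟨(residueMap K R R').toRingHom.injective, fun y => ?_⟩
  obtain ⟨c, rfl⟩ := (ParameterAlgebra.bijective_residue (K := K) (R := R')).2 y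
  refine ⟨algebraMap R (𝕜 R) (algebraMap K R c), ?_⟩
  rw [AlgHom.commutes, ← IsScalarTower.algebraMap_apply]

/-- The identification of the residue fields of two parameter algebras (both are `K`). -/
def residueEquiv : 𝕜 R' ≃ₐ[R] 𝕜 R :=
  (AlgEquiv.ofBijective (residueMap K R R') (residueMap_bijective K R R')).symm

/-- The transition map `R'_{i+1} → R'_i`, where `R'_i = R' / 𝔪' ^ (i + 1)`. -/
def transition (i : ℕ) : (R' ⧸ 𝔪 R' ^ (i + 2)) →ₐ[R'] (R' ⧸ 𝔪 R' ^ (i + 1)) :=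
  Ideal.Quotient.factorₐ R' (Ideal.pow_le_pow_right (by omega))

/-- The map from `R'_0 = R' / 𝔪' ^ (0 + 1)` to the residue field of `R'`. -/
def toResidue : (R' ⧸ 𝔪 R' ^ (0 + 1)) →ₐ[R'] 𝕜 R' :=
  Ideal.Quotient.factorₐ R' (J := 𝔪 R') (by simp)

end Parameter

/-! ### Kinds of deformations -/

/-- The two kinds of deformations. -/
inductive DefKind
  | assoc
  | poisson

/-- In the associative case the bracket is the commutator. In the Poisson case the algebra is
commutative and the bracket is a Poisson bracket. -/
def IsBracketOfKind {R A : Type u} [CommRing R] [Ring A] [Algebra R A]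
    (br : A →ₗ[R] A →ₗ[R] A) : DefKind → Prop
  | .assoc => ∀ a b, br a b = a * b - b * a
  | .poisson => (∀ a b : A, a * b = b * a) ∧ (∀ a, br a a = 0) ∧
      (∀ a b c, br a (br b c) + br b (br c a) + br c (br a b) = 0) ∧
      (∀ a b c, br a (b * c) = br a b * c + b * br a c) ∧
      (∀ a b c, br (a * b) c = br a c * b + a * br b c)

section Kind

variable {R A : Type u} [CommRing R] [Ring A] [Algebra R A]
  {br : A →ₗ[R] A →ₗ[R] A} {κ : DefKind}

theorem IsBracketOfKind.leibniz_mul (h : IsBracketOfKind br κ) (α a b : A) :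
    br α (a * b) = br α a * b + a * br α b := by
  cases κ with
  | assoc => simp only [IsBracketOfKind] at h; simp only [h]; noncomm_ring
  | poisson => exact h.2.2.2.1 α a b

theorem IsBracketOfKind.leibniz_br (h : IsBracketOfKind br κ) (α a b : A) :
    br α (br a b) = br (br α a) b + br a (br α b) := by
  cases κ with
  | assoc => simp only [IsBracketOfKind] at h; simp only [h]; noncomm_ring
  | poisson =>
    have hskew : ∀ x y, br x y = - br y x := by
      intro x y
      have := h.2.1 (x + y)
      simp only [map_add, LinearMap.add_apply, h.2.1, zero_add, add_zero] at this
      rw [eq_neg_iff_add_eq_zero, add_comm]; exact this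
    have := h.2.2.1 α a b
    rw [hskew b α, map_neg, hskew b (br α a)] at this
    rw [← sub_eq_zero, ← this]
    abel

variable (K : Type u) [Field K] [Algebra K R] [CharZero K] {F : ℕ → Submodule R A}

/-- The automorphism `exp (ad α)`. -/
def expAdEquiv (hF : IsFiltBracket F br)
    (hmul : ∀ {i j a b}, a ∈ F i → b ∈ F j → a * b ∈ F (i + j)) (hk : IsBracketOfKind br κ)
    {α : A} (hα : α ∈ F 1) : A ≃ₐ[R] A :=
  AlgEquiv.ofLinearEquiv
    { toFun := expAd K F br α
      invFun := expAd K F br (-α)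
      map_add' := expAd_add K hF hα
      map_smul' := expAd_smul K hF hα
      left_inv := expAd_neg_expAd K hF hα
      right_inv := fun a => by
        have := expAd_neg_expAd K hF (Submodule.neg_mem _ hα) a
        rwa [neg_neg] at this }
    (by
      have h0 : br α 1 = 0 := by
        have := hk.leibniz_mul α 1 1
        simpa using this
      refine expAd_eq K hF hα fun k => ?_
      rcases k with _ | k
      · exact hF.mem_zero _
      · rw [Finset.sum_range_succ']
        have : ∀ i, expAdTerm K br α 1 (i + 1) = 0 := by
          intro i
          rw [expAdTerm, Function.iterate_succ_apply, h0]
          have : (fun b => br α b)^[i] 0 = 0 := iterate_map_zero (br α) i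
          rw [this, smul_zero]
        rw [Finset.sum_eq_zero fun i _ => this i]
        simp [expAdTerm])
    (expAd_bilin K hF hα (LinearMap.mul R A) hmul (hk.leibniz_mul α))

end Kind

/-! ### Deformations of algebras -/

section Alg

variable (K R C : Type u) [Field K] [CommRing R] [Algebra K R] [IsLocalRing R]
  [CommRing C] [Algebra K C]

/-- An `R`-algebra `A` with an `R`-bilinear bracket and a homomorphism `ψ : K ⊗_R A → C` of
`K`-algebras. Here `K` as an `R`-algebra is the residue field of `R`. -/
structure PreAlgDef where
  carrier : Type u
  [ring : Ring carrier]
  [algebra : Algebra R carrier]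
  br : carrier →ₗ[R] carrier →ₗ[R] carrier
  aug : 𝕜 R ⊗[R] carrier →ₐ[K] C

attribute [instance] PreAlgDef.ring PreAlgDef.algebra

variable {K R C}

/-- `A` is an associative, resp. Poisson, `R`-deformation of `C`: it is flat and `𝔪`-adically
complete, and `ψ` is an isomorphism, for the zero bracket on `C`. -/
structure PreAlgDef.IsDeformation (A : PreAlgDef K R C) (κ : DefKind) : Prop where
  kind : IsBracketOfKind A.br κ
  flat : Module.Flat R A.carrier
  complete : IsAdicComplete (𝔪 R) A.carrier
  bijective_aug : Function.Bijective A.aug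
  aug_br : ∀ a b, A.aug (1 ⊗ₜ A.br a b) = 0

variable (K R C) in
/-- The associative, resp. Poisson, `R`-deformations of the commutative `K`-algebra `C`. -/
structure AlgDef (κ : DefKind) extends PreAlgDef K R C where
  isDeformation : toPreAlgDef.IsDeformation κ

/-- Gauge transformations: isomorphisms of `R`-algebras which respect the brackets and commute
with the augmentations. -/
@[ext]
structure AlgGauge (A B : PreAlgDef K R C) where
  toEquiv : A.carrier ≃ₐ[R] B.carrier
  map_br : ∀ a b, toEquiv (A.br a b) = B.br (toEquiv a) (toEquiv b)
  map_aug : ∀ a, B.aug (1 ⊗ₜ toEquiv a) = A.aug (1 ⊗ₜ a)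

instance (κ : DefKind) : Groupoid (AlgDef K R C κ) where
  Hom A B := AlgGauge A.toPreAlgDef B.toPreAlgDef
  id A := ⟨AlgEquiv.refl, fun _ _ => rfl, fun _ => rfl⟩
  comp f g := ⟨f.toEquiv.trans g.toEquiv,
    fun a b => by simp [f.map_br, g.map_br], fun a => by simp [f.map_aug, g.map_aug]⟩
  inv f := ⟨f.toEquiv.symm,
    fun a b => by apply f.toEquiv.injective; simp [f.map_br],
    fun a => by rw [← f.map_aug]; simp⟩
  id_comp _ := rfl
  comp_id _ := rfl
  assoc _ _ _ := rfl
  inv_comp f := AlgGauge.ext (by apply AlgEquiv.ext; intro a; exact f.toEquiv.apply_symm_apply a)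
  comp_inv f := AlgGauge.ext (by apply AlgEquiv.ext; intro a; exact f.toEquiv.symm_apply_apply a)

/-- The `𝔪`-adic filtration `𝔪 ^ n A`. -/
def adicFilt (R A : Type u) [CommRing R] [IsLocalRing R] [AddCommGroup A] [Module R A] (n : ℕ) :
    Submodule R A :=
  (𝔪 R) ^ n • ⊤

theorem adicFilt_bilin {A : Type u} [AddCommGroup A] [Module R A] (B : A →ₗ[R] A →ₗ[R] A)
    {i j : ℕ} {a b : A} (ha : a ∈ adicFilt R A i) (hb : b ∈ adicFilt R A j) :
    B a b ∈ adicFilt R A (i + j) := by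
  refine Submodule.smul_induction_on ha (fun r hr x _ => ?_) fun x y hx hy => ?_
  · refine Submodule.smul_induction_on hb (fun s hs y _ => ?_) fun x' y' hx hy => ?_
    · rw [map_smul, map_smul, LinearMap.smul_apply, ← mul_smul, mul_comm]
      refine Submodule.smul_mem_smul ?_ trivial
      rw [pow_add]
      exact Ideal.mul_mem_mul hr hs
    · rw [map_add]; exact Submodule.add_mem _ hx hy
  · rw [map_add, LinearMap.add_apply]; exact Submodule.add_mem _ hx hy

theorem isCompleteFilt_adicFilt {A : Type u} [AddCommGroup A] [Module R A]
    (h : IsAdicComplete (𝔪 R) A) : IsCompleteFilt (adicFilt R A) where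
  antitone _ _ hij := Submodule.smul_mono_left (Ideal.pow_le_pow_right hij)
  sep a ha := h.haus' a fun n => by rw [SModEq.zero]; exact ha n
  complete s hs := by
    have hs' : ∀ {m n : ℕ}, m ≤ n → s m ≡ s n [SMOD (𝔪 R) ^ m • (⊤ : Submodule R A)] := by
      intro m n hmn
      induction n, hmn using Nat.le_induction with
      | base => rfl
      | succ n hmn ih =>
        refine ih.trans (SModEq.sub_mem.2 ?_)
        rw [← neg_sub]
        exact Submodule.neg_mem _ (Submodule.smul_mono_left (Ideal.pow_le_pow_right hmn) (hs n))
    obtain ⟨z, hz⟩ := h.prec' s hs'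
    exact ⟨z, fun n => SModEq.sub_mem.1 (hz n).symm⟩

variable {κ : DefKind}

theorem AlgDef.isFiltBracket (A : AlgDef K R C κ) :
    IsFiltBracket (adicFilt R A.carrier) A.br where
  toIsCompleteFilt := isCompleteFilt_adicFilt A.isDeformation.complete
  bracket_mem ha hb := adicFilt_bilin A.br ha hb
  mem_zero a := by simp [adicFilt]

theorem AlgGauge.map_adicFilt {A B : PreAlgDef K R C} (g : AlgGauge A B) {n : ℕ}
    {a : A.carrier} (ha : a ∈ adicFilt R A.carrier n) :
    g.toEquiv a ∈ adicFilt R B.carrier n := by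
  refine Submodule.smul_induction_on ha (fun r hr x _ => ?_) fun x y hx hy => ?_
  · rw [map_smul]; exact Submodule.smul_mem_smul hr trivial
  · rw [map_add]; exact Submodule.add_mem _ hx hy

theorem one_tmul_eq_zero {A : Type u} [AddCommGroup A] [Module R A] {a : A}
    (ha : a ∈ adicFilt R A 1) : (1 : 𝕜 R) ⊗ₜ[R] a = 0 := by
  refine Submodule.smul_induction_on ha (fun r hr x _ => ?_) fun x y hx hy => ?_
  · rw [← TensorProduct.smul_tmul, Algebra.smul_def, mul_one]
    rw [pow_one] at hr
    have : algebraMap R (𝕜 R) r = 0 := (IsLocalRing.residue_eq_zero_iff _).2 hr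
    rw [this, TensorProduct.zero_tmul]
  · rw [TensorProduct.tmul_add, hx, hy, add_zero]

variable [CharZero K]

/-- The gauge transformation `ig (exp α) = exp (ad α)` for `α ∈ 𝔪 A`. -/
def AlgDef.ig (A : AlgDef K R C κ) (α : adicFilt R A.carrier 1) : A ⟶ A where
  toEquiv := expAdEquiv K A.isFiltBracket (adicFilt_bilin (LinearMap.mul R A.carrier))
    A.isDeformation.kind α.2
  map_br := expAd_bilin K A.isFiltBracket α.2 A.br
      (adicFilt_bilin _) (A.isDeformation.kind.leibniz_br α.1)
  map_aug a := by
    have := one_tmul_eq_zero (expAd_sub_mem K A.isFiltBracket α.2 a)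
    rw [TensorProduct.tmul_sub, sub_eq_zero] at this
    exact congrArg A.aug this

variable (K R C κ) in
/-- The crossed groupoid `AssDef(R, C)`, resp. `PoisDef(R, C)`. The `2`-morphisms are the elements
of `IG(A) = exp(𝔪 A)`, identified with `𝔪 A` through `exp`. -/
def algDef : PreCrossedGroupoid.{u} where
  Ob := AlgDef K R C κ
  IG A := adicFilt R A.carrier 1
  one _ := 0
  mul {A} a b := ⟨bch K (adicFilt R A.carrier) A.br a.1 b.1, bch_mem K A.isFiltBracket a.2 b.2⟩
  inv a := -a
  twist g a := ⟨AlgGauge.toEquiv g a.1, AlgGauge.map_adicFilt g a.2⟩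
  feedback {A} a := A.ig a

end Alg

section AlgBaseChange

variable (K R R' C : Type u) [Field K] [CommRing R] [Algebra K R] [IsLocalRing R]
  [CommRing R'] [Algebra K R'] [IsLocalRing R'] [ParameterAlgebra K R']
  [Algebra R R'] [IsScalarTower K R R'] [CommRing C] [Algebra K C]

variable (A : Type u) [Ring A] [Algebra R A]

/-- The map `R'_{i+1} ⊗_R A → R'_i ⊗_R A`. -/
def transTensor (i : ℕ) :
    ((R' ⧸ 𝔪 R' ^ (i + 2)) ⊗[R] A) →ₐ[R'] ((R' ⧸ 𝔪 R' ^ (i + 1)) ⊗[R] A) :=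
  Algebra.TensorProduct.map (transition R' i) (AlgHom.id R A)

/-- The completed tensor product `lim_i R'_i ⊗_R A`. -/
def complTensor : Subalgebra R' (∀ i : ℕ, (R' ⧸ 𝔪 R' ^ (i + 1)) ⊗[R] A) where
  carrier := {f | ∀ i, transTensor R R' A i (f (i + 1)) = f i}
  mul_mem' hf hg i := by rw [Pi.mul_apply, map_mul, hf i, hg i]; rfl
  add_mem' hf hg i := by rw [Pi.add_apply, map_add, hf i, hg i]; rfl
  algebraMap_mem' r i := (transTensor R R' A i).commutes r

end AlgBaseChange
set_option linter.unusedSectionVars false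

section AlgBaseChange

variable (K R R' C : Type u) [Field K] [CommRing R] [Algebra K R] [IsLocalRing R]
  [CommRing R'] [Algebra K R'] [IsLocalRing R'] [ParameterAlgebra K R']
  [Algebra R R'] [IsScalarTower K R R'] [CommRing C] [Algebra K C]

variable {R}

theorem map_baseChange {S B B' A A' : Type u} [CommRing S] [Algebra R S] [CommRing B]
    [Algebra R B] [Algebra S B] [IsScalarTower R S B] [CommRing B'] [Algebra R B'] [Algebra S B']
    [IsScalarTower R S B'] [Ring A] [Algebra R A] [Ring A'] [Algebra R A']
    (φ : B →ₐ[S] B') (g : A →ₐ[R] A') (br : A →ₗ[R] A →ₗ[R] A) (br' : A' →ₗ[R] A' →ₗ[R] A')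
    (h : ∀ a b, g (br a b) = br' (g a) (g b)) (t u : B ⊗[R] A) :
    Algebra.TensorProduct.map φ g (LinearMap.BilinMap.baseChange B br t u) =
      LinearMap.BilinMap.baseChange B' br' (Algebra.TensorProduct.map φ g t)
        (Algebra.TensorProduct.map φ g u) := by
  induction t using TensorProduct.induction_on with
  | zero => simp
  | add t t' ht ht' => simp only [map_add, LinearMap.add_apply, ht, ht']
  | tmul b a =>
    induction u using TensorProduct.induction_on with
    | zero => simp
    | add t t' ht ht' => simp only [map_add, ht, ht']
    | tmul b' a' => simp [h]

variable {C}

theorem residueLift_commute {S A : Type u} [Ring S] [Algebra R' S] [Ring A] [Algebra R A]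
    (p : S →ₐ[R'] 𝕜 R' ⊗[R] A) (c : 𝕜 R') (s : S) :
    Commute (Algebra.ofId (𝕜 R') (𝕜 R' ⊗[R] A) c) (p s) :=
  Algebra.commutes c (p s)

/-- A homomorphism `S → K' ⊗_R A` of `R'`-algebras, with `K'` the residue field of `R'`, extended
to `K' ⊗_{R'} S → K' ⊗_R A = K ⊗_R A`. -/
def residueLift {S A : Type u} [Ring S] [Algebra R' S] [Ring A] [Algebra R A]
    (p : S →ₐ[R'] 𝕜 R' ⊗[R] A) : 𝕜 R' ⊗[R'] S →ₐ[K] 𝕜 R ⊗[R] A :=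
  ((Algebra.TensorProduct.map (residueEquiv K R R' : 𝕜 R' →ₐ[R] 𝕜 R)
    (AlgHom.id R A)).restrictScalars K).comp
    ((Algebra.TensorProduct.lift (Algebra.ofId (𝕜 R') (𝕜 R' ⊗[R] A)) p
      (residueLift_commute R' p)).restrictScalars K)

/-- The bracket of `R' ⊗̂_R A`. -/
def complBr {A : Type u} [Ring A] [Algebra R A] (br : A →ₗ[R] A →ₗ[R] A) :
    complTensor R R' A →ₗ[R'] complTensor R R' A →ₗ[R'] complTensor R R' A :=
  LinearMap.mk₂ R'
    (fun f g => ⟨fun i => LinearMap.BilinMap.baseChange (R' ⧸ 𝔪 R' ^ (i + 1)) br (f.1 i) (g.1 i),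
      fun i => by
        rw [transTensor, map_baseChange (transition R' i) (AlgHom.id R A) br br fun _ _ => rfl]
        congr 1
        · exact congrArg _ (f.2 i)
        · exact g.2 i⟩)
    (fun f f' g => by ext i; simp)
    (fun r f g => by
      ext i
      simp only [Subalgebra.coe_smul, Pi.smul_apply]
      rw [← algebraMap_smul (R' ⧸ 𝔪 R' ^ (i + 1)) r (f.1 i), map_smul, LinearMap.smul_apply,
        algebraMap_smul])
    (fun f g g' => by ext i; simp)
    (fun r f g => by
      ext i
      simp only [Subalgebra.coe_smul, Pi.smul_apply]
      rw [← algebraMap_smul (R' ⧸ 𝔪 R' ^ (i + 1)) r (g.1 i), map_smul, algebraMap_smul])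

/-- The projection `R' ⊗̂_R A → R'_0 ⊗_R A`, with `R'_0` the residue field of `R'`. -/
def complProj (A : Type u) [Ring A] [Algebra R A] :
    complTensor R R' A →ₐ[R'] 𝕜 R' ⊗[R] A :=
  (Algebra.TensorProduct.map (toResidue R') (AlgHom.id R A)).comp
    ((Pi.evalAlgHom R' (fun i : ℕ => (R' ⧸ 𝔪 R' ^ (i + 1)) ⊗[R] A) 0).comp
      (complTensor R R' A).val)

/-- The completed base change `R' ⊗̂_R A`, with its bracket and augmentation. -/
def PreAlgDef.baseChange (A : PreAlgDef K R C) : PreAlgDef K R' C where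
  carrier := complTensor R R' A.carrier
  br := complBr R' A.br
  aug := A.aug.comp (residueLift K R' (complProj R' A.carrier))

/-- The map `R' ⊗̂_R A → R' ⊗̂_R B` induced by `g : A → B`. -/
def complMap {A B : Type u} [Ring A] [Algebra R A] [Ring B] [Algebra R B] (g : A →ₐ[R] B) :
    complTensor R R' A →ₐ[R'] complTensor R R' B where
  toFun f := ⟨fun i => Algebra.TensorProduct.map (AlgHom.id R' (R' ⧸ 𝔪 R' ^ (i + 1))) g (f.1 i),
    fun i => by
      have h := f.2 i
      beta_reduce
      rw [← h, transTensor, transTensor, ← AlgHom.comp_apply, ← AlgHom.comp_apply,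
        ← Algebra.TensorProduct.map_comp, ← Algebra.TensorProduct.map_comp]
      rfl⟩
  map_one' := by ext i; simp
  map_mul' _ _ := by ext i; simp
  map_zero' := by ext i; simp
  map_add' _ _ := by ext i; simp
  commutes' r := Subtype.ext (funext fun i =>
    (Algebra.TensorProduct.map (AlgHom.id R' (R' ⧸ 𝔪 R' ^ (i + 1))) g).commutes r)

theorem complMap_complMap {A B D : Type u} [Ring A] [Algebra R A] [Ring B] [Algebra R B]
    [Ring D] [Algebra R D] (g : A →ₐ[R] B) (h : B →ₐ[R] D) (f : complTensor R R' A) :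
    complMap R' h (complMap R' g f) = complMap R' (h.comp g) f := by
  refine Subtype.ext (funext fun i => ?_)
  change Algebra.TensorProduct.map _ _ (Algebra.TensorProduct.map _ _ _) = _
  rw [← AlgHom.comp_apply, ← Algebra.TensorProduct.map_comp]
  rfl

theorem complMap_id {A : Type u} [Ring A] [Algebra R A] (f : complTensor R R' A) :
    complMap R' (AlgHom.id R A) f = f := by
  refine Subtype.ext (funext fun i => ?_)
  change Algebra.TensorProduct.map _ _ _ = _
  rw [Algebra.TensorProduct.map_id]
  rfl

/-- The isomorphism `R' ⊗̂_R A → R' ⊗̂_R B` induced by an isomorphism `A → B`. -/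
def complEquiv {A B : Type u} [Ring A] [Algebra R A] [Ring B] [Algebra R B] (g : A ≃ₐ[R] B) :
    complTensor R R' A ≃ₐ[R'] complTensor R R' B :=
  AlgEquiv.ofAlgHom (complMap R' (g : A →ₐ[R] B)) (complMap R' (g.symm : B →ₐ[R] A))
    (AlgHom.ext fun f => by
      rw [AlgHom.comp_apply, complMap_complMap, AlgEquiv.comp_symm, complMap_id]
      rfl)
    (AlgHom.ext fun f => by
      rw [AlgHom.comp_apply, complMap_complMap, AlgEquiv.symm_comp, complMap_id]
      rfl)

/-- The canonical map `A → R' ⊗̂_R A`. -/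
def toCompl {A : Type u} [Ring A] [Algebra R A] (a : A) : complTensor R R' A :=
  ⟨fun _ => 1 ⊗ₜ[R] a, fun i => by simp [transTensor]⟩

theorem toCompl_mem (K : Type u) {R : Type u} (R' : Type u) [Field K] [CommRing R] [Algebra K R]
    [IsLocalRing R] [CommRing R'] [Algebra K R'] [IsLocalRing R'] [ParameterAlgebra K R']
    [Algebra R R'] [IsScalarTower K R R'] {A : Type u} [Ring A] [Algebra R A] {a : A} (ha : a ∈ adicFilt R A 1) :
    toCompl (R := R) R' a ∈ adicFilt R' (complTensor R R' A) 1 := by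
  refine Submodule.smul_induction_on ha (fun r hr x _ => ?_) fun x y hx hy => ?_
  · have : toCompl (R := R) R' (r • x) = algebraMap R R' r • toCompl R' x := by
      refine Subtype.ext (funext fun i => ?_)
      change (1 : R' ⧸ 𝔪 R' ^ (i + 1)) ⊗ₜ[R] (r • x) =
        algebraMap R R' r • ((1 : R' ⧸ 𝔪 R' ^ (i + 1)) ⊗ₜ[R] x)
      rw [← TensorProduct.smul_tmul, TensorProduct.smul_tmul', algebraMap_smul]
    rw [this]
    rw [pow_one] at hr
    exact Submodule.smul_mem_smul (by rw [pow_one]; exact algebraMap_mem_maximalIdeal K R R' hr)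
      trivial
  · have : toCompl (R := R) R' (x + y) = toCompl R' x + toCompl R' y :=
      Subtype.ext (funext fun i => TensorProduct.tmul_add _ _ _)
    rw [this]
    exact Submodule.add_mem _ hx hy

theorem residue_tensor_eq {A : Type u} [AddCommGroup A] [Module R A] (t : 𝕜 R ⊗[R] A) :
    ∃ a, t = 1 ⊗ₜ a := by
  induction t using TensorProduct.induction_on with
  | zero => exact ⟨0, by simp⟩
  | add t t' ht ht' =>
    obtain ⟨a, rfl⟩ := ht
    obtain ⟨b, rfl⟩ := ht'
    exact ⟨a + b, by rw [TensorProduct.tmul_add]⟩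
  | tmul c a =>
    obtain ⟨r, rfl⟩ := IsLocalRing.residue_surjective c
    refine ⟨r • a, ?_⟩
    rw [← TensorProduct.smul_tmul, Algebra.smul_def, mul_one]
    rfl

theorem map_residueEquiv {A B : Type u} [Ring A] [Algebra R A] [Ring B] [Algebra R B]
    (g : A →ₐ[R] B) (t : 𝕜 R' ⊗[R] A) :
    Algebra.TensorProduct.map (residueEquiv K R R' : 𝕜 R' →ₐ[R] 𝕜 R) (AlgHom.id R B)
      (Algebra.TensorProduct.map (AlgHom.id R (𝕜 R')) g t) =
    Algebra.TensorProduct.map (AlgHom.id R (𝕜 R)) g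
      (Algebra.TensorProduct.map (residueEquiv K R R' : 𝕜 R' →ₐ[R] 𝕜 R) (AlgHom.id R A) t) := by
  rw [← AlgHom.comp_apply, ← AlgHom.comp_apply, ← Algebra.TensorProduct.map_comp,
    ← Algebra.TensorProduct.map_comp]
  rfl

theorem residueLift_one_tmul {S A : Type u} [Ring S] [Algebra R' S] [Ring A] [Algebra R A]
    (p : S →ₐ[R'] 𝕜 R' ⊗[R] A) (s : S) :
    residueLift K R' p (1 ⊗ₜ s) = Algebra.TensorProduct.map
      (residueEquiv K R R' : 𝕜 R' →ₐ[R] 𝕜 R) (AlgHom.id R A) (p s) := by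
  change Algebra.TensorProduct.map (residueEquiv K R R' : 𝕜 R' →ₐ[R] 𝕜 R) (AlgHom.id R A)
    (Algebra.TensorProduct.lift (Algebra.ofId (𝕜 R') (𝕜 R' ⊗[R] A)) p
      (residueLift_commute R' p) (1 ⊗ₜ s)) = _
  rw [Algebra.TensorProduct.lift_tmul, map_one, one_mul]

theorem AlgGauge.map_aug_tensor {A B : PreAlgDef K R C} (g : AlgGauge A B)
    (t : 𝕜 R ⊗[R] A.carrier) :
    B.aug (Algebra.TensorProduct.map (AlgHom.id R (𝕜 R)) (g.toEquiv : A.carrier →ₐ[R] B.carrier) t)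
      = A.aug t := by
  obtain ⟨a, rfl⟩ := residue_tensor_eq t
  simpa using g.map_aug a

theorem baseChange_aug {A B : PreAlgDef K R C} (g : AlgGauge A B)
    (f : complTensor R R' A.carrier) :
    B.aug (residueLift K R' (complProj R' B.carrier) (1 ⊗ₜ complEquiv R' g.toEquiv f)) =
      A.aug (residueLift K R' (complProj R' A.carrier) (1 ⊗ₜ f)) := by
  rw [residueLift_one_tmul, residueLift_one_tmul, ← g.map_aug_tensor, ← map_residueEquiv]
  congr 2
  change Algebra.TensorProduct.map (toResidue R') (AlgHom.id R B.carrier)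
    (Algebra.TensorProduct.map (AlgHom.id R' (R' ⧸ 𝔪 R' ^ (0 + 1)))
      (g.toEquiv : A.carrier →ₐ[R] B.carrier) (f.1 0)) =
    Algebra.TensorProduct.map (AlgHom.id R (𝕜 R')) _
      (Algebra.TensorProduct.map (toResidue R') (AlgHom.id R A.carrier) (f.1 0))
  generalize f.1 0 = t
  induction t using TensorProduct.induction_on with
  | zero => simp
  | add t t' ht ht' => simp only [map_add, ht, ht']
  | tmul c a => simp

/-- The gauge transformation `R' ⊗̂_R A → R' ⊗̂_R B` induced by `g : A → B`. -/
def AlgGauge.baseChange {A B : PreAlgDef K R C} (g : AlgGauge A B) :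
    AlgGauge (A.baseChange K R') (B.baseChange K R') where
  toEquiv := complEquiv R' g.toEquiv
  map_br a b := Subtype.ext (funext fun i => map_baseChange (AlgHom.id R' _)
    (g.toEquiv : A.carrier →ₐ[R] B.carrier) A.br B.br g.map_br (a.1 i) (b.1 i))
  map_aug f := baseChange_aug K R' g f

variable [CharZero K] {κ : DefKind}

/-- Base change of deformations, given that it preserves deformations. -/
def AlgDef.baseChange
    (h : ∀ A : AlgDef K R C κ, (A.toPreAlgDef.baseChange K R').IsDeformation κ) :
    AlgDef K R C κ ⥤ AlgDef K R' C κ where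
  obj A := ⟨A.toPreAlgDef.baseChange K R', h A⟩
  map g := AlgGauge.baseChange K R' g
  map_id A := AlgGauge.ext (AlgEquiv.ext fun f => complMap_id R' (A := A.carrier) f)
  map_comp {A B D} (g : AlgGauge _ _) (g' : AlgGauge _ _) :=
    AlgGauge.ext (AlgEquiv.ext fun f =>
      (complMap_complMap R' (g.toEquiv : A.carrier →ₐ[R] B.carrier)
        (g'.toEquiv : B.carrier →ₐ[R] D.carrier) f).symm)

/-- The base change map `AssDef(R, C) → AssDef(R', C)`, `A ↦ R' ⊗̂_R A` (resp. for `PoisDef`),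
given that base change preserves deformations. -/
def algBaseChange
    (h : ∀ A : AlgDef K R C κ, (A.toPreAlgDef.baseChange K R').IsDeformation κ) :
    PreCrossedGroupoid.Map (algDef K R C κ) (algDef K R' C κ) where
  functor := AlgDef.baseChange K R' h
  map₂ a := ⟨toCompl R' a.1, toCompl_mem K R' a.2⟩

end AlgBaseChange

/-! ### Sheaves of algebras, stalks, tensor products -/

section Sheaf

variable {R : Type u} [CommRing R] {X : TopCat.{u}} (𝒜 : TopCat.Presheaf (AlgCat.{u} R) X)

/-- Sections over `V`. -/
abbrev Sec (V : Opens X) : Type u := 𝒜.obj (op V)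

/-- Restriction of sections. -/
def res {V W : Opens X} (h : W ≤ V) : Sec 𝒜 V →ₐ[R] Sec 𝒜 W := (𝒜.map (homOfLE h).op).hom

theorem res_res {V W Z : Opens X} (h : W ≤ V) (h' : Z ≤ W) (s : Sec 𝒜 V) :
    res 𝒜 h' (res 𝒜 h s) = res 𝒜 (h'.trans h) s := by
  simp only [res, ← AlgHom.comp_apply, ← AlgCat.hom_comp, ← Functor.map_comp]
  rfl

theorem res_self {V : Opens X} (h : V ≤ V) (s : Sec 𝒜 V) : res 𝒜 h s = s := by
  have : (homOfLE h).op = 𝟙 (op V) := rfl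
  rw [res, this, CategoryTheory.Functor.map_id]
  rfl

/-- The open neighbourhoods of `x`, ordered by reverse inclusion. -/
abbrev Nhd (x : X) := {V : Opens X // x ∈ V}ᵒᵈ

instance (x : X) : IsDirectedOrder (Nhd x) where
  directed V W := ⟨OrderDual.toDual ⟨(OrderDual.ofDual V).1 ⊓ (OrderDual.ofDual W).1,
    (OrderDual.ofDual V).2, (OrderDual.ofDual W).2⟩,
    show _ ≤ (OrderDual.ofDual V).1 from inf_le_left,
    show _ ≤ (OrderDual.ofDual W).1 from inf_le_right⟩

instance (x : X) : Nonempty (Nhd x) := ⟨OrderDual.toDual ⟨⊤, trivial⟩⟩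

/-- The transition maps defining the stalk at `x`. -/
def nhdMap (x : X) (V W : Nhd x) (h : V ≤ W) :
    Sec 𝒜 (OrderDual.ofDual V).1 →ₐ[R] Sec 𝒜 (OrderDual.ofDual W).1 :=
  res 𝒜 (show (OrderDual.ofDual W).1 ≤ (OrderDual.ofDual V).1 from h)

instance (x : X) : DirectedSystem (fun V : Nhd x => Sec 𝒜 (OrderDual.ofDual V).1)
    (nhdMap 𝒜 x · · ·) where
  map_self _ s := res_self 𝒜 _ s
  map_map _ _ _ _ _ s := res_res 𝒜 _ _ s

/-- The stalk at `x`, the direct limit of the algebras of sections over the neighbourhoods. -/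
def Stalk (x : X) : Type u :=
  DirectLimit (fun V : Nhd x => Sec 𝒜 (OrderDual.ofDual V).1) (nhdMap 𝒜 x)

instance (x : X) : Ring (Stalk 𝒜 x) :=
  inferInstanceAs (Ring (DirectLimit (fun V : Nhd x => Sec 𝒜 (OrderDual.ofDual V).1) (nhdMap 𝒜 x)))

instance (x : X) : Algebra R (Stalk 𝒜 x) :=
  inferInstanceAs
    (Algebra R (DirectLimit (fun V : Nhd x => Sec 𝒜 (OrderDual.ofDual V).1) (nhdMap 𝒜 x)))

/-- The germ at `x` of a section. -/
def germ {V : Opens X} {x : X} (hx : x ∈ V) : Sec 𝒜 V →ₐ[R] Stalk 𝒜 x where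
  toFun s := (⟦⟨OrderDual.toDual ⟨V, hx⟩, s⟩⟧ :
    DirectLimit (fun V : Nhd x => Sec 𝒜 (OrderDual.ofDual V).1) (nhdMap 𝒜 x))
  map_one' := (DirectLimit.one_def (f := nhdMap 𝒜 x) (OrderDual.toDual ⟨V, hx⟩)).symm
  map_mul' _ _ := (DirectLimit.mul_def (f := nhdMap 𝒜 x) (OrderDual.toDual ⟨V, hx⟩) _ _).symm
  map_zero' := (DirectLimit.zero_def (f := nhdMap 𝒜 x) (OrderDual.toDual ⟨V, hx⟩)).symm
  map_add' _ _ := (DirectLimit.add_def (f := nhdMap 𝒜 x) (OrderDual.toDual ⟨V, hx⟩) _ _).symm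
  commutes' r := (DirectLimit.algebraMap_def (f := nhdMap 𝒜 x) (OrderDual.toDual ⟨V, hx⟩) r).symm

theorem germ_res {V W : Opens X} (h : W ≤ V) {x : X} (hx : x ∈ W) (s : Sec 𝒜 V) :
    germ 𝒜 hx (res 𝒜 h s) = germ 𝒜 (h hx) s :=
  Quotient.sound ⟨OrderDual.toDual ⟨W, hx⟩, le_rfl, h, res_res 𝒜 h le_rfl s⟩

theorem exists_germ {x : X} (a : Stalk 𝒜 x) :
    ∃ (V : Opens X) (hx : x ∈ V) (s : Sec 𝒜 V), germ 𝒜 hx s = a := by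
  obtain ⟨V, s, rfl⟩ := DirectLimit.exists_eq_mk (nhdMap 𝒜 x) a
  exact ⟨(OrderDual.ofDual V).1, (OrderDual.ofDual V).2, s, rfl⟩

theorem germ_eq {V W : Opens X} {x : X} (hx : x ∈ V) (hx' : x ∈ W) {s : Sec 𝒜 V} {t : Sec 𝒜 W}
    (h : germ 𝒜 hx s = germ 𝒜 hx' t) :
    ∃ (Z : Opens X) (hZ : Z ≤ V) (hZ' : Z ≤ W) (_ : x ∈ Z), res 𝒜 hZ s = res 𝒜 hZ' t := by
  obtain ⟨Z, h1, h2, h3⟩ := Quotient.eq.1 h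
  exact ⟨(OrderDual.ofDual Z).1, h1, h2, (OrderDual.ofDual Z).2, h3⟩

/-- A homomorphism out of the stalk, given by a compatible family of homomorphisms. -/
def stalkLift (x : X) {B : Type u} [Ring B] [Algebra R B]
    (φ : ∀ V : Opens X, x ∈ V → (Sec 𝒜 V →ₐ[R] B))
    (hφ : ∀ (V W : Opens X) (h : W ≤ V) (hx : x ∈ W) (s : Sec 𝒜 V),
      φ W hx (res 𝒜 h s) = φ V (h hx) s) : Stalk 𝒜 x →ₐ[R] B where
  toFun := DirectLimit.lift (nhdMap 𝒜 x)
    (fun V => φ (OrderDual.ofDual V).1 (OrderDual.ofDual V).2)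
    fun V W h s => (hφ _ _ h (OrderDual.ofDual W).2 s).symm
  map_one' := DirectLimit.lift_one
    (fun V : Nhd x => φ (OrderDual.ofDual V).1 (OrderDual.ofDual V).2) _
  map_mul' := DirectLimit.lift_mul
    (fun V : Nhd x => φ (OrderDual.ofDual V).1 (OrderDual.ofDual V).2) _
  map_zero' := DirectLimit.lift_zero
    (fun V : Nhd x => φ (OrderDual.ofDual V).1 (OrderDual.ofDual V).2) _
  map_add' := DirectLimit.lift_add
    (fun V : Nhd x => φ (OrderDual.ofDual V).1 (OrderDual.ofDual V).2) _
  commutes' r := by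
    rw [← (germ 𝒜 (V := ⊤) (x := x) trivial).commutes r]
    exact (φ ⊤ trivial).commutes r

theorem stalkLift_germ (x : X) {B : Type u} [Ring B] [Algebra R B]
    (φ : ∀ V : Opens X, x ∈ V → (Sec 𝒜 V →ₐ[R] B))
    (hφ : ∀ (V W : Opens X) (h : W ≤ V) (hx : x ∈ W) (s : Sec 𝒜 V),
      φ W hx (res 𝒜 h s) = φ V (h hx) s) {V : Opens X} (hx : x ∈ V) (s : Sec 𝒜 V) :
    stalkLift 𝒜 x φ hφ (germ 𝒜 hx s) = φ V hx s := rfl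

/-- The map `B ⊗_R 𝒜(V) → B ⊗_R 𝒜_x`. -/
def germTensor (B : Type u) [CommRing B] [Algebra R B] {V : Opens X} {x : X} (hx : x ∈ V) :
    B ⊗[R] Sec 𝒜 V →ₐ[B] B ⊗[R] Stalk 𝒜 x :=
  Algebra.TensorProduct.map (AlgHom.id B B) (germ 𝒜 hx)

/-- The map `B ⊗_R 𝒜(V) → B ⊗_R 𝒜(W)`. -/
def resTensor (B : Type u) [CommRing B] [Algebra R B] {V W : Opens X} (h : W ≤ V) :
    B ⊗[R] Sec 𝒜 V →ₐ[B] B ⊗[R] Sec 𝒜 W :=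
  Algebra.TensorProduct.map (AlgHom.id B B) (res 𝒜 h)

theorem germTensor_resTensor (B : Type u) [CommRing B] [Algebra R B] {V W : Opens X} (h : W ≤ V)
    {x : X} (hx : x ∈ W) (t : B ⊗[R] Sec 𝒜 V) :
    germTensor 𝒜 B hx (resTensor 𝒜 B h t) = germTensor 𝒜 B (h hx) t := by
  have : (germ 𝒜 hx).comp (res 𝒜 h) = germ 𝒜 (h hx) := AlgHom.ext fun s => germ_res 𝒜 h hx s
  rw [germTensor, resTensor, ← AlgHom.comp_apply, ← Algebra.TensorProduct.map_comp, this]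
  rfl

/-- The sections over `V` of the sheaf `B ⊗_R 𝒜` associated to the presheaf
`W ↦ B ⊗_R 𝒜(W)`: families of elements of the stalks `B ⊗_R 𝒜_x`, `x ∈ V`, which locally come
from elements of `B ⊗_R 𝒜(W)`. -/
def sheafTensor (B : Type u) [CommRing B] [Algebra R B] (V : Opens X) :
    Subalgebra B (∀ x : V, B ⊗[R] Stalk 𝒜 x.1) where
  carrier := {f | ∀ x : V, ∃ (W : Opens X) (hW : W ≤ V) (_ : x.1 ∈ W) (t : B ⊗[R] Sec 𝒜 W),
    ∀ (y : X) (hy : y ∈ W), f ⟨y, hW hy⟩ = germTensor 𝒜 B hy t}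
  mul_mem' {f g} hf hg x := by
    obtain ⟨W, hW, hx, t, ht⟩ := hf x
    obtain ⟨W', hW', hx', t', ht'⟩ := hg x
    refine ⟨W ⊓ W', inf_le_left.trans hW, ⟨hx, hx'⟩,
      resTensor 𝒜 B inf_le_left t * resTensor 𝒜 B inf_le_right t', fun y hy => ?_⟩
    rw [map_mul, germTensor_resTensor, germTensor_resTensor, ← ht, ← ht']
    rfl
  add_mem' {f g} hf hg x := by
    obtain ⟨W, hW, hx, t, ht⟩ := hf x
    obtain ⟨W', hW', hx', t', ht'⟩ := hg x
    refine ⟨W ⊓ W', inf_le_left.trans hW, ⟨hx, hx'⟩,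
      resTensor 𝒜 B inf_le_left t + resTensor 𝒜 B inf_le_right t', fun y hy => ?_⟩
    rw [map_add, germTensor_resTensor, germTensor_resTensor, ← ht, ← ht']
    rfl
  algebraMap_mem' b x := ⟨V, le_rfl, x.2, algebraMap B _ b, fun y hy =>
    ((germTensor 𝒜 B hy).commutes b).symm⟩

/-- The canonical map `B ⊗_R 𝒜(V) → (B ⊗_R 𝒜)(V)`. -/
def toSheafTensor (B : Type u) [CommRing B] [Algebra R B] (V : Opens X) :
    B ⊗[R] Sec 𝒜 V →ₐ[B] sheafTensor 𝒜 B V :=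
  (AlgHom.pi fun x : V => germTensor 𝒜 B x.2).codRestrict (sheafTensor 𝒜 B V) fun t x =>
    ⟨V, le_rfl, x.2, t, fun _ _ => rfl⟩

/-- Restriction of sections of `B ⊗_R 𝒜`. -/
def sheafTensorRes (B : Type u) [CommRing B] [Algebra R B] {V W : Opens X} (h : W ≤ V)
    (f : sheafTensor 𝒜 B V) : sheafTensor 𝒜 B W :=
  ⟨fun x => f.1 ⟨x.1, h x.2⟩, fun x => by
    obtain ⟨Z, hZ, hx, t, ht⟩ := f.2 ⟨x.1, h x.2⟩
    refine ⟨Z ⊓ W, inf_le_right, ⟨hx, x.2⟩, resTensor 𝒜 B inf_le_left t, fun y hy => ?_⟩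
    rw [germTensor_resTensor, ← ht]⟩

/-- The bracket on the stalk `𝒜_x` induced by brackets on the sections, as a map of sets. -/
def preStalkBr (br : ∀ V : Opens X, Sec 𝒜 V →ₗ[R] Sec 𝒜 V →ₗ[R] Sec 𝒜 V)
    (hbr : ∀ {V W : Opens X} (h : W ≤ V) (a b : Sec 𝒜 V),
      res 𝒜 h (br V a b) = br W (res 𝒜 h a) (res 𝒜 h b)) (x : X) :
    Stalk 𝒜 x → Stalk 𝒜 x → Stalk 𝒜 x :=
  DirectLimit.map₂ (nhdMap 𝒜 x) (nhdMap 𝒜 x) (nhdMap 𝒜 x)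
    (fun V a b => br (OrderDual.ofDual V).1 a b) fun _ _ h a b => hbr h a b

theorem preStalkBr_germ (br : ∀ V : Opens X, Sec 𝒜 V →ₗ[R] Sec 𝒜 V →ₗ[R] Sec 𝒜 V)
    (hbr : ∀ {V W : Opens X} (h : W ≤ V) (a b : Sec 𝒜 V),
      res 𝒜 h (br V a b) = br W (res 𝒜 h a) (res 𝒜 h b)) {V : Opens X} {x : X} (hx : x ∈ V)
    (a b : Sec 𝒜 V) :
    preStalkBr 𝒜 br hbr x (germ 𝒜 hx a) (germ 𝒜 hx b) = germ 𝒜 hx (br V a b) :=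
  DirectLimit.map₂_def (nhdMap 𝒜 x) (nhdMap 𝒜 x) (nhdMap 𝒜 x)
      (fun V a b => br (OrderDual.ofDual V).1 a b) (fun _ _ h a b => hbr h a b)
      (OrderDual.toDual ⟨V, hx⟩) a b

theorem exists_germ₃ {x : X} (a b c : Stalk 𝒜 x) :
    ∃ (V : Opens X) (hx : x ∈ V) (s t r : Sec 𝒜 V),
      germ 𝒜 hx s = a ∧ germ 𝒜 hx t = b ∧ germ 𝒜 hx r = c := by
  obtain ⟨V, hV, s, rfl⟩ := exists_germ 𝒜 a
  obtain ⟨W, hW, t, rfl⟩ := exists_germ 𝒜 b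
  obtain ⟨Z, hZ, r, rfl⟩ := exists_germ 𝒜 c
  exact ⟨V ⊓ W ⊓ Z, ⟨⟨hV, hW⟩, hZ⟩, res 𝒜 (inf_le_left.trans inf_le_left) s,
    res 𝒜 (inf_le_left.trans inf_le_right) t, res 𝒜 inf_le_right r,
    germ_res 𝒜 _ _ _, germ_res 𝒜 _ _ _, germ_res 𝒜 _ _ _⟩

/-- The bracket on the stalk `𝒜_x` induced by brackets on the sections. -/
def stalkBr (br : ∀ V : Opens X, Sec 𝒜 V →ₗ[R] Sec 𝒜 V →ₗ[R] Sec 𝒜 V)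
    (hbr : ∀ {V W : Opens X} (h : W ≤ V) (a b : Sec 𝒜 V),
      res 𝒜 h (br V a b) = br W (res 𝒜 h a) (res 𝒜 h b)) (x : X) :
    Stalk 𝒜 x →ₗ[R] Stalk 𝒜 x →ₗ[R] Stalk 𝒜 x :=
  LinearMap.mk₂ R (preStalkBr 𝒜 br hbr x)
    (fun a a' b => by
      obtain ⟨V, hx, a, a', b, rfl, rfl, rfl⟩ := exists_germ₃ 𝒜 a a' b
      rw [← map_add, preStalkBr_germ, preStalkBr_germ, preStalkBr_germ, map_add,
        LinearMap.add_apply, map_add])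
    (fun r a b => by
      obtain ⟨V, hx, a, b, -, rfl, rfl, -⟩ := exists_germ₃ 𝒜 a b 0
      rw [← map_smul, preStalkBr_germ, preStalkBr_germ, map_smul, LinearMap.smul_apply, map_smul])
    (fun a b b' => by
      obtain ⟨V, hx, a, b, b', rfl, rfl, rfl⟩ := exists_germ₃ 𝒜 a b b'
      rw [← map_add, preStalkBr_germ, preStalkBr_germ, preStalkBr_germ, map_add, map_add])
    (fun r a b => by
      obtain ⟨V, hx, a, b, -, rfl, rfl, -⟩ := exists_germ₃ 𝒜 a b 0
      rw [← map_smul, preStalkBr_germ, preStalkBr_germ, map_smul, map_smul])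

theorem stalkBr_germ (br : ∀ V : Opens X, Sec 𝒜 V →ₗ[R] Sec 𝒜 V →ₗ[R] Sec 𝒜 V)
    (hbr : ∀ {V W : Opens X} (h : W ≤ V) (a b : Sec 𝒜 V),
      res 𝒜 h (br V a b) = br W (res 𝒜 h a) (res 𝒜 h b)) {V : Opens X} {x : X} (hx : x ∈ V)
    (a b : Sec 𝒜 V) :
    germ 𝒜 hx (br V a b) = stalkBr 𝒜 br hbr x (germ 𝒜 hx a) (germ 𝒜 hx b) :=
  (preStalkBr_germ 𝒜 br hbr hx a b).symm

section Compl

variable (R' : Type u) [CommRing R'] [IsLocalRing R'] [Algebra R R']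

/-- The sections over `V` of the sheaf `R' ⊗̂_R 𝒜 = lim_i (R'_i ⊗_R 𝒜)`. -/
def complSheaf (V : Opens X) :
    Subalgebra R' (∀ (i : ℕ) (x : V), (R' ⧸ 𝔪 R' ^ (i + 1)) ⊗[R] Stalk 𝒜 x.1) where
  carrier := {f | (∀ i, f i ∈ sheafTensor 𝒜 (R' ⧸ 𝔪 R' ^ (i + 1)) V) ∧
    ∀ i x, transTensor R R' (Stalk 𝒜 x.1) i (f (i + 1) x) = f i x}
  mul_mem' {f g} hf hg :=
    ⟨fun i => (sheafTensor 𝒜 (R' ⧸ 𝔪 R' ^ (i + 1)) V).mul_mem (hf.1 i) (hg.1 i), fun i x => by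
      have h := map_mul (transTensor R R' (Stalk 𝒜 x.1) i) (f (i + 1) x) (g (i + 1) x)
      rw [hf.2 i x, hg.2 i x] at h
      exact h⟩
  add_mem' {f g} hf hg :=
    ⟨fun i => (sheafTensor 𝒜 (R' ⧸ 𝔪 R' ^ (i + 1)) V).add_mem (hf.1 i) (hg.1 i), fun i x => by
      have h := map_add (transTensor R R' (Stalk 𝒜 x.1) i) (f (i + 1) x) (g (i + 1) x)
      rw [hf.2 i x, hg.2 i x] at h
      exact h⟩
  algebraMap_mem' r := ⟨fun i => Subalgebra.algebraMap_mem
      (sheafTensor 𝒜 (R' ⧸ 𝔪 R' ^ (i + 1)) V) (algebraMap R' (R' ⧸ 𝔪 R' ^ (i + 1)) r),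
    fun i x => (transTensor R R' (Stalk 𝒜 x.1) i).commutes r⟩

/-- The canonical map `R' ⊗̂_R 𝒜(V) → (R' ⊗̂_R 𝒜)(V)`. -/
def complToSheaf (V : Opens X) : complTensor R R' (Sec 𝒜 V) →ₐ[R'] complSheaf 𝒜 R' V where
  toFun f := ⟨fun i x => germTensor 𝒜 (R' ⧸ 𝔪 R' ^ (i + 1)) x.2 (f.1 i),
    fun i x => ⟨V, le_rfl, x.2, f.1 i, fun _ _ => rfl⟩, fun i x => by
      beta_reduce
      rw [← f.2 i]
      generalize f.1 (i + 1) = t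
      induction t using TensorProduct.induction_on with
      | zero => simp
      | add t t' ht ht' => simp only [map_add, ht, ht']
      | tmul c a => simp [germTensor, transTensor]⟩
  map_one' := Subtype.ext (funext fun i => funext fun x =>
    map_one (germTensor 𝒜 (R' ⧸ 𝔪 R' ^ (i + 1)) x.2))
  map_mul' f g := Subtype.ext (funext fun i => funext fun x =>
    map_mul (germTensor 𝒜 (R' ⧸ 𝔪 R' ^ (i + 1)) x.2) (f.1 i) (g.1 i))
  map_zero' := Subtype.ext (funext fun i => funext fun x =>
    map_zero (germTensor 𝒜 (R' ⧸ 𝔪 R' ^ (i + 1)) x.2))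
  map_add' f g := Subtype.ext (funext fun i => funext fun x =>
    map_add (germTensor 𝒜 (R' ⧸ 𝔪 R' ^ (i + 1)) x.2) (f.1 i) (g.1 i))
  commutes' r := Subtype.ext (funext fun i => funext fun x =>
    (germTensor 𝒜 (R' ⧸ 𝔪 R' ^ (i + 1)) x.2).commutes (algebraMap R' (R' ⧸ 𝔪 R' ^ (i + 1)) r))

/-- The canonical map `𝒜(V) → (R' ⊗̂_R 𝒜)(V)`. -/
def toComplSheaf (V : Opens X) (s : Sec 𝒜 V) : complSheaf 𝒜 R' V :=
  complToSheaf 𝒜 R' V (toCompl R' s)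

/-- Restriction of sections of `R' ⊗̂_R 𝒜`. -/
def complSheafRes {V W : Opens X} (h : W ≤ V) : complSheaf 𝒜 R' V →ₐ[R'] complSheaf 𝒜 R' W where
  toFun f := ⟨fun i x => f.1 i ⟨x.1, h x.2⟩,
    fun i => (sheafTensorRes 𝒜 (R' ⧸ 𝔪 R' ^ (i + 1)) h ⟨f.1 i, f.2.1 i⟩).2,
    fun i x => f.2.2 i ⟨x.1, h x.2⟩⟩
  map_one' := rfl
  map_mul' _ _ := rfl
  map_zero' := rfl
  map_add' _ _ := rfl
  commutes' _ := rfl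

/-- The sheaf of `R'`-algebras `R' ⊗̂_R 𝒜`. -/
def complPresheaf : TopCat.Presheaf (AlgCat.{u} R') X where
  obj V := AlgCat.of R' (complSheaf 𝒜 R' V.unop)
  map h := AlgCat.ofHom (complSheafRes 𝒜 R' h.unop.le)
  map_id _ := rfl
  map_comp _ _ := rfl

end Compl

end Sheaf

/-! ### Deformations of sheaves of algebras -/

section SheafFilt

variable {R : Type u} [CommRing R] [IsLocalRing R]

theorem map_adicFilt {A B : Type u} [AddCommGroup A] [Module R A] [AddCommGroup B] [Module R B]
    (φ : A →ₗ[R] B) {n : ℕ} {a : A} (ha : a ∈ adicFilt R A n) : φ a ∈ adicFilt R B n := by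
  refine Submodule.smul_induction_on ha (fun r hr x _ => ?_) fun x y hx hy => ?_
  · rw [map_smul]; exact Submodule.smul_mem_smul hr trivial
  · rw [map_add]; exact Submodule.add_mem _ hx hy

theorem one_tmul_eq_zero_iff {A : Type u} [AddCommGroup A] [Module R A] (n : ℕ) (a : A) :
    (1 : R ⧸ 𝔪 R ^ n) ⊗ₜ[R] a = 0 ↔ a ∈ adicFilt R A n := by
  rw [← (TensorProduct.quotTensorEquivQuotSMul A (𝔪 R ^ n)).map_eq_zero_iff,
    ← map_one (Ideal.Quotient.mk (𝔪 R ^ n)), TensorProduct.quotTensorEquivQuotSMul_mk_tmul,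
    one_smul, Submodule.Quotient.mk_eq_zero]
  rfl

variable {X : TopCat.{u}} (𝒜 : TopCat.Presheaf (AlgCat.{u} R) X)

theorem res_adicFilt {V W : Opens X} (h : W ≤ V) {n : ℕ} {s : Sec 𝒜 V}
    (hs : s ∈ adicFilt R (Sec 𝒜 V) n) : res 𝒜 h s ∈ adicFilt R (Sec 𝒜 W) n :=
  map_adicFilt (res 𝒜 h).toLinearMap hs

/-- `Γ(V, 𝔪 ^ n 𝒜)`: the sections which locally lie in `𝔪 ^ n 𝒜(W)`. -/
def sheafFilt (V : Opens X) (n : ℕ) : Submodule R (Sec 𝒜 V) where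
  carrier := {s | ∀ x ∈ V, ∃ (W : Opens X) (hW : W ≤ V), x ∈ W ∧
    res 𝒜 hW s ∈ adicFilt R (Sec 𝒜 W) n}
  zero_mem' x hx := ⟨V, le_rfl, hx, by rw [map_zero]; exact Submodule.zero_mem _⟩
  add_mem' {s t} hs ht x hx := by
    obtain ⟨W, hW, hxW, h1⟩ := hs x hx
    obtain ⟨Z, hZ, hxZ, h2⟩ := ht x hx
    refine ⟨W ⊓ Z, inf_le_left.trans hW, ⟨hxW, hxZ⟩, ?_⟩
    rw [map_add, ← res_res 𝒜 hW inf_le_left s, ← res_res 𝒜 hZ inf_le_right t]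
    exact Submodule.add_mem _ (res_adicFilt 𝒜 _ h1) (res_adicFilt 𝒜 _ h2)
  smul_mem' r s hs x hx := by
    obtain ⟨W, hW, hxW, h1⟩ := hs x hx
    exact ⟨W, hW, hxW, by rw [map_smul]; exact Submodule.smul_mem _ _ h1⟩

theorem res_sheafFilt {V W : Opens X} (h : W ≤ V) {n : ℕ} {s : Sec 𝒜 V}
    (hs : s ∈ sheafFilt 𝒜 V n) : res 𝒜 h s ∈ sheafFilt 𝒜 W n := fun x hx => by
  obtain ⟨Z, hZ, hxZ, h1⟩ := hs x (h hx)
  refine ⟨Z ⊓ W, inf_le_right, ⟨hxZ, hx⟩, ?_⟩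
  have := res_adicFilt 𝒜 (inf_le_left : Z ⊓ W ≤ Z) h1
  rw [res_res] at this ⊢
  exact this

theorem sheafFilt_bilin (B : ∀ V : Opens X, Sec 𝒜 V →ₗ[R] Sec 𝒜 V →ₗ[R] Sec 𝒜 V)
    (hB : ∀ {V W : Opens X} (h : W ≤ V) (a b : Sec 𝒜 V),
      res 𝒜 h (B V a b) = B W (res 𝒜 h a) (res 𝒜 h b)) {V : Opens X} {i j : ℕ} {a b : Sec 𝒜 V}
    (ha : a ∈ sheafFilt 𝒜 V i) (hb : b ∈ sheafFilt 𝒜 V j) :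
    B V a b ∈ sheafFilt 𝒜 V (i + j) := fun x hx => by
  obtain ⟨W, hW, hxW, h1⟩ := ha x hx
  obtain ⟨Z, hZ, hxZ, h2⟩ := hb x hx
  refine ⟨W ⊓ Z, inf_le_left.trans hW, ⟨hxW, hxZ⟩, ?_⟩
  have h1' := res_adicFilt 𝒜 (inf_le_left : W ⊓ Z ≤ W) h1
  have h2' := res_adicFilt 𝒜 (inf_le_right : W ⊓ Z ≤ Z) h2
  rw [res_res] at h1' h2'
  rw [hB]
  exact adicFilt_bilin _ h1' h2'

theorem exists_germ_adicFilt {x : X} {n : ℕ} {a : Stalk 𝒜 x}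
    (ha : a ∈ adicFilt R (Stalk 𝒜 x) n) :
    ∃ (V : Opens X) (hx : x ∈ V) (s : Sec 𝒜 V), s ∈ adicFilt R (Sec 𝒜 V) n ∧ germ 𝒜 hx s = a := by
  refine Submodule.smul_induction_on ha (fun r hr a _ => ?_) fun a b ha hb => ?_
  · obtain ⟨V, hx, s, rfl⟩ := exists_germ 𝒜 a
    exact ⟨V, hx, r • s, Submodule.smul_mem_smul hr trivial, map_smul _ _ _⟩
  · obtain ⟨V, hV, s, hs, rfl⟩ := ha
    obtain ⟨W, hW, t, ht, rfl⟩ := hb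
    refine ⟨V ⊓ W, ⟨hV, hW⟩, res 𝒜 inf_le_left s + res 𝒜 inf_le_right t,
      Submodule.add_mem _ (res_adicFilt 𝒜 _ hs) (res_adicFilt 𝒜 _ ht), ?_⟩
    exact (map_add _ _ _).trans (congrArg₂ (· + ·) (germ_res 𝒜 _ _ _) (germ_res 𝒜 _ _ _))

theorem mem_sheafFilt_iff {V : Opens X} {n : ℕ} {s : Sec 𝒜 V} :
    s ∈ sheafFilt 𝒜 V n ↔ ∀ (x : X) (hx : x ∈ V), (1 : R ⧸ 𝔪 R ^ n) ⊗ₜ[R] germ 𝒜 hx s = 0 := by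
  simp only [one_tmul_eq_zero_iff]
  constructor
  · intro hs x hx
    obtain ⟨W, hW, hxW, h1⟩ := hs x hx
    rw [← germ_res 𝒜 hW hxW]
    exact map_adicFilt (germ 𝒜 hxW).toLinearMap h1
  · intro h x hx
    obtain ⟨W, hxW, t, ht, e⟩ := exists_germ_adicFilt 𝒜 (h x hx)
    obtain ⟨Z, hZ, hZ', hxZ, e'⟩ := germ_eq 𝒜 hxW hx e
    refine ⟨Z, hZ', hxZ, ?_⟩
    rw [← e']
    exact res_adicFilt 𝒜 hZ ht

theorem isCompleteFilt_sheafFilt {V : Opens X}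
    (h : Function.Bijective (toComplSheaf 𝒜 R V)) : IsCompleteFilt (sheafFilt 𝒜 V) where
  antitone i j hij s hs x hx := by
    obtain ⟨W, hW, hxW, h1⟩ := hs x hx
    exact ⟨W, hW, hxW, Submodule.smul_mono_left (Ideal.pow_le_pow_right hij) h1⟩
  sep s hs := h.1 <| Subtype.ext <| funext fun i => funext fun x => by
    have h1 := (mem_sheafFilt_iff 𝒜).1 (hs (i + 1)) x.1 x.2
    have h2 : (toComplSheaf 𝒜 R V 0).1 i x =
      (1 : R ⧸ 𝔪 R ^ (i + 1)) ⊗ₜ[R] germ 𝒜 x.2 (0 : Sec 𝒜 V) := rfl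
    rw [h2, map_zero, TensorProduct.tmul_zero]
    exact h1
  complete s hs := by
    obtain ⟨z, hz⟩ := h.2 ⟨fun i x => (1 : R ⧸ 𝔪 R ^ (i + 1)) ⊗ₜ[R] germ 𝒜 x.2 (s (i + 1)),
      fun i x => ⟨V, le_rfl, x.2, 1 ⊗ₜ s (i + 1), fun y hy => rfl⟩, fun i x => by
        have h1 := (mem_sheafFilt_iff 𝒜).1 (hs (i + 1)) x.1 x.2
        rw [map_sub, TensorProduct.tmul_sub, sub_eq_zero] at h1
        beta_reduce
        rw [← h1]
        change Algebra.TensorProduct.map (transition R i) (AlgHom.id R (Stalk 𝒜 x.1)) _ = _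
        rw [Algebra.TensorProduct.map_tmul, map_one]
        rfl⟩
    refine ⟨z, fun n => ?_⟩
    rcases n with _ | i
    · exact fun x hx => ⟨V, le_rfl, hx, by simp [adicFilt]⟩
    · rw [mem_sheafFilt_iff]
      intro x hx
      rw [map_sub, TensorProduct.tmul_sub, sub_eq_zero]
      exact congrFun (congrFun (congrArg Subtype.val hz) i) ⟨x, hx⟩

end SheafFilt

section SheafDef

variable (K R : Type u) [Field K] [CommRing R] [Algebra K R] [IsLocalRing R] {X : TopCat.{u}}
  (O : TopCat.Presheaf (CommAlgCat.{u} K) X)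

/-- A presheaf of `R`-algebras `𝒜` with an `R`-bilinear bracket and a homomorphism
`ψ : K ⊗_R 𝒜 → O` of sheaves of `K`-algebras. -/
structure PreSheafDef where
  alg : TopCat.Presheaf (AlgCat.{u} R) X
  br : ∀ V : Opens X, Sec alg V →ₗ[R] Sec alg V →ₗ[R] Sec alg V
  br_res : ∀ {V W : Opens X} (h : W ≤ V) (a b : Sec alg V),
    res alg h (br V a b) = br W (res alg h a) (res alg h b)
  aug : ∀ V : Opens X, sheafTensor alg (𝕜 R) V →ₐ[K] O.obj (op V)
  aug_res : ∀ {V W : Opens X} (h : W ≤ V) (f : sheafTensor alg (𝕜 R) V),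
    aug W (sheafTensorRes alg (𝕜 R) h f) = (O.map (homOfLE h).op).hom (aug V f)

variable {K R O}

/-- `𝒜` is an associative, resp. Poisson, `R`-deformation of `O`: it is a sheaf, flat over `R`,
`𝔪`-adically complete (that is, `𝒜 → lim_i R_i ⊗_R 𝒜` is an isomorphism of sheaves), and `ψ` is an
isomorphism, for the zero bracket on `O`. -/
structure PreSheafDef.IsDeformation (𝒜 : PreSheafDef K R O) (κ : DefKind) : Prop where
  isSheaf : 𝒜.alg.IsSheaf
  kind : ∀ V, IsBracketOfKind (𝒜.br V) κ
  flat : ∀ x, Module.Flat R (Stalk 𝒜.alg x)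
  complete : ∀ V, Function.Bijective (toComplSheaf 𝒜.alg R V)
  bijective_aug : ∀ V, Function.Bijective (𝒜.aug V)
  aug_br : ∀ V a b, 𝒜.aug V (toSheafTensor 𝒜.alg (𝕜 R) V (1 ⊗ₜ 𝒜.br V a b)) = 0

variable (K R O) in
/-- The associative, resp. Poisson, `R`-deformations of the sheaf of `K`-algebras `O`. -/
structure SheafDef (κ : DefKind) extends PreSheafDef K R O where
  isDeformation : toPreSheafDef.IsDeformation κ

end SheafDef

section SheafHom

variable {R : Type u} [CommRing R] {X : TopCat.{u}}

/-- Homomorphisms of presheaves of `R`-algebras. -/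
@[ext]
structure SheafHom (𝒜 ℬ : TopCat.Presheaf (AlgCat.{u} R) X) where
  app : ∀ V : Opens X, Sec 𝒜 V →ₐ[R] Sec ℬ V
  app_res : ∀ {V W : Opens X} (h : W ≤ V) (s : Sec 𝒜 V),
    app W (res 𝒜 h s) = res ℬ h (app V s)

variable {𝒜 ℬ 𝒞 : TopCat.Presheaf (AlgCat.{u} R) X}

/-- The identity. -/
def SheafHom.id (𝒜 : TopCat.Presheaf (AlgCat.{u} R) X) : SheafHom 𝒜 𝒜 where
  app V := AlgHom.id R (Sec 𝒜 V)
  app_res _ _ := rfl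

/-- Composition, first `g` and then `h`. -/
def SheafHom.comp (g : SheafHom 𝒜 ℬ) (h : SheafHom ℬ 𝒞) : SheafHom 𝒜 𝒞 where
  app V := (h.app V).comp (g.app V)
  app_res i s := by
    change h.app _ (g.app _ (res 𝒜 i s)) = res 𝒞 i (h.app _ (g.app _ s))
    rw [g.app_res, h.app_res]

/-- The map induced on stalks. -/
def stalkMap (g : SheafHom 𝒜 ℬ) (x : X) : Stalk 𝒜 x →ₐ[R] Stalk ℬ x :=
  stalkLift 𝒜 x (fun V hx => (germ ℬ hx).comp (g.app V)) fun V W h hx s => by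
    change germ ℬ hx (g.app W (res 𝒜 h s)) = germ ℬ (h hx) (g.app V s)
    rw [g.app_res, germ_res]

theorem stalkMap_germ (g : SheafHom 𝒜 ℬ) {V : Opens X} {x : X} (hx : x ∈ V) (s : Sec 𝒜 V) :
    stalkMap g x (germ 𝒜 hx s) = germ ℬ hx (g.app V s) := rfl

theorem stalkMap_id (x : X) : stalkMap (SheafHom.id 𝒜) x = AlgHom.id R (Stalk 𝒜 x) :=
  AlgHom.ext fun a => by
    obtain ⟨V, hx, s, rfl⟩ := exists_germ 𝒜 a
    rfl

theorem stalkMap_comp (g : SheafHom 𝒜 ℬ) (h : SheafHom ℬ 𝒞) (x : X) :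
    stalkMap (g.comp h) x = (stalkMap h x).comp (stalkMap g x) :=
  AlgHom.ext fun a => by
    obtain ⟨V, hx, s, rfl⟩ := exists_germ 𝒜 a
    rfl

/-- The map `B ⊗_R 𝒜_x → B ⊗_R ℬ_x`. -/
def stalkTensor (B : Type u) [CommRing B] [Algebra R B] (g : SheafHom 𝒜 ℬ) (x : X) :
    B ⊗[R] Stalk 𝒜 x →ₐ[B] B ⊗[R] Stalk ℬ x :=
  Algebra.TensorProduct.map (AlgHom.id B B) (stalkMap g x)

theorem stalkTensor_id (B : Type u) [CommRing B] [Algebra R B] (x : X) (t : B ⊗[R] Stalk 𝒜 x) :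
    stalkTensor B (SheafHom.id 𝒜) x t = t := by
  rw [stalkTensor, stalkMap_id, Algebra.TensorProduct.map_id]
  rfl

theorem stalkTensor_comp (B : Type u) [CommRing B] [Algebra R B] (g : SheafHom 𝒜 ℬ)
    (h : SheafHom ℬ 𝒞) (x : X) (t : B ⊗[R] Stalk 𝒜 x) :
    stalkTensor B (g.comp h) x t = stalkTensor B h x (stalkTensor B g x t) := by
  rw [stalkTensor, stalkTensor, stalkTensor, stalkMap_comp, ← AlgHom.comp_apply,
    ← Algebra.TensorProduct.map_comp]
  rfl

theorem stalkTensor_germTensor (B : Type u) [CommRing B] [Algebra R B] (g : SheafHom 𝒜 ℬ)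
    {V : Opens X} {x : X} (hx : x ∈ V) (t : B ⊗[R] Sec 𝒜 V) :
    stalkTensor B g x (germTensor 𝒜 B hx t) =
      germTensor ℬ B hx (Algebra.TensorProduct.map (AlgHom.id B B) (g.app V) t) := by
  rw [stalkTensor, germTensor, germTensor, ← AlgHom.comp_apply, ← AlgHom.comp_apply,
    ← Algebra.TensorProduct.map_comp, ← Algebra.TensorProduct.map_comp]
  rfl

/-- The map `B ⊗_R 𝒜 → B ⊗_R ℬ` of sheaves. -/
def sheafTensorMap (B : Type u) [CommRing B] [Algebra R B] (g : SheafHom 𝒜 ℬ) (V : Opens X)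
    (f : sheafTensor 𝒜 B V) : sheafTensor ℬ B V :=
  ⟨fun x => stalkTensor B g x.1 (f.1 x), fun x => by
    obtain ⟨W, hW, hx, t, ht⟩ := f.2 x
    refine ⟨W, hW, hx, Algebra.TensorProduct.map (AlgHom.id B B) (g.app W) t, fun y hy => ?_⟩
    rw [← stalkTensor_germTensor, ← ht]⟩

theorem sheafTensorMap_id (B : Type u) [CommRing B] [Algebra R B] (V : Opens X)
    (f : sheafTensor 𝒜 B V) : sheafTensorMap B (SheafHom.id 𝒜) V f = f :=
  Subtype.ext (funext fun x => stalkTensor_id B x.1 (f.1 x))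

theorem sheafTensorMap_comp (B : Type u) [CommRing B] [Algebra R B] (g : SheafHom 𝒜 ℬ)
    (h : SheafHom ℬ 𝒞) (V : Opens X) (f : sheafTensor 𝒜 B V) :
    sheafTensorMap B (g.comp h) V f = sheafTensorMap B h V (sheafTensorMap B g V f) :=
  Subtype.ext (funext fun x => stalkTensor_comp B g h x.1 (f.1 x))

/-- An isomorphism of presheaves of algebras. -/
structure SheafEquiv (𝒜 ℬ : TopCat.Presheaf (AlgCat.{u} R) X) where
  hom : SheafHom 𝒜 ℬ
  inv : SheafHom ℬ 𝒜
  hom_inv : hom.comp inv = SheafHom.id 𝒜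
  inv_hom : inv.comp hom = SheafHom.id ℬ

theorem SheafEquiv.ext {g h : SheafEquiv 𝒜 ℬ} (e : g.hom = h.hom) : g = h := by
  have h1 : g.inv = h.inv := by
    have h2 : g.inv.comp (h.hom.comp h.inv) = h.inv := by
      rw [← e]
      change (g.inv.comp g.hom).comp h.inv = h.inv
      rw [g.inv_hom]
      rfl
    rw [h.hom_inv] at h2
    exact h2
  cases g
  cases h
  cases e
  cases h1
  rfl

theorem SheafEquiv.inv_app_hom_app (g : SheafEquiv 𝒜 ℬ) (V : Opens X) (s : Sec 𝒜 V) :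
    g.inv.app V (g.hom.app V s) = s :=
  DFunLike.congr_fun (congrFun (congrArg SheafHom.app g.hom_inv) V) s

theorem SheafEquiv.hom_app_inv_app (g : SheafEquiv 𝒜 ℬ) (V : Opens X) (s : Sec ℬ V) :
    g.hom.app V (g.inv.app V s) = s :=
  DFunLike.congr_fun (congrFun (congrArg SheafHom.app g.inv_hom) V) s

/-- The isomorphism of the algebras of sections. -/
def SheafEquiv.toAlgEquiv (g : SheafEquiv 𝒜 ℬ) (V : Opens X) : Sec 𝒜 V ≃ₐ[R] Sec ℬ V :=
  AlgEquiv.ofAlgHom (g.hom.app V) (g.inv.app V)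
    (AlgHom.ext fun s => g.hom_app_inv_app V s) (AlgHom.ext fun s => g.inv_app_hom_app V s)

end SheafHom

section SheafGauge

variable {K R : Type u} [Field K] [CommRing R] [Algebra K R] [IsLocalRing R] {X : TopCat.{u}}
  {O : TopCat.Presheaf (CommAlgCat.{u} K) X}

/-- Gauge transformations: isomorphisms of sheaves of `R`-algebras which respect the brackets and
commute with the augmentations. -/
@[ext]
structure SheafGauge (𝒜 ℬ : PreSheafDef K R O) where
  toEquiv : SheafEquiv 𝒜.alg ℬ.alg
  map_br : ∀ V a b, toEquiv.hom.app V (𝒜.br V a b) =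
    ℬ.br V (toEquiv.hom.app V a) (toEquiv.hom.app V b)
  map_aug : ∀ V f, ℬ.aug V (sheafTensorMap (𝕜 R) toEquiv.hom V f) = 𝒜.aug V f

variable {κ : DefKind}

instance : Groupoid (SheafDef K R O κ) where
  Hom 𝒜 ℬ := SheafGauge 𝒜.toPreSheafDef ℬ.toPreSheafDef
  id 𝒜 := ⟨⟨SheafHom.id 𝒜.alg, SheafHom.id 𝒜.alg, rfl, rfl⟩, fun _ _ _ => rfl,
    fun V f => congrArg (𝒜.aug V) (sheafTensorMap_id (𝕜 R) V f)⟩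
  comp {𝒜 ℬ 𝒞} g h := ⟨⟨g.toEquiv.hom.comp h.toEquiv.hom, h.toEquiv.inv.comp g.toEquiv.inv, by
      change g.toEquiv.hom.comp ((h.toEquiv.hom.comp h.toEquiv.inv).comp g.toEquiv.inv) = _
      rw [h.toEquiv.hom_inv]
      exact g.toEquiv.hom_inv, by
      change h.toEquiv.inv.comp ((g.toEquiv.inv.comp g.toEquiv.hom).comp h.toEquiv.hom) = _
      rw [g.toEquiv.inv_hom]
      exact h.toEquiv.inv_hom⟩,
    fun V a b => by
      change h.toEquiv.hom.app V (g.toEquiv.hom.app V (𝒜.br V a b)) = _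
      rw [g.map_br, h.map_br]
      rfl,
    fun V f => by rw [sheafTensorMap_comp, h.map_aug, g.map_aug]⟩
  inv {𝒜 ℬ} g := ⟨⟨g.toEquiv.inv, g.toEquiv.hom, g.toEquiv.inv_hom, g.toEquiv.hom_inv⟩,
    fun V a b => by
      refine (g.toEquiv.toAlgEquiv V).injective ?_
      change g.toEquiv.hom.app V (g.toEquiv.inv.app V (ℬ.br V a b)) =
        g.toEquiv.hom.app V (𝒜.br V (g.toEquiv.inv.app V a) (g.toEquiv.inv.app V b))
      rw [g.map_br]
      simp only [SheafEquiv.hom_app_inv_app],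
    fun V f => by
      rw [← g.map_aug, ← sheafTensorMap_comp, g.toEquiv.inv_hom, sheafTensorMap_id]⟩
  id_comp _ := rfl
  comp_id _ := rfl
  assoc _ _ _ := rfl
  inv_comp g := SheafGauge.ext (SheafEquiv.ext g.toEquiv.inv_hom)
  comp_inv g := SheafGauge.ext (SheafEquiv.ext g.toEquiv.hom_inv)

theorem SheafDef.isFiltBracket (𝒜 : SheafDef K R O κ) (V : Opens X) :
    IsFiltBracket (sheafFilt 𝒜.alg V) (𝒜.br V) where
  toIsCompleteFilt := isCompleteFilt_sheafFilt 𝒜.alg (𝒜.isDeformation.complete V)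
  bracket_mem ha hb := sheafFilt_bilin 𝒜.alg 𝒜.br 𝒜.br_res ha hb
  mem_zero a x hx := ⟨V, le_rfl, hx, by simp [adicFilt]⟩

theorem sheafFilt_mul (𝒜 : TopCat.Presheaf (AlgCat.{u} R) X) {V : Opens X} {i j : ℕ}
    {a b : Sec 𝒜 V} (ha : a ∈ sheafFilt 𝒜 V i) (hb : b ∈ sheafFilt 𝒜 V j) :
    a * b ∈ sheafFilt 𝒜 V (i + j) :=
  sheafFilt_bilin 𝒜 (fun W => LinearMap.mul R (Sec 𝒜 W)) (fun h a b => map_mul (res 𝒜 h) a b) ha hb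

theorem SheafHom.map_sheafFilt {𝒜 ℬ : TopCat.Presheaf (AlgCat.{u} R) X} (g : SheafHom 𝒜 ℬ)
    {V : Opens X} {n : ℕ} {s : Sec 𝒜 V} (hs : s ∈ sheafFilt 𝒜 V n) :
    g.app V s ∈ sheafFilt ℬ V n := fun x hx => by
  obtain ⟨W, hW, hxW, h⟩ := hs x hx
  refine ⟨W, hW, hxW, ?_⟩
  rw [← g.app_res]
  exact map_adicFilt (g.app W).toLinearMap h

variable [CharZero K]

/-- The endomorphism `exp (ad α)` of `𝒜`. -/
def SheafDef.igHom (𝒜 : SheafDef K R O κ) (α : Sec 𝒜.alg ⊤) (hα : α ∈ sheafFilt 𝒜.alg ⊤ 1) :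
    SheafHom 𝒜.alg 𝒜.alg where
  app V := (expAdEquiv K (𝒜.isFiltBracket V) (sheafFilt_mul 𝒜.alg) (𝒜.isDeformation.kind V)
    (res_sheafFilt 𝒜.alg (le_top : V ≤ ⊤) hα) : Sec 𝒜.alg V ≃ₐ[R] Sec 𝒜.alg V)
  app_res {V W} h s := by
    have := expAd_map K (𝒜.isFiltBracket V) (𝒜.isFiltBracket W) (res 𝒜.alg h).toLinearMap
      (res_sheafFilt 𝒜.alg h) (𝒜.br_res h) (res_sheafFilt 𝒜.alg (le_top : V ≤ ⊤) hα) s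
    have e : (res 𝒜.alg h).toLinearMap (res 𝒜.alg (le_top : V ≤ ⊤) α) =
        res 𝒜.alg (le_top : W ≤ ⊤) α := res_res 𝒜.alg _ _ α
    rw [e] at this
    exact this.symm

theorem SheafDef.igHom_sub_mem (𝒜 : SheafDef K R O κ) {α : Sec 𝒜.alg ⊤}
    (hα : α ∈ sheafFilt 𝒜.alg ⊤ 1) (V : Opens X) (s : Sec 𝒜.alg V) :
    (𝒜.igHom α hα).app V s - s ∈ sheafFilt 𝒜.alg V 1 :=
  expAd_sub_mem K (𝒜.isFiltBracket V) (res_sheafFilt 𝒜.alg (le_top : V ≤ ⊤) hα) s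

theorem SheafDef.igHom_neg (𝒜 : SheafDef K R O κ) {α : Sec 𝒜.alg ⊤}
    (hα : α ∈ sheafFilt 𝒜.alg ⊤ 1) (hα' : -α ∈ sheafFilt 𝒜.alg ⊤ 1) :
    (𝒜.igHom α hα).comp (𝒜.igHom (-α) hα') = SheafHom.id 𝒜.alg := by
  refine SheafHom.ext (funext fun V => AlgHom.ext fun s => ?_)
  have := expAd_neg_expAd K (𝒜.isFiltBracket V) (res_sheafFilt 𝒜.alg (le_top : V ≤ ⊤) hα) s
  rw [← map_neg] at this
  exact this

/-- The gauge transformation `ig (exp α) = exp (ad α)` for `α ∈ Γ(X, 𝔪 𝒜)`. -/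
def SheafDef.ig (𝒜 : SheafDef K R O κ) (α : sheafFilt 𝒜.alg ⊤ 1) : 𝒜 ⟶ 𝒜 where
  toEquiv :=
    { hom := 𝒜.igHom α.1 α.2
      inv := 𝒜.igHom (-α.1) (Submodule.neg_mem _ α.2)
      hom_inv := 𝒜.igHom_neg α.2 _
      inv_hom := by
        have h := 𝒜.igHom_neg (Submodule.neg_mem _ α.2)
        simp only [neg_neg] at h
        exact h α.2 }
  map_br V := expAd_bilin K (𝒜.isFiltBracket V) (res_sheafFilt 𝒜.alg (le_top : V ≤ ⊤) α.2) (𝒜.br V)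
    (𝒜.isFiltBracket V).bracket_mem ((𝒜.isDeformation.kind V).leibniz_br _)
  map_aug V f := by
    refine congrArg (𝒜.aug V) (Subtype.ext (funext fun x => ?_))
    change stalkTensor (𝕜 R) (𝒜.igHom α.1 α.2) x.1 (f.1 x) = f.1 x
    obtain ⟨a, ha⟩ := residue_tensor_eq (f.1 x)
    rw [ha]
    obtain ⟨W, hx, s, rfl⟩ := exists_germ 𝒜.alg a
    obtain ⟨Z, hZ, hxZ, h⟩ := 𝒜.igHom_sub_mem α.2 W s x.1 hx
    have h1 := one_tmul_eq_zero (map_adicFilt (germ 𝒜.alg hxZ).toLinearMap h)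
    have h2 : (germ 𝒜.alg hxZ).toLinearMap (res 𝒜.alg hZ ((𝒜.igHom α.1 α.2).app W s - s)) =
      germ 𝒜.alg hx ((𝒜.igHom α.1 α.2).app W s) - germ 𝒜.alg hx s :=
      (germ_res 𝒜.alg hZ hxZ _).trans (map_sub _ _ _)
    rw [h2, TensorProduct.tmul_sub, sub_eq_zero] at h1
    exact h1

variable (K R O κ) in
/-- The crossed groupoid `AssDef(R, O)`, resp. `PoisDef(R, O)`. The `2`-morphisms are the elements
of `IG(𝒜) = Γ(X, exp(𝔪 𝒜))`, identified with `Γ(X, 𝔪 𝒜)` through `exp`. -/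
def sheafDef : PreCrossedGroupoid.{u} where
  Ob := SheafDef K R O κ
  IG 𝒜 := sheafFilt 𝒜.alg ⊤ 1
  one _ := 0
  mul {𝒜} a b := ⟨bch K (sheafFilt 𝒜.alg ⊤) (𝒜.br ⊤) a.1 b.1,
    bch_mem K (𝒜.isFiltBracket ⊤) a.2 b.2⟩
  inv a := -a
  twist g a := ⟨(SheafGauge.toEquiv g).hom.app ⊤ a.1, SheafHom.map_sheafFilt _ a.2⟩
  feedback {𝒜} a := 𝒜.ig a

/-! ### Global sections -/

/-- The global sections of a deformation of `O`, with the augmentation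
`K ⊗_R Γ(X, 𝒜) → Γ(X, K ⊗_R 𝒜) → Γ(X, O)`. -/
def PreSheafDef.gamma (𝒜 : PreSheafDef K R O) : PreAlgDef K R (O.obj (op ⊤)) where
  carrier := Sec 𝒜.alg ⊤
  br := 𝒜.br ⊤
  aug := (𝒜.aug ⊤).comp ((toSheafTensor 𝒜.alg (𝕜 R) ⊤).restrictScalars K)

/-- Global sections of a gauge transformation. -/
def SheafGauge.gamma {𝒜 ℬ : PreSheafDef K R O} (g : SheafGauge 𝒜 ℬ) :
    AlgGauge 𝒜.gamma ℬ.gamma where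
  toEquiv := g.toEquiv.toAlgEquiv ⊤
  map_br := g.map_br ⊤
  map_aug a := g.map_aug ⊤ (toSheafTensor 𝒜.alg (𝕜 R) ⊤ (1 ⊗ₜ a))

/-- Global sections preserve deformations: `Γ(X, 𝒜)` is a deformation of `Γ(X, O)` and
`Γ(X, 𝔪 𝒜) ⊆ 𝔪 Γ(X, 𝒜)`. -/
def GammaPreserves (K R : Type u) [Field K] [CommRing R] [Algebra K R] [IsLocalRing R]
    {X : TopCat.{u}} (O : TopCat.Presheaf (CommAlgCat.{u} K) X) (κ : DefKind) : Prop :=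
  ∀ 𝒜 : SheafDef K R O κ, 𝒜.gamma.IsDeformation κ ∧
    ∀ a ∈ sheafFilt 𝒜.alg ⊤ 1, a ∈ adicFilt R (Sec 𝒜.alg ⊤) 1

/-- The map `Γ(X, -) : AssDef(R, O) → AssDef(R, Γ(X, O))` (resp. for `PoisDef`). -/
def gamma (h : GammaPreserves K R O κ) :
    PreCrossedGroupoid.Map (sheafDef K R O κ) (algDef K R (O.obj (op ⊤)) κ) where
  functor :=
    { obj := fun 𝒜 => (⟨PreSheafDef.gamma 𝒜.toPreSheafDef, (h 𝒜).1⟩ : AlgDef K R (O.obj (op ⊤)) κ)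
      map := fun g => SheafGauge.gamma g
      map_id := fun _ => rfl
      map_comp := fun _ _ => rfl }
  map₂ {𝒜} a := ⟨a.1, (h 𝒜).2 a.1 a.2⟩

end SheafGauge

/-! ### Base change for sheaves -/

section SheafBaseChange

variable (K : Type u) {R : Type u} (R' : Type u) [Field K] [CommRing R] [Algebra K R]
  [IsLocalRing R] [CommRing R'] [Algebra K R'] [IsLocalRing R'] [ParameterAlgebra K R']
  [Algebra R R'] [IsScalarTower K R R'] {X : TopCat.{u}}

section Bracket

theorem baseChange_add_left {B A : Type u} [CommRing B] [Algebra R B] [AddCommGroup A]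
    [Module R A] (br : A →ₗ[R] A →ₗ[R] A) (t t' u : B ⊗[R] A) :
    LinearMap.BilinMap.baseChange B br (t + t') u =
      LinearMap.BilinMap.baseChange B br t u + LinearMap.BilinMap.baseChange B br t' u := by
  rw [map_add, LinearMap.add_apply]

theorem baseChange_smul_left {S B A : Type u} [CommRing S] [CommRing B] [Algebra R B] [Algebra S B]
    [AddCommGroup A] [Module R A] (br : A →ₗ[R] A →ₗ[R] A) (r : S) (t u : B ⊗[R] A) :
    LinearMap.BilinMap.baseChange B br (r • t) u =
      r • LinearMap.BilinMap.baseChange B br t u := by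
  rw [← algebraMap_smul B r t, map_smul, LinearMap.smul_apply, algebraMap_smul]

theorem baseChange_smul_right {S B A : Type u} [CommRing S] [CommRing B] [Algebra R B]
    [Algebra S B] [AddCommGroup A] [Module R A] (br : A →ₗ[R] A →ₗ[R] A) (r : S)
    (t u : B ⊗[R] A) :
    LinearMap.BilinMap.baseChange B br t (r • u) =
      r • LinearMap.BilinMap.baseChange B br t u := by
  rw [← algebraMap_smul B r u, map_smul, algebraMap_smul]

variable {𝒜 : TopCat.Presheaf (AlgCat.{u} R) X}
  (br : ∀ V : Opens X, Sec 𝒜 V →ₗ[R] Sec 𝒜 V →ₗ[R] Sec 𝒜 V)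
  (hbr : ∀ {V W : Opens X} (h : W ≤ V) (a b : Sec 𝒜 V),
    res 𝒜 h (br V a b) = br W (res 𝒜 h a) (res 𝒜 h b))

theorem germTensor_baseChange (B : Type u) [CommRing B] [Algebra R B] {V : Opens X} {x : X}
    (hx : x ∈ V) (t u : B ⊗[R] Sec 𝒜 V) :
    germTensor 𝒜 B hx (LinearMap.BilinMap.baseChange B (br V) t u) =
      LinearMap.BilinMap.baseChange B (stalkBr 𝒜 br hbr x) (germTensor 𝒜 B hx t)
        (germTensor 𝒜 B hx u) :=
  map_baseChange (AlgHom.id B B) (germ 𝒜 hx) (br V) (stalkBr 𝒜 br hbr x)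
    (stalkBr_germ 𝒜 br hbr hx) t u

theorem sheafTensor_br_mem (B : Type u) [CommRing B] [Algebra R B] {V : Opens X}
    {f g : ∀ x : V, B ⊗[R] Stalk 𝒜 x.1} (hf : f ∈ sheafTensor 𝒜 B V)
    (hg : g ∈ sheafTensor 𝒜 B V) :
    (fun x : V => LinearMap.BilinMap.baseChange B (stalkBr 𝒜 br hbr x.1) (f x) (g x)) ∈
      sheafTensor 𝒜 B V := fun x => by
  obtain ⟨W, hW, hx, t, ht⟩ := hf x
  obtain ⟨W', hW', hx', t', ht'⟩ := hg x
  refine ⟨W ⊓ W', inf_le_left.trans hW, ⟨hx, hx'⟩,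
    LinearMap.BilinMap.baseChange B (br (W ⊓ W')) (resTensor 𝒜 B inf_le_left t)
      (resTensor 𝒜 B inf_le_right t'), fun y hy => ?_⟩
  rw [germTensor_baseChange br hbr, germTensor_resTensor, germTensor_resTensor, ← ht, ← ht']

/-- The bracket of `R' ⊗̂_R 𝒜`. -/
def complSheafBr (V : Opens X) :
    complSheaf 𝒜 R' V →ₗ[R'] complSheaf 𝒜 R' V →ₗ[R'] complSheaf 𝒜 R' V :=
  LinearMap.mk₂ R'
    (fun f g => ⟨fun i x => LinearMap.BilinMap.baseChange (R' ⧸ 𝔪 R' ^ (i + 1))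
        (stalkBr 𝒜 br hbr x.1) (f.1 i x) (g.1 i x),
      fun i => sheafTensor_br_mem br hbr (R' ⧸ 𝔪 R' ^ (i + 1)) (f.2.1 i) (g.2.1 i),
      fun i x => by
        have h := map_baseChange (transition R' i) (AlgHom.id R (Stalk 𝒜 x.1))
          (stalkBr 𝒜 br hbr x.1) (stalkBr 𝒜 br hbr x.1) (fun _ _ => rfl)
          (f.1 (i + 1) x) (g.1 (i + 1) x)
        refine h.trans ?_
        have h1 := f.2.2 i x
        have h2 := g.2.2 i x
        rw [transTensor] at h1 h2
        rw [h1, h2]⟩)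
    (fun f f' g => Subtype.ext (funext fun i => funext fun x =>
      baseChange_add_left (stalkBr 𝒜 br hbr x.1) (f.1 i x) (f'.1 i x) (g.1 i x)))
    (fun r f g => Subtype.ext (funext fun i => funext fun x =>
      baseChange_smul_left (stalkBr 𝒜 br hbr x.1) r (f.1 i x) (g.1 i x)))
    (fun f g g' => Subtype.ext (funext fun i => funext fun x =>
      map_add (LinearMap.BilinMap.baseChange (R' ⧸ 𝔪 R' ^ (i + 1)) (stalkBr 𝒜 br hbr x.1)
        (f.1 i x)) (g.1 i x) (g'.1 i x)))
    (fun r f g => Subtype.ext (funext fun i => funext fun x =>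
      baseChange_smul_right (stalkBr 𝒜 br hbr x.1) r (f.1 i x) (g.1 i x)))

end Bracket

section Proj

variable (𝒜 : TopCat.Presheaf (AlgCat.{u} R) X)

/-- The map `(R' ⊗̂_R 𝒜)_x → R'_0 ⊗_R 𝒜_x` on stalks, with `R'_0` the residue field of `R'`. -/
def stalkProj (x : X) : Stalk (complPresheaf 𝒜 R') x →ₐ[R'] 𝕜 R' ⊗[R] Stalk 𝒜 x :=
  stalkLift (complPresheaf 𝒜 R') x
    (fun V hx =>
      { toFun := fun f : complSheaf 𝒜 R' V =>
          Algebra.TensorProduct.map (toResidue R') (AlgHom.id R (Stalk 𝒜 x)) (f.1 0 ⟨x, hx⟩)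
        map_one' := map_one _
        map_mul' := fun f g => map_mul (Algebra.TensorProduct.map (toResidue R')
          (AlgHom.id R (Stalk 𝒜 x))) (f.1 0 ⟨x, hx⟩) (g.1 0 ⟨x, hx⟩)
        map_zero' := map_zero _
        map_add' := fun f g => map_add (Algebra.TensorProduct.map (toResidue R')
          (AlgHom.id R (Stalk 𝒜 x))) (f.1 0 ⟨x, hx⟩) (g.1 0 ⟨x, hx⟩)
        commutes' := fun r => (Algebra.TensorProduct.map (toResidue R')
          (AlgHom.id R (Stalk 𝒜 x))).commutes r })
    fun _ _ _ _ _ => rfl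

theorem stalkProj_germ {x : X} {V : Opens X} (hx : x ∈ V) (f : complSheaf 𝒜 R' V) :
    stalkProj R' 𝒜 x (germ (complPresheaf 𝒜 R') hx f) =
      Algebra.TensorProduct.map (toResidue R') (AlgHom.id R (Stalk 𝒜 x)) (f.1 0 ⟨x, hx⟩) := rfl

theorem map_germTensor {S B B' : Type u} [CommRing S] [CommRing B] [Algebra R B] [Algebra S B]
    [CommRing B'] [Algebra R B'] [Algebra S B'] [Algebra R S] [IsScalarTower R S B]
    [IsScalarTower R S B'] (φ : B →ₐ[S] B') {V : Opens X} {x : X} (hx : x ∈ V)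
    (t : B ⊗[R] Sec 𝒜 V) :
    Algebra.TensorProduct.map φ (AlgHom.id R (Stalk 𝒜 x)) (germTensor 𝒜 B hx t) =
      germTensor 𝒜 B' hx (Algebra.TensorProduct.map φ (AlgHom.id R (Sec 𝒜 V)) t) := by
  induction t using TensorProduct.induction_on with
  | zero => simp
  | add t t' ht ht' => simp only [map_add, ht, ht']
  | tmul c a => simp [germTensor]

theorem residueLift_stalkProj_mem {V : Opens X}
    (f : sheafTensor (complPresheaf 𝒜 R') (𝕜 R') V) :
    (fun x : V => residueLift K R' (stalkProj R' 𝒜 x.1) (f.1 x)) ∈ sheafTensor 𝒜 (𝕜 R) V :=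
  fun x => by
    obtain ⟨W, hW, hx, t, ht⟩ := f.2 x
    obtain ⟨s, rfl⟩ := residue_tensor_eq t
    obtain ⟨Z, hZ, hxZ, u, hu⟩ := s.2.1 0 ⟨x.1, hx⟩
    refine ⟨Z, hZ.trans hW, hxZ, Algebra.TensorProduct.map
      (residueEquiv K R R' : 𝕜 R' →ₐ[R] 𝕜 R) (AlgHom.id R (Sec 𝒜 Z))
      (Algebra.TensorProduct.map (toResidue R') (AlgHom.id R (Sec 𝒜 Z)) u), fun y hy => ?_⟩
    have h1 : f.1 ⟨y, hW (hZ hy)⟩ = 1 ⊗ₜ germ (complPresheaf 𝒜 R') (hZ hy) s := ht y (hZ hy)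
    have h2 := stalkProj_germ R' 𝒜 (hZ hy) s
    beta_reduce
    rw [h1, residueLift_one_tmul]
    refine (congrArg _ (h2.trans (congrArg _ (hu y hy)))).trans ?_
    rw [map_germTensor, map_germTensor]

/-- The isomorphism `K' ⊗_{R'} (R' ⊗̂_R 𝒜) → K ⊗_R 𝒜` on sections over `V`, with `K'` and `K` the
residue fields of `R'` and `R`. -/
def sheafResidueLift (V : Opens X) :
    sheafTensor (complPresheaf 𝒜 R') (𝕜 R') V →ₐ[K] sheafTensor 𝒜 (𝕜 R) V where
  toFun f := ⟨fun x => residueLift K R' (stalkProj R' 𝒜 x.1) (f.1 x),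
    residueLift_stalkProj_mem K R' 𝒜 f⟩
  map_one' := Subtype.ext (funext fun x => map_one (residueLift K R' (stalkProj R' 𝒜 x.1)))
  map_mul' f g := Subtype.ext (funext fun x =>
    map_mul (residueLift K R' (stalkProj R' 𝒜 x.1)) (f.1 x) (g.1 x))
  map_zero' := Subtype.ext (funext fun x => map_zero (residueLift K R' (stalkProj R' 𝒜 x.1)))
  map_add' f g := Subtype.ext (funext fun x =>
    map_add (residueLift K R' (stalkProj R' 𝒜 x.1)) (f.1 x) (g.1 x))
  commutes' c := Subtype.ext (funext fun x =>
    (residueLift K R' (stalkProj R' 𝒜 x.1)).commutes c)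

end Proj

section Hom

variable {𝒜 ℬ 𝒞 : TopCat.Presheaf (AlgCat.{u} R) X}

/-- The components of a section of `R' ⊗̂_R 𝒜`. -/
abbrev complSheafCoe {V : Opens X} (f : complSheaf 𝒜 R' V) (i : ℕ) (x : V) :
    (R' ⧸ 𝔪 R' ^ (i + 1)) ⊗[R] Stalk 𝒜 x.1 := f.1 i x

/-- The map `R' ⊗̂_R 𝒜 → R' ⊗̂_R ℬ` induced by `g : 𝒜 → ℬ`. -/
def complSheafMap (g : SheafHom 𝒜 ℬ) : SheafHom (complPresheaf 𝒜 R') (complPresheaf ℬ R') where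
  app V :=
    { toFun := fun f : complSheaf 𝒜 R' V =>
        (⟨fun i x => stalkTensor (R' ⧸ 𝔪 R' ^ (i + 1)) g x.1 (f.1 i x),
          fun i => (sheafTensorMap (R' ⧸ 𝔪 R' ^ (i + 1)) g V ⟨f.1 i, f.2.1 i⟩).2,
          fun i x => by
            have h := f.2.2 i x
            beta_reduce
            rw [← h, transTensor, transTensor, stalkTensor, stalkTensor]
            generalize f.1 (i + 1) x = t
            induction t using TensorProduct.induction_on with
            | zero => simp
            | add t t' ht ht' => simp only [map_add, ht, ht']
            | tmul c a => simp⟩ : complSheaf ℬ R' V)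
      map_one' := Subtype.ext (funext fun i => funext fun x =>
        map_one (stalkTensor (R' ⧸ 𝔪 R' ^ (i + 1)) g x.1))
      map_mul' := fun f f' => Subtype.ext (funext fun i => funext fun x =>
        map_mul (stalkTensor (R' ⧸ 𝔪 R' ^ (i + 1)) g x.1) (complSheafCoe R' f i x) (complSheafCoe R' f' i x))
      map_zero' := Subtype.ext (funext fun i => funext fun x =>
        map_zero (stalkTensor (R' ⧸ 𝔪 R' ^ (i + 1)) g x.1))
      map_add' := fun f f' => Subtype.ext (funext fun i => funext fun x =>
        map_add (stalkTensor (R' ⧸ 𝔪 R' ^ (i + 1)) g x.1) (complSheafCoe R' f i x) (complSheafCoe R' f' i x))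
      commutes' := fun r => Subtype.ext (funext fun i => funext fun x =>
        (stalkTensor (R' ⧸ 𝔪 R' ^ (i + 1)) g x.1).commutes
          (algebraMap R' (R' ⧸ 𝔪 R' ^ (i + 1)) r)) }
  app_res _ _ := rfl

theorem complSheafMap_id :
    complSheafMap R' (SheafHom.id 𝒜) = SheafHom.id (complPresheaf 𝒜 R') :=
  SheafHom.ext (funext fun V => AlgHom.ext fun f : complSheaf 𝒜 R' V =>
    Subtype.ext (funext fun i => funext fun x =>
      stalkTensor_id (R' ⧸ 𝔪 R' ^ (i + 1)) x.1 (f.1 i x)))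

theorem complSheafMap_comp (g : SheafHom 𝒜 ℬ) (h : SheafHom ℬ 𝒞) :
    complSheafMap R' (g.comp h) = (complSheafMap R' g).comp (complSheafMap R' h) :=
  SheafHom.ext (funext fun V => AlgHom.ext fun f : complSheaf 𝒜 R' V =>
    Subtype.ext (funext fun i => funext fun x =>
      stalkTensor_comp (R' ⧸ 𝔪 R' ^ (i + 1)) g h x.1 (f.1 i x)))

/-- The isomorphism `R' ⊗̂_R 𝒜 → R' ⊗̂_R ℬ` induced by an isomorphism `𝒜 → ℬ`. -/
def complSheafEquiv (g : SheafEquiv 𝒜 ℬ) :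
    SheafEquiv (complPresheaf 𝒜 R') (complPresheaf ℬ R') where
  hom := complSheafMap R' g.hom
  inv := complSheafMap R' g.inv
  hom_inv := by rw [← complSheafMap_comp, g.hom_inv, complSheafMap_id]
  inv_hom := by rw [← complSheafMap_comp, g.inv_hom, complSheafMap_id]

theorem stalkProj_complSheafMap (g : SheafHom 𝒜 ℬ) (x : X)
    (a : Stalk (complPresheaf 𝒜 R') x) :
    stalkProj R' ℬ x (stalkMap (complSheafMap R' g) x a) =
      Algebra.TensorProduct.map (AlgHom.id R (𝕜 R')) (stalkMap g x) (stalkProj R' 𝒜 x a) := by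
  obtain ⟨V, hx, f, rfl⟩ := exists_germ (complPresheaf 𝒜 R') a
  rw [stalkMap_germ]
  refine (stalkProj_germ R' ℬ hx _).trans ?_
  rw [stalkProj_germ R' 𝒜 hx f]
  change Algebra.TensorProduct.map (toResidue R') (AlgHom.id R (Stalk ℬ x))
    (Algebra.TensorProduct.map (AlgHom.id (R' ⧸ 𝔪 R' ^ (0 + 1)) (R' ⧸ 𝔪 R' ^ (0 + 1)))
      (stalkMap g x) (complSheafCoe R' f 0 ⟨x, hx⟩)) =
    Algebra.TensorProduct.map (AlgHom.id R (𝕜 R')) (stalkMap g x)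
      (Algebra.TensorProduct.map (toResidue R') (AlgHom.id R (Stalk 𝒜 x))
        (complSheafCoe R' f 0 ⟨x, hx⟩))
  generalize complSheafCoe R' f 0 ⟨x, hx⟩ = t
  induction t using TensorProduct.induction_on with
  | zero => simp
  | add t t' ht ht' => simp only [map_add, ht, ht']
  | tmul c a => simp

theorem sheafResidueLift_map (g : SheafHom 𝒜 ℬ) (V : Opens X)
    (f : sheafTensor (complPresheaf 𝒜 R') (𝕜 R') V) :
    sheafResidueLift K R' ℬ V (sheafTensorMap (𝕜 R') (complSheafMap R' g) V f) =
      sheafTensorMap (𝕜 R) g V (sheafResidueLift K R' 𝒜 V f) :=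
  Subtype.ext (funext fun x => by
    change residueLift K R' (stalkProj R' ℬ x.1)
        (stalkTensor (𝕜 R') (complSheafMap R' g) x.1 (f.1 x)) =
      stalkTensor (𝕜 R) g x.1 (residueLift K R' (stalkProj R' 𝒜 x.1) (f.1 x))
    obtain ⟨a, ha⟩ := residue_tensor_eq (f.1 x)
    rw [ha, stalkTensor, Algebra.TensorProduct.map_tmul, map_one, residueLift_one_tmul,
      residueLift_one_tmul, stalkProj_complSheafMap, map_residueEquiv]
    change _ = Algebra.TensorProduct.map (AlgHom.id (𝕜 R) (𝕜 R)) (stalkMap g x.1) _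
    rfl)

theorem stalkMap_stalkBr {br : ∀ V : Opens X, Sec 𝒜 V →ₗ[R] Sec 𝒜 V →ₗ[R] Sec 𝒜 V}
    (hbr : ∀ {V W : Opens X} (h : W ≤ V) (a b : Sec 𝒜 V),
      res 𝒜 h (br V a b) = br W (res 𝒜 h a) (res 𝒜 h b))
    {br' : ∀ V : Opens X, Sec ℬ V →ₗ[R] Sec ℬ V →ₗ[R] Sec ℬ V}
    (hbr' : ∀ {V W : Opens X} (h : W ≤ V) (a b : Sec ℬ V),
      res ℬ h (br' V a b) = br' W (res ℬ h a) (res ℬ h b))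
    (g : SheafHom 𝒜 ℬ) (hg : ∀ V a b, g.app V (br V a b) = br' V (g.app V a) (g.app V b))
    (x : X) (a b : Stalk 𝒜 x) :
    stalkMap g x (stalkBr 𝒜 br hbr x a b) =
      stalkBr ℬ br' hbr' x (stalkMap g x a) (stalkMap g x b) := by
  obtain ⟨V, hx, s, t, -, rfl, rfl, -⟩ := exists_germ₃ 𝒜 a b 0
  rw [← stalkBr_germ, stalkMap_germ, stalkMap_germ, stalkMap_germ, ← stalkBr_germ, hg]

end Hom

variable {O : TopCat.Presheaf (CommAlgCat.{u} K) X}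

/-- The completed base change `R' ⊗̂_R 𝒜`, with its bracket and augmentation. -/
def PreSheafDef.baseChange (𝒜 : PreSheafDef K R O) : PreSheafDef K R' O where
  alg := complPresheaf 𝒜.alg R'
  br V := complSheafBr R' 𝒜.br 𝒜.br_res V
  br_res _ _ _ := rfl
  aug V := (𝒜.aug V).comp (sheafResidueLift K R' 𝒜.alg V)
  aug_res h f := 𝒜.aug_res h (sheafResidueLift K R' 𝒜.alg _ f)

/-- The gauge transformation `R' ⊗̂_R 𝒜 → R' ⊗̂_R ℬ` induced by `g : 𝒜 → ℬ`. -/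
def SheafGauge.baseChange {𝒜 ℬ : PreSheafDef K R O} (g : SheafGauge 𝒜 ℬ) :
    SheafGauge (𝒜.baseChange K R') (ℬ.baseChange K R') where
  toEquiv := complSheafEquiv R' g.toEquiv
  map_br V (a b : complSheaf 𝒜.alg R' V) := Subtype.ext (funext fun i => funext fun x =>
    map_baseChange (AlgHom.id (R' ⧸ 𝔪 R' ^ (i + 1)) (R' ⧸ 𝔪 R' ^ (i + 1)))
      (stalkMap g.toEquiv.hom x.1) (stalkBr 𝒜.alg 𝒜.br 𝒜.br_res x.1)
      (stalkBr ℬ.alg ℬ.br ℬ.br_res x.1)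
      (stalkMap_stalkBr 𝒜.br_res ℬ.br_res g.toEquiv.hom g.map_br x.1) (a.1 i x) (b.1 i x))
  map_aug V f := by
    have h := sheafResidueLift_map K R' g.toEquiv.hom V f
    exact (congrArg (ℬ.aug V) h).trans (g.map_aug V (sheafResidueLift K R' 𝒜.alg V f))

theorem toComplSheaf_mem (K : Type u) {R : Type u} (R' : Type u) [Field K] [CommRing R]
    [Algebra K R] [IsLocalRing R] [CommRing R'] [Algebra K R'] [IsLocalRing R']
    [ParameterAlgebra K R'] [Algebra R R'] [IsScalarTower K R R'] {X : TopCat.{u}} (𝒜 : TopCat.Presheaf (AlgCat.{u} R) X) {V : Opens X} {a : Sec 𝒜 V}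
    (ha : a ∈ sheafFilt 𝒜 V 1) :
    (toComplSheaf 𝒜 R' V a : Sec (complPresheaf 𝒜 R') V) ∈
      sheafFilt (complPresheaf 𝒜 R') V 1 := fun x hx => by
  obtain ⟨W, hW, hxW, h⟩ := ha x hx
  refine ⟨W, hW, hxW, ?_⟩
  have h1 := map_adicFilt (A := complTensor R R' (Sec 𝒜 W)) (B := complSheaf 𝒜 R' W)
    (complToSheaf 𝒜 R' W).toLinearMap (toCompl_mem K R' h)
  have h2 : res (complPresheaf 𝒜 R') hW (toComplSheaf 𝒜 R' V a : complSheaf 𝒜 R' V) =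
      complToSheaf 𝒜 R' W (toCompl R' (res 𝒜 hW a)) :=
    Subtype.ext (funext fun i => funext fun y =>
      congrArg ((1 : R' ⧸ 𝔪 R' ^ (i + 1)) ⊗ₜ[R] ·) (germ_res 𝒜 hW y.2 a).symm)
  rw [h2]
  exact h1

variable [CharZero K] {κ : DefKind}

/-- The base change map `AssDef(R, O) → AssDef(R', O)`, `𝒜 ↦ R' ⊗̂_R 𝒜` (resp. for `PoisDef`),
given that base change preserves deformations. -/
def sheafBaseChange
    (h : ∀ 𝒜 : SheafDef K R O κ, (𝒜.toPreSheafDef.baseChange K R').IsDeformation κ) :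
    PreCrossedGroupoid.Map (sheafDef K R O κ) (sheafDef K R' O κ) where
  functor :=
    { obj := fun 𝒜 => (⟨PreSheafDef.baseChange K R' 𝒜.toPreSheafDef, h 𝒜⟩ : SheafDef K R' O κ)
      map := fun g => SheafGauge.baseChange K R' g
      map_id := fun _ => SheafGauge.ext (SheafEquiv.ext (complSheafMap_id R'))
      map_comp := fun (g : SheafGauge _ _) (g' : SheafGauge _ _) =>
        SheafGauge.ext (SheafEquiv.ext
          (complSheafMap_comp R' g.toEquiv.hom g'.toEquiv.hom)) }
  map₂ {𝒜} a := ⟨toComplSheaf (SheafDef.toPreSheafDef 𝒜).alg R' ⊤ a.1,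
    toComplSheaf_mem K R' (SheafDef.toPreSheafDef 𝒜).alg a.2⟩

end SheafBaseChange

/-! ### The structure sheaf of a `K`-scheme -/

section Scheme

open AlgebraicGeometry

variable {K : Type u} [Field K] {Y : Scheme.{u}} (f : Y ⟶ Spec (.of K))

/-- The structure map `K → Γ(V, O_Y)` of a `K`-scheme. -/
def structureMap (V : Y.Opens) : K →+* Γ(Y, V) :=
  ((Scheme.ΓSpecIso (.of K)).inv ≫ f.appTop ≫ Y.presheaf.map (homOfLE le_top).op).hom

theorem map_structureMap {V W : Y.Opens} (h : op V ⟶ op W) (c : K) :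
    (Y.presheaf.map h).hom (structureMap f V c) = structureMap f W c := by
  have e : ((Scheme.ΓSpecIso (.of K)).inv ≫ f.appTop ≫ Y.presheaf.map (homOfLE le_top).op) ≫
      Y.presheaf.map h =
      (Scheme.ΓSpecIso (.of K)).inv ≫ f.appTop ≫ Y.presheaf.map (homOfLE (le_top : W ≤ ⊤)).op := by
    rw [Category.assoc, Category.assoc, ← Functor.map_comp]
    rfl
  exact congrArg (fun φ : CommRingCat.of K ⟶ Γ(Y, W) => φ.hom c) e

/-- The structure sheaf of a `K`-scheme, as a sheaf of `K`-algebras. -/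
def structurePresheaf : TopCat.Presheaf (CommAlgCat.{u} K) Y where
  obj V := letI := (structureMap f V.unop).toAlgebra; CommAlgCat.of K Γ(Y, V.unop)
  map {V W} h :=
    letI := (structureMap f V.unop).toAlgebra
    letI := (structureMap f W.unop).toAlgebra
    CommAlgCat.ofHom (X := Γ(Y, V.unop)) (Y := Γ(Y, W.unop))
      { toRingHom := (Y.presheaf.map h).hom
        commutes' := fun c => map_structureMap f h c }
  map_id V := by
    refine ConcreteCategory.hom_ext _ _ fun a => ?_
    exact congrArg (fun φ : Y.presheaf.obj V ⟶ Y.presheaf.obj V => φ.hom a)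
      (Y.presheaf.map_id V)
  map_comp {V W Z} h h' := by
    refine ConcreteCategory.hom_ext _ _ fun a => ?_
    exact congrArg (fun φ : Y.presheaf.obj V ⟶ Y.presheaf.obj Z => φ.hom a)
      (Y.presheaf.map_comp h h')

end Scheme

end YDef

end

open AlgebraicGeometry

noncomputable section

namespace YDef

local notation "𝔪" => IsLocalRing.maximalIdeal
local notation "𝕜" => IsLocalRing.ResidueField

set_option linter.unusedVariables false
set_option linter.unusedSectionVars false

/-! ### Lie brackets -/

section BCH

/-- An alternating bilinear map satisfying the Jacobi identity, in Leibniz form. -/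
structure IsLieBr {R A : Type u} [CommRing R] [AddCommGroup A] [Module R A]
    (br : A →ₗ[R] A →ₗ[R] A) : Prop where
  self : ∀ a, br a a = 0
  leibniz : ∀ a b c, br a (br b c) = br (br a b) c + br b (br a c)

variable {R A : Type u} [CommRing R] [AddCommGroup A] [Module R A]
  {F : ℕ → Submodule R A} {br : A →ₗ[R] A →ₗ[R] A}

theorem IsLieBr.skew (h : IsLieBr br) (a b : A) : br a b = -br b a := by
  have := h.self (a + b)
  simp only [map_add, LinearMap.add_apply, h.self, zero_add, add_zero] at this
  rw [eq_neg_iff_add_eq_zero, add_comm]; exact this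

theorem IsBracketOfKind.isLieBr {A : Type u} [Ring A] [Algebra R A] {br : A →ₗ[R] A →ₗ[R] A}
    {κ : DefKind} (h : IsBracketOfKind br κ) : IsLieBr br where
  self a := by
    cases κ with
    | assoc => exact (h a a).trans (sub_self _)
    | poisson => exact h.2.1 a
  leibniz := h.leibniz_br

/-- The endomorphism `T` raises the filtration degree by `n`. -/
def RaisesBy (F : ℕ → Submodule R A) (n : ℕ) (T : Module.End R A) : Prop :=
  ∀ d a, a ∈ F d → T a ∈ F (d + n)

namespace RaisesBy

variable {n m : ℕ} {T T' U U' : Module.End R A}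

theorem zero : RaisesBy F n (0 : Module.End R A) := fun _ _ _ => Submodule.zero_mem _

theorem one : RaisesBy F 0 (1 : Module.End R A) := fun _ _ h => h

theorem add (h : RaisesBy F n T) (h' : RaisesBy F n T') : RaisesBy F n (T + T') :=
  fun d a ha => Submodule.add_mem _ (h d a ha) (h' d a ha)

theorem sub (h : RaisesBy F n T) (h' : RaisesBy F n T') : RaisesBy F n (T - T') :=
  fun d a ha => Submodule.sub_mem _ (h d a ha) (h' d a ha)

theorem smul (r : R) (h : RaisesBy F n T) : RaisesBy F n (r • T) :=
  fun d a ha => Submodule.smul_mem _ r (h d a ha)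

theorem mul (h : RaisesBy F n T) (h' : RaisesBy F m T') : RaisesBy F (n + m) (T * T') :=
  fun d a ha => by
    have := h _ _ (h' d a ha)
    rwa [add_assoc, add_comm m n] at this

theorem mono (hF : Antitone F) (h : RaisesBy F n T) (hm : m ≤ n) : RaisesBy F m T :=
  fun d a ha => hF (by omega) (h d a ha)

theorem pow (h : RaisesBy F n T) (k : ℕ) : RaisesBy F (k * n) (T ^ k) := by
  induction k with
  | zero => simpa using one
  | succ k ih => rw [pow_succ, Nat.succ_mul]; exact ih.mul h

theorem mul_sub_mul (hT : RaisesBy F 0 T) (hU : RaisesBy F 0 U') (h : RaisesBy F n (T - T'))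
    (h' : RaisesBy F n (U - U')) : RaisesBy F n (T * U - T' * U') := by
  have e : T * U - T' * U' = T * (U - U') + (T - T') * U' := by noncomm_ring
  rw [e]
  have h1 := hT.mul h'
  have h2 := h.mul hU
  rw [zero_add] at h1
  exact h1.add h2

theorem pow_sub_pow (hT : RaisesBy F 0 T) (hT' : RaisesBy F 0 T') (h : RaisesBy F n (T - T'))
    (k : ℕ) : RaisesBy F n (T ^ k - T' ^ k) := by
  induction k with
  | zero => simpa using zero
  | succ k ih =>
    rw [pow_succ, pow_succ]
    refine mul_sub_mul ?_ hT' ih h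
    simpa using hT.pow k

end RaisesBy

theorem IsFiltBracket.raisesBy (hF : IsFiltBracket F br) {a : A} {n : ℕ} (ha : a ∈ F n) :
    RaisesBy F n (br a) := fun d b hb => by
  rw [add_comm]
  exact hF.bracket_mem ha hb

open Polynomial in
theorem raisesBy_aeval (hF : IsFiltBracket F br) {α : A} (hα : α ∈ F 1) (p : R[X]) :
    RaisesBy F 0 (aeval (br α) p) := by
  induction p using Polynomial.induction_on with
  | C r => rw [aeval_C, Algebra.algebraMap_eq_smul_one]; exact RaisesBy.one.smul r
  | add p q hp hq => rw [map_add]; exact hp.add hq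
  | monomial n r _ =>
    rw [map_mul, aeval_C, Algebra.algebraMap_eq_smul_one, smul_one_mul, map_pow, aeval_X]
    exact ((hF.raisesBy hα).pow _).mono hF.antitone (Nat.zero_le _) |>.smul r

/-! ### Truncated exponentials -/

section PolynomialIdentity

open Polynomial

variable (K : Type u) [Field K]

/-- The truncated exponential series `∑ i < N, X ^ i / i!`. -/
def expPoly (N : ℕ) : K[X] := ∑ i ∈ Finset.range N, C ((i.factorial : K)⁻¹) * X ^ i

/-- The truncation of `(exp X - 1) / X`. -/
def expQuotPoly (N : ℕ) : K[X] :=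
  ∑ i ∈ Finset.range N, C (((i + 1).factorial : K)⁻¹) * X ^ i

/-- The truncation of `log Y / (Y - 1)` at `Y = exp X`. -/
def logQuotPoly (N : ℕ) : K[X] :=
  ∑ k ∈ Finset.range N, C ((-1) ^ k / ((k : K) + 1)) * (expPoly K (N + 1) - 1) ^ k

theorem expPoly_sub_one (N : ℕ) : expPoly K (N + 1) - 1 = X * expQuotPoly K N := by
  rw [expPoly, Finset.sum_range_succ', expQuotPoly, Finset.mul_sum]
  simp only [Nat.factorial_zero, Nat.cast_one, inv_one, map_one, pow_zero, mul_one,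
    add_sub_cancel_right]
  exact Finset.sum_congr rfl fun i _ => by ring

variable [CharZero K]

theorem derivative_expPoly (N : ℕ) : derivative (expPoly K (N + 1)) = expPoly K N := by
  rw [expPoly, Finset.sum_range_succ', expPoly, derivative_add, derivative_sum]
  simp only [derivative_C_mul, derivative_X_pow, Nat.factorial_zero, Nat.cast_one, inv_one,
    map_one, pow_zero, mul_one, derivative_one, add_zero]
  refine Finset.sum_congr rfl fun i _ => ?_
  rw [← mul_assoc, ← C_mul, Nat.add_sub_cancel]
  congr 2
  rw [Nat.factorial_succ]
  have : ((i : K) + 1) ≠ 0 := by exact_mod_cast Nat.succ_ne_zero i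
  have h2 : (i.factorial : K) ≠ 0 := by exact_mod_cast Nat.factorial_ne_zero _
  push_cast
  field_simp

theorem X_pow_dvd_of_derivative {f : K[X]} {N : ℕ} (h0 : f.coeff 0 = 0)
    (h : X ^ N ∣ derivative f) : X ^ (N + 1) ∣ f := by
  rw [X_pow_dvd_iff] at h ⊢
  intro d hd
  rcases d with _ | d
  · exact h0
  · have := h d (by omega)
    rw [coeff_derivative] at this
    refine (mul_eq_zero.1 this).resolve_right ?_
    exact_mod_cast Nat.succ_ne_zero d

theorem X_pow_dvd_log_sub {E : K[X]} {N : ℕ} {c : K} (hX : X ∣ E - 1)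
    (h2 : derivative E = E - C c * X ^ N) :
    X ^ (N + 1) ∣
      (∑ k ∈ Finset.range N, C ((-1) ^ k / ((k : K) + 1)) * (E - 1) ^ (k + 1)) - X := by
  have hc : (E - 1).coeff 0 = 0 := by
    obtain ⟨q, hq⟩ := hX
    rw [hq, mul_comm]
    simp
  refine X_pow_dvd_of_derivative K ?_ ?_
  · rw [coeff_sub, finsetSum_coeff, coeff_X_zero, sub_zero]
    refine Finset.sum_eq_zero fun k _ => ?_
    rw [coeff_C_mul, pow_succ, mul_coeff_zero, hc, mul_zero, mul_zero]
  · rw [derivative_sub, derivative_sum, derivative_X]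
    have h1 : ∀ k : ℕ, derivative (C ((-1) ^ k / ((k : K) + 1)) * (E - 1) ^ (k + 1)) =
        (1 - E) ^ k * derivative E := by
      intro k
      rw [derivative_C_mul, derivative_pow, derivative_sub, derivative_one, sub_zero,
        Nat.add_sub_cancel]
      have : ((k : K) + 1) ≠ 0 := by exact_mod_cast Nat.succ_ne_zero k
      have h3 : C ((-1) ^ k / ((k : K) + 1)) * C (((k + 1 : ℕ) : K)) = (-1) ^ k := by
        rw [← C_mul]
        push_cast
        rw [div_mul_cancel₀ _ this]
        simp
      rw [← mul_assoc, ← mul_assoc, h3, ← neg_sub E 1, neg_pow (E - 1)]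
    simp only [h1]
    rw [← Finset.sum_mul]
    have h3 : (∑ k ∈ Finset.range N, (1 - E) ^ k) * E = 1 - (1 - E) ^ N := by
      have := geom_sum_mul (1 - E) N
      linear_combination -this
    have h4 : (∑ k ∈ Finset.range N, (1 - E) ^ k) * derivative E - 1 =
        -((1 - E) ^ N) - X ^ N * ((∑ k ∈ Finset.range N, (1 - E) ^ k) * C c) := by
      rw [h2]
      linear_combination h3
    rw [h4]
    refine dvd_sub ((dvd_neg).2 (pow_dvd_pow_of_dvd ?_ N)) (dvd_mul_right _ _)
    rw [← neg_sub]
    exact (dvd_neg).2 hX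

theorem mul_sum_mul_pow {S : Type*} [CommRing S] (D : S) (c : ℕ → S) (N : ℕ) :
    D * ∑ k ∈ Finset.range N, c k * D ^ k = ∑ k ∈ Finset.range N, c k * D ^ (k + 1) := by
  rw [Finset.mul_sum]
  exact Finset.sum_congr rfl fun k _ => by rw [pow_succ']; exact mul_left_comm _ _ _

theorem X_pow_dvd_expQuot_mul_logQuot (N : ℕ) :
    X ^ N ∣ expQuotPoly K N * logQuotPoly K N - 1 := by
  have hX : X ∣ expPoly K (N + 1) - 1 := by rw [expPoly_sub_one]; exact dvd_mul_right _ _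
  have hd : derivative (expPoly K (N + 1)) =
      expPoly K (N + 1) - C ((N.factorial : K)⁻¹) * X ^ N := by
    rw [derivative_expPoly]
    simp only [expPoly]
    rw [Finset.sum_range_succ, add_sub_cancel_right]
  have key := X_pow_dvd_log_sub K hX hd
  have e : X * (expQuotPoly K N * logQuotPoly K N - 1) = (∑ k ∈ Finset.range N,
      C ((-1) ^ k / ((k : K) + 1)) * (expPoly K (N + 1) - 1) ^ (k + 1)) - X := by
    have h1 := mul_sum_mul_pow (expPoly K (N + 1) - 1)
      (fun k => C ((-1) ^ k / ((k : K) + 1))) N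
    have h2 : X * (expQuotPoly K N * logQuotPoly K N) =
        (expPoly K (N + 1) - 1) * logQuotPoly K N := by
      rw [expPoly_sub_one K N]
      exact (mul_assoc _ _ _).symm
    exact (mul_sub_one _ _).trans (congrArg (· - X) (h2.trans h1))
  rw [← e, pow_succ'] at key
  exact (mul_dvd_mul_iff_left X_ne_zero).1 key

end PolynomialIdentity

section ExpAd

open Polynomial

variable (K : Type u) [Field K] [Algebra K R]

/-- The endomorphism `p (ad α)`. -/
def polyAd (br : A →ₗ[R] A →ₗ[R] A) (p : K[X]) (α : A) : Module.End R A :=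
  aeval (br α) (p.map (algebraMap K R))

theorem polyAd_mul (p q : K[X]) (α : A) : polyAd K br (p * q) α = polyAd K br p α * polyAd K br q α := by
  simp [polyAd]

theorem polyAd_sub (p q : K[X]) (α : A) : polyAd K br (p - q) α = polyAd K br p α - polyAd K br q α := by
  simp [polyAd]

theorem polyAd_one (α : A) : polyAd K br 1 α = 1 := by simp [polyAd]

theorem polyAd_sum {ι : Type*} (s : Finset ι) (p : ι → K[X]) (α : A) :
    polyAd K br (∑ i ∈ s, p i) α = ∑ i ∈ s, polyAd K br (p i) α := by
  simp [polyAd, Polynomial.map_sum]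

theorem polyAd_C_mul (c : K) (p : K[X]) (α : A) :
    polyAd K br (C c * p) α = algebraMap K R c • polyAd K br p α := by
  rw [polyAd, Polynomial.map_mul, map_C, map_mul, aeval_C, Algebra.algebraMap_eq_smul_one, smul_one_mul]
  rfl

theorem polyAd_pow (p : K[X]) (k : ℕ) (α : A) : polyAd K br (p ^ k) α = polyAd K br p α ^ k := by
  simp [polyAd]

theorem polyAd_X (α : A) : polyAd K br X α = br α := by simp [polyAd]

theorem raisesBy_polyAd (hF : IsFiltBracket F br) {α : A} (hα : α ∈ F 1) (p : K[X]) :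
    RaisesBy F 0 (polyAd K br p α) := raisesBy_aeval hF hα _

theorem expAdTerm_eq (α a : A) (i : ℕ) :
    expAdTerm K br α a i = (algebraMap K R ((i.factorial : K)⁻¹) • br α ^ i) a := by
  rw [expAdTerm, LinearMap.smul_apply, Module.End.pow_apply]

theorem polyAd_expPoly (α : A) (N : ℕ) (a : A) :
    polyAd K br (expPoly K N) α a = ∑ i ∈ Finset.range N, expAdTerm K br α a i := by
  rw [expPoly, polyAd_sum, LinearMap.sum_apply]
  exact Finset.sum_congr rfl fun i _ => by rw [expAdTerm_eq, polyAd_C_mul, polyAd_pow, polyAd_X]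

/-- `exp (ad α)` as an `R`-linear endomorphism. -/
def expAdEnd (hF : IsFiltBracket F br) {α : A} (hα : α ∈ F 1) : Module.End R A where
  toFun := expAd K F br α
  map_add' := expAd_add K hF hα
  map_smul' := expAd_smul K hF hα

theorem expAdEnd_sub_polyAd (hF : IsFiltBracket F br) {α : A} (hα : α ∈ F 1) (N : ℕ) :
    RaisesBy F N (expAdEnd K hF hα - polyAd K br (expPoly K N) α) := fun d a ha => by
  have h1 := expAd_spec K hF hα a (d + N)
  rw [add_comm d N, Finset.sum_range_add, ← sub_sub, add_comm N d] at h1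
  have h2 : ∑ x ∈ Finset.range d, expAdTerm K br α a (N + x) ∈ F (d + N) :=
    Submodule.sum_mem _ fun x _ => by
      rw [expAdTerm_eq]
      refine hF.antitone ?_ ((((hF.raisesBy hα).pow (N + x)).smul _) d a ha)
      omega
  have := Submodule.add_mem _ h1 h2
  rw [sub_add_cancel] at this
  rw [LinearMap.sub_apply, polyAd_expPoly]
  exact this

theorem raisesBy_expAdEnd (hF : IsFiltBracket F br) {α : A} (hα : α ∈ F 1) :
    RaisesBy F 0 (expAdEnd K hF hα) := by
  simpa [expPoly, polyAd] using expAdEnd_sub_polyAd K hF hα 0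

theorem raisesBy_expAdEnd_sub_one (hF : IsFiltBracket F br) {α : A} (hα : α ∈ F 1) :
    RaisesBy F 1 (expAdEnd K hF hα - 1) := by
  simpa [expPoly, polyAd] using expAdEnd_sub_polyAd K hF hα 1

theorem expAd_mem (hF : IsFiltBracket F br) {α : A} (hα : α ∈ F 1) {n : ℕ} {a : A} (ha : a ∈ F n) :
    expAd K F br α a ∈ F n := raisesBy_expAdEnd K hF hα n a ha

theorem expAd_br [CharZero K] (hF : IsFiltBracket F br) (hL : IsLieBr br) {α : A} (hα : α ∈ F 1)
    (a b : A) : expAd K F br α (br a b) = br (expAd K F br α a) (expAd K F br α b) :=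
  expAd_bilin K hF hα br hF.bracket_mem (hL.leibniz α) a b

theorem expAd_eq_add (hF : IsFiltBracket F br) {α : A} (hα : α ∈ F 1) {a : A}
    (h : br α (br α a) = 0) : expAd K F br α a = a + br α a := by
  refine expAd_eq K hF hα fun k => ?_
  have hz : ∀ i, expAdTerm K br α a (i + 2) = 0 := by
    intro i
    rw [expAdTerm_eq, LinearMap.smul_apply, pow_add, Module.End.mul_apply, pow_two,
      Module.End.mul_apply, h, map_zero, smul_zero]
  rcases k with _ | _ | k
  · exact hF.mem_zero _
  · simpa [expAdTerm] using hF.bracket_mem hα (hF.mem_zero a)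
  · rw [Finset.sum_range_succ', Finset.sum_range_succ', Finset.sum_eq_zero fun i _ => hz i]
    simp [expAdTerm, add_comm a]

end ExpAd

end BCH

/-! ### Dynkin's form of the Baker-Campbell-Hausdorff series -/

section Dynkin

variable {R A : Type u} [CommRing R] [AddCommGroup A] [Module R A]
  {F : ℕ → Submodule R A} {br : A →ₗ[R] A →ₗ[R] A}

theorem lieWord_append (br : A →ₗ[R] A →ₗ[R] A) (l l' : List A) (h : l' ≠ []) :
    lieWord br (l ++ l') = l.foldr (fun a b => br a b) (lieWord br l') := by
  induction l with
  | nil => rfl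
  | cons a l ih =>
    obtain ⟨b, m, hm⟩ := List.exists_cons_of_ne_nil (l := l ++ l') (by simp [h])
    rw [List.cons_append, hm, lieWord, ← hm, ih, List.foldr_cons]

theorem foldr_replicate (x z : A) (n : ℕ) :
    (List.replicate n x).foldr (fun a b => br a b) z = (br x ^ n) z := by
  induction n with
  | zero => rfl
  | succ n ih => rw [List.replicate_succ, List.foldr_cons, ih, pow_succ', Module.End.mul_apply]

variable (K : Type u) [Field K] [Algebra K R]

/-- The word `x ^ r * y ^ s`. -/
abbrev blockWord (x y : A) (q : ℕ × ℕ) : List A := List.replicate q.1 x ++ List.replicate q.2 y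

/-- The coefficient `1 / (r! * s!)`. -/
abbrev blockCoeff (q : ℕ × ℕ) : K := ((q.1.factorial : K) * (q.2.factorial : K))⁻¹

/-- The pairs `(r, s) ≠ (0, 0)` with `r, s < N`. -/
abbrev blocks (N : ℕ) : Finset (ℕ × ℕ) :=
  (Finset.range N ×ˢ Finset.range N).filter fun q => 0 < q.1 + q.2

/-- The sum over all sequences of `k` blocks of the associated iterated brackets. -/
def dynkinSum (br : A →ₗ[R] A →ₗ[R] A) (x y : A) (N k : ℕ) : A :=
  ∑ p ∈ Fintype.piFinset fun _ : Fin k => blocks N,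
    algebraMap K R (∏ i, blockCoeff K (p i)) •
      lieWord br ((List.ofFn p).flatMap (blockWord x y))

theorem sum_piFinset_succ {k : ℕ} (s : Finset (ℕ × ℕ)) (f : (Fin (k + 1) → ℕ × ℕ) → A) :
    ∑ p ∈ Fintype.piFinset (fun _ : Fin (k + 1) => s), f p =
      ∑ q ∈ s, ∑ p ∈ Fintype.piFinset (fun _ : Fin k => s), f (Fin.cons q p) := by
  rw [← Finset.sum_product']
  refine (Finset.sum_bij' (fun x _ => Fin.cons x.1 x.2) (fun p _ => (p 0, Fin.tail p))
    ?_ ?_ ?_ ?_ ?_).symm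
  · rintro ⟨q, p⟩ h
    simp only [Finset.mem_product, Fintype.mem_piFinset] at h
    refine Fintype.mem_piFinset.2 fun i => ?_
    refine Fin.cases ?_ (fun j => ?_) i
    · exact h.1
    · simpa using h.2 j
  · intro p h
    rw [Fintype.mem_piFinset] at h
    exact Finset.mem_product.2 ⟨h 0, Fintype.mem_piFinset.2 fun i => h i.succ⟩
  · rintro ⟨q, p⟩ _; simp
  · intro p _; simp
  · rintro ⟨q, p⟩ _; rfl

theorem dynkinSum_one (x y : A) (N : ℕ) :
    dynkinSum K br x y N 1 =
      ∑ q ∈ blocks N, algebraMap K R (blockCoeff K q) • lieWord br (blockWord x y q) := by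
  rw [dynkinSum, sum_piFinset_succ]
  refine Finset.sum_congr rfl fun q _ => ?_
  simp

theorem flatMap_blockWord_ne_nil {x y : A} {N k : ℕ} {p : Fin (k + 1) → ℕ × ℕ}
    (hp : p ∈ Fintype.piFinset fun _ : Fin (k + 1) => blocks N) :
    (List.ofFn p).flatMap (blockWord x y) ≠ [] := by
  have h := (Finset.mem_filter.1 (Fintype.mem_piFinset.1 hp 0)).2
  rw [List.ofFn_succ, List.flatMap_cons]
  intro h0
  have := congrArg List.length h0
  simp only [List.length_append, List.length_replicate, List.length_nil] at this
  omega

theorem dynkinSum_succ (x y : A) (N k : ℕ) :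
    dynkinSum K br x y N (k + 2) =
      (∑ q ∈ blocks N, algebraMap K R (blockCoeff K q) • (br x ^ q.1 * br y ^ q.2))
        (dynkinSum K br x y N (k + 1)) := by
  rw [dynkinSum, sum_piFinset_succ, LinearMap.sum_apply]
  refine Finset.sum_congr rfl fun q _ => ?_
  rw [dynkinSum, map_sum]
  refine Finset.sum_congr rfl fun p hp => ?_
  rw [List.ofFn_succ, List.flatMap_cons, Fin.prod_univ_succ]
  simp only [Fin.cons_zero, Fin.cons_succ]
  rw [lieWord_append br _ _ (flatMap_blockWord_ne_nil hp), List.foldr_append, foldr_replicate,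
    foldr_replicate, map_smul, LinearMap.smul_apply, Module.End.mul_apply, map_mul, ← smul_smul,
    smul_comm]

theorem lieWord_replicate (h : ∀ a, br a a = 0) (x : A) (n : ℕ) :
    lieWord br (List.replicate (n + 2) x) = 0 := by
  induction n with
  | zero => simp [List.replicate, lieWord, h]
  | succ n ih => rw [List.replicate_succ, List.replicate_succ, lieWord, ← List.replicate_succ, ih, map_zero]

theorem sum_blocks (N : ℕ) (f : ℕ × ℕ → A) (h0 : f (0, 0) = 0) :
    ∑ q ∈ blocks N, f q = ∑ r ∈ Finset.range N, ∑ s ∈ Finset.range N, f (r, s) := by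
  rw [← Finset.sum_product']
  refine Finset.sum_subset (Finset.filter_subset _ _) fun q hq hq' => ?_
  have : q.1 + q.2 = 0 := by
    by_contra h
    exact hq' (Finset.mem_filter.2 ⟨hq, Nat.pos_of_ne_zero h⟩)
  have e : q = (0, 0) := Prod.ext (by omega) (by omega)
  rw [e, h0]

theorem dynkinSum_one_eq (hL : IsLieBr br) (x y : A) (N : ℕ) :
    dynkinSum K br x y (N + 2) 1 = x + polyAd K br (expPoly K (N + 2)) x y := by
  rw [dynkinSum_one, sum_blocks (N + 2) (fun q => algebraMap K R (blockCoeff K q) •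
    lieWord br (blockWord x y q)) (by simp [blockWord, lieWord]), polyAd_expPoly]
  have h1 : ∀ r, ∑ s ∈ Finset.range (N + 2),
      algebraMap K R (blockCoeff K (r, s)) • lieWord br (blockWord x y (r, s)) =
      (if r = 1 then x else 0) + expAdTerm K br x y r := by
    intro r
    rw [Finset.sum_range_succ', Finset.sum_range_succ', Finset.sum_eq_zero]
    · rw [zero_add, add_comm]
      congr 1
      · rcases r with _ | _ | r
        · simp [blockWord, lieWord]
        · simp [blockWord, lieWord]
        · rw [blockWord, List.replicate_zero, List.append_nil, lieWord_replicate hL.self, smul_zero,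
            if_neg (by omega)]
      · rw [blockWord, lieWord_append br _ _ (by simp), foldr_replicate, expAdTerm_eq]
        simp [blockCoeff, lieWord]
    · intro s _
      rw [blockWord, lieWord_append br _ _ (by simp), lieWord_replicate hL.self, foldr_replicate,
        map_zero, smul_zero]
  rw [Finset.sum_congr rfl fun r _ => h1 r, Finset.sum_add_distrib]
  simp

theorem sum_blocks_pow (x y : A) (N : ℕ) :
    (∑ q ∈ blocks (N + 1), algebraMap K R (blockCoeff K q) • (br x ^ q.1 * br y ^ q.2) :
      Module.End R A) =
    polyAd K br (expPoly K (N + 1)) x * polyAd K br (expPoly K (N + 1)) y - 1 := by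
  have h : ∀ f : ℕ × ℕ → Module.End R A, ∑ q ∈ blocks (N + 1), f q =
      (∑ r ∈ Finset.range (N + 1), ∑ s ∈ Finset.range (N + 1), f (r, s)) - f (0, 0) := by
    intro f
    rw [eq_sub_iff_add_eq, ← Finset.sum_product', ← Finset.sum_filter_add_sum_filter_not
      (Finset.range (N + 1) ×ˢ Finset.range (N + 1)) fun q => 0 < q.1 + q.2]
    congr 1
    have : (Finset.range (N + 1) ×ˢ Finset.range (N + 1)).filter (fun q => ¬ 0 < q.1 + q.2) =
        {(0, 0)} := by
      ext ⟨r, s⟩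
      simp only [Finset.mem_filter, Finset.mem_product, Finset.mem_range, Finset.mem_singleton,
        Prod.mk.injEq]
      omega
    rw [this, Finset.sum_singleton]
  rw [h, expPoly, polyAd_sum, polyAd_sum, Finset.sum_mul_sum]
  congr 1
  · refine Finset.sum_congr rfl fun r _ => Finset.sum_congr rfl fun s _ => ?_
    rw [polyAd_C_mul, polyAd_C_mul, polyAd_pow, polyAd_X, polyAd_pow, polyAd_X, smul_mul_smul_comm,
      ← map_mul]
    congr 2
    exact mul_inv _ _
  · simp [blockCoeff]

theorem dynkinSum_eq (x y : A) (N k : ℕ) :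
    dynkinSum K br x y (N + 1) (k + 1) =
      ((polyAd K br (expPoly K (N + 1)) x * polyAd K br (expPoly K (N + 1)) y - 1) ^ k)
        (dynkinSum K br x y (N + 1) 1) := by
  induction k with
  | zero => simp
  | succ k ih => rw [dynkinSum_succ, ih, sum_blocks_pow, pow_succ', Module.End.mul_apply]

theorem length_flatMap_blockWord (x y : A) {k : ℕ} (p : Fin k → ℕ × ℕ) :
    ((List.ofFn p).flatMap (blockWord x y)).length = ∑ i, ((p i).1 + (p i).2) := by
  rw [List.length_flatMap]
  simp only [List.length_append, List.length_replicate, List.map_ofFn, List.sum_ofFn,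
    Function.comp_apply]

theorem sum_bchTerm_sub_mem (hF : IsFiltBracket F br) [CharZero K] {x y : A} (hx : x ∈ F 1)
    (hy : y ∈ F 1) (N : ℕ) :
    ∑ m ∈ Finset.range N, (m : R) • bchTerm K br x y m -
      ∑ k ∈ Finset.range N, algebraMap K R ((-1) ^ k / ((k : K) + 1)) •
        dynkinSum K br x y N (k + 1) ∈ F N := by
  classical
  have hw : ∀ {k : ℕ} (p : Fin k → ℕ × ℕ), lieWord br ((List.ofFn p).flatMap (blockWord x y)) ∈
      F (∑ i, ((p i).1 + (p i).2)) := by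
    intro k p
    rw [← length_flatMap_blockWord x y p]
    refine lieWord_mem hF _ fun a ha => ?_
    simp only [List.mem_flatMap, List.mem_append, List.mem_replicate] at ha
    obtain ⟨q, -, h | h⟩ := ha
    · rw [h.2]; exact hx
    · rw [h.2]; exact hy
  let t : (k : ℕ) → (Fin k → ℕ × ℕ) → A := fun k p =>
    algebraMap K R ((-1) ^ (k - 1) / (k : K) * ∏ i, blockCoeff K (p i)) •
      lieWord br ((List.ofFn p).flatMap (blockWord x y))
  have ht : ∀ {k : ℕ} (p : Fin k → ℕ × ℕ), t k p ∈ F (∑ i, ((p i).1 + (p i).2)) :=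
    fun p => Submodule.smul_mem _ _ (hw p)
  have hbox : ∀ {m : ℕ}, m < N → ∀ k : ℕ,
      (Fintype.piFinset fun _ : Fin k => Finset.range (m + 1) ×ˢ Finset.range (m + 1)).filter
        (fun p => (∀ i, 0 < (p i).1 + (p i).2) ∧ ∑ i, ((p i).1 + (p i).2) = m) =
      (Fintype.piFinset fun _ : Fin k => blocks N).filter
        (fun p => ∑ i, ((p i).1 + (p i).2) = m) := by
    intro m hm k
    ext p
    simp only [Finset.mem_filter, Fintype.mem_piFinset, Finset.mem_product, Finset.mem_range]
    constructor
    · rintro ⟨h1, h2, h3⟩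
      exact ⟨fun i => ⟨⟨by have := (h1 i).1; omega, by have := (h1 i).2; omega⟩, h2 i⟩, h3⟩
    · rintro ⟨h1, h3⟩
      refine ⟨fun i => ?_, fun i => (h1 i).2, h3⟩
      have := Finset.single_le_sum (f := fun i => (p i).1 + (p i).2) (fun _ _ => Nat.zero_le _)
        (Finset.mem_univ i)
      rw [h3] at this
      constructor <;> omega
  have hterm : ∀ m, m < N → (m : R) • bchTerm K br x y m =
      ∑ k ∈ Finset.range N, ∑ p ∈ (Fintype.piFinset fun _ : Fin (k + 1) => blocks N).filter
        (fun p => ∑ i, ((p i).1 + (p i).2) = m), t (k + 1) p := by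
    intro m hm
    have e1 : (m : R) • bchTerm K br x y m = ∑ k ∈ Finset.Icc 1 m,
        ∑ p ∈ (Fintype.piFinset fun _ : Fin k => blocks N).filter
          (fun p => ∑ i, ((p i).1 + (p i).2) = m), t k p := by
      rw [bchTerm, Finset.smul_sum]
      refine Finset.sum_congr rfl fun k hk => ?_
      rw [Finset.smul_sum, ← hbox hm k]
      refine Finset.sum_congr ?_ fun p hp => ?_
      · ext; simp only [Finset.mem_filter]
      · rw [smul_smul, ← map_natCast (algebraMap K R) m, ← map_mul]
        simp only [t]
        congr 2
        have hm0 : (m : K) ≠ 0 := by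
          rw [Finset.mem_Icc] at hk
          exact_mod_cast (by omega : m ≠ 0)
        have hk0 : (k : K) ≠ 0 := by
          rw [Finset.mem_Icc] at hk
          exact_mod_cast (by omega : k ≠ 0)
        rw [Finset.prod_inv_distrib]
        have hp0 : (∏ i, (((p i).1.factorial : K) * ((p i).2.factorial : K))) ≠ 0 :=
          Finset.prod_ne_zero_iff.2 fun i _ => mul_ne_zero
            (by exact_mod_cast Nat.factorial_ne_zero _) (by exact_mod_cast Nat.factorial_ne_zero _)
        field_simp
    rw [e1, Finset.sum_subset (s₂ := Finset.Icc 1 N) (fun k hk => ?_) fun k hk hk' => ?_]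
    · rw [← Finset.sum_image (s := Finset.range N) (g := fun k => k + 1)
        (f := fun k => ∑ p ∈ (Fintype.piFinset fun _ : Fin k => blocks N).filter
          (fun p => ∑ i, ((p i).1 + (p i).2) = m), t k p) (by intro a _ b _ h; simpa using h)]
      congr 1
      ext k
      simp only [Finset.mem_Icc, Finset.mem_image, Finset.mem_range]
      constructor
      · rintro ⟨h1, h2⟩; exact ⟨k - 1, by omega, by omega⟩
      · rintro ⟨j, h1, rfl⟩; omega
    · rw [Finset.mem_Icc] at hk ⊢; omega
    · refine Finset.sum_eq_zero fun p hp => ?_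
      exfalso
      rw [Finset.mem_Icc] at hk hk'
      obtain ⟨h1, h2⟩ := Finset.mem_filter.1 hp
      rw [Fintype.mem_piFinset] at h1
      have := Finset.card_nsmul_le_sum Finset.univ (fun i => (p i).1 + (p i).2) 1
        fun i _ => (Finset.mem_filter.1 (h1 i)).2
      simp only [Finset.card_univ, Fintype.card_fin, smul_eq_mul, mul_one, h2] at this
      omega
  rw [Finset.sum_congr rfl fun m hm => hterm m (Finset.mem_range.1 hm), Finset.sum_comm,
    ← Finset.sum_sub_distrib]
  refine Submodule.sum_mem _ fun k _ => ?_
  have hd : algebraMap K R ((-1) ^ k / ((k : K) + 1)) • dynkinSum K br x y N (k + 1) =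
      ∑ p ∈ Fintype.piFinset fun _ : Fin (k + 1) => blocks N, t (k + 1) p := by
    rw [dynkinSum, Finset.smul_sum]
    refine Finset.sum_congr rfl fun p _ => ?_
    simp only [t, Nat.add_sub_cancel]
    rw [smul_smul, ← map_mul]
    push_cast
    rfl
  rw [hd, ← Finset.sum_filter_add_sum_filter_not (Fintype.piFinset fun _ : Fin (k + 1) => blocks N)
    (fun p => ∑ i, ((p i).1 + (p i).2) < N)]
  have hs : ∑ m ∈ Finset.range N, ∑ p ∈ (Fintype.piFinset fun _ : Fin (k + 1) => blocks N).filter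
      (fun p => ∑ i, ((p i).1 + (p i).2) = m), t (k + 1) p =
      ∑ p ∈ (Fintype.piFinset fun _ : Fin (k + 1) => blocks N).filter
        (fun p => ∑ i, ((p i).1 + (p i).2) < N), t (k + 1) p := by
    rw [← Finset.sum_fiberwise_of_maps_to (t := Finset.range N)
      (g := fun p : Fin (k + 1) → ℕ × ℕ => ∑ i, ((p i).1 + (p i).2))
      (fun p hp => Finset.mem_range.2 (Finset.mem_filter.1 hp).2)]
    refine Finset.sum_congr rfl fun m hm => Finset.sum_congr ?_ fun _ _ => rfl
    ext p
    simp only [Finset.mem_filter, Finset.mem_range] at hm ⊢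
    constructor
    · rintro ⟨h1, h2⟩; exact ⟨⟨h1, by omega⟩, h2⟩
    · rintro ⟨⟨h1, _⟩, h2⟩; exact ⟨h1, h2⟩
  rw [hs, sub_add_eq_sub_sub, sub_self, zero_sub]
  refine Submodule.neg_mem _ (Submodule.sum_mem _ fun p hp => hF.antitone ?_ (ht p))
  exact not_lt.1 (Finset.mem_filter.1 hp).2

end Dynkin

/-! ### Filtered Lie algebras with an Euler element -/

section Euler

variable {R A : Type u} [CommRing R] [AddCommGroup A] [Module R A]
  {F : ℕ → Submodule R A} {br : A →ₗ[R] A →ₗ[R] A}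

/-- `D` acts on the `n`-th graded piece of the filtration as multiplication by `n`. -/
def IsEuler (F : ℕ → Submodule R A) (br : A →ₗ[R] A →ₗ[R] A) (D : A) : Prop :=
  ∀ n w, w ∈ F n → br D w - (n : R) • w ∈ F (n + 1)

variable (K : Type u) [Field K] [Algebra K R] [CharZero K]

include K in
theorem mem_of_natCast_smul_mem {N : Submodule R A} {n : ℕ} (hn : n ≠ 0) {a : A}
    (h : (n : R) • a ∈ N) : a ∈ N := by
  have := N.smul_mem (algebraMap K R (n : K)⁻¹) h
  rwa [smul_smul, ← map_natCast (algebraMap K R), ← map_mul, inv_mul_cancel₀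
    (by exact_mod_cast hn), map_one, one_smul] at this

theorem br_lieWord {D : A} (hL : IsLieBr br) : ∀ l : List A, (∀ a ∈ l, br D a = a) →
    br D (lieWord br l) = (l.length : R) • lieWord br l
  | [], _ => by simp [lieWord]
  | [a], h => by simpa [lieWord] using h a (by simp)
  | a :: b :: l, h => by
      rw [lieWord, hL.leibniz, h a (by simp),
        br_lieWord hL (b :: l) fun c hc => h c (List.mem_cons_of_mem _ hc), map_smul]
      simp only [List.length_cons]
      push_cast
      module

theorem br_bchTerm {D x y : A} (hL : IsLieBr br) (hx : br D x = x) (hy : br D y = y) (n : ℕ) :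
    br D (bchTerm K br x y n) = (n : R) • bchTerm K br x y n := by
  rw [bchTerm, map_sum, Finset.smul_sum]
  refine Finset.sum_congr rfl fun k _ => ?_
  rw [map_sum, Finset.smul_sum]
  refine Finset.sum_congr rfl fun p hp => ?_
  rw [map_smul, br_lieWord hL, smul_comm]
  · congr 3
    exact (length_flatMap_blockWord x y p).trans (Finset.mem_filter.1 hp).2.2
  · intro a ha
    simp only [List.mem_flatMap, List.mem_append, List.mem_replicate] at ha
    obtain ⟨q, -, h | h⟩ := ha
    · rw [h.2, hx]
    · rw [h.2, hy]

variable {K}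

section Homogeneous

variable {D x y : A} (hF : IsFiltBracket F br) (hL : IsLieBr br) (hD : IsEuler F br D)
  (hx : x ∈ F 1) (hy : y ∈ F 1) (hDx : br D x = x) (hDy : br D y = y)

include hF hL hx hy hDx hDy in
theorem expAd_expAd_euler :
    expAd K F br x (expAd K F br y D) = D - (x + expAd K F br x y) := by
  have hyD : br y D = -y := by rw [hL.skew, hDy]
  have hxD : br x D = -x := by rw [hL.skew, hDx]
  have e1 : expAd K F br y D = D + -y := by
    rw [expAd_eq_add K hF hy, hyD]
    rw [hyD, map_neg, hL.self, neg_zero]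
  have e2 : expAd K F br x D = D + -x := by
    rw [expAd_eq_add K hF hx, hxD]
    rw [hxD, map_neg, hL.self, neg_zero]
  rw [e1, expAd_add K hF hx, e2]
  have : expAd K F br x (-y) = -expAd K F br x y := (expAdEnd K hF hx).map_neg y
  rw [this]
  abel

include hF hL hx hy hDx hDy in
theorem br_euler_bch_sub_mem (N : ℕ) :
    br D (bch K F br x y) - ∑ k ∈ Finset.range (N + 2), algebraMap K R ((-1) ^ k / ((k : K) + 1)) •
      ((polyAd K br (expPoly K (N + 2)) x * polyAd K br (expPoly K (N + 2)) y - 1) ^ k)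
        (x + polyAd K br (expPoly K (N + 2)) x y) ∈ F (N + 2) := by
  have h1 := filtSum_spec hF.toIsCompleteFilt (bchTerm_mem K hF hx hy) (N + 2)
  have h2 := hF.bracket_mem (hF.mem_zero D) h1
  rw [zero_add, map_sub, map_sum] at h2
  simp only [br_bchTerm K hL hDx hDy] at h2
  have h3 := sum_bchTerm_sub_mem K hF hx hy (N + 2)
  have h4 := Submodule.add_mem _ h2 h3
  rw [sub_add_sub_cancel] at h4
  have h5 : ∀ k, dynkinSum K br x y (N + 2) (k + 1) = ((polyAd K br (expPoly K (N + 2)) x *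
      polyAd K br (expPoly K (N + 2)) y - 1) ^ k) (x + polyAd K br (expPoly K (N + 2)) x y) :=
    fun k => by rw [dynkinSum_eq K x y (N + 1), dynkinSum_one_eq K hL x y N]
  simp only [h5] at h4
  exact h4

include hF hL hx hy hDx hDy in
theorem expAd_bch_euler_sub_mem {n : ℕ} (hn : 1 ≤ n)
    (hS : RaisesBy F n (expAdEnd K hF (bch_mem K hF hx hy) - expAdEnd K hF hx * expAdEnd K hF hy)) :
    expAd K F br (bch K F br x y) D - expAd K F br x (expAd K F br y D) ∈ F (n + 1) := by
  set z := bch K F br x y with hz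
  have hzm : z ∈ F 1 := bch_mem K hF hx hy
  obtain ⟨m, rfl⟩ : ∃ m, n = m + 1 := ⟨n - 1, by omega⟩
  set N := m + 2 with hN
  set V := x + expAd K F br x y with hV
  have hVm : V ∈ F 1 := Submodule.add_mem _ hx (expAd_mem K hF hx hy)
  set Q := polyAd K br (expPoly K (N + 1)) z with hQ
  set P := polyAd K br (expPoly K N) x * polyAd K br (expPoly K N) y with hP
  have hP0 : RaisesBy F 0 P := (raisesBy_polyAd K hF hx _).mul (raisesBy_polyAd K hF hy _)
  have hQ0 : RaisesBy F 0 Q := raisesBy_polyAd K hF hzm _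
  have hQP : RaisesBy F (m + 1) (P - Q) := by
    have h1 := (expAdEnd_sub_polyAd K hF hzm (N + 1)).mono hF.antitone (show m + 1 ≤ _ by omega)
    have h2 := (RaisesBy.mul_sub_mul (raisesBy_expAdEnd K hF hx) (raisesBy_polyAd K hF hy _)
      (expAdEnd_sub_polyAd K hF hx N) (expAdEnd_sub_polyAd K hF hy N)).mono hF.antitone
      (show m + 1 ≤ _ by omega)
    have := (h1.sub h2).sub hS
    convert this using 1
    rw [hP, hQ]
    abel
  have hpow : ∀ k, RaisesBy F (m + 1) ((P - 1) ^ k - (Q - 1) ^ k) := fun k => by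
    refine RaisesBy.pow_sub_pow (hP0.sub RaisesBy.one) (hQ0.sub RaisesBy.one) ?_ k
    rwa [sub_sub_sub_cancel_right]
  have h1 := br_euler_bch_sub_mem (K := K) hF hL hx hy hDx hDy m
  have hVN : x + polyAd K br (expPoly K (m + 2)) x y - V ∈ F (m + 2) := by
    rw [hV, add_sub_add_left_eq_sub, ← neg_sub]
    refine Submodule.neg_mem _ (hF.antitone ?_ (expAdEnd_sub_polyAd K hF hx (m + 2) 1 y hy))
    omega
  have h2 : br D z - polyAd K br (logQuotPoly K N) z V ∈ F N := by
    have h3 : ∑ k ∈ Finset.range (m + 2), algebraMap K R ((-1) ^ k / ((k : K) + 1)) •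
        ((P - 1) ^ k) (x + polyAd K br (expPoly K (m + 2)) x y) -
        polyAd K br (logQuotPoly K N) z V ∈ F N := by
      rw [logQuotPoly, polyAd_sum, LinearMap.sum_apply, ← Finset.sum_sub_distrib]
      refine Submodule.sum_mem _ fun k _ => ?_
      rw [polyAd_C_mul, LinearMap.smul_apply, polyAd_pow, polyAd_sub, polyAd_one, ← smul_sub]
      refine Submodule.smul_mem _ _ ?_
      rw [← sub_add_sub_cancel _ (((P - 1) ^ k) V), ← map_sub, ← LinearMap.sub_apply]
      refine Submodule.add_mem _ ?_ (hF.antitone (by omega) (hpow k 1 V hVm))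
      have := ((hP0.sub RaisesBy.one).pow k) _ _ hVN
      simpa using this
    have := Submodule.add_mem _ h1 h3
    rwa [sub_add_sub_cancel] at this
  have h5 : polyAd K br (expQuotPoly K N) z (br D z) - V ∈ F N := by
    have h6 := raisesBy_polyAd K hF hzm (expQuotPoly K N) _ _ h2
    rw [add_zero, map_sub, ← Module.End.mul_apply _ (polyAd K br (logQuotPoly K N) z),
      ← polyAd_mul] at h6
    obtain ⟨q, hq⟩ := X_pow_dvd_expQuot_mul_logQuot K N
    rw [sub_eq_iff_eq_add] at hq
    have h7 : polyAd K br (Polynomial.X ^ N * q) z V ∈ F N := by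
      rw [polyAd_mul, polyAd_pow, polyAd_X]
      have := (((hF.raisesBy hzm).pow N).mul (raisesBy_polyAd K hF hzm q)) 1 V hVm
      exact hF.antitone (by omega) this
    have := Submodule.add_mem _ h6 h7
    rw [hq] at this
    simp only [polyAd, Polynomial.map_add, map_add, LinearMap.add_apply, Polynomial.map_one,
      map_one, Module.End.one_apply] at this
    convert this using 1
    simp only [polyAd]
    abel
  have h8 : expAd K F br z D - (D - V) ∈ F N := by
    have h9 := hF.antitone (show N ≤ 0 + (N + 1) by omega)
      (expAdEnd_sub_polyAd K hF hzm (N + 1) 0 D (hF.mem_zero D))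
    have h10 : polyAd K br (expPoly K (N + 1)) z D = D - polyAd K br (expQuotPoly K N) z (br D z) := by
      have : expPoly K (N + 1) = 1 + expQuotPoly K N * Polynomial.X := by
        rw [mul_comm, ← expPoly_sub_one]
        ring
      rw [this]
      simp only [polyAd, Polynomial.map_add, map_add, LinearMap.add_apply, Polynomial.map_one,
        map_one, Module.End.one_apply, Polynomial.map_mul, map_mul, Module.End.mul_apply,
        Polynomial.map_X, Polynomial.aeval_X]
      rw [hL.skew z D, map_neg, sub_eq_add_neg]
    rw [LinearMap.sub_apply, h10] at h9
    have := Submodule.sub_mem _ h9 h5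
    convert this using 1
    change expAd K F br z D - (D - V) = expAd K F br z D - _ - _
    abel
  rw [expAd_expAd_euler hF hL hx hy hDx hDy]
  exact h8

include hD hF hL hx hy hDx hDy in
theorem raisesBy_expAd_bch_sub (n : ℕ) :
    RaisesBy F (n + 1)
      (expAdEnd K hF (bch_mem K hF hx hy) - expAdEnd K hF hx * expAdEnd K hF hy) := by
  have hzm := bch_mem K hF hx hy
  have h1 : ∀ {α : A} (h : α ∈ F 1), RaisesBy F 1 (expAdEnd K hF h - 1) := fun h =>
    raisesBy_expAdEnd_sub_one K hF h
  have hP1 : RaisesBy F 1 (expAdEnd K hF hx * expAdEnd K hF hy - 1) := by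
    have := RaisesBy.mul_sub_mul (raisesBy_expAdEnd K hF hx) RaisesBy.one (h1 hx) (h1 hy)
    rwa [mul_one] at this
  induction n with
  | zero =>
    have := (h1 hzm).sub hP1
    rwa [sub_sub_sub_cancel_right] at this
  | succ n ih =>
    intro d u hu
    set Q := expAdEnd K hF (bch_mem K hF hx hy) with hQ
    set P := expAdEnd K hF hx * expAdEnd K hF hy with hP
    have hQb : ∀ a b, Q (br a b) = br (Q a) (Q b) := fun a b => expAd_br K hF hL hzm a b
    have hPb : ∀ a b, P (br a b) = br (P a) (P b) := fun a b => by
      change expAd K F br x (expAd K F br y (br a b)) = _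
      rw [expAd_br K hF hL hy, expAd_br K hF hL hx]
      rfl
    have hw : (Q - P) u ∈ F (d + (n + 1)) := ih d u hu
    set w := (Q - P) u with hwdef
    have hDD : Q D - P D ∈ F (n + 2) :=
      expAd_bch_euler_sub_mem hF hL hx hy hDx hDy (Nat.succ_pos n) ih
    have e1 : (Q - P) (br D u) = br (Q D - P D) (Q u) + br (P D - D) w + br D w := by
      rw [LinearMap.sub_apply, hQb, hPb, hwdef, LinearMap.sub_apply]
      simp only [map_sub, LinearMap.sub_apply]
      abel
    have hQu : Q u ∈ F d := raisesBy_expAdEnd K hF hzm d u hu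
    have h2 : br (Q D - P D) (Q u) ∈ F (d + (n + 1 + 1)) := by
      have := hF.bracket_mem hDD hQu
      rwa [show n + 2 + d = d + (n + 1 + 1) by omega] at this
    have h3 : br (P D - D) w ∈ F (d + (n + 1 + 1)) := by
      have := hF.bracket_mem (hP1 0 D (hF.mem_zero D)) hw
      rwa [show 0 + 1 + (d + (n + 1)) = d + (n + 1 + 1) by omega] at this
    have h4 := hD _ _ hw
    have h5 := ih _ _ (hD _ _ hu)
    rw [map_sub, map_smul, e1] at h5
    rw [show d + 1 + (n + 1) = d + (n + 1 + 1) by omega] at h5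
    rw [show d + (n + 1) + 1 = d + (n + 1 + 1) by omega] at h4
    have h6 := Submodule.sub_mem _ (Submodule.sub_mem _ (Submodule.add_mem _ h2 h3) h5)
      (Submodule.neg_mem _ h4)
    have e2 : br (Q D - P D) (Q u) + br (P D - D) w -
        (br (Q D - P D) (Q u) + br (P D - D) w + br D w - (d : R) • w) -
        -(br D w - ((d + (n + 1) : ℕ) : R) • w) = -((n + 1 : ℕ) : R) • w := by
      push_cast
      module
    rw [e2, neg_smul] at h6
    exact mem_of_natCast_smul_mem K (Nat.succ_ne_zero n) ((Submodule.neg_mem_iff _).1 h6)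

include hD hF hL hx hy hDx hDy in
theorem expAd_bch_of_homogeneous (u : A) :
    expAd K F br (bch K F br x y) u = expAd K F br x (expAd K F br y u) := by
  rw [← sub_eq_zero]
  refine hF.sep _ fun n => hF.antitone (show n ≤ 0 + (n + 1) by omega)
    (raisesBy_expAd_bch_sub (K := K) hF hL hD hx hy hDx hDy n 0 u (hF.mem_zero u))

end Homogeneous

/-- An element of filtration degree `1` is determined by the value of its exponential on an Euler
element. -/
theorem eq_of_expAd_euler_eq (hF : IsFiltBracket F br) (hL : IsLieBr br) {D : A}
    (hD : IsEuler F br D) {u v : A} (hu : u ∈ F 1) (hv : v ∈ F 1)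
    (h : expAd K F br u D = expAd K F br v D) : u = v := by
  have key : ∀ n, u - v ∈ F (n + 1) := by
    intro n
    induction n with
    | zero => exact Submodule.sub_mem _ hu hv
    | succ n ih =>
      have hi : ∀ i, (br u ^ (i + 1)) D ∈ F 1 ∧
          (br u ^ (i + 2)) D - (br v ^ (i + 2)) D ∈ F (n + 2) := by
        intro i
        have hu1 : ∀ j, (br u ^ (j + 1)) D ∈ F 1 := fun j => by
          have := (hF.raisesBy hu).pow (j + 1) 0 D (hF.mem_zero D)
          exact hF.antitone (by omega) this
        refine ⟨hu1 i, ?_⟩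
        have hdiff : ∀ j, (br u ^ (j + 1)) D - (br v ^ (j + 1)) D ∈ F (n + 1) := by
          intro j
          have := RaisesBy.pow_sub_pow ((hF.raisesBy hu).mono hF.antitone (Nat.zero_le _))
            ((hF.raisesBy hv).mono hF.antitone (Nat.zero_le _)) (n := n + 1)
            (by rw [← map_sub]; exact hF.raisesBy ih) (j + 1) 0 D (hF.mem_zero D)
          exact hF.antitone (by omega) this
        have e : (br u ^ (i + 2)) D - (br v ^ (i + 2)) D = br (u - v) ((br u ^ (i + 1)) D) +
            br v ((br u ^ (i + 1)) D - (br v ^ (i + 1)) D) := by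
          rw [pow_succ' _ (i + 1), pow_succ' _ (i + 1), Module.End.mul_apply, Module.End.mul_apply]
          simp only [map_sub, LinearMap.sub_apply]
          abel
        rw [e]
        have h0 := hF.bracket_mem ih (hu1 i)
        refine Submodule.add_mem _ h0 ?_
        have := hF.bracket_mem hv (hdiff i)
        rwa [show 1 + (n + 1) = n + 2 by omega] at this
      have h1 := expAd_spec K hF hu D (n + 2)
      have h2 := expAd_spec K hF hv D (n + 2)
      have h3 := Submodule.sub_mem _ h2 h1
      rw [h, sub_sub_sub_cancel_left, ← Finset.sum_sub_distrib, Finset.sum_range_succ',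
        Finset.sum_range_succ'] at h3
      have h4 : ∑ i ∈ Finset.range n, (expAdTerm K br u D (i + 1 + 1) - expAdTerm K br v D (i + 1 + 1))
          ∈ F (n + 2) := Submodule.sum_mem _ fun i _ => by
        rw [expAdTerm_eq, expAdTerm_eq, LinearMap.smul_apply, LinearMap.smul_apply, ← smul_sub]
        exact Submodule.smul_mem _ _ (hi i).2
      have h5 := Submodule.sub_mem _ h3 h4
      have h6 : br (u - v) D ∈ F (n + 2) := by
        convert h5 using 1
        simp [expAdTerm]
      rw [hL.skew] at h6
      have h7 := hD _ _ ih
      have h8 := Submodule.add_mem _ h7 h6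
      rw [show br D (u - v) - ((n + 1 : ℕ) : R) • (u - v) + -br D (u - v) =
        -(((n + 1 : ℕ) : R) • (u - v)) by abel] at h8
      exact mem_of_natCast_smul_mem K (Nat.succ_ne_zero n) ((Submodule.neg_mem_iff _).1 h8)
  rw [← sub_eq_zero]
  exact hF.sep _ fun n => hF.antitone (Nat.le_succ n) (key n)

end Euler

/-! ### Functoriality of the Baker-Campbell-Hausdorff series -/

section Map

variable (K : Type u) [Field K]
  {R A : Type u} [CommRing R] [AddCommGroup A] [Module R A] [Algebra K R]
  {F : ℕ → Submodule R A} {br : A →ₗ[R] A →ₗ[R] A}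
  {R' A' : Type u} [CommRing R'] [AddCommGroup A'] [Module R' A'] [Algebra K R']
  {F' : ℕ → Submodule R' A'} {br' : A' →ₗ[R'] A' →ₗ[R'] A'}

theorem map_lieWord (φ : A →+ A') (hF : IsFiltBracket F br)
    (hbr : ∀ a ∈ F 1, ∀ b ∈ F 1, φ (br a b) = br' (φ a) (φ b)) :
    ∀ l : List A, (∀ a ∈ l, a ∈ F 1) → φ (lieWord br l) = lieWord br' (l.map φ)
  | [], _ => by simp [lieWord]
  | [a], _ => rfl
  | a :: b :: l, h => by
      have h1 : ∀ c ∈ b :: l, c ∈ F 1 := fun c hc => h c (List.mem_cons_of_mem _ hc)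
      have h2 : lieWord br (b :: l) ∈ F 1 := hF.antitone (by simp) (lieWord_mem hF (b :: l) h1)
      rw [lieWord, hbr _ (h a (by simp)) _ h2, map_lieWord φ hF hbr (b :: l) h1]
      rfl

theorem map_bchTerm (φ : A →+ A') (hφ : ∀ (c : K) a, φ (algebraMap K R c • a) =
      algebraMap K R' c • φ a) (hF : IsFiltBracket F br)
    (hbr : ∀ a ∈ F 1, ∀ b ∈ F 1, φ (br a b) = br' (φ a) (φ b)) {x y : A} (hx : x ∈ F 1)
    (hy : y ∈ F 1) (n : ℕ) : φ (bchTerm K br x y n) = bchTerm K br' (φ x) (φ y) n := by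
  rw [bchTerm, map_sum, bchTerm]
  refine Finset.sum_congr rfl fun k _ => ?_
  rw [map_sum]
  refine Finset.sum_congr rfl fun p _ => ?_
  rw [hφ, map_lieWord φ hF hbr]
  · rw [List.map_flatMap]
    simp only [List.map_append, List.map_replicate]
  · intro a ha
    simp only [List.mem_flatMap, List.mem_append, List.mem_replicate] at ha
    obtain ⟨q, -, h | h⟩ := ha
    · rw [h.2]; exact hx
    · rw [h.2]; exact hy

theorem map_bch (φ : A →+ A') (hφ : ∀ (c : K) a, φ (algebraMap K R c • a) =
      algebraMap K R' c • φ a) (hF : IsFiltBracket F br) (hF' : IsFiltBracket F' br')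
    (hφF : ∀ {n a}, a ∈ F n → φ a ∈ F' n)
    (hbr : ∀ a ∈ F 1, ∀ b ∈ F 1, φ (br a b) = br' (φ a) (φ b)) {x y : A} (hx : x ∈ F 1)
    (hy : y ∈ F 1) : φ (bch K F br x y) = bch K F' br' (φ x) (φ y) := by
  refine (filtSum_eq hF'.toIsCompleteFilt (bchTerm_mem K hF' (hφF hx) (hφF hy)) fun k => ?_).symm
  have := hφF (filtSum_spec hF.toIsCompleteFilt (bchTerm_mem K hF hx hy) k)
  rw [map_sub, map_sum] at this
  simp only [map_bchTerm K φ hφ hF hbr hx hy] at this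
  exact this

theorem map_expAd (φ : A →+ A') (hφ : ∀ (c : K) a, φ (algebraMap K R c • a) =
      algebraMap K R' c • φ a) (hF : IsFiltBracket F br) (hF' : IsFiltBracket F' br')
    (hφF : ∀ {n a}, a ∈ F n → φ a ∈ F' n) {α : A} (hα : α ∈ F 1) (S : Set A)
    (hS : ∀ b ∈ S, br α b ∈ S ∧ φ (br α b) = br' (φ α) (φ b)) {a : A} (ha : a ∈ S) :
    φ (expAd K F br α a) = expAd K F' br' (φ α) (φ a) := by
  refine (expAd_eq K hF' (hφF hα) fun k => ?_).symm
  have h : ∀ i, φ (expAdTerm K br α a i) = expAdTerm K br' (φ α) (φ a) i := by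
    intro i
    have : (fun b => br α b)^[i] a ∈ S ∧
        φ ((fun b => br α b)^[i] a) = (fun b => br' (φ α) b)^[i] (φ a) := by
      induction i with
      | zero => exact ⟨ha, rfl⟩
      | succ n ih =>
        rw [Function.iterate_succ_apply', Function.iterate_succ_apply']
        exact ⟨(hS _ ih.1).1, by rw [(hS _ ih.1).2, ih.2]⟩
    rw [expAdTerm, expAdTerm, hφ, this.2]
  have := hφF (expAd_spec K hF hα a k)
  rw [map_sub, map_sum] at this
  simpa only [h] using this

end Map

/-! ### The graded Lie algebra of a filtration, extended by the grading derivation -/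

section Graded

variable {R A : Type u} [CommRing R] [AddCommGroup A] [Module R A]
  {F : ℕ → Submodule R A} {br : A →ₗ[R] A →ₗ[R] A}

theorem sum_antidiagonal_assoc (T : ℕ → ℕ → ℕ → A) (n : ℕ) :
    ∑ p ∈ Finset.HasAntidiagonal.antidiagonal n,
      ∑ q ∈ Finset.HasAntidiagonal.antidiagonal p.2, T p.1 q.1 q.2 =
    ∑ p ∈ Finset.HasAntidiagonal.antidiagonal n,
      ∑ q ∈ Finset.HasAntidiagonal.antidiagonal p.1, T q.1 q.2 p.2 := by
  rw [Finset.sum_sigma', Finset.sum_sigma']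
  refine Finset.sum_nbij' (fun x => ⟨(x.1.1 + x.2.1, x.2.2), (x.1.1, x.2.1)⟩)
    (fun x => ⟨(x.2.1, x.2.2 + x.1.2), (x.2.2, x.1.2)⟩) ?_ ?_ ?_ ?_ ?_
  all_goals
    rintro ⟨⟨i, m⟩, ⟨j, k⟩⟩ h
    obtain ⟨h1, h2⟩ := Finset.mem_sigma.1 h
    simp only [Finset.HasAntidiagonal.mem_antidiagonal] at h1 h2
    subst h2
    subst h1
    simp [add_assoc]

theorem sum_antidiagonal_left_comm (T : ℕ → ℕ → ℕ → A) (n : ℕ) :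
    ∑ p ∈ Finset.HasAntidiagonal.antidiagonal n,
      ∑ q ∈ Finset.HasAntidiagonal.antidiagonal p.2, T p.1 q.1 q.2 =
    ∑ p ∈ Finset.HasAntidiagonal.antidiagonal n,
      ∑ q ∈ Finset.HasAntidiagonal.antidiagonal p.2, T q.1 p.1 q.2 := by
  rw [Finset.sum_sigma', Finset.sum_sigma']
  refine Finset.sum_nbij' (fun x => ⟨(x.2.1, x.1.1 + x.2.2), (x.1.1, x.2.2)⟩)
    (fun x => ⟨(x.2.1, x.1.1 + x.2.2), (x.1.1, x.2.2)⟩) ?_ ?_ ?_ ?_ ?_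
  all_goals
    rintro ⟨⟨i, m⟩, ⟨j, k⟩⟩ h
    obtain ⟨h1, h2⟩ := Finset.mem_sigma.1 h
    simp only [Finset.HasAntidiagonal.mem_antidiagonal] at h1 h2
    subst h2
    subst h1
    simp [add_left_comm]

/-- Sequences `f` with `f n ∈ F n`. -/
abbrev GradedSeq (F : ℕ → Submodule R A) : Submodule R (ℕ → A) := Submodule.pi Set.univ F

/-- Convolution of sequences with respect to the bracket. -/
def convBr (hF : IsFiltBracket F br) : GradedSeq F →ₗ[R] GradedSeq F →ₗ[R] GradedSeq F :=
  LinearMap.mk₂ R (fun f g => ⟨fun n => ∑ p ∈ Finset.HasAntidiagonal.antidiagonal n,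
      br (f.1 p.1) (g.1 p.2), fun n _ => Submodule.sum_mem _ fun p hp => by
        rw [← Finset.HasAntidiagonal.mem_antidiagonal.1 hp]
        exact hF.bracket_mem (f.2 _ trivial) (g.2 _ trivial)⟩)
    (fun f f' g => Subtype.ext (funext fun n => by simp [Finset.sum_add_distrib]))
    (fun r f g => Subtype.ext (funext fun n => by simp [Finset.smul_sum]))
    (fun f g g' => Subtype.ext (funext fun n => by simp [Finset.sum_add_distrib]))
    (fun r f g => Subtype.ext (funext fun n => by simp [Finset.smul_sum]))

theorem convBr_apply (hF : IsFiltBracket F br) (f g : GradedSeq F) (n : ℕ) :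
    (convBr hF f g).1 n = ∑ p ∈ Finset.HasAntidiagonal.antidiagonal n, br (f.1 p.1) (g.1 p.2) :=
  rfl

theorem convBr_skew (hF : IsFiltBracket F br) (hL : IsLieBr br) (f g : GradedSeq F) :
    convBr hF f g = -convBr hF g f := Subtype.ext (funext fun n => by
  change ∑ p ∈ Finset.HasAntidiagonal.antidiagonal n, br (f.1 p.1) (g.1 p.2) =
    -∑ p ∈ Finset.HasAntidiagonal.antidiagonal n, br (g.1 p.1) (f.1 p.2)
  rw [← Finset.Nat.sum_antidiagonal_swap, ← Finset.sum_neg_distrib]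
  exact Finset.sum_congr rfl fun p _ => hL.skew _ _)

theorem convBr_leibniz (hF : IsFiltBracket F br) (hL : IsLieBr br) (f g h : GradedSeq F) :
    convBr hF f (convBr hF g h) =
      convBr hF (convBr hF f g) h + convBr hF g (convBr hF f h) :=
  Subtype.ext (funext fun n => by
    rw [Submodule.coe_add, Pi.add_apply]
    simp only [convBr_apply, map_sum, LinearMap.sum_apply]
    rw [← sum_antidiagonal_assoc (fun i j k => br (br (f.1 i) (g.1 j)) (h.1 k)),
      sum_antidiagonal_left_comm (fun j i k => br (g.1 j) (br (f.1 i) (h.1 k))),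
      ← Finset.sum_add_distrib]
    refine Finset.sum_congr rfl fun p _ => ?_
    rw [← Finset.sum_add_distrib]
    exact Finset.sum_congr rfl fun q _ => hL.leibniz _ _ _)

/-- The grading derivation. -/
def degreeMap (F : ℕ → Submodule R A) : GradedSeq F →ₗ[R] GradedSeq F where
  toFun f := ⟨fun n => (n : R) • f.1 n, fun n _ => Submodule.smul_mem _ _ (f.2 n trivial)⟩
  map_add' f g := Subtype.ext (funext fun n => smul_add _ _ _)
  map_smul' r f := Subtype.ext (funext fun n => smul_comm _ _ _)

theorem degreeMap_convBr (hF : IsFiltBracket F br) (f g : GradedSeq F) :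
    degreeMap F (convBr hF f g) = convBr hF (degreeMap F f) g + convBr hF f (degreeMap F g) :=
  Subtype.ext (funext fun n => by
    change (n : R) • ∑ p ∈ Finset.HasAntidiagonal.antidiagonal n, br (f.1 p.1) (g.1 p.2) =
      (∑ p ∈ Finset.HasAntidiagonal.antidiagonal n, br ((p.1 : R) • f.1 p.1) (g.1 p.2)) +
      ∑ p ∈ Finset.HasAntidiagonal.antidiagonal n, br (f.1 p.1) ((p.2 : R) • g.1 p.2)
    rw [Finset.smul_sum, ← Finset.sum_add_distrib]
    refine Finset.sum_congr rfl fun p hp => ?_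
    rw [map_smul, map_smul, LinearMap.smul_apply, ← add_smul, ← Nat.cast_add,
      Finset.HasAntidiagonal.mem_antidiagonal.1 hp])

/-- The extension of the graded Lie algebra by the grading derivation. -/
abbrev EulerExt (F : ℕ → Submodule R A) : Type u := GradedSeq F × R

/-- The bracket of `EulerExt F`. -/
def eulerBr (hF : IsFiltBracket F br) : EulerExt F →ₗ[R] EulerExt F →ₗ[R] EulerExt F :=
  LinearMap.mk₂ R (fun a b => (convBr hF a.1 b.1 + a.2 • degreeMap F b.1 - b.2 • degreeMap F a.1, 0))
    (fun a a' b => Prod.ext (by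
      simp only [Prod.fst_add, Prod.snd_add, map_add, LinearMap.add_apply]; module) (by simp))
    (fun r a b => Prod.ext (by
      simp only [Prod.smul_fst, Prod.smul_snd, map_smul, LinearMap.smul_apply, smul_eq_mul]
      module) (by simp))
    (fun a b b' => Prod.ext (by
      simp only [Prod.fst_add, Prod.snd_add, map_add]; module) (by simp))
    (fun r a b => Prod.ext (by
      simp only [Prod.smul_fst, Prod.smul_snd, map_smul, smul_eq_mul]
      module) (by simp))

theorem eulerBr_apply (hF : IsFiltBracket F br) (a b : EulerExt F) :
    eulerBr hF a b = (convBr hF a.1 b.1 + a.2 • degreeMap F b.1 - b.2 • degreeMap F a.1, 0) := rfl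

theorem isLieBr_eulerBr (hF : IsFiltBracket F br) (hL : IsLieBr br) : IsLieBr (eulerBr hF) where
  self a := Prod.ext (by
    have h : convBr hF a.1 a.1 = 0 := Subtype.ext (funext fun n => by
      rw [convBr_apply]
      refine Finset.sum_involution (fun p _ => p.swap) ?_ ?_ ?_ ?_
      · intro p _
        rw [hL.skew]
        exact neg_add_cancel _
      · rintro ⟨i, j⟩ _ hne heq
        simp only [Prod.swap_prod_mk, Prod.mk.injEq] at heq
        obtain rfl := heq.1
        exact hne (hL.self _)
      · intro p hp
        rw [Finset.HasAntidiagonal.mem_antidiagonal] at hp ⊢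
        rw [← hp]; exact add_comm _ _
      · intro p _; rfl)
    change convBr hF a.1 a.1 + a.2 • degreeMap F a.1 - a.2 • degreeMap F a.1 = 0
    rw [h, zero_add, sub_self]) rfl
  leibniz a b c := Prod.ext (by
    simp only [eulerBr_apply, Prod.fst_add, map_add, map_sub, map_smul, LinearMap.add_apply,
      LinearMap.sub_apply, LinearMap.smul_apply, degreeMap_convBr, zero_smul, sub_zero, add_zero,
      convBr_leibniz hF hL a.1 b.1 c.1]
    rw [convBr_skew hF hL b.1 (degreeMap F a.1)]
    module) (by simp [eulerBr_apply])

/-- The filtration of `EulerExt F` by degree. -/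
def eulerFilt (F : ℕ → Submodule R A) (k : ℕ) : Submodule R (EulerExt F) where
  carrier := {a | (∀ i < k, a.1.1 i = 0) ∧ (1 ≤ k → a.2 = 0)}
  zero_mem' := ⟨fun _ _ => rfl, fun _ => rfl⟩
  add_mem' {a b} ha hb := ⟨fun i hi => by
    change a.1.1 i + b.1.1 i = 0
    rw [ha.1 i hi, hb.1 i hi, add_zero], fun h => by
    change a.2 + b.2 = 0
    rw [ha.2 h, hb.2 h, add_zero]⟩
  smul_mem' r a ha := ⟨fun i hi => by
    change r • a.1.1 i = 0
    rw [ha.1 i hi, smul_zero], fun h => by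
    change r • a.2 = 0
    rw [ha.2 h, smul_zero]⟩

theorem isCompleteFilt_eulerFilt (F : ℕ → Submodule R A) : IsCompleteFilt (eulerFilt F) where
  antitone i j hij a ha := ⟨fun k hk => ha.1 k (hk.trans_le hij), fun h => ha.2 (h.trans hij)⟩
  sep a ha := Prod.ext (Subtype.ext (funext fun n => (ha (n + 1)).1 n (Nat.lt_succ_self n)))
    ((ha 1).2 le_rfl)
  complete s hs := by
    have h1 : ∀ i n, i + 1 ≤ n → (s n).1.1 i = (s (i + 1)).1.1 i ∧ (s n).2 = (s 1).2 := by
      intro i n hn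
      induction n, hn using Nat.le_induction with
      | base =>
        refine ⟨rfl, ?_⟩
        induction i with
        | zero => rfl
        | succ i ih => rw [← ih]; exact sub_eq_zero.1 ((hs (i + 1)).2 (by omega))
      | succ n hn ih =>
        exact ⟨(sub_eq_zero.1 ((hs n).1 i (by omega))).trans ih.1,
          (sub_eq_zero.1 ((hs n).2 (by omega))).trans ih.2⟩
    refine ⟨(⟨fun i => (s (i + 1)).1.1 i, fun i _ => (s (i + 1)).1.2 i trivial⟩, (s 1).2),
      fun n => ⟨fun i hi => sub_eq_zero.2 (h1 i n hi).1.symm, fun hn => sub_eq_zero.2 ?_⟩⟩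
    exact (h1 0 n hn).2.symm

theorem isFiltBracket_eulerBr (hF : IsFiltBracket F br) :
    IsFiltBracket (eulerFilt F) (eulerBr hF) where
  toIsCompleteFilt := isCompleteFilt_eulerFilt F
  mem_zero a := ⟨fun i hi => absurd hi (Nat.not_lt_zero i), fun h => absurd h (by omega)⟩
  bracket_mem {i j a b} ha hb := by
    refine ⟨fun n hn => ?_, fun _ => rfl⟩
    change (∑ p ∈ Finset.HasAntidiagonal.antidiagonal n, br (a.1.1 p.1) (b.1.1 p.2)) +
      a.2 • ((n : R) • b.1.1 n) - b.2 • ((n : R) • a.1.1 n) = 0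
    have h1 : a.2 • ((n : R) • b.1.1 n) = 0 := by
      rcases Nat.eq_zero_or_pos i with rfl | hi
      · rw [hb.1 n (by omega), smul_zero, smul_zero]
      · rw [ha.2 hi, zero_smul]
    have h2 : b.2 • ((n : R) • a.1.1 n) = 0 := by
      rcases Nat.eq_zero_or_pos j with rfl | hj
      · rw [ha.1 n (by omega), smul_zero, smul_zero]
      · rw [hb.2 hj, zero_smul]
    rw [h1, h2, add_zero, sub_zero]
    refine Finset.sum_eq_zero fun p hp => ?_
    rw [Finset.HasAntidiagonal.mem_antidiagonal] at hp
    rcases lt_or_ge p.1 i with h | h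
    · rw [ha.1 _ h, map_zero, LinearMap.zero_apply]
    · rw [hb.1 p.2 (by omega), map_zero]

/-- The Euler element. -/
abbrev eulerElt (F : ℕ → Submodule R A) : EulerExt F := (0, 1)

theorem eulerBr_eulerElt (hF : IsFiltBracket F br) (w : EulerExt F) :
    eulerBr hF (eulerElt F) w = (degreeMap F w.1, 0) := by
  rw [eulerBr_apply]
  simp

theorem isEuler_eulerElt (hF : IsFiltBracket F br) :
    IsEuler (eulerFilt F) (eulerBr hF) (eulerElt F) := fun n w hw => by
  rw [eulerBr_eulerElt]
  refine ⟨fun i hi => ?_, fun _ => ?_⟩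
  · change (i : R) • w.1.1 i - (n : R) • w.1.1 i = 0
    rcases Nat.lt_succ_iff_lt_or_eq.1 hi with h | rfl
    · rw [hw.1 i h, smul_zero, smul_zero, sub_zero]
    · exact sub_self _
  · change (0 : R) - (n : R) • w.2 = 0
    rcases Nat.eq_zero_or_pos n with rfl | h
    · simp
    · rw [hw.2 h, smul_zero, sub_zero]

/-- The element `a` placed in degree `n`. -/
def homogeneousElt {n : ℕ} {a : A} (ha : a ∈ F n) : EulerExt F :=
  (⟨Pi.single n a, fun i _ => by
    rcases eq_or_ne i n with rfl | h
    · simpa using ha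
    · rw [Pi.single_eq_of_ne h]; exact Submodule.zero_mem _⟩, 0)

theorem homogeneousElt_mem {n : ℕ} {a : A} (ha : a ∈ F n) :
    homogeneousElt ha ∈ eulerFilt F n :=
  ⟨fun _ hi => Pi.single_eq_of_ne hi.ne _, fun _ => rfl⟩

theorem eulerBr_homogeneousElt (hF : IsFiltBracket F br) {a : A} (ha : a ∈ F 1) :
    eulerBr hF (eulerElt F) (homogeneousElt ha) = homogeneousElt ha := by
  rw [eulerBr_eulerElt]
  refine Prod.ext (Subtype.ext (funext fun i => ?_)) rfl
  change (i : R) • (Pi.single 1 a : ℕ → A) i = (Pi.single 1 a : ℕ → A) i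
  rcases eq_or_ne i 1 with rfl | h
  · simp
  · rw [Pi.single_eq_of_ne h, smul_zero]

theorem sum_gradedSeq_sub_mem (hF : IsCompleteFilt F) (f : GradedSeq F) (k : ℕ) :
    filtSum F f.1 - ∑ i ∈ Finset.range k, f.1 i ∈ F k :=
  filtSum_spec hF (fun n => f.2 n trivial) k

/-- The sum of the components of an element of `EulerExt F`. -/
def eulerEval (hF : IsCompleteFilt F) : EulerExt F →ₗ[R] A where
  toFun a := filtSum F a.1.1
  map_add' a b := filtSum_eq hF (fun n => (a + b).1.2 n trivial) fun k => by
    have := Submodule.add_mem _ (sum_gradedSeq_sub_mem hF a.1 k) (sum_gradedSeq_sub_mem hF b.1 k)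
    convert this using 1
    change _ - ∑ i ∈ Finset.range k, (a.1.1 i + b.1.1 i) = _
    rw [Finset.sum_add_distrib]
    abel
  map_smul' r a := filtSum_eq hF (fun n => (r • a).1.2 n trivial) fun k => by
    have := Submodule.smul_mem _ r (sum_gradedSeq_sub_mem hF a.1 k)
    rw [smul_sub, Finset.smul_sum] at this
    exact this

theorem eulerEval_mem (hF : IsCompleteFilt F) {n : ℕ} {a : EulerExt F} (ha : a ∈ eulerFilt F n) :
    eulerEval hF a ∈ F n := by
  have := sum_gradedSeq_sub_mem hF a.1 n
  rwa [Finset.sum_eq_zero fun i hi => ha.1 i (Finset.mem_range.1 hi), sub_zero] at this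

theorem eulerEval_homogeneousElt (hF : IsCompleteFilt F) {n : ℕ} {a : A} (ha : a ∈ F n) :
    eulerEval hF (homogeneousElt ha) = a :=
  filtSum_eq hF (fun i => (homogeneousElt ha).1.2 i trivial) fun k => by
    change a - ∑ i ∈ Finset.range k, (Pi.single n a : ℕ → A) i ∈ F k
    rcases lt_or_ge n k with h | h
    · rw [Finset.sum_eq_single_of_mem n (Finset.mem_range.2 h)
        fun i _ hi => Pi.single_eq_of_ne hi _, Pi.single_eq_same, sub_self]
      exact Submodule.zero_mem _
    · rw [Finset.sum_eq_zero fun i hi =>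
        Pi.single_eq_of_ne ((Finset.mem_range.1 hi).trans_le h).ne _, sub_zero]
      exact hF.antitone h ha

theorem eulerEval_br (hF : IsFiltBracket F br) {a b : EulerExt F} (ha : a.2 = 0) (hb : b.2 = 0) :
    eulerEval hF.toIsCompleteFilt (eulerBr hF a b) =
      br (eulerEval hF.toIsCompleteFilt a) (eulerEval hF.toIsCompleteFilt b) := by
  have e : (eulerBr hF a b).1 = convBr hF a.1 b.1 := by
    rw [eulerBr_apply, ha, hb]; simp
  refine filtSum_eq hF.toIsCompleteFilt (fun n => (eulerBr hF a b).1.2 n trivial) fun k => ?_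
  rw [e]
  have h1 := sum_gradedSeq_sub_mem hF.toIsCompleteFilt a.1 k
  have h2 := sum_gradedSeq_sub_mem hF.toIsCompleteFilt b.1 k
  have h3 := sum_antidiagonal_sub_mem (fun i j => br (a.1.1 i) (b.1.1 j)) k hF.antitone
    fun i j => hF.bracket_mem (a.1.2 i trivial) (b.1.2 j trivial)
  have h4 := hF.bracket_mem h1 (hF.mem_zero (eulerEval hF.toIsCompleteFilt b))
  have h5 := hF.bracket_mem (hF.mem_zero (∑ i ∈ Finset.range k, a.1.1 i)) h2
  rw [zero_add] at h5
  rw [add_zero] at h4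
  have := Submodule.add_mem _ (Submodule.add_mem _ h4 h5) h3
  convert this using 1
  change br (filtSum F a.1.1) (filtSum F b.1.1) - ∑ i ∈ Finset.range k, (convBr hF a.1 b.1).1 i =
    br (filtSum F a.1.1 - _) (filtSum F b.1.1) + br _ (filtSum F b.1.1 - _) + _
  simp only [convBr_apply, map_sub, LinearMap.sub_apply, map_sum, LinearMap.sum_apply]
  rw [Finset.sum_comm (s := Finset.range k) (t := Finset.range k)]
  abel

end Graded

/-! ### The group law -/

section GroupLaw

variable (K : Type u) [Field K] [CharZero K]
  {R A : Type u} [CommRing R] [AddCommGroup A] [Module R A] [Algebra K R]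
  {F : ℕ → Submodule R A} {br : A →ₗ[R] A →ₗ[R] A}
  (hF : IsFiltBracket F br) (hL : IsLieBr br)

include hF in
theorem eulerEval_bch {x y : EulerExt F} (hx : x ∈ eulerFilt F 1) (hy : y ∈ eulerFilt F 1) :
    eulerEval hF.toIsCompleteFilt (bch K (eulerFilt F) (eulerBr hF) x y) =
      bch K F br (eulerEval hF.toIsCompleteFilt x) (eulerEval hF.toIsCompleteFilt y) :=
  map_bch K (eulerEval hF.toIsCompleteFilt).toAddMonoidHom 
    (fun c a => (eulerEval hF.toIsCompleteFilt).map_smul _ a)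
    (isFiltBracket_eulerBr hF) hF (eulerEval_mem hF.toIsCompleteFilt)
    (fun a ha b hb => eulerEval_br hF (ha.2 le_rfl) (hb.2 le_rfl)) hx hy

include hF in
theorem eulerEval_expAd {x u : EulerExt F} (hx : x ∈ eulerFilt F 1) (hu : u.2 = 0) :
    eulerEval hF.toIsCompleteFilt (expAd K (eulerFilt F) (eulerBr hF) x u) =
      expAd K F br (eulerEval hF.toIsCompleteFilt x) (eulerEval hF.toIsCompleteFilt u) :=
  map_expAd K (eulerEval hF.toIsCompleteFilt).toAddMonoidHom 
    (fun c a => (eulerEval hF.toIsCompleteFilt).map_smul _ a)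
    (isFiltBracket_eulerBr hF) hF (eulerEval_mem hF.toIsCompleteFilt) hx {b | b.2 = 0}
    (fun b hb => ⟨rfl, eulerEval_br hF (hx.2 le_rfl) hb⟩) hu

include hF hL in
/-- `exp (ad (log (exp x * exp y))) = exp (ad x) ∘ exp (ad y)`. -/
theorem expAd_bch {x y : A} (hx : x ∈ F 1) (hy : y ∈ F 1) (u : A) :
    expAd K F br (bch K F br x y) u = expAd K F br x (expAd K F br y u) := by
  have hX := homogeneousElt_mem hx
  have hY := homogeneousElt_mem hy
  have hE := isFiltBracket_eulerBr hF
  have h := expAd_bch_of_homogeneous (K := K) hE (isLieBr_eulerBr hF hL) (isEuler_eulerElt hF)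
    hX hY (eulerBr_homogeneousElt hF hx) (eulerBr_homogeneousElt hF hy)
    (homogeneousElt (hF.mem_zero u))
  have hs : ∀ {α v : EulerExt F}, α ∈ eulerFilt F 1 → v.2 = 0 →
      (expAd K (eulerFilt F) (eulerBr hF) α v).2 = 0 := fun {α v} hα hv => by
    have := (expAd_sub_mem K hE hα v).2 le_rfl
    rw [Prod.snd_sub, sub_eq_zero] at this
    rw [this, hv]
  have h1 := congrArg (eulerEval hF.toIsCompleteFilt) h
  rw [eulerEval_expAd K hF (bch_mem K hE hX hY) rfl, eulerEval_bch K hF hX hY,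
    eulerEval_expAd K hF hX (hs hY rfl), eulerEval_expAd K hF hY rfl] at h1
  simpa only [eulerEval_homogeneousElt] using h1

/-- The identities between `2`-morphisms, for a filtered Lie algebra. -/
structure BchGroupLaw (F : ℕ → Submodule R A) (br : A →ₗ[R] A →ₗ[R] A) : Prop where
  assoc : ∀ {x y z}, x ∈ F 1 → y ∈ F 1 → z ∈ F 1 →
    bch K F br (bch K F br x y) z = bch K F br x (bch K F br y z)
  zero_left : ∀ {x}, x ∈ F 1 → bch K F br 0 x = x
  zero_right : ∀ {x}, x ∈ F 1 → bch K F br x 0 = x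
  neg_left : ∀ {x}, x ∈ F 1 → bch K F br (-x) x = 0
  conj : ∀ {x y}, x ∈ F 1 → y ∈ F 1 → expAd K F br x y = bch K F br (bch K F br x y) (-x)

include hF in
theorem expAd_zero (u : A) : expAd K F br 0 u = u := by
  rw [expAd_eq_add K hF (Submodule.zero_mem _) (by simp)]
  simp

include hF in
theorem expAd_expAd_neg {x : A} (hx : x ∈ F 1) (u : A) :
    expAd K F br x (expAd K F br (-x) u) = u := by
  have := expAd_neg_expAd K hF (Submodule.neg_mem _ hx) u
  rwa [neg_neg] at this

include hF hL in
theorem expAd_expAd_conj {x y : A} (hx : x ∈ F 1) (hy : y ∈ F 1) (u : A) :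
    expAd K F br (expAd K F br x y) u =
      expAd K F br x (expAd K F br y (expAd K F br (-x) u)) := by
  have := expAd_map K hF hF (expAdEnd K hF hx) (fun h => expAd_mem K hF hx h)
    (expAd_br K hF hL hx) hy (expAd K F br (-x) u)
  change expAd K F br x _ = expAd K F br (expAd K F br x y) (expAd K F br x _) at this
  rw [this, expAd_expAd_neg K hF hx]

include hF hL in
theorem bchGroupLaw_of_euler {D : A} (hD : IsEuler F br D) : BchGroupLaw K F br where
  assoc hx hy hz := by
    have hxy := bch_mem K hF hx hy
    have hyz := bch_mem K hF hy hz
    refine eq_of_expAd_euler_eq (K := K) hF hL hD (bch_mem K hF hxy hz) (bch_mem K hF hx hyz) ?_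
    rw [expAd_bch K hF hL hxy hz, expAd_bch K hF hL hx hyz, expAd_bch K hF hL hx hy,
      expAd_bch K hF hL hy hz]
  zero_left hx := by
    refine eq_of_expAd_euler_eq (K := K) hF hL hD (bch_mem K hF (Submodule.zero_mem _) hx) hx ?_
    rw [expAd_bch K hF hL (Submodule.zero_mem _) hx, expAd_zero K hF]
  zero_right hx := by
    refine eq_of_expAd_euler_eq (K := K) hF hL hD (bch_mem K hF hx (Submodule.zero_mem _)) hx ?_
    rw [expAd_bch K hF hL hx (Submodule.zero_mem _), expAd_zero K hF]
  neg_left hx := by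
    have hx' := Submodule.neg_mem _ hx
    refine eq_of_expAd_euler_eq (K := K) hF hL hD (bch_mem K hF hx' hx) (Submodule.zero_mem _) ?_
    rw [expAd_bch K hF hL hx' hx, expAd_neg_expAd K hF hx, expAd_zero K hF]
  conj hx hy := by
    have hx' := Submodule.neg_mem _ hx
    have hxy := bch_mem K hF hx hy
    refine eq_of_expAd_euler_eq (K := K) hF hL hD (expAd_mem K hF hx hy)
      (bch_mem K hF hxy hx') ?_
    rw [expAd_bch K hF hL hxy hx', expAd_bch K hF hL hx hy, expAd_expAd_conj K hF hL hx hy]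

include hF hL in
theorem bchGroupLaw : BchGroupLaw K F br := by
  have hE := isFiltBracket_eulerBr hF
  have G := bchGroupLaw_of_euler K hE (isLieBr_eulerBr hF hL) (isEuler_eulerElt hF)
  let ev := eulerEval hF.toIsCompleteFilt
  have hm : ∀ {x : A} (hx : x ∈ F 1), homogeneousElt hx ∈ eulerFilt F 1 := homogeneousElt_mem
  have he : ∀ {x : A} (hx : x ∈ F 1), ev (homogeneousElt hx) = x :=
    fun hx => eulerEval_homogeneousElt hF.toIsCompleteFilt hx
  have hb : ∀ {x y : EulerExt F} (_ : x ∈ eulerFilt F 1) (_ : y ∈ eulerFilt F 1),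
      ev (bch K (eulerFilt F) (eulerBr hF) x y) = bch K F br (ev x) (ev y) :=
    fun hx hy => eulerEval_bch K hF hx hy
  constructor
  · intro x y z hx hy hz
    have := congrArg ev (G.assoc (hm hx) (hm hy) (hm hz))
    rwa [hb (bch_mem K hE (hm hx) (hm hy)) (hm hz), hb (hm hx) (bch_mem K hE (hm hy) (hm hz)),
      hb (hm hx) (hm hy), hb (hm hy) (hm hz), he, he, he] at this
  · intro x hx
    have := congrArg ev (G.zero_left (hm hx))
    rwa [hb (Submodule.zero_mem _) (hm hx), he, map_zero] at this
  · intro x hx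
    have := congrArg ev (G.zero_right (hm hx))
    rwa [hb (hm hx) (Submodule.zero_mem _), he, map_zero] at this
  · intro x hx
    have := congrArg ev (G.neg_left (hm hx))
    rwa [hb (Submodule.neg_mem _ (hm hx)) (hm hx), map_neg, he, map_zero] at this
  · intro x y hx hy
    have := congrArg ev (G.conj (hm hx) (hm hy))
    rwa [hb (bch_mem K hE (hm hx) (hm hy)) (Submodule.neg_mem _ (hm hx)), hb (hm hx) (hm hy),
      map_neg, he, he, show ev (expAd K (eulerFilt F) (eulerBr hF) _ _) = _ from
        eulerEval_expAd K hF (hm hx) rfl, show eulerEval _ _ = _ from he hx,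
        show eulerEval _ _ = _ from he hy] at this

end GroupLaw

/-! ### The crossed groupoids of deformations -/

section CrossedGroupoid

variable {K R : Type u} [Field K] [CommRing R] [Algebra K R] [IsLocalRing R] [CharZero K]
  {κ : DefKind}

theorem isCrossedGroupoid_algDef (C : Type u) [CommRing C] [Algebra K C] :
    (algDef K R C κ).IsCrossedGroupoid where
  mul_assoc {A} a b c := Subtype.ext ((bchGroupLaw K (AlgDef.isFiltBracket A)
    (PreAlgDef.IsDeformation.kind (AlgDef.isDeformation A)).isLieBr).assoc a.2 b.2 c.2)
  one_mul {A} a := Subtype.ext ((bchGroupLaw K (AlgDef.isFiltBracket A)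
    (PreAlgDef.IsDeformation.kind (AlgDef.isDeformation A)).isLieBr).zero_left a.2)
  mul_one {A} a := Subtype.ext ((bchGroupLaw K (AlgDef.isFiltBracket A)
    (PreAlgDef.IsDeformation.kind (AlgDef.isDeformation A)).isLieBr).zero_right a.2)
  inv_mul {A} a := Subtype.ext ((bchGroupLaw K (AlgDef.isFiltBracket A)
    (PreAlgDef.IsDeformation.kind (AlgDef.isDeformation A)).isLieBr).neg_left a.2)
  twist_mul {A B} g a b := Subtype.ext <|
    map_bch K (AlgGauge.toEquiv g).toLinearMap.toAddMonoidHom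
      (fun c x => (AlgGauge.toEquiv g).toLinearMap.map_smul _ x) (AlgDef.isFiltBracket A)
      (AlgDef.isFiltBracket B) (fun h => AlgGauge.map_adicFilt g h)
      (fun x _ y _ => AlgGauge.map_br g x y) a.2 b.2
  twist_id _ := rfl
  twist_comp _ _ _ := rfl
  feedback_one A := AlgGauge.ext (AlgEquiv.ext fun x => expAd_zero K (AlgDef.isFiltBracket A) x)
  feedback_mul {A} a b := AlgGauge.ext (AlgEquiv.ext fun x =>
    expAd_bch K (AlgDef.isFiltBracket A)
      (PreAlgDef.IsDeformation.kind (AlgDef.isDeformation A)).isLieBr a.2 b.2 x)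
  feedback_twist {A B} g a := AlgGauge.ext (AlgEquiv.ext fun x => by
    have h := expAd_map K (AlgDef.isFiltBracket A) (AlgDef.isFiltBracket B)
      (AlgGauge.toEquiv g).toLinearMap (fun h => AlgGauge.map_adicFilt g h)
      (AlgGauge.map_br g) a.2 ((AlgGauge.toEquiv g).symm x)
    refine Eq.trans ?_ h.symm
    exact congrArg _ ((AlgGauge.toEquiv g).apply_symm_apply x).symm)
  twist_feedback {A} a b := Subtype.ext ((bchGroupLaw K (AlgDef.isFiltBracket A)
    (PreAlgDef.IsDeformation.kind (AlgDef.isDeformation A)).isLieBr).conj a.2 b.2)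

variable {X : TopCat.{u}} {O : TopCat.Presheaf (CommAlgCat.{u} K) X}

theorem SheafDef.isLieBr (𝒜 : SheafDef K R O κ) (V : Opens X) : IsLieBr (𝒜.br V) :=
  (𝒜.isDeformation.kind V).isLieBr

theorem SheafDef.ig_app (𝒜 : SheafDef K R O κ) (α : sheafFilt 𝒜.alg ⊤ 1) (V : Opens X)
    (s : Sec 𝒜.alg V) :
    (SheafGauge.toEquiv (𝒜.ig α)).hom.app V s =
      expAd K (sheafFilt 𝒜.alg V) (𝒜.br V) (res 𝒜.alg (le_top : V ≤ ⊤) α.1) s := rfl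

theorem SheafDef.res_bch (𝒜 : SheafDef K R O κ) {V W : Opens X} (h : W ≤ V) {a b : Sec 𝒜.alg V}
    (ha : a ∈ sheafFilt 𝒜.alg V 1) (hb : b ∈ sheafFilt 𝒜.alg V 1) :
    res 𝒜.alg h (bch K (sheafFilt 𝒜.alg V) (𝒜.br V) a b) =
      bch K (sheafFilt 𝒜.alg W) (𝒜.br W) (res 𝒜.alg h a) (res 𝒜.alg h b) :=
  map_bch K (res 𝒜.alg h).toLinearMap.toAddMonoidHom
    (fun c x => (res 𝒜.alg h).toLinearMap.map_smul _ x) (𝒜.isFiltBracket V) (𝒜.isFiltBracket W)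
    (res_sheafFilt 𝒜.alg h) (fun x _ y _ => 𝒜.br_res h x y) ha hb

theorem SheafGauge.hom_ext {𝒜 ℬ : PreSheafDef K R O} {g h : SheafGauge 𝒜 ℬ}
    (H : ∀ V s, g.toEquiv.hom.app V s = h.toEquiv.hom.app V s) : g = h :=
  SheafGauge.ext (SheafEquiv.ext (SheafHom.ext (funext fun V => AlgHom.ext (H V))))

theorem isCrossedGroupoid_sheafDef : (sheafDef K R O κ).IsCrossedGroupoid where
  mul_assoc {𝒜} a b c := Subtype.ext ((bchGroupLaw K (SheafDef.isFiltBracket 𝒜 ⊤)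
    (SheafDef.isLieBr 𝒜 ⊤)).assoc a.2 b.2 c.2)
  one_mul {𝒜} a := Subtype.ext ((bchGroupLaw K (SheafDef.isFiltBracket 𝒜 ⊤)
    (SheafDef.isLieBr 𝒜 ⊤)).zero_left a.2)
  mul_one {𝒜} a := Subtype.ext ((bchGroupLaw K (SheafDef.isFiltBracket 𝒜 ⊤)
    (SheafDef.isLieBr 𝒜 ⊤)).zero_right a.2)
  inv_mul {𝒜} a := Subtype.ext ((bchGroupLaw K (SheafDef.isFiltBracket 𝒜 ⊤)
    (SheafDef.isLieBr 𝒜 ⊤)).neg_left a.2)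
  twist_mul {𝒜 ℬ} g a b := Subtype.ext <|
    map_bch K ((SheafGauge.toEquiv g).hom.app ⊤).toLinearMap.toAddMonoidHom
      (fun c x => ((SheafGauge.toEquiv g).hom.app ⊤).toLinearMap.map_smul _ x)
      (SheafDef.isFiltBracket 𝒜 ⊤) (SheafDef.isFiltBracket ℬ ⊤)
      (fun h => SheafHom.map_sheafFilt _ h)
      (fun x _ y _ => SheafGauge.map_br g ⊤ x y) a.2 b.2
  twist_id _ := rfl
  twist_comp _ _ _ := rfl
  feedback_one 𝒜 := SheafGauge.hom_ext fun V s => by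
    refine (SheafDef.ig_app 𝒜 0 V s).trans ?_
    refine (congrArg (fun α => expAd K (sheafFilt _ V) (PreSheafDef.br _ V) α s)
      (map_zero (res _ (le_top : V ≤ ⊤)))).trans ?_
    exact expAd_zero K (SheafDef.isFiltBracket 𝒜 V) s
  feedback_mul {𝒜} a b := SheafGauge.hom_ext fun V s => by
    refine (SheafDef.ig_app 𝒜 ((sheafDef K R O κ).mul a b) V s).trans ?_
    refine (congrArg (fun α => expAd K (sheafFilt _ V) (PreSheafDef.br _ V) α s)
      (SheafDef.res_bch 𝒜 (le_top : V ≤ ⊤) a.2 b.2)).trans ?_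
    exact expAd_bch K (SheafDef.isFiltBracket 𝒜 V) (SheafDef.isLieBr 𝒜 V)
      (res_sheafFilt _ _ a.2) (res_sheafFilt _ _ b.2) s
  feedback_twist {𝒜 ℬ} g a := SheafGauge.hom_ext fun V s => by
    have h := expAd_map K (SheafDef.isFiltBracket 𝒜 V) (SheafDef.isFiltBracket ℬ V)
      ((SheafGauge.toEquiv g).hom.app V).toLinearMap (fun h => SheafHom.map_sheafFilt _ h)
      (SheafGauge.map_br g V) (res_sheafFilt _ (le_top : V ≤ ⊤) a.2)
      ((SheafGauge.toEquiv g).inv.app V s)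
    refine Eq.trans ?_ h.symm
    refine (SheafDef.ig_app ℬ ((sheafDef K R O κ).twist g a) V s).trans ?_
    exact congrArg₂ (expAd K (sheafFilt _ V) (PreSheafDef.br _ V))
      ((SheafGauge.toEquiv g).hom.app_res _ _).symm
      ((SheafGauge.toEquiv g).hom_app_inv_app V s).symm
  twist_feedback {𝒜} a b := Subtype.ext <| by
    have h := (bchGroupLaw K (SheafDef.isFiltBracket 𝒜 ⊤) (SheafDef.isLieBr 𝒜 ⊤)).conj a.2 b.2
    refine Eq.trans ?_ h
    exact congrArg (fun α => expAd K (sheafFilt _ ⊤) (PreSheafDef.br _ ⊤) α b.1)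
      (res_self _ _ _)

end CrossedGroupoid

/-! ### A criterion for flatness and completeness -/

section FlatFilt

variable {R : Type u} [CommRing R] [IsLocalRing R]

theorem exists_residue_family (R N : Type u) [CommRing R] [IsLocalRing R] [AddCommGroup N]
    [Module R N] : ∃ (ι : Type u) (e : ι → N),
    Submodule.span R (Set.range e) ⊔ 𝔪 R • (⊤ : Submodule R N) = ⊤ ∧
    (∀ (s : Finset ι) (c : ι → R), ∑ i ∈ s, c i • e i ∈ 𝔪 R • (⊤ : Submodule R N) →
      ∀ i ∈ s, c i ∈ 𝔪 R) ∧ (Module.Finite R N → Finite ι) := by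
  let : Field (R ⧸ 𝔪 R) := Ideal.Quotient.field _
  let b := Module.Basis.ofVectorSpace (R ⧸ 𝔪 R) (N ⧸ (𝔪 R • (⊤ : Submodule R N)))
  let π := (𝔪 R • (⊤ : Submodule R N)).mkQ
  have hπ : Function.Surjective π := Submodule.mkQ_surjective _
  have hsm : ∀ (r : R) (x : N), π (r • x) = Ideal.Quotient.mk (𝔪 R) r • π x := fun r x =>
    (Module.Quotient.mk_smul_mk N (𝔪 R) r x).symm
  choose g hg using hπ
  refine ⟨_, fun i => g (b i), ?_, ?_, ?_⟩
  · rw [eq_top_iff]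
    intro x _
    have h1 : ∀ y ∈ Submodule.span (R ⧸ 𝔪 R) (Set.range b),
        ∃ x ∈ Submodule.span R (Set.range fun i => g (b i)), π x = y := by
      intro y hy
      induction hy using Submodule.span_induction with
      | mem y hy =>
        obtain ⟨i, rfl⟩ := hy
        exact ⟨g (b i), Submodule.subset_span ⟨i, rfl⟩, hg _⟩
      | zero => exact ⟨0, Submodule.zero_mem _, map_zero _⟩
      | add y y' _ _ hy hy' =>
        obtain ⟨x, hx, rfl⟩ := hy
        obtain ⟨x', hx', rfl⟩ := hy'
        exact ⟨x + x', Submodule.add_mem _ hx hx', map_add _ _ _⟩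
      | smul c y _ hy =>
        obtain ⟨x, hx, rfl⟩ := hy
        obtain ⟨r, rfl⟩ := Ideal.Quotient.mk_surjective c
        exact ⟨r • x, Submodule.smul_mem _ _ hx, hsm r x⟩
    obtain ⟨z, hz, e⟩ := h1 (π x) (by rw [b.span_eq]; trivial)
    have : x - z ∈ 𝔪 R • (⊤ : Submodule R N) := by
      rw [← Submodule.ker_mkQ (𝔪 R • (⊤ : Submodule R N)), LinearMap.mem_ker, map_sub]
      exact sub_eq_zero.2 e.symm
    rw [← add_sub_cancel z x]
    exact Submodule.add_mem_sup hz this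
  · intro s c h i hi
    have h1 : π (∑ i ∈ s, c i • g (b i)) = 0 := by
      rwa [← LinearMap.mem_ker, Submodule.ker_mkQ]
    rw [map_sum] at h1
    simp only [hsm, hg] at h1
    exact Ideal.Quotient.eq_zero_iff_mem.1
      (linearIndependent_iff'.1 b.linearIndependent s (fun i => Ideal.Quotient.mk (𝔪 R) (c i))
        h1 i hi)
  · intro h
    have : Module.Finite R (N ⧸ (𝔪 R • (⊤ : Submodule R N))) := inferInstance
    have : IsScalarTower R (R ⧸ 𝔪 R) (N ⧸ (𝔪 R • (⊤ : Submodule R N))) :=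
      ⟨fun r c y => by
        obtain ⟨t, rfl⟩ := Ideal.Quotient.mk_surjective c
        obtain ⟨x, rfl⟩ := Submodule.mkQ_surjective _ y
        change (Ideal.Quotient.mk (𝔪 R) (r * t)) • π x = r • (Ideal.Quotient.mk (𝔪 R) t • π x)
        rw [← hsm, ← hsm, mul_smul, map_smul]⟩
    have : Module.Finite (R ⧸ 𝔪 R) (N ⧸ (𝔪 R • (⊤ : Submodule R N))) :=
      Module.Finite.of_restrictScalars_finite R _ _
    exact Module.Finite.finite_basis b

/-- `r` represents a basis of `𝔪 ^ n / 𝔪 ^ (n + 1)`. -/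
structure IsMinGen {ι : Type u} [Fintype ι] (n : ℕ) (r : ι → R) : Prop where
  mem : ∀ j, r j ∈ 𝔪 R ^ n
  exists_sub_mem : ∀ t ∈ 𝔪 R ^ n, ∃ c : ι → R, t - ∑ j, c j * r j ∈ 𝔪 R ^ (n + 1)
  indep : ∀ c : ι → R, ∑ j, c j * r j ∈ 𝔪 R ^ (n + 1) → ∀ j, c j ∈ 𝔪 R

theorem coe_mem_of_mem_smul_top {n : ℕ} {x : ↥(𝔪 R ^ n)} :
    x ∈ 𝔪 R • (⊤ : Submodule R ↥(𝔪 R ^ n)) ↔ (x : R) ∈ 𝔪 R ^ (n + 1) := by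
  have h : (𝔪 R • (⊤ : Submodule R ↥(𝔪 R ^ n))).map (𝔪 R ^ n).subtype = 𝔪 R ^ (n + 1) := by
    rw [Submodule.map_smul'', Submodule.map_top, Submodule.range_subtype, pow_succ, mul_comm,
      smul_eq_mul]
  rw [← h]
  constructor
  · intro hx
    exact ⟨x, hx, rfl⟩
  · rintro ⟨y, hy, e⟩
    obtain rfl := Subtype.ext e
    exact hy

theorem exists_isMinGen [IsNoetherianRing R] (n : ℕ) :
    ∃ (ι : Type u) (_ : Fintype ι) (r : ι → R), IsMinGen n r := by
  obtain ⟨ι, e, h1, h2, h3⟩ := exists_residue_family R ↥(𝔪 R ^ n)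
  have := h3 inferInstance
  let := Fintype.ofFinite ι
  refine ⟨ι, inferInstance, fun i => e i, fun j => (e j).2, fun t ht => ?_, fun c hc j => ?_⟩
  · have ht' : (⟨t, ht⟩ : ↥(𝔪 R ^ n)) ∈
        Submodule.span R (Set.range e) ⊔ 𝔪 R • (⊤ : Submodule R ↥(𝔪 R ^ n)) := by
      rw [h1]; trivial
    obtain ⟨y, hy, z, hz, hyz⟩ := Submodule.mem_sup.1 ht'
    obtain ⟨c, rfl⟩ := (Submodule.mem_span_range_iff_exists_fun R).1 hy
    refine ⟨c, ?_⟩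
    have := congrArg Subtype.val hyz
    simp only [Submodule.coe_add, Submodule.coe_sum, Submodule.coe_smul, smul_eq_mul] at this
    rw [← this, add_sub_cancel_left]
    exact coe_mem_of_mem_smul_top.1 hz
  · refine h2 Finset.univ c ?_ j (Finset.mem_univ j)
    rw [coe_mem_of_mem_smul_top]
    simpa using hc

section Approx

variable {H M : Type u} [AddCommGroup H] [Module R H] [AddCommGroup M] [Module R M]

/-- Successive approximation. -/
theorem exists_eq_of_approx {E : ℕ → Submodule R H} {G : ℕ → Submodule R M}
    (hE : Antitone E) (hs : ∀ x, (∀ n, x ∈ E n) → x = 0) (hG : IsCompleteFilt G)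
    (T : M →ₗ[R] H) (hT : ∀ {n y}, y ∈ G n → T y ∈ E n) (c : ℕ)
    (step : ∀ n, ∀ x ∈ E n, ∃ y ∈ G (n - c), x - T y ∈ E (n + 1)) {x : H} (hx : x ∈ E 0) :
    ∃ y, T y = x := by
  choose! f hf hf' using step
  let s : ℕ → M := fun n => Nat.rec 0 (fun n z => z + f n (x - T z)) n
  have hs' : ∀ n, s (n + 1) = s n + f n (x - T (s n)) := fun _ => rfl
  have h1 : ∀ n, x - T (s n) ∈ E n := by
    intro n
    induction n with
    | zero => simpa [s] using hx
    | succ n ih =>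
      rw [hs', map_add, ← sub_sub]
      exact hf' n _ ih
  obtain ⟨z, hz⟩ := hG.complete (fun n => s (n + c)) fun n => by
    have := hf (n + c) _ (h1 (n + c))
    rw [Nat.add_sub_cancel] at this
    rw [show n + 1 + c = n + c + 1 by ring, hs', add_sub_cancel_left]
    exact this
  refine ⟨z, sub_eq_zero.1 (hs _ fun n => ?_)⟩
  have h2 := hT (hz n)
  have h3 := hE (Nat.le_add_right n c) (h1 (n + c))
  have := Submodule.sub_mem _ h2 h3
  rwa [map_sub, sub_sub_sub_cancel_right] at this

end Approx

variable {M : Type u} [AddCommGroup M] [Module R M]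

/-- Filtrations which turn out to be the adic filtration of a flat module. -/
structure FlatFilt (F : ℕ → Submodule R M) : Prop extends IsCompleteFilt F where
  mem_zero : ∀ a, a ∈ F 0
  smul_mem : ∀ {i n r a}, r ∈ 𝔪 R ^ i → a ∈ F n → r • a ∈ F (n + i)
  le_sup : ∀ n, F n ≤ (𝔪 R) ^ n • ⊤ ⊔ F (n + 1)
  indep : ∀ (n : ℕ) {ι : Type u} [Fintype ι] (r : ι → R), IsMinGen n r →
    ∀ a : ι → M, ∑ j, r j • a j ∈ F (n + 1) → ∀ j, a j ∈ F 1

theorem exists_sum_of_mem_span_smul {ι : Type u} [Fintype ι] (s : ι → R) (N : Submodule R M)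
    {x : M} (hx : x ∈ Ideal.span (Set.range s) • N) :
    ∃ y : ι → M, (∀ j, y j ∈ N) ∧ x = ∑ j, s j • y j := by
  refine Submodule.smul_induction_on hx (fun r hr a ha => ?_) fun x y hx hy => ?_
  · obtain ⟨c, rfl⟩ := (Submodule.mem_span_range_iff_exists_fun R).1 hr
    refine ⟨fun j => c j • a, fun j => Submodule.smul_mem _ _ ha, ?_⟩
    simp only [smul_eq_mul]
    rw [Finset.sum_smul]
    exact Finset.sum_congr rfl fun j _ => by rw [smul_smul, mul_comm]
  · obtain ⟨y', hy', rfl⟩ := hx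
    obtain ⟨z, hz, rfl⟩ := hy
    exact ⟨y' + z, fun j => Submodule.add_mem _ (hy' j) (hz j), by
      simp [Finset.sum_add_distrib]⟩

theorem isCompleteFilt_pi {F : ℕ → Submodule R M} (hF : IsCompleteFilt F) (ι : Type u) :
    IsCompleteFilt fun n => Submodule.pi (Set.univ : Set ι) fun _ => F n where
  antitone i j hij a ha k hk := hF.antitone hij (ha k hk)
  sep a ha := funext fun k => hF.sep _ fun n => ha n k trivial
  complete s hs := by
    choose z hz using fun k => hF.complete (fun n => s n k) fun n => hs n k trivial
    exact ⟨z, fun n k _ => hz k n⟩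

namespace FlatFilt

variable {F : ℕ → Submodule R M} (hF : FlatFilt F)
include hF

theorem adicFilt_le (n : ℕ) : adicFilt R M n ≤ F n := by
  refine Submodule.smul_le.2 fun r hr a _ => ?_
  have := hF.smul_mem hr (hF.mem_zero a)
  rwa [zero_add] at this

theorem eq_adicFilt [IsNoetherianRing R] (n : ℕ) : F n = adicFilt R M n := by
  refine le_antisymm (fun x hx => ?_) (hF.adicFilt_le n)
  obtain ⟨d, s, hs⟩ := Submodule.fg_iff_exists_fin_generating_family.1
    (IsNoetherian.noetherian (𝔪 R ^ n))
  let s' : ULift.{u} (Fin d) → R := fun j => s j.down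
  have hs' : Ideal.span (Set.range s') = 𝔪 R ^ n := by
    rw [← hs]
    change Submodule.span R _ = _
    congr 1
    ext r
    exact ⟨fun ⟨j, h⟩ => ⟨j.down, h⟩, fun ⟨j, h⟩ => ⟨⟨j⟩, h⟩⟩
  have hmem : ∀ j, s' j ∈ 𝔪 R ^ n := fun j => hs' ▸ Submodule.subset_span ⟨j, rfl⟩
  let T : (ULift.{u} (Fin d) → M) →ₗ[R] M := ∑ j, s' j • LinearMap.proj j
  have hT : ∀ y, T y = ∑ j, s' j • y j := fun y => by simp [T]
  obtain ⟨y, hy⟩ := exists_eq_of_approx (E := fun i => F (n + i))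
    (fun i j hij => hF.antitone (by omega))
    (fun x hx => hF.sep _ fun i => hF.antitone (Nat.le_add_left i n) (hx i))
    (isCompleteFilt_pi hF.toIsCompleteFilt (ULift.{u} (Fin d))) T
    (fun {i y} hy => by
      rw [hT]
      refine Submodule.sum_mem _ fun j _ => ?_
      rw [add_comm]
      exact hF.smul_mem (hmem j) (hy j trivial)) 0
    (fun i x hx => by
      obtain ⟨a, ha, b, hb, rfl⟩ := Submodule.mem_sup.1 (hF.le_sup (n + i) hx)
      rw [pow_add, ← hs', mul_smul] at ha
      obtain ⟨y, hy, rfl⟩ := exists_sum_of_mem_span_smul s' _ ha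
      refine ⟨y, fun j _ => hF.adicFilt_le i (hy j), ?_⟩
      rw [hT, add_sub_cancel_left]
      exact hb) (x := x) hx
  rw [← hy, hT]
  exact Submodule.sum_mem _ fun j _ => Submodule.smul_mem_smul (hmem j) trivial

theorem isAdicComplete [IsNoetherianRing R] : IsAdicComplete (𝔪 R) M where
  haus' x hx := hF.sep x fun n => by
    rw [hF.eq_adicFilt]
    exact SModEq.zero.1 (hx n)
  prec' f hf := by
    obtain ⟨z, hz⟩ := hF.complete f fun n => by
      rw [hF.eq_adicFilt, ← neg_sub]
      exact Submodule.neg_mem _ (SModEq.sub_mem.1 (hf n.le_succ))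
    refine ⟨z, fun n => ?_⟩
    have := hz n
    rw [hF.eq_adicFilt] at this
    exact (SModEq.sub_mem.2 this).symm

theorem mem_pow_of_sum_mem [IsNoetherianRing R] {ι : Type u} {e : ι → M}
    (he : ∀ (s : Finset ι) (c : ι → R), ∑ i ∈ s, c i • e i ∈ F 1 → ∀ i ∈ s, c i ∈ 𝔪 R)
    (n : ℕ) (s : Finset ι) (ρ : ι → R) (h : ∑ i ∈ s, ρ i • e i ∈ F n) :
    ∀ i ∈ s, ρ i ∈ 𝔪 R ^ n := by
  induction n with
  | zero => intro i _; simp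
  | succ n ih =>
    have h1 := ih (hF.antitone n.le_succ h)
    obtain ⟨κ, _, r, hr⟩ := exists_isMinGen (R := R) n
    choose! c hc using hr.exists_sub_mem
    have h2 : ∑ j, r j • ∑ i ∈ s, c (ρ i) j • e i ∈ F (n + 1) := by
      have h3 : ∑ i ∈ s, (ρ i - ∑ j, c (ρ i) j * r j) • e i ∈ F (n + 1) :=
        Submodule.sum_mem _ fun i hi => by
          have := hF.smul_mem (hc _ (h1 i hi)) (hF.mem_zero (e i))
          rwa [zero_add] at this
      have h4 := Submodule.sub_mem _ h h3
      convert h4 using 1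
      simp only [sub_smul, Finset.sum_sub_distrib, sub_sub_cancel, Finset.smul_sum,
        Finset.sum_smul]
      rw [Finset.sum_comm]
      exact Finset.sum_congr rfl fun i _ => Finset.sum_congr rfl fun j _ => by
        rw [smul_smul, mul_comm]
    intro i hi
    have h5 : ∀ j, c (ρ i) j ∈ 𝔪 R := fun j =>
      he s (fun i => c (ρ i) j) (hF.indep n r hr _ h2 j) i hi
    have h6 := hc _ (h1 i hi)
    have h7 : ∑ j, c (ρ i) j * r j ∈ 𝔪 R ^ (n + 1) := Ideal.sum_mem _ fun j _ => by
      rw [pow_succ']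
      exact Ideal.mul_mem_mul (h5 j) (hr.mem j)
    simpa using Ideal.add_mem _ h6 h7

theorem le_smul_span_sup [IsNoetherianRing R] {N : Submodule R M} (hN : N ⊔ F 1 = ⊤)
    (n k : ℕ) : F n ≤ 𝔪 R ^ n • N ⊔ F (n + k) := by
  induction k with
  | zero => exact le_sup_right
  | succ k ih =>
    refine ih.trans (sup_le le_sup_left ?_)
    have h1 : F (n + k) ≤ 𝔪 R ^ (n + k) • N ⊔ F (n + k + 1) := by
      refine (hF.le_sup (n + k)).trans (sup_le ?_ le_sup_right)
      rw [← hN, Submodule.smul_sup]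
      refine sup_le_sup_left (Submodule.smul_le.2 fun r hr a ha => ?_) _
      have := hF.smul_mem hr ha
      rwa [add_comm] at this
    refine h1.trans (sup_le_sup_right ?_ _)
    exact Submodule.smul_mono_left (Ideal.pow_le_pow_right (Nat.le_add_right n k))

theorem exists_approx_relation [IsNoetherianRing R] {d : ℕ} (a : Fin d → R) :
    ∃ c : ℕ, ∀ n, ∀ x : Fin d → M, (∀ l, x l ∈ F n) → ∑ l, a l • x l = 0 →
      ∃ (ι : Type u) (s : Finset ι) (ν : ι → Fin d → R) (e : ι → M),
        (∀ i ∈ s, ν i ∈ 𝔪 R ^ (n - c) • LinearMap.ker (Fintype.linearCombination R a)) ∧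
        ∀ l, x l - ∑ i ∈ s, ν i l • e i ∈ F (n + 1) := by
  set φ : (Fin d → R) →ₗ[R] R := Fintype.linearCombination R a with hφ
  have hφa : ∀ t, φ t = ∑ l, a l * t l := fun t => by
    simp [hφ, Fintype.linearCombination_apply, mul_comm]
  obtain ⟨c, hc⟩ := Ideal.exists_pow_inf_eq_pow_smul (𝔪 R) (LinearMap.ker φ)
  obtain ⟨c', hc'⟩ := Ideal.exists_pow_inf_eq_pow_smul (𝔪 R) (LinearMap.range φ)
  have hpow : ∀ k (t : Fin d → R), t ∈ 𝔪 R ^ k • (⊤ : Submodule R (Fin d → R)) ↔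
      ∀ l, t l ∈ 𝔪 R ^ k := by
    intro k t
    constructor
    · intro ht l
      refine Submodule.smul_induction_on ht (fun r hr a _ => ?_) fun a b ha hb => ?_
      · exact Ideal.mul_mem_right _ _ hr
      · exact Ideal.add_mem _ ha hb
    · intro ht
      have e : t = ∑ l, t l • (Pi.single l (1 : R) : Fin d → R) := by
        funext j
        simp [Pi.single_apply]
      rw [e]
      exact Submodule.sum_mem _ fun l _ => Submodule.smul_mem_smul (ht l) trivial
  refine ⟨c, fun n x hx hax => ?_⟩
  obtain ⟨ι, e, h1, h2, -⟩ := exists_residue_family R M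
  have hF1 : F 1 = 𝔪 R • (⊤ : Submodule R M) := by
    rw [hF.eq_adicFilt, adicFilt, pow_one]
  rw [← hF1] at h1
  have he : ∀ (s : Finset ι) (c : ι → R), ∑ i ∈ s, c i • e i ∈ F 1 → ∀ i ∈ s, c i ∈ 𝔪 R := by
    rw [hF1]; exact h2
  set n' := n + 1 + c' with hn'
  have h3 : ∀ l, ∃ ρ : ι →₀ R, (∀ i, ρ i ∈ 𝔪 R ^ n) ∧
      x l - (ρ.sum fun i r => r • e i) ∈ F n' := by
    intro l
    obtain ⟨y, hy, z, hz, e'⟩ := Submodule.mem_sup.1 (hF.le_smul_span_sup h1 n (1 + c') (hx l))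
    obtain ⟨ρ, hρ, rfl⟩ := (Submodule.mem_ideal_smul_span_iff_exists_sum _ _ _).1 hy
    refine ⟨ρ, hρ, ?_⟩
    rw [← e', add_sub_cancel_left, hn', add_assoc]
    exact hz
  choose ρ hρ hρ' using h3
  classical
  let s : Finset ι := Finset.univ.biUnion fun l => (ρ l).support
  have hsum : ∀ l, ((ρ l).sum fun i r => r • e i) = ∑ i ∈ s, ρ l i • e i := fun l =>
    Finset.sum_subset (Finset.subset_biUnion_of_mem (fun l => (ρ l).support) (Finset.mem_univ l))
      fun i _ hi => by simp [Finsupp.notMem_support_iff.1 hi]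
  simp only [hsum] at hρ'
  have h4 : ∀ i ∈ s, φ (fun l => ρ l i) ∈ 𝔪 R ^ n' := by
    refine hF.mem_pow_of_sum_mem he n' s _ ?_
    have h5 : ∑ l, a l • (x l - ∑ i ∈ s, ρ l i • e i) ∈ F n' :=
      Submodule.sum_mem _ fun l _ => Submodule.smul_mem _ _ (hρ' l)
    simp only [smul_sub, Finset.sum_sub_distrib, hax, zero_sub] at h5
    have e' : ∑ i ∈ s, φ (fun l => ρ l i) • e i = ∑ l, a l • ∑ i ∈ s, ρ l i • e i := by
      simp only [hφa, Finset.sum_smul, Finset.smul_sum, smul_smul]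
      rw [Finset.sum_comm]
    rw [e']
    exact (Submodule.neg_mem_iff _).1 h5
  have h6 : ∀ i ∈ s, ∃ μ : Fin d → R, (∀ l, μ l ∈ 𝔪 R ^ (n + 1)) ∧ φ μ = φ (fun l => ρ l i) := by
    intro i hi
    have h7 : φ (fun l => ρ l i) ∈ 𝔪 R ^ n' • (⊤ : Submodule R R) ⊓ LinearMap.range φ :=
      ⟨by simpa using h4 i hi, ⟨_, rfl⟩⟩
    rw [hc' n' (by omega), hn', Nat.add_sub_cancel] at h7
    have h8 : φ (fun l => ρ l i) ∈ 𝔪 R ^ (n + 1) • LinearMap.range φ :=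
      Submodule.smul_mono le_rfl inf_le_right h7
    rw [LinearMap.range_eq_map, ← Submodule.map_smul''] at h8
    obtain ⟨μ, hμ, e'⟩ := h8
    exact ⟨μ, (hpow _ _).1 hμ, e'⟩
  choose! μ hμ hμ' using h6
  refine ⟨ι, s, fun i l => ρ l i - μ i l, e, fun i hi => ?_, fun l => ?_⟩
  · have h9 : (fun l => ρ l i - μ i l) ∈ LinearMap.ker φ := by
      rw [LinearMap.mem_ker]
      change φ ((fun l => ρ l i) - μ i) = 0
      rw [map_sub, hμ' i hi, sub_self]
    have h10 : (fun l => ρ l i - μ i l) ∈ 𝔪 R ^ n • (⊤ : Submodule R (Fin d → R)) := by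
      rw [hpow]
      exact fun l => Ideal.sub_mem _ (hρ l i)
        (Ideal.pow_le_pow_right n.le_succ (hμ i hi l))
    rcases le_total c n with h | h
    · exact Submodule.smul_mono le_rfl inf_le_right ((hc n h).le ⟨h10, h9⟩)
    · rw [Nat.sub_eq_zero_of_le h, pow_zero, Ideal.one_eq_top, Submodule.top_smul]
      exact h9
  · have h11 : ∑ i ∈ s, μ i l • e i ∈ F (n + 1) := Submodule.sum_mem _ fun i hi => by
      have := hF.smul_mem (hμ i hi l) (hF.mem_zero (e i))
      rwa [zero_add] at this
    have h12 := hF.antitone (show n + 1 ≤ n' by omega) (hρ' l)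
    convert Submodule.add_mem _ h12 h11 using 1
    simp only [sub_smul, Finset.sum_sub_distrib]
    abel

theorem flat [IsNoetherianRing R] : Module.Flat R M := by
  refine Module.Flat.of_forall_isTrivialRelation fun {d a x} hax => ?_
  obtain ⟨c, hc⟩ := hF.exists_approx_relation a
  set φ : (Fin d → R) →ₗ[R] R := Fintype.linearCombination R a with hφ
  obtain ⟨p, z, hz⟩ := Submodule.fg_iff_exists_fin_generating_family.1
    (IsNoetherian.noetherian (LinearMap.ker φ))
  have hzk : ∀ k, ∑ l, a l * z k l = 0 := fun k => by
    have : z k ∈ LinearMap.ker φ := hz ▸ Submodule.subset_span ⟨k, rfl⟩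
    simpa [hφ, Fintype.linearCombination_apply, mul_comm] using this
  let H : Submodule R (ULift.{u} (Fin d) → M) :=
    LinearMap.ker (∑ l : ULift.{u} (Fin d), a l.down • LinearMap.proj (R := R)
      (φ := fun _ : ULift.{u} (Fin d) => M) l)
  have hH : ∀ y, y ∈ H ↔ ∑ l, a l • y ⟨l⟩ = 0 := fun y => by
    simp only [H, LinearMap.mem_ker, LinearMap.sum_apply, LinearMap.smul_apply,
      LinearMap.proj_apply]
    rw [← Equiv.sum_comp Equiv.ulift.symm]
    rfl
  let T₀ : (ULift.{u} (Fin p) → M) →ₗ[R] (ULift.{u} (Fin d) → M) :=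
    LinearMap.pi fun l => ∑ k, z k.down l.down • LinearMap.proj k
  have hT₀ : ∀ y l, T₀ y l = ∑ k, z k l.down • y ⟨k⟩ := fun y l => by
    simp only [T₀, LinearMap.pi_apply, LinearMap.sum_apply, LinearMap.smul_apply,
      LinearMap.proj_apply]
    rw [← Equiv.sum_comp Equiv.ulift.symm]
    rfl
  let T : (ULift.{u} (Fin p) → M) →ₗ[R] H := T₀.codRestrict H fun y => by
    rw [hH]
    simp only [hT₀, Finset.smul_sum, smul_smul]
    rw [Finset.sum_comm]
    refine Finset.sum_eq_zero fun k _ => ?_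
    rw [← Finset.sum_smul, hzk, zero_smul]
  obtain ⟨y, hy⟩ := exists_eq_of_approx
    (E := fun n => (Submodule.pi (Set.univ : Set (ULift.{u} (Fin d))) fun _ => F n).comap H.subtype)
    (G := fun n => Submodule.pi (Set.univ : Set (ULift.{u} (Fin p))) fun _ => F n)
    (fun i j hij y hy l hl => hF.antitone hij (hy l hl))
    (fun y hy => Subtype.ext (funext fun l => hF.sep _ fun n => hy n l trivial))
    (isCompleteFilt_pi hF.toIsCompleteFilt _) T
    (fun {n y} hy l _ => by
      change T₀ y l ∈ F n
      rw [hT₀]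
      exact Submodule.sum_mem _ fun k _ => Submodule.smul_mem _ _ (hy _ trivial)) c
    (fun n y hy => by
      obtain ⟨ι, s, ν, e, h1, h2⟩ := hc n (fun l => y.1 ⟨l⟩) (fun l => hy _ trivial)
        ((hH _).1 y.2)
      have h3 : ∀ i ∈ s, ∃ t : Fin p → R, (∀ k, t k ∈ 𝔪 R ^ (n - c)) ∧ ν i = ∑ k, t k • z k := by
        intro i hi
        have := h1 i hi
        rw [← hz] at this
        obtain ⟨t, ht, e'⟩ := (Submodule.mem_ideal_smul_span_iff_exists_sum _ _ _).1 this
        refine ⟨t, ht, ?_⟩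
        rw [← e', Finsupp.sum_fintype]
        simp
      choose! t ht ht' using h3
      refine ⟨fun k => ∑ i ∈ s, t i k.down • e i, fun k _ => Submodule.sum_mem _ fun i hi => ?_,
        fun l _ => ?_⟩
      · have := hF.smul_mem (ht i hi k.down) (hF.mem_zero (e i))
        rwa [zero_add] at this
      · change y.1 l - T₀ _ l ∈ F (n + 1)
        convert h2 l.down using 2
        rw [hT₀]
        simp only [Finset.smul_sum, smul_smul]
        rw [Finset.sum_comm]
        refine Finset.sum_congr rfl fun i hi => ?_
        rw [ht' i hi, ← Finset.sum_smul]
        congr 1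
        simp [mul_comm])
    (x := ⟨fun l => x l.down, (hH _).2 hax⟩) (fun l _ => hF.mem_zero _)
  have hy' : ∀ l, x l = ∑ k, z k l • y ⟨k⟩ := fun l => by
    rw [← hT₀ y ⟨l⟩]
    exact (congrFun (congrArg Subtype.val hy) ⟨l⟩).symm
  exact ⟨p, fun l k => z k l, fun k => y ⟨k⟩, hy', hzk⟩

end FlatFilt

end FlatFilt

/-! ### Brackets and base change -/

section Kind

theorem IsBracketOfKind.of_maps {R A : Type u} [CommRing R] [Ring A] [Algebra R A]
    {br : A →ₗ[R] A →ₗ[R] A} {κ : DefKind} {ι : Type u} {S : ι → Type u} {B : ι → Type u}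
    [∀ i, CommRing (S i)] [∀ i, Ring (B i)] [∀ i, Algebra (S i) (B i)]
    {br' : ∀ i, B i →ₗ[S i] B i →ₗ[S i] B i} (h : ∀ i, IsBracketOfKind (br' i) κ)
    (φ : ∀ i, A →+* B i) (hφ : ∀ i a b, φ i (br a b) = br' i (φ i a) (φ i b))
    (inj : ∀ a b, (∀ i, φ i a = φ i b) → a = b) : IsBracketOfKind br κ := by
  cases κ with
  | assoc =>
    intro a b
    refine inj _ _ fun i => ?_
    rw [hφ, h i, map_sub, map_mul, map_mul]
  | poisson =>
    refine ⟨fun a b => inj _ _ fun i => ?_, fun a => inj _ _ fun i => ?_,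
      fun a b c => inj _ _ fun i => ?_, fun a b c => inj _ _ fun i => ?_,
      fun a b c => inj _ _ fun i => ?_⟩
    · rw [map_mul, map_mul, (h i).1]
    · rw [hφ, (h i).2.1, map_zero]
    · simp only [hφ, map_add, (h i).2.2.1, map_zero]
    · simp only [hφ, map_add, map_mul, (h i).2.2.2.1]
    · simp only [hφ, map_add, map_mul, (h i).2.2.2.2]

variable {R A : Type u} [CommRing R] [Ring A] [Algebra R A] {br : A →ₗ[R] A →ₗ[R] A}
  {κ : DefKind}

theorem IsBracketOfKind.baseChange (h : IsBracketOfKind br κ) (B : Type u) [CommRing B]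
    [Algebra R B] : IsBracketOfKind (LinearMap.BilinMap.baseChange B br) κ := by
  cases κ with
  | assoc =>
    intro a b
    induction a using TensorProduct.induction_on with
    | zero => simp
    | add t t' ht ht' => rw [map_add, LinearMap.add_apply, ht, ht']; noncomm_ring
    | tmul c x =>
      induction b using TensorProduct.induction_on with
      | zero => simp
      | add t t' ht ht' => rw [map_add, ht, ht']; noncomm_ring
      | tmul d y =>
        rw [LinearMap.BilinMap.baseChange_tmul, h x y, TensorProduct.tmul_sub,
          Algebra.TensorProduct.tmul_mul_tmul, Algebra.TensorProduct.tmul_mul_tmul, mul_comm d c]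
  | poisson =>
    have hsk : ∀ x y, br x y = -br y x := h.isLieBr.skew
    have hskew : ∀ a b, LinearMap.BilinMap.baseChange B br a b =
        -LinearMap.BilinMap.baseChange B br b a := by
      intro a b
      induction a using TensorProduct.induction_on with
      | zero => simp
      | add t t' ht ht' => rw [map_add, LinearMap.add_apply, ht, ht', map_add, neg_add]
      | tmul c x =>
        induction b using TensorProduct.induction_on with
        | zero => simp
        | add t t' ht ht' => rw [map_add, ht, ht', map_add, LinearMap.add_apply, neg_add]
        | tmul d y =>
          rw [LinearMap.BilinMap.baseChange_tmul, LinearMap.BilinMap.baseChange_tmul, hsk x y,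
            TensorProduct.tmul_neg, mul_comm]
    refine ⟨fun a b => ?_, fun a => ?_, fun a b c => ?_, fun a b c => ?_, fun a b c => ?_⟩
    · induction a using TensorProduct.induction_on with
      | zero => simp
      | add t t' ht ht' => rw [add_mul, mul_add, ht, ht']
      | tmul c x =>
        induction b using TensorProduct.induction_on with
        | zero => simp
        | add t t' ht ht' => rw [add_mul, mul_add, ht, ht']
        | tmul d y => simp only [Algebra.TensorProduct.tmul_mul_tmul, h.1 x y, mul_comm c d]
    · induction a using TensorProduct.induction_on with
      | zero => simp
      | add t t' ht ht' =>
        rw [map_add, map_add, LinearMap.add_apply, LinearMap.add_apply, ht, ht', hskew t t']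
        abel
      | tmul c x => simp [h.2.1]
    · induction a using TensorProduct.induction_on with
      | zero => simp
      | add t t' ht ht' =>
        simp only [map_add, LinearMap.add_apply]
        rw [← add_zero (0 : B ⊗[R] A)]
        nth_rw 1 [← ht]
        rw [← ht']
        abel
      | tmul p x =>
        induction b using TensorProduct.induction_on with
        | zero => simp
        | add t t' ht ht' =>
          simp only [map_add, LinearMap.add_apply]
          rw [← add_zero (0 : B ⊗[R] A)]
          nth_rw 1 [← ht]
          rw [← ht']
          abel
        | tmul q y =>
          induction c using TensorProduct.induction_on with
          | zero => simp
          | add t t' ht ht' =>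
            simp only [map_add, LinearMap.add_apply]
            rw [← add_zero (0 : B ⊗[R] A)]
            nth_rw 1 [← ht]
            rw [← ht']
            abel
          | tmul r z =>
            simp only [LinearMap.BilinMap.baseChange_tmul]
            rw [show q * (r * p) = p * (q * r) by ring, show r * (p * q) = p * (q * r) by ring,
              ← TensorProduct.tmul_add, ← TensorProduct.tmul_add, h.2.2.1, TensorProduct.tmul_zero]
    · induction a using TensorProduct.induction_on with
      | zero => simp
      | add t t' ht ht' =>
        simp only [map_add, LinearMap.add_apply, add_mul, mul_add, ht, ht']; abel
      | tmul p x =>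
        induction b using TensorProduct.induction_on with
        | zero => simp
        | add t t' ht ht' => simp only [map_add, add_mul, ht, ht']; abel
        | tmul q y =>
          induction c using TensorProduct.induction_on with
          | zero => simp
          | add t t' ht ht' => simp only [map_add, mul_add, ht, ht']; abel
          | tmul r z =>
            simp only [Algebra.TensorProduct.tmul_mul_tmul, LinearMap.BilinMap.baseChange_tmul,
              h.2.2.2.1, TensorProduct.tmul_add]
            rw [show q * (p * r) = p * (q * r) by ring, mul_assoc]
    · induction a using TensorProduct.induction_on with
      | zero => simp
      | add t t' ht ht' =>
        simp only [map_add, LinearMap.add_apply, add_mul, ht, ht']; abel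
      | tmul p x =>
        induction b using TensorProduct.induction_on with
        | zero => simp
        | add t t' ht ht' =>
          simp only [map_add, mul_add, LinearMap.add_apply, ht, ht']; abel
        | tmul q y =>
          induction c using TensorProduct.induction_on with
          | zero => simp
          | add t t' ht ht' => simp only [map_add, mul_add, add_mul, ht, ht']; abel
          | tmul r z =>
            simp only [Algebra.TensorProduct.tmul_mul_tmul, LinearMap.BilinMap.baseChange_tmul,
              h.2.2.2.2, TensorProduct.tmul_add]
            rw [show p * r * q = p * q * r by ring, mul_assoc]

end Kind

/-! ### The filtration of the completed base change -/

section AlgBaseChange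

variable {R R' : Type u} [CommRing R] [IsLocalRing R] [CommRing R'] [IsLocalRing R']
  [Algebra R R'] {A : Type u} [Ring A] [Algebra R A]

theorem transTensor_tmul (i : ℕ) (r : R') (a : A) :
    transTensor R R' A i (Ideal.Quotient.mk _ r ⊗ₜ a) = Ideal.Quotient.mk _ r ⊗ₜ a := rfl

theorem transTensor_surjective (i : ℕ) : Function.Surjective (transTensor R R' A i) := by
  intro t
  induction t using TensorProduct.induction_on with
  | zero => exact ⟨0, map_zero _⟩
  | add t t' ht ht' =>
    obtain ⟨s, rfl⟩ := ht
    obtain ⟨s', rfl⟩ := ht'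
    exact ⟨s + s', map_add _ _ _⟩
  | tmul c a =>
    obtain ⟨r, rfl⟩ := Ideal.Quotient.mk_surjective c
    exact ⟨Ideal.Quotient.mk _ r ⊗ₜ a, transTensor_tmul i r a⟩

theorem pow_smul_tensor_eq_zero {n i : ℕ} (h : i ≤ n) {r : R'} (hr : r ∈ 𝔪 R' ^ n)
    (t : (R' ⧸ 𝔪 R' ^ i) ⊗[R] A) : r • t = 0 := by
  rw [← algebraMap_smul (R' ⧸ 𝔪 R' ^ i) r t]
  have : algebraMap R' (R' ⧸ 𝔪 R' ^ i) r = 0 :=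
    Ideal.Quotient.eq_zero_iff_mem.2 (Ideal.pow_le_pow_right h hr)
  rw [this, zero_smul]

theorem mem_of_transTensor_eq_zero {i : ℕ} {t : (R' ⧸ 𝔪 R' ^ (i + 2)) ⊗[R] A}
    (ht : transTensor R R' A i t = 0) :
    t ∈ 𝔪 R' ^ (i + 1) • (⊤ : Submodule R' ((R' ⧸ 𝔪 R' ^ (i + 2)) ⊗[R] A)) := by
  let p : (R' ⧸ 𝔪 R' ^ (i + 2)) →ₗ[R] (R' ⧸ 𝔪 R' ^ (i + 1)) :=
    ((transition R' i).restrictScalars R).toLinearMap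
  have hp : Function.Surjective p := Ideal.Quotient.factor_surjective (Ideal.pow_le_pow_right (by omega))
  have hex := rTensor_exact A (LinearMap.exact_subtype_ker_map p) hp
  have h1 : p.rTensor A t = 0 := ht
  obtain ⟨s, rfl⟩ := (hex t).1 h1
  clear ht h1
  induction s using TensorProduct.induction_on with
  | zero => rw [map_zero]; exact Submodule.zero_mem _
  | add s s' hs hs' => rw [map_add]; exact Submodule.add_mem _ hs hs'
  | tmul k a =>
    obtain ⟨k, hk⟩ := k
    obtain ⟨r, rfl⟩ := Ideal.Quotient.mk_surjective k
    have hr : r ∈ 𝔪 R' ^ (i + 1) := Ideal.Quotient.eq_zero_iff_mem.1 hk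
    have : (LinearMap.ker p).subtype.rTensor A (⟨_, hk⟩ ⊗ₜ a) =
        r • ((1 : R' ⧸ 𝔪 R' ^ (i + 2)) ⊗ₜ[R] a) := by
      rw [TensorProduct.smul_tmul', Algebra.smul_def, mul_one]
      rfl
    rw [this]
    exact Submodule.smul_mem_smul hr trivial

theorem transTensor_mem {n i : ℕ} (h : n ≤ i + 1) {t : (R' ⧸ 𝔪 R' ^ (i + 2)) ⊗[R] A}
    (ht : transTensor R R' A i t ∈
      𝔪 R' ^ n • (⊤ : Submodule R' ((R' ⧸ 𝔪 R' ^ (i + 1)) ⊗[R] A))) :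
    t ∈ 𝔪 R' ^ n • (⊤ : Submodule R' ((R' ⧸ 𝔪 R' ^ (i + 2)) ⊗[R] A)) := by
  have h1 : (𝔪 R' ^ n • (⊤ : Submodule R' ((R' ⧸ 𝔪 R' ^ (i + 2)) ⊗[R] A))).map
      (transTensor R R' A i).toLinearMap = 𝔪 R' ^ n • ⊤ := by
    rw [Submodule.map_smul'', Submodule.map_top, LinearMap.range_eq_top.2]
    exact transTensor_surjective i
  rw [← h1] at ht
  obtain ⟨s, hs, e⟩ := ht
  have h2 : transTensor R R' A i (t - s) = 0 := by
    rw [map_sub, sub_eq_zero]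
    exact e.symm
  rw [← sub_add_cancel t s]
  exact Submodule.add_mem _ (Submodule.smul_mono_left (Ideal.pow_le_pow_right h)
    (mem_of_transTensor_eq_zero h2)) hs

/-- The kernels of the projections of `R' ⊗̂_R A`. -/
def complFilt (R R' A : Type u) [CommRing R] [IsLocalRing R] [CommRing R'] [IsLocalRing R']
    [Algebra R R'] [Ring A] [Algebra R A] (n : ℕ) : Submodule R' (complTensor R R' A) where
  carrier := {f | ∀ i < n, f.1 i = 0}
  zero_mem' _ _ := rfl
  add_mem' {f g} hf hg i hi := by
    change f.1 i + g.1 i = 0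
    rw [hf i hi, hg i hi, add_zero]
  smul_mem' r f hf i hi := by
    change r • f.1 i = 0
    rw [hf i hi, smul_zero]

theorem mem_complFilt_succ {n : ℕ} {f : complTensor R R' A} :
    f ∈ complFilt R R' A (n + 1) ↔ f.1 n = 0 := by
  refine ⟨fun h => h n n.lt_succ_self, fun h i hi => ?_⟩
  have : ∀ m, i ≤ m → f.1 m = 0 → f.1 i = 0 := by
    intro m hm
    induction m, hm using Nat.le_induction with
    | base => exact id
    | succ m hm ih =>
      intro h1
      refine ih ?_
      rw [← f.2 m, h1, map_zero]
  exact this n (Nat.le_of_lt_succ hi) h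

theorem component_mem {n : ℕ} {f : complTensor R R' A} (hf : f ∈ complFilt R R' A n) (i : ℕ) :
    f.1 i ∈ 𝔪 R' ^ n • (⊤ : Submodule R' ((R' ⧸ 𝔪 R' ^ (i + 1)) ⊗[R] A)) := by
  rcases lt_or_ge i n with h | h
  · rw [hf i h]; exact Submodule.zero_mem _
  · rcases n with _ | n
    · simp
    · induction i, h using Nat.le_induction with
      | base =>
        refine transTensor_mem le_rfl ?_
        rw [f.2, hf n n.lt_succ_self]
        exact Submodule.zero_mem _
      | succ i hi ih =>
        refine transTensor_mem (by omega) ?_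
        rw [f.2]
        exact ih

/-- The projections of `R' ⊗̂_R A`, as linear maps. -/
def complEval (R R' A : Type u) [CommRing R] [IsLocalRing R] [CommRing R'] [IsLocalRing R']
    [Algebra R R'] [Ring A] [Algebra R A] (i : ℕ) :
    complTensor R R' A →ₗ[R'] (R' ⧸ 𝔪 R' ^ (i + 1)) ⊗[R] A where
  toFun f := f.1 i
  map_add' _ _ := rfl
  map_smul' _ _ := rfl

theorem exists_span_toCompl (i : ℕ) (t : (R' ⧸ 𝔪 R' ^ (i + 1)) ⊗[R] A) :
    ∃ f ∈ Submodule.span R' (Set.range (toCompl (R := R) (A := A) R')), complEval R R' A i f = t := by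
  induction t using TensorProduct.induction_on with
  | zero => exact ⟨0, Submodule.zero_mem _, rfl⟩
  | add t t' ht ht' =>
    obtain ⟨s, hs, rfl⟩ := ht
    obtain ⟨s', hs', rfl⟩ := ht'
    exact ⟨s + s', Submodule.add_mem _ hs hs', map_add _ _ _⟩
  | tmul c a =>
    obtain ⟨r, rfl⟩ := Ideal.Quotient.mk_surjective c
    refine ⟨r • toCompl R' a, Submodule.smul_mem _ _ (Submodule.subset_span ⟨a, rfl⟩), ?_⟩
    change r • ((1 : R' ⧸ 𝔪 R' ^ (i + 1)) ⊗ₜ[R] a) = _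
    rw [TensorProduct.smul_tmul', Algebra.smul_def, mul_one]
    rfl

theorem complEval_surjective (i : ℕ) : Function.Surjective (complEval R R' A i) := fun t => by
  obtain ⟨f, -, e⟩ := exists_span_toCompl i t
  exact ⟨f, e⟩

theorem isCompleteFilt_complFilt : IsCompleteFilt (R := R') (A := complTensor R R' A) (complFilt R R' A) where
  antitone i j hij f hf k hk := hf k (hk.trans_le hij)
  sep f hf := Subtype.ext (funext fun i => hf (i + 1) i i.lt_succ_self)
  complete s hs := by
    have h : ∀ i n, i + 1 ≤ n → (s n).1 i = (s (i + 1)).1 i := by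
      intro i n hn
      induction n, hn using Nat.le_induction with
      | base => rfl
      | succ n hn ih => rw [← ih]; exact sub_eq_zero.1 (hs n i (by omega))
    refine ⟨⟨fun i => (s (i + 1)).1 i, fun i => ?_⟩, fun n i hi => ?_⟩
    · exact ((s (i + 2)).2 i).trans (h i (i + 2) (by omega))
    · exact sub_eq_zero.2 (h i n hi).symm

theorem flatFilt_complFilt [Module.Flat R A] : FlatFilt (R := R') (M := complTensor R R' A) (complFilt R R' A) where
  toIsCompleteFilt := isCompleteFilt_complFilt
  mem_zero f i hi := absurd hi (Nat.not_lt_zero i)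
  smul_mem {i n r f} hr hf j hj := by
    change r • f.1 j = 0
    refine Submodule.smul_induction_on (component_mem hf j) (fun s hs t _ => ?_)
      fun x y hx hy => by rw [smul_add, hx, hy, add_zero]
    rw [← mul_smul]
    refine pow_smul_tensor_eq_zero (n := n + i) hj ?_ t
    rw [pow_add, mul_comm r s]
    exact Ideal.mul_mem_mul hs hr
  le_sup n f hf := by
    have h1 := component_mem hf n
    have h2 : (𝔪 R' ^ n • (⊤ : Submodule R' (complTensor R R' A))).map (complEval R R' A n) =
        𝔪 R' ^ n • ⊤ := by
      rw [Submodule.map_smul'', Submodule.map_top, LinearMap.range_eq_top.2]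
      exact complEval_surjective n
    rw [← h2] at h1
    obtain ⟨g, hg, e⟩ := h1
    rw [← add_sub_cancel g f]
    refine Submodule.add_mem_sup hg (mem_complFilt_succ.2 ?_)
    exact sub_eq_zero.2 e.symm
  indep n ι _ r hr a ha j := by
    rw [mem_complFilt_succ] at ha ⊢
    have h1 : ∑ j, (Ideal.Quotient.mk (𝔪 R' ^ (n + 1)) (r j)) • (a j).1 n = 0 := by
      have h2 : complEval R R' A n (∑ j, r j • a j) = 0 := ha
      rw [map_sum] at h2
      refine Eq.trans (Finset.sum_congr rfl fun j _ => ?_) h2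
      rw [map_smul]
      exact algebraMap_smul (R' ⧸ 𝔪 R' ^ (n + 1)) (r j) ((a j).1 n)
    obtain ⟨k, Z, y, h3, h4⟩ := Module.Flat.isTrivialRelation_of_sum_smul_eq_zero h1
    choose Z' hZ' using fun j k => Ideal.Quotient.mk_surjective (Z j k)
    have h5 : ∀ l j, Z' j l ∈ 𝔪 R' := fun l => hr.indep (fun j => Z' j l) (by
      rw [← Ideal.Quotient.eq_zero_iff_mem, map_sum, ← h4 l]
      refine Finset.sum_congr rfl fun j _ => ?_
      rw [map_mul, hZ', mul_comm])
    have h6 : (a j).1 n ∈ 𝔪 R' • (⊤ : Submodule R' ((R' ⧸ 𝔪 R' ^ (n + 1)) ⊗[R] A)) := by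
      rw [show (a j).1 n = _ from h3 j]
      refine Submodule.sum_mem _ fun l _ => ?_
      rw [← hZ']
      have h7 := Submodule.smul_mem_smul (h5 l j)
        (Submodule.mem_top : y l ∈ (⊤ : Submodule R' ((R' ⧸ 𝔪 R' ^ (n + 1)) ⊗[R] A)))
      rwa [← algebraMap_smul (R' ⧸ 𝔪 R' ^ (n + 1)) (Z' j l) (y l)] at h7
    have h8 : ∀ m, (a j).1 m ∈ 𝔪 R' • (⊤ : Submodule R' ((R' ⧸ 𝔪 R' ^ (m + 1)) ⊗[R] A)) →
        (a j).1 0 ∈ 𝔪 R' • (⊤ : Submodule R' ((R' ⧸ 𝔪 R' ^ (0 + 1)) ⊗[R] A)) := by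
      intro m
      induction m with
      | zero => exact id
      | succ m ih =>
        intro h
        refine ih ?_
        rw [← (a j).2 m]
        have := Submodule.mem_map_of_mem (f := (transTensor R R' A m).toLinearMap) h
        rw [Submodule.map_smul''] at this
        exact Submodule.smul_mono le_rfl le_top this
    have h9 := h8 n h6
    refine Submodule.smul_induction_on h9 (fun s hs t _ => ?_)
      fun x y hx hy => by rw [hx, hy, add_zero]
    exact pow_smul_tensor_eq_zero (n := 1) le_rfl (by rwa [pow_one]) t

end AlgBaseChange

/-! ### Base change of deformations of algebras -/

section AlgBaseChange

variable (K : Type u) {R : Type u} (R' : Type u) [Field K] [CommRing R] [Algebra K R]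
  [IsLocalRing R] [CommRing R'] [Algebra K R'] [IsLocalRing R'] [ParameterAlgebra K R']
  [Algebra R R'] [IsScalarTower K R R']

include K in
theorem algebraMap_pow_mem {n : ℕ} {r : R} (hr : r ∈ 𝔪 R ^ n) :
    algebraMap R R' r ∈ 𝔪 R' ^ n := by
  have h : (𝔪 R).map (algebraMap R R') ≤ 𝔪 R' :=
    Ideal.map_le_iff_le_comap.2 fun r hr => algebraMap_mem_maximalIdeal K R R' hr
  have := Ideal.mem_map_of_mem (algebraMap R R') hr
  rw [Ideal.map_pow] at this
  exact Ideal.pow_right_mono h n this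

variable {R'} in
theorem map_residueEquiv_injective (A : Type u) [Ring A] [Algebra R A] :
    Function.Bijective (Algebra.TensorProduct.map (residueEquiv K R R' : 𝕜 R' →ₐ[R] 𝕜 R)
      (AlgHom.id R A)) :=
  (Algebra.TensorProduct.congr (residueEquiv K R R') (AlgEquiv.refl (A₁ := A))).bijective

theorem residueLift_bijective {S A : Type u} [Ring S] [Algebra R' S] [Ring A] [Algebra R A]
    (p : S →ₐ[R'] 𝕜 R' ⊗[R] A) (hp : Function.Surjective p)
    (hk : ∀ s, p s = 0 → s ∈ adicFilt R' S 1) : Function.Bijective (residueLift K R' p) := by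
  constructor
  · rw [injective_iff_map_eq_zero]
    intro t ht
    obtain ⟨s, rfl⟩ := residue_tensor_eq t
    rw [residueLift_one_tmul] at ht
    refine one_tmul_eq_zero (hk s ((map_residueEquiv_injective K A).1 ?_))
    rw [ht, map_zero]
  · intro t
    obtain ⟨t', rfl⟩ := (map_residueEquiv_injective (R' := R') K A).2 t
    obtain ⟨s, rfl⟩ := hp t'
    exact ⟨1 ⊗ₜ s, residueLift_one_tmul K R' p s⟩

variable {A : Type u} [Ring A] [Algebra R A]

theorem map_toResidue_bijective (A : Type u) [Ring A] [Algebra R A] :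
    Function.Bijective (Algebra.TensorProduct.map (toResidue R') (AlgHom.id R A)) := by
  have h : Function.Bijective (toResidue R') := by
    refine ⟨?_, Ideal.Quotient.factor_surjective (by simp)⟩
    rw [injective_iff_map_eq_zero]
    intro c hc
    obtain ⟨r, rfl⟩ := Ideal.Quotient.mk_surjective c
    rw [Ideal.Quotient.eq_zero_iff_mem]
    simpa using Ideal.Quotient.eq_zero_iff_mem.1 hc
  exact (Algebra.TensorProduct.congr (AlgEquiv.ofBijective (toResidue R') h)
    (AlgEquiv.refl (R := R) (A₁ := A))).bijective

theorem complProj_surjective : Function.Surjective (complProj (R := R) R' A) := fun t => by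
  obtain ⟨s, rfl⟩ := (map_toResidue_bijective R' A).2 t
  obtain ⟨f, rfl⟩ := complEval_surjective 0 s
  exact ⟨f, rfl⟩

theorem complProj_br (br : A →ₗ[R] A →ₗ[R] A) (f g : complTensor R R' A) :
    complProj R' A (complBr R' br f g) =
      LinearMap.BilinMap.baseChange (𝕜 R') br (complProj R' A f) (complProj R' A g) :=
  map_baseChange (toResidue R') (AlgHom.id R A) br br (fun _ _ => rfl) (f.1 0) (g.1 0)

theorem PreAlgDef.aug_baseChange_br {C : Type u} [CommRing C] [Algebra K C]
    (A : PreAlgDef K R C) (h : ∀ a b, A.aug (1 ⊗ₜ A.br a b) = 0) (t u : 𝕜 R ⊗[R] A.carrier) :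
    A.aug (LinearMap.BilinMap.baseChange (𝕜 R) A.br t u) = 0 := by
  obtain ⟨a, rfl⟩ := residue_tensor_eq t
  obtain ⟨b, rfl⟩ := residue_tensor_eq u
  rw [LinearMap.BilinMap.baseChange_tmul, mul_one]
  exact h a b

variable {C : Type u} [CommRing C] [Algebra K C] {κ : DefKind}

theorem complBr_kind {br : A →ₗ[R] A →ₗ[R] A} (h : IsBracketOfKind br κ) :
    IsBracketOfKind (R := R') (A := complTensor R R' A) (complBr R' br) κ :=
  IsBracketOfKind.of_maps (ι := ULift.{u} ℕ) (fun i => h.baseChange (R' ⧸ 𝔪 R' ^ (i.down + 1)))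
    (fun i => ((Pi.evalRingHom _ i.down).comp (complTensor R R' A).val.toRingHom :
      complTensor R R' A →+* (R' ⧸ 𝔪 R' ^ (i.down + 1)) ⊗[R] A))
    (fun i f g => rfl) fun f g h => Subtype.ext (funext fun i => h ⟨i⟩)

theorem residueLift_complProj_br (br : A →ₗ[R] A →ₗ[R] A) (f g : complTensor R R' A) :
    residueLift K R' (complProj R' A) (1 ⊗ₜ complBr R' br f g) =
      LinearMap.BilinMap.baseChange (𝕜 R) br (residueLift K R' (complProj R' A) (1 ⊗ₜ f))
        (residueLift K R' (complProj R' A) (1 ⊗ₜ g)) := by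
  rw [residueLift_one_tmul, complProj_br, residueLift_one_tmul, residueLift_one_tmul,
    map_baseChange (S := R) (residueEquiv K R R' : 𝕜 R' →ₐ[R] 𝕜 R) (AlgHom.id R A) br
      br (fun _ _ => rfl)]

theorem PreAlgDef.IsDeformation.baseChange {A : PreAlgDef K R C} (h : A.IsDeformation κ) :
    (A.baseChange K R').IsDeformation κ := by
  have hN : IsNoetherianRing R' := ParameterAlgebra.isNoetherianRing K
  have hfl := h.flat
  have hF := flatFilt_complFilt (R := R) (R' := R') (A := A.carrier)
  refine ⟨complBr_kind R' h.kind, hF.flat, hF.isAdicComplete, ?_, fun f g => ?_⟩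
  · refine h.bijective_aug.comp (residueLift_bijective K R' _ (complProj_surjective R') fun s hs => ?_)
    rw [← hF.eq_adicFilt]
    refine mem_complFilt_succ.2 ((map_toResidue_bijective R' A.carrier).1 ?_)
    exact hs.trans (map_zero _).symm
  · exact (congrArg A.aug (residueLift_complProj_br K R' A.br f g)).trans
      (A.aug_baseChange_br K h.aug_br _ _)

theorem compl_linearMap_ext [IsNoetherianRing R'] [Module.Flat R A] {M : Type u} [AddCommGroup M]
    [Module R' M] (hM : IsAdicComplete (𝔪 R') M) {φ ψ : complTensor R R' A →ₗ[R'] M}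
    (h : ∀ a, φ (toCompl R' a) = ψ (toCompl R' a)) : φ = ψ := by
  have hF := flatFilt_complFilt (R := R) (R' := R') (A := A)
  refine LinearMap.ext fun f => sub_eq_zero.1 ((isCompleteFilt_adicFilt hM).sep _ fun n => ?_)
  refine (isCompleteFilt_adicFilt hM).antitone n.le_succ ?_
  obtain ⟨g, hg, e⟩ := exists_span_toCompl n (f.1 n)
  have h1 : (φ - ψ) g = 0 := by
    have : Submodule.span R' (Set.range (toCompl (R := R) (A := A) R')) ≤ LinearMap.ker (φ - ψ) := by
      rw [Submodule.span_le]
      rintro _ ⟨a, rfl⟩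
      exact sub_eq_zero.2 (h a)
    exact this hg
  have h2 : f - g ∈ complFilt R R' A (n + 1) := mem_complFilt_succ.2 (sub_eq_zero.2 e.symm)
  rw [hF.eq_adicFilt] at h2
  have h3 := map_adicFilt (φ - ψ) h2
  have h4 : (φ - ψ) (f - g) = (φ - ψ) f := by
    refine (LinearMap.map_sub (φ - ψ) f g).trans ?_
    rw [h1, sub_zero]
  rwa [h4] at h3

theorem toCompl_add (a b : A) :
    toCompl (R := R) R' (a + b) = toCompl R' a + toCompl R' b :=
  Subtype.ext (funext fun _ => TensorProduct.tmul_add _ _ _)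

theorem toCompl_smul (r : R) (a : A) :
    toCompl (R := R) R' (r • a) = algebraMap R R' r • toCompl R' a := by
  refine Subtype.ext (funext fun i => ?_)
  change (1 : R' ⧸ 𝔪 R' ^ (i + 1)) ⊗ₜ[R] (r • a) =
    algebraMap R R' r • ((1 : R' ⧸ 𝔪 R' ^ (i + 1)) ⊗ₜ[R] a)
  rw [← TensorProduct.smul_tmul, TensorProduct.smul_tmul', algebraMap_smul]

/-- The canonical map `A → R' ⊗̂_R A`, as an additive map. -/
def toComplHom (A : Type u) [Ring A] [Algebra R A] : A →+ complTensor R R' A where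
  toFun := toCompl R'
  map_zero' := Subtype.ext (funext fun _ => TensorProduct.tmul_zero _ _)
  map_add' := toCompl_add R'

include K in
theorem toCompl_mem_adicFilt {n : ℕ} {a : A} (ha : a ∈ adicFilt R A n) :
    toCompl (R := R) R' a ∈ adicFilt R' (complTensor R R' A) n := by
  refine Submodule.smul_induction_on ha (fun r hr x _ => ?_) fun x y hx hy => ?_
  · rw [toCompl_smul]
    exact Submodule.smul_mem_smul (algebraMap_pow_mem K R' hr) trivial
  · rw [toCompl_add]
    exact Submodule.add_mem _ hx hy

theorem toCompl_br (br : A →ₗ[R] A →ₗ[R] A) (a b : A) :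
    toCompl R' (br a b) = complBr R' br (toCompl R' a) (toCompl R' b) := by
  refine Subtype.ext (funext fun i => ?_)
  change (1 : R' ⧸ 𝔪 R' ^ (i + 1)) ⊗ₜ[R] br a b =
    LinearMap.BilinMap.baseChange (R' ⧸ 𝔪 R' ^ (i + 1)) br (1 ⊗ₜ a) (1 ⊗ₜ b)
  rw [LinearMap.BilinMap.baseChange_tmul, mul_one]

theorem toCompl_algebraMap_smul (c : K) (a : A) :
    toComplHom (R := R) R' A (algebraMap K R c • a) =
      algebraMap K R' c • toComplHom (R := R) R' A a := by
  refine (toCompl_smul R' _ a).trans ?_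
  rw [← IsScalarTower.algebraMap_apply]
  rfl

variable [CharZero K]

theorem isMorphism_algBaseChange
    (h : ∀ A : AlgDef K R C κ, (A.toPreAlgDef.baseChange K R').IsDeformation κ) :
    (algBaseChange K R' h).IsMorphism where
  map₂_mul {A} a b := Subtype.ext <|
    map_bch K (toComplHom R' (PreAlgDef.carrier (AlgDef.toPreAlgDef A)))
      (toCompl_algebraMap_smul K R') (AlgDef.isFiltBracket A)
      (AlgDef.isFiltBracket ((algBaseChange K R' h).functor.obj A))
      (toCompl_mem_adicFilt K R') (fun x _ y _ => toCompl_br R' _ x y) a.2 b.2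
  map₂_twist {A B} g a := Subtype.ext <| Subtype.ext (funext fun i => by
    change (1 : R' ⧸ 𝔪 R' ^ (i + 1)) ⊗ₜ[R] _ = Algebra.TensorProduct.map _ _ (1 ⊗ₜ a.1)
    rw [Algebra.TensorProduct.map_tmul, map_one]
    rfl)
  map_feedback {A} a := AlgGauge.ext (AlgEquiv.ext fun f => by
    have hN : IsNoetherianRing R' := ParameterAlgebra.isNoetherianRing K
    have hfl : Module.Flat R (PreAlgDef.carrier (AlgDef.toPreAlgDef A)) :=
      PreAlgDef.IsDeformation.flat (AlgDef.isDeformation A)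
    refine LinearMap.congr_fun (compl_linearMap_ext R'
      (φ := (AlgGauge.toEquiv ((algBaseChange K R' h).functor.map
        ((algDef K R C κ).feedback a))).toLinearMap)
      (ψ := (AlgGauge.toEquiv ((algDef K R' C κ).feedback
        ((algBaseChange K R' h).map₂ a))).toLinearMap)
      (PreAlgDef.IsDeformation.complete (h A)) fun x => ?_) f
    have h1 := map_expAd K (toComplHom R' (PreAlgDef.carrier (AlgDef.toPreAlgDef A)))
      (toCompl_algebraMap_smul K R') (AlgDef.isFiltBracket A)
      (AlgDef.isFiltBracket ((algBaseChange K R' h).functor.obj A))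
      (toCompl_mem_adicFilt K R') a.2 Set.univ (fun b _ => ⟨trivial, toCompl_br R' _ _ b⟩)
      (Set.mem_univ x)
    refine Eq.trans ?_ h1
    refine Subtype.ext (funext fun i => ?_)
    change Algebra.TensorProduct.map _ _ ((1 : R' ⧸ 𝔪 R' ^ (i + 1)) ⊗ₜ x) = _
    rw [Algebra.TensorProduct.map_tmul, map_one]
    rfl)

end AlgBaseChange

/-! ### Maps between flat complete modules -/

section Bijective

variable {R : Type u} [CommRing R] [IsLocalRing R] {M N : Type u} [AddCommGroup M] [Module R M]
  [AddCommGroup N] [Module R N] {F : ℕ → Submodule R M} {G : ℕ → Submodule R N}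

theorem FlatFilt.exists_sub_sum_mem (hF : FlatFilt F) {ι : Type u} [Fintype ι] {n : ℕ}
    {r : ι → R} (hr : IsMinGen n r) {x : M} (hx : x ∈ F n) :
    ∃ a : ι → M, x - ∑ j, r j • a j ∈ F (n + 1) := by
  obtain ⟨y, hy, z, hz, rfl⟩ := Submodule.mem_sup.1 (hF.le_sup n hx)
  suffices h : ∃ a : ι → M, y - ∑ j, r j • a j ∈ F (n + 1) by
    obtain ⟨a, ha⟩ := h
    exact ⟨a, by rw [add_sub_right_comm]; exact Submodule.add_mem _ ha hz⟩
  refine Submodule.smul_induction_on hy (fun s hs m _ => ?_) fun x y hx hy => ?_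
  · obtain ⟨c, hc⟩ := hr.exists_sub_mem s hs
    refine ⟨fun j => c j • m, ?_⟩
    have := hF.smul_mem hc (hF.mem_zero m)
    rw [zero_add] at this
    convert this using 1
    rw [sub_smul, Finset.sum_smul]
    exact congrArg _ (Finset.sum_congr rfl fun j _ => by rw [smul_smul, mul_comm])
  · obtain ⟨a, ha⟩ := hx
    obtain ⟨b, hb⟩ := hy
    refine ⟨a + b, ?_⟩
    convert Submodule.add_mem _ ha hb using 1
    simp only [Pi.add_apply, smul_add, Finset.sum_add_distrib]
    abel

theorem FlatFilt.bijective [IsNoetherianRing R] (hF : FlatFilt F) (hG : FlatFilt G) (φ : M →ₗ[R] N)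
    (h1 : ∀ x, φ x ∈ G 1 → x ∈ F 1) (h2 : ∀ y, ∃ x, y - φ x ∈ G 1) : Function.Bijective φ := by
  have hφ : ∀ {n x}, x ∈ F n → φ x ∈ G n := fun {n x} hx => by
    rw [hF.eq_adicFilt] at hx
    exact hG.adicFilt_le n (map_adicFilt φ hx)
  constructor
  · rw [injective_iff_map_eq_zero]
    intro x hx
    refine hF.sep _ fun n => ?_
    induction n with
    | zero => exact hF.mem_zero x
    | succ n ih =>
      obtain ⟨ι, _, r, hr⟩ := exists_isMinGen (R := R) n
      obtain ⟨a, ha⟩ := hF.exists_sub_sum_mem hr ih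
      have h3 := hφ ha
      rw [map_sub, hx, zero_sub, Submodule.neg_mem_iff, map_sum] at h3
      simp only [map_smul] at h3
      have h4 : ∑ j, r j • a j ∈ F (n + 1) := Submodule.sum_mem _ fun j _ => by
        have := hF.smul_mem (hr.mem j) (h1 _ (hG.indep n r hr _ h3 j))
        rwa [add_comm] at this
      simpa using Submodule.add_mem _ ha h4
  · intro y
    refine exists_eq_of_approx hG.antitone hG.sep hF.toIsCompleteFilt φ hφ 0 (fun n y hy => ?_)
      (hG.mem_zero y)
    obtain ⟨ι, _, r, hr⟩ := exists_isMinGen (R := R) n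
    obtain ⟨b, hb⟩ := hG.exists_sub_sum_mem hr hy
    choose a ha using fun j => h2 (b j)
    refine ⟨∑ j, r j • a j, Submodule.sum_mem _ fun j _ => ?_, ?_⟩
    · have := hF.smul_mem (hr.mem j) (hF.mem_zero (a j))
      rwa [zero_add] at this
    · have h3 : ∑ j, r j • (b j - φ (a j)) ∈ G (n + 1) := Submodule.sum_mem _ fun j _ => by
        have := hG.smul_mem (hr.mem j) (ha j)
        rwa [add_comm] at this
      convert Submodule.add_mem _ hb h3 using 1
      simp only [map_sum, map_smul, smul_sub, Finset.sum_sub_distrib]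
      abel

end Bijective

/-! ### Affine models -/

section Model

variable {K : Type u} [Field K] {X : TopCat.{u}}

/-- A description of a sheaf `O` of `K`-algebras by fractions of global sections, as it is available
for the structure sheaf of an integral affine scheme: `L` is the field of fractions and `D c` is the
basic open set of `c`. -/
structure AffModel (O : TopCat.Presheaf (CommAlgCat.{u} K) X) where
  L : Type u
  [commRing : CommRing L]
  [algebra : Algebra K L]
  ev : ∀ V : Opens X, O.obj (op V) →ₐ[K] (V → L)
  ev_res : ∀ {V W : Opens X} (h : W ≤ V) (s : O.obj (op V)) (x : W),
    ev W ((O.map (homOfLE h).op).hom s) x = ev V s ⟨x.1, h x.2⟩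
  ev_const : ∀ (V : Opens X) (s : O.obj (op V)) (x y : V), ev V s x = ev V s y
  ev_injective : ∀ V, Function.Injective (ev V)
  lam : O.obj (op ⊤) →ₐ[K] L
  lam_injective : Function.Injective lam
  ev_top : ∀ c x, ev ⊤ c x = lam c
  D : O.obj (op ⊤) → Opens X
  isUnit_lam : ∀ {x : X} {c}, x ∈ D c → IsUnit (lam c)
  exists_frac : ∀ (V : Opens X) (h : O.obj (op V)) (x : V),
    ∃ s c, x.1 ∈ D s ∧ lam s * ev V h x = lam c
  exists_section : ∀ (V : Opens X) (σ : L), (∀ x ∈ V, ∃ s c, x ∈ D s ∧ lam s * σ = lam c) →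
    ∃ h : O.obj (op V), ∀ x, ev V h x = σ
  D_mul : ∀ a b, D (a * b) = D a ⊓ D b
  D_one : D 1 = ⊤
  D_basis : ∀ {V : Opens X} {x : X}, x ∈ V → ∃ c, x ∈ D c ∧ D c ≤ V
  D_le_iff : ∀ (f : O.obj (op ⊤)) (T : Set (O.obj (op ⊤))),
    (∀ x ∈ D f, ∃ g ∈ T, x ∈ D g) ↔ ∃ N : ℕ, f ^ N ∈ Ideal.span T
  nonempty_inter : ∀ {V W : Opens X} {x y : X}, x ∈ V → y ∈ W → ∃ z, z ∈ V ∧ z ∈ W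

attribute [instance] AffModel.commRing AffModel.algebra

namespace AffModel

variable {O : TopCat.Presheaf (CommAlgCat.{u} K) X} (M : AffModel O)

/-- `σ` is a section of `O` over `V`. -/
def IsReg (V : Opens X) (σ : M.L) : Prop := ∀ x ∈ V, ∃ s c, x ∈ M.D s ∧ M.lam s * σ = M.lam c

variable {M}

theorem isReg_ev {V : Opens X} (h : O.obj (op V)) {x : X} (hx : x ∈ V) :
    M.IsReg V (M.ev V h ⟨x, hx⟩) := fun y hy => by
  rw [M.ev_const V h ⟨x, hx⟩ ⟨y, hy⟩]
  exact M.exists_frac V h ⟨y, hy⟩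

theorem IsReg.mono {V W : Opens X} {σ : M.L} (h : M.IsReg V σ) (hW : W ≤ V) : M.IsReg W σ :=
  fun x hx => h x (hW hx)

theorem D_pow_succ (c : O.obj (op ⊤)) (n : ℕ) : M.D (c ^ (n + 1)) = M.D c := by
  induction n with
  | zero => rw [zero_add, pow_one]
  | succ n ih => rw [pow_succ, M.D_mul, ih, inf_idem]

theorem mem_D_pow {x : X} {c : O.obj (op ⊤)} (h : x ∈ M.D c) (n : ℕ) : x ∈ M.D (c ^ n) := by
  cases n with
  | zero => rw [pow_zero, M.D_one]; trivial
  | succ n => rwa [D_pow_succ]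

theorem mem_D_mul {x : X} {a b : O.obj (op ⊤)} (ha : x ∈ M.D a) (hb : x ∈ M.D b) :
    x ∈ M.D (a * b) := by
  rw [M.D_mul]; exact ⟨ha, hb⟩

theorem isReg_lam (V : Opens X) (c : O.obj (op ⊤)) : M.IsReg V (M.lam c) := fun x _ =>
  ⟨1, c, by rw [M.D_one]; trivial, by rw [map_one, one_mul]⟩

/-- Clearing denominators. -/
theorem IsReg.exists_pow_mul {f : O.obj (op ⊤)} {σ : M.L} (h : M.IsReg (M.D f) σ) :
    ∃ (N : ℕ), ∀ m ≥ N, ∃ c, M.lam f ^ m * σ = M.lam c := by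
  let I : Ideal (O.obj (op ⊤)) :=
    { carrier := {s | ∃ c, M.lam s * σ = M.lam c}
      zero_mem' := ⟨0, by simp⟩
      add_mem' := by
        rintro a b ⟨c, hc⟩ ⟨d, hd⟩
        exact ⟨c + d, by rw [map_add, map_add, add_mul, hc, hd]⟩
      smul_mem' := by
        rintro a b ⟨c, hc⟩
        exact ⟨a * c, by rw [smul_eq_mul, map_mul, mul_assoc, hc, map_mul]⟩ }
  obtain ⟨N, hN⟩ := (M.D_le_iff f {s | ∃ c, M.lam s * σ = M.lam c}).1 fun x hx => by
    obtain ⟨s, c, hs, e⟩ := h x hx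
    exact ⟨s, ⟨c, e⟩, hs⟩
  have hI : Ideal.span {s | ∃ c, M.lam s * σ = M.lam c} ≤ I := Ideal.span_le.2 fun s hs => hs
  refine ⟨N, fun m hm => ?_⟩
  obtain ⟨k, rfl⟩ := Nat.exists_eq_add_of_le hm
  have h1 : f ^ (N + k) ∈ I := by
    rw [pow_add]; exact I.mul_mem_right _ (hI hN)
  obtain ⟨c, hc⟩ := h1
  exact ⟨c, by rw [← hc, map_pow]⟩

end AffModel

end Model

/-! ### Formal sheaves -/

section Formal

variable {K R : Type u} [Field K] [CommRing R] [Algebra K R] [IsLocalRing R] {X : TopCat.{u}}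
  {O : TopCat.Presheaf (CommAlgCat.{u} K) X}

namespace AffModel

variable (M : AffModel O) (P : PreSheafDef K R O)

/-- The value at a point of the function given by the reduction of a section. -/
def sy {V : Opens X} {x : X} (hx : x ∈ V) : Sec P.alg V →+* M.L :=
  (Pi.evalRingHom (fun _ : V => M.L) ⟨x, hx⟩).comp ((M.ev V).toRingHom.comp
    ((P.aug V).toRingHom.comp ((toSheafTensor P.alg (𝕜 R) V).toRingHom.comp
      (Algebra.TensorProduct.includeRight : Sec P.alg V →ₐ[R] 𝕜 R ⊗[R] Sec P.alg V).toRingHom)))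

theorem sy_eq {V : Opens X} {x : X} (hx : x ∈ V) (t : Sec P.alg V) :
    M.sy P hx t = M.ev V (P.aug V (toSheafTensor P.alg (𝕜 R) V (1 ⊗ₜ t))) ⟨x, hx⟩ := rfl

variable {M P}

theorem sy_const {V : Opens X} {x y : X} (hx : x ∈ V) (hy : y ∈ V) (t : Sec P.alg V) :
    M.sy P hx t = M.sy P hy t := M.ev_const V _ _ _

theorem sy_res {V W : Opens X} (h : W ≤ V) {x : X} (hx : x ∈ W) (t : Sec P.alg V) :
    M.sy P hx (res P.alg h t) = M.sy P (h hx) t := by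
  rw [sy_eq, sy_eq]
  refine Eq.trans ?_ (M.ev_res h _ ⟨x, hx⟩)
  rw [← P.aug_res h]
  refine congrFun (congrArg (M.ev W) (congrArg (P.aug W) ?_)) _
  refine Subtype.ext (funext fun y => ?_)
  exact congrArg ((1 : 𝕜 R) ⊗ₜ[R] ·) (germ_res P.alg h y.2 t)

theorem isReg_sy {V : Opens X} {x : X} (hx : x ∈ V) (t : Sec P.alg V) : M.IsReg V (M.sy P hx t) :=
  isReg_ev _ hx

end AffModel

/-- A filtered presheaf of algebras which behaves like a deformation of `O` filtered by the powers of
the maximal ideal. -/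
structure IsFormal (M : AffModel O) (P : PreSheafDef K R O)
    (F : ∀ V : Opens X, ℕ → Submodule R (Sec P.alg V)) : Prop where
  mem_zero : ∀ V t, t ∈ F V 0
  antitone : ∀ V, Antitone (F V)
  sep : ∀ V t, (∀ n, t ∈ F V n) → t = 0
  res_mem : ∀ {V W : Opens X} (h : W ≤ V) {n t}, t ∈ F V n → res P.alg h t ∈ F W n
  mem_of_local : ∀ {V : Opens X} {n t}, (∀ x ∈ V, ∃ (W : Opens X) (h : W ≤ V), x ∈ W ∧
    res P.alg h t ∈ F W n) → t ∈ F V n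
  smul_mem : ∀ {V i n r t}, r ∈ 𝔪 R ^ i → t ∈ F V n → r • t ∈ F V (n + i)
  mul_mem : ∀ {V n} (s) {t}, t ∈ F V n → s * t ∈ F V n
  glue : ∀ (V : Opens X) (W : ℕ → V → Opens X) (hW : ∀ n x, W n x ≤ V) (_ : ∀ n x, x.1 ∈ W n x)
    (τ : ∀ n x, Sec P.alg (W n x)),
    (∀ n x y, res P.alg (inf_le_left : W n x ⊓ W n y ≤ W n x) (τ n x) -
      res P.alg (inf_le_right : W n x ⊓ W n y ≤ W n y) (τ n y) ∈ F (W n x ⊓ W n y) n) →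
    (∀ n x, res P.alg (inf_le_left : W (n + 1) x ⊓ W n x ≤ W (n + 1) x) (τ (n + 1) x) -
      res P.alg (inf_le_right : W (n + 1) x ⊓ W n x ≤ W n x) (τ n x) ∈
        F (W (n + 1) x ⊓ W n x) n) →
    ∃ t : Sec P.alg V, ∀ n x, res P.alg (hW n x) t - τ n x ∈ F (W n x) n
  mem_one_iff : ∀ {V : Opens X} {t : Sec P.alg V},
    t ∈ F V 1 ↔ ∀ (x : X) (hx : x ∈ V), M.sy P hx t = 0
  exists_sy_eq : ∀ (V : Opens X) (h : O.obj (op V)) (x : X) (hx : x ∈ V),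
    ∃ (W : Opens X) (_ : W ≤ V) (hxW : x ∈ W) (t : Sec P.alg W), M.sy P hxW t = M.ev V h ⟨x, hx⟩
  gen : ∀ {V : Opens X} {n t}, t ∈ F V n → ∀ {ι : Type u} [Fintype ι] (r : ι → R), IsMinGen n r →
    ∀ x ∈ V, ∃ (W : Opens X) (h : W ≤ V) (_ : x ∈ W) (a : ι → Sec P.alg W),
      res P.alg h t - ∑ j, r j • a j ∈ F W (n + 1)
  indep : ∀ {V : Opens X} (n : ℕ) {ι : Type u} [Fintype ι] (r : ι → R), IsMinGen n r →
    ∀ a : ι → Sec P.alg V, ∑ j, r j • a j ∈ F V (n + 1) → ∀ j, a j ∈ F V 1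

variable {M : AffModel O} {P : PreSheafDef K R O} {F : ∀ V : Opens X, ℕ → Submodule R (Sec P.alg V)}

namespace IsFormal

variable (M F) in
/-- `t` is congruent to `∑ r j • a j`, where `a j` reduces to `σ j`. -/
def HasSymbol {ι : Type u} [Fintype ι] (n : ℕ) (r : ι → R) (V : Opens X) (t : Sec P.alg V)
    (σ : ι → M.L) : Prop :=
  ∀ x ∈ V, ∃ (W : Opens X) (h : W ≤ V) (hx : x ∈ W) (a : ι → Sec P.alg W),
    res P.alg h t - ∑ j, r j • a j ∈ F W (n + 1) ∧ ∀ j, M.sy P hx (a j) = σ j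

variable (hF : IsFormal M P F) {ι : Type u} [Fintype ι] {n : ℕ} {r : ι → R}
include hF

theorem exists_res {V V' : Opens X} (h : V' ≤ V) {t : Sec P.alg V} {σ : ι → M.L} {x : X}
    (hx : x ∈ V') (H : HasSymbol M F n r V t σ) :
    ∃ (W : Opens X) (h : W ≤ V) (_ : W ≤ V') (hx : x ∈ W) (a : ι → Sec P.alg W),
      res P.alg h t - ∑ j, r j • a j ∈ F W (n + 1) ∧ ∀ j, M.sy P hx (a j) = σ j := by
  obtain ⟨W, hW, hxW, a, h1, h2⟩ := H x (h hx)
  refine ⟨W ⊓ V', inf_le_left.trans hW, inf_le_right, ⟨hxW, hx⟩,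
    fun j => res P.alg inf_le_left (a j), ?_, fun j => ?_⟩
  · have := hF.res_mem (inf_le_left : W ⊓ V' ≤ W) h1
    simpa only [map_sub, map_sum, map_smul, res_res] using this
  · exact (AffModel.sy_res _ _ _).trans (h2 j)

theorem hasSymbol_res {V V' : Opens X} (h : V' ≤ V) {t : Sec P.alg V} {σ : ι → M.L}
    (H : HasSymbol M F n r V t σ) : HasSymbol M F n r V' (res P.alg h t) σ := fun x hx => by
  obtain ⟨W, hW, hW', hxW, a, h1, h2⟩ := hF.exists_res h hx H
  exact ⟨W, hW', hxW, a, by rwa [res_res], h2⟩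

theorem exists_common {V : Opens X} {t t' : Sec P.alg V} {σ σ' : ι → M.L}
    (H : HasSymbol M F n r V t σ) (H' : HasSymbol M F n r V t' σ') {x : X} (hx : x ∈ V) :
    ∃ (W : Opens X) (h : W ≤ V) (hx : x ∈ W) (a a' : ι → Sec P.alg W),
      res P.alg h t - ∑ j, r j • a j ∈ F W (n + 1) ∧ (∀ j, M.sy P hx (a j) = σ j) ∧
      res P.alg h t' - ∑ j, r j • a' j ∈ F W (n + 1) ∧ ∀ j, M.sy P hx (a' j) = σ' j := by
  obtain ⟨W, hW, hxW, a, h1, h2⟩ := H x hx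
  obtain ⟨Z, hZ, hZ', hxZ, b, h3, h4⟩ := hF.exists_res hW hxW H'
  refine ⟨Z, hZ, hxZ, fun j => res P.alg hZ' (a j), b, ?_, fun j => ?_, h3, h4⟩
  · have := hF.res_mem hZ' h1
    simpa only [map_sub, map_sum, map_smul, res_res] using this
  · exact (AffModel.sy_res _ _ _).trans (h2 j)

theorem hasSymbol_add {V : Opens X} {t t' : Sec P.alg V} {σ σ' : ι → M.L}
    (H : HasSymbol M F n r V t σ) (H' : HasSymbol M F n r V t' σ') :
    HasSymbol M F n r V (t + t') (σ + σ') := fun x hx => by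
  obtain ⟨W, hW, hxW, a, a', h1, h2, h3, h4⟩ := hF.exists_common H H' hx
  refine ⟨W, hW, hxW, a + a', ?_, fun j => ?_⟩
  · convert Submodule.add_mem _ h1 h3 using 1
    simp only [map_add, Pi.add_apply, smul_add, Finset.sum_add_distrib]
    abel
  · rw [Pi.add_apply, map_add, h2, h4, Pi.add_apply]

theorem hasSymbol_sub {V : Opens X} {t t' : Sec P.alg V} {σ σ' : ι → M.L}
    (H : HasSymbol M F n r V t σ) (H' : HasSymbol M F n r V t' σ') :
    HasSymbol M F n r V (t - t') (σ - σ') := fun x hx => by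
  obtain ⟨W, hW, hxW, a, a', h1, h2, h3, h4⟩ := hF.exists_common H H' hx
  refine ⟨W, hW, hxW, a - a', ?_, fun j => ?_⟩
  · convert Submodule.sub_mem _ h1 h3 using 1
    simp only [map_sub, Pi.sub_apply, smul_sub, Finset.sum_sub_distrib]
    abel
  · rw [Pi.sub_apply, map_sub, h2, h4, Pi.sub_apply]

theorem hasSymbol_mul {V : Opens X} (s : Sec P.alg V) {t : Sec P.alg V} {σ : ι → M.L} {c : M.L}
    (hs : ∀ (x : X) (hx : x ∈ V), M.sy P hx s = c) (H : HasSymbol M F n r V t σ) :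
    HasSymbol M F n r V (s * t) (fun j => c * σ j) := fun x hx => by
  obtain ⟨W, hW, hxW, a, h1, h2⟩ := H x hx
  refine ⟨W, hW, hxW, fun j => res P.alg hW s * a j, ?_, fun j => ?_⟩
  · have := hF.mul_mem (res P.alg hW s) h1
    simpa only [map_mul, mul_sub, Finset.mul_sum, mul_smul_comm] using this
  · rw [map_mul, h2, AffModel.sy_res, hs]

theorem hasSymbol_sum {V : Opens X} (a : ι → Sec P.alg V) {σ : ι → M.L}
    (h : ∀ (x : X) (hx : x ∈ V) (j : ι), M.sy P hx (a j) = σ j) :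
    HasSymbol M F n r V (∑ j, r j • a j) σ := fun x hx =>
  ⟨V, le_rfl, hx, a, by rw [res_self, sub_self]; exact Submodule.zero_mem _, h x hx⟩

variable (hr : IsMinGen n r)
include hr

theorem hasSymbol_unique {V : Opens X} {t : Sec P.alg V} {σ σ' : ι → M.L}
    (H : HasSymbol M F n r V t σ) (H' : HasSymbol M F n r V t σ') {x : X} (hx : x ∈ V) :
    σ = σ' := by
  obtain ⟨W, hW, hxW, a, a', h1, h2, h3, h4⟩ := hF.exists_common H H' hx
  funext j
  have h5 := Submodule.sub_mem _ h3 h1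
  rw [sub_sub_sub_cancel_left, ← Finset.sum_sub_distrib] at h5
  simp only [← smul_sub] at h5
  have h6 := hF.mem_one_iff.1 (hF.indep n r hr (fun j => a j - a' j) h5 j) x hxW
  rwa [map_sub, h2, h4, sub_eq_zero] at h6

theorem hasSymbol_zero {V : Opens X} {t : Sec P.alg V} (ht : t ∈ F V (n + 1)) :
    HasSymbol M F n r V t 0 := fun x hx =>
  ⟨V, le_rfl, hx, 0, by simpa [res_self] using ht, fun j => map_zero _⟩

theorem mem_of_hasSymbol_zero {V : Opens X} {t : Sec P.alg V} (H : HasSymbol M F n r V t 0) :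
    t ∈ F V (n + 1) := hF.mem_of_local fun x hx => by
  obtain ⟨W, hW, hxW, a, h1, h2⟩ := H x hx
  refine ⟨W, hW, hxW, ?_⟩
  have h3 : ∑ j, r j • a j ∈ F W (n + 1) := Submodule.sum_mem _ fun j _ => by
    have : a j ∈ F W 1 := hF.mem_one_iff.2 fun y hy => by
      rw [AffModel.sy_const hy hxW, h2]; rfl
    have := hF.smul_mem (hr.mem j) this
    rwa [add_comm] at this
  simpa using Submodule.add_mem _ h1 h3

theorem exists_hasSymbol {V : Opens X} {t : Sec P.alg V} (ht : t ∈ F V n) :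
    ∃ σ, HasSymbol M F n r V t σ ∧ ∀ j, M.IsReg V (σ j) := by
  by_cases hV : ∃ x, x ∈ V
  · obtain ⟨x, hx⟩ := hV
    have key : ∀ y ∈ V, ∃ (W : Opens X) (h : W ≤ V) (hy : y ∈ W) (a : ι → Sec P.alg W),
      res P.alg h t - ∑ j, r j • a j ∈ F W (n + 1) := fun y hy => hF.gen ht r hr y hy
    choose W hW hxW a ha using key
    have hs : ∀ y (hy : y ∈ V), HasSymbol M F n r (W y hy) (res P.alg (hW y hy) t)
        (fun j => M.sy P (hxW y hy) (a y hy j)) := fun y hy z hz =>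
      ⟨W y hy, le_rfl, hz, a y hy, by rw [res_self]; exact ha y hy,
        fun j => AffModel.sy_const _ _ _⟩
    have e : ∀ y (hy : y ∈ V) j, M.sy P (hxW y hy) (a y hy j) = M.sy P (hxW x hx) (a x hx j) := by
      intro y hy j
      obtain ⟨z, hz, hz'⟩ := M.nonempty_inter (hxW y hy) (hxW x hx)
      have h1 := hF.hasSymbol_res (inf_le_left : W y hy ⊓ W x hx ≤ _) (hs y hy)
      have h2 := hF.hasSymbol_res (inf_le_right : W y hy ⊓ W x hx ≤ _) (hs x hx)
      rw [res_res] at h1 h2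
      exact congrFun (hF.hasSymbol_unique hr h1 h2 (x := z) ⟨hz, hz'⟩) j
    refine ⟨fun j => M.sy P (hxW x hx) (a x hx j), fun y hy =>
      ⟨W y hy, hW y hy, hxW y hy, a y hy, ha y hy, e y hy⟩, fun j y hy => ?_⟩
    have := AffModel.isReg_sy (M := M) (hxW y hy) (a y hy j) y (hxW y hy)
    rwa [e y hy] at this
  · exact ⟨0, fun x hx => absurd ⟨x, hx⟩ hV, fun _ x hx => absurd ⟨x, hx⟩ hV⟩

omit hr

theorem exists_section_local {V : Opens X} {σ : ι → M.L} (h : ∀ j, M.IsReg V (σ j)) {x : X}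
    (hx : x ∈ V) : ∃ (W : Opens X) (_ : W ≤ V) (_ : x ∈ W) (a : ι → Sec P.alg W),
      ∀ (y : X) (hy : y ∈ W) j, M.sy P hy (a j) = σ j := by
  have key : ∀ j, ∃ (W : Opens X) (_ : W ≤ V) (hx : x ∈ W) (a : Sec P.alg W),
      M.sy P hx a = σ j := fun j => by
    obtain ⟨g, hg⟩ := M.exists_section V (σ j) (h j)
    obtain ⟨W, hW, hxW, t, ht⟩ := hF.exists_sy_eq V g x hx
    exact ⟨W, hW, hxW, t, ht.trans (hg ⟨x, hx⟩)⟩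
  choose W hW hxW a ha using key
  refine ⟨V ⊓ Finset.univ.inf W, inf_le_left, ⟨hx, ?_⟩, fun j => res P.alg
    (inf_le_right.trans (Finset.inf_le (Finset.mem_univ j))) (a j), fun y hy j => ?_⟩
  · have : ∀ s : Finset ι, x ∈ s.inf W := fun s => by
      classical
      induction s using Finset.induction_on with
      | empty => rw [Finset.inf_empty]; trivial
      | insert a s _ ih => rw [Finset.inf_insert]; exact ⟨hxW a, ih⟩
    exact this _
  · rw [AffModel.sy_res, AffModel.sy_const _ (hxW j), ha]

end IsFormal

end Formal

section Lift

variable {K R : Type u} [Field K] [CommRing R] [Algebra K R] [IsLocalRing R] {X : TopCat.{u}}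
  {O : TopCat.Presheaf (CommAlgCat.{u} K) X} {M : AffModel O} {P : PreSheafDef K R O}
  {F : ∀ V : Opens X, ℕ → Submodule R (Sec P.alg V)}

namespace IsFormal

/-- A family of local sections over a neighbourhood of each point of `V`, compatible modulo `F n`. -/
structure Approx (P : PreSheafDef K R O) (F : ∀ V : Opens X, ℕ → Submodule R (Sec P.alg V))
    (V : Opens X) (n : ℕ) where
  W : V → Opens X
  le : ∀ x, W x ≤ V
  mem : ∀ x, x.1 ∈ W x
  τ : ∀ x, Sec P.alg (W x)
  compat : ∀ x y, res P.alg (inf_le_left : W x ⊓ W y ≤ W x) (τ x) -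
    res P.alg (inf_le_right : W x ⊓ W y ≤ W y) (τ y) ∈ F (W x ⊓ W y) n

/-- The Čech cocycle `σ k l = h k - h l` on the basic open sets `D (g k)`. -/
theorem exists_cobound {κ ι : Type u} [Fintype κ] [Fintype ι] {f : O.obj (op ⊤)}
    {g : κ → O.obj (op ⊤)} (hg : ∀ k, M.D (g k) ≤ M.D f)
    (hne : ∀ k, ∃ x, x ∈ M.D (g k)) (hcov : ∀ x ∈ M.D f, ∃ k, x ∈ M.D (g k))
    (σ : κ → κ → ι → M.L) (hσ : ∀ k l j, M.IsReg (M.D (g k * g l)) (σ k l j))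
    (hc : ∀ k l m, σ k l + σ l m = σ k m) :
    ∃ h : κ → ι → M.L, (∀ k j, M.IsReg (M.D (g k)) (h k j)) ∧ ∀ k l, h k - h l = σ k l := by
  by_cases hf : ∃ x, x ∈ M.D f
  swap
  · have hκ : ∀ k : κ, False := fun k => by
      obtain ⟨x, hx⟩ := hne k
      exact hf ⟨x, hg k hx⟩
    exact ⟨fun k => (hκ k).elim, fun k => (hκ k).elim, fun k => (hκ k).elim⟩
  obtain ⟨N, hN⟩ : ∃ N : ℕ, ∀ k l j, ∃ c, M.lam (g k * g l) ^ N * σ k l j = M.lam c := by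
    have : ∀ k l j, ∃ N : ℕ, ∀ m ≥ N, ∃ c, M.lam (g k * g l) ^ m * σ k l j = M.lam c :=
      fun k l j => (hσ k l j).exists_pow_mul
    choose N hN using this
    refine ⟨Finset.univ.sup fun k => Finset.univ.sup fun l => Finset.univ.sup fun j => N k l j,
      fun k l j => hN k l j _ ?_⟩
    refine le_trans ?_ (Finset.le_sup (Finset.mem_univ k))
    refine le_trans ?_ (Finset.le_sup (Finset.mem_univ l))
    exact Finset.le_sup (f := fun j => N k l j) (Finset.mem_univ j)
  choose c hc' using hN
  obtain ⟨N', hN'⟩ := (M.D_le_iff f (Set.range fun k => g k ^ N)).1 fun x hx => by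
    obtain ⟨k, hk⟩ := hcov x hx
    exact ⟨g k ^ N, ⟨k, rfl⟩, AffModel.mem_D_pow hk N⟩
  rw [Ideal.span, Submodule.mem_span_range_iff_exists_fun] at hN'
  obtain ⟨e, he⟩ := hN'
  obtain ⟨x₀, hx₀⟩ := hf
  obtain ⟨φ, hφ⟩ := M.isUnit_lam (AffModel.mem_D_pow hx₀ N')
  have he' : ∑ k, M.lam (e k) * M.lam (g k) ^ N = (φ : M.L) := by
    rw [hφ, ← he, map_sum]
    simp only [smul_eq_mul, map_mul, map_pow]
  refine ⟨fun k j => ↑φ⁻¹ * ∑ l, M.lam (e l) * M.lam (g l) ^ N * σ k l j, fun k j x hx => ?_,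
    fun k m => ?_⟩
  · refine ⟨f ^ N' * g k ^ N, ∑ l, e l * c k l j, AffModel.mem_D_mul
      (AffModel.mem_D_pow (hg k hx) _) (AffModel.mem_D_pow hx _), ?_⟩
    beta_reduce
    rw [map_mul, ← hφ, map_pow, map_sum, Finset.mul_sum, Finset.mul_sum]
    refine Finset.sum_congr rfl fun l _ => ?_
    rw [map_mul, ← hc', map_mul, mul_pow]
    have := φ.mul_inv
    calc _ = (φ * ↑φ⁻¹ : M.L) *
          (M.lam (e l) * (M.lam (g k) ^ N * M.lam (g l) ^ N * σ k l j)) := by ring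
      _ = _ := by rw [this, one_mul]
  · funext j
    simp only [Pi.sub_apply]
    rw [← mul_sub, ← Finset.sum_sub_distrib]
    have : ∀ l, M.lam (e l) * M.lam (g l) ^ N * σ k l j - M.lam (e l) * M.lam (g l) ^ N * σ m l j =
        (M.lam (e l) * M.lam (g l) ^ N) * σ k m j := fun l => by
      rw [← hc k m l, Pi.add_apply]; ring
    simp only [this]
    rw [← Finset.sum_mul, he', ← mul_assoc, φ.inv_mul, one_mul]

variable (hF : IsFormal M P F) {ι : Type u} [Fintype ι] {n : ℕ} {r : ι → R}
include hF

theorem Approx.exists_lift [IsNoetherianRing R] {f : O.obj (op ⊤)} (T : Approx P F (M.D f) n) :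
    ∃ T' : Approx P F (M.D f) (n + 1), ∀ x y,
      res P.alg (inf_le_left : T'.W x ⊓ T.W y ≤ T'.W x) (T'.τ x) -
        res P.alg (inf_le_right : T'.W x ⊓ T.W y ≤ T.W y) (T.τ y) ∈ F (T'.W x ⊓ T.W y) n := by
  obtain ⟨ι, _, r, hr⟩ := exists_isMinGen (R := R) n
  have hb : ∀ x : M.D f, ∃ c, x.1 ∈ M.D c ∧ M.D c ≤ T.W x := fun x => M.D_basis (T.mem x)
  choose g hxg hg using hb
  obtain ⟨N, hN⟩ := (M.D_le_iff f (Set.range g)).1 fun x hx => ⟨g ⟨x, hx⟩, ⟨_, rfl⟩, hxg ⟨x, hx⟩⟩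
  obtain ⟨S, hS, hNS⟩ := Submodule.mem_span_finite_of_mem_span hN
  have hcov : ∀ x ∈ M.D f, ∃ c : S, x ∈ M.D c.1 := fun x hx => by
    obtain ⟨c, hc, hxc⟩ := (M.D_le_iff f (S : Set (O.obj (op ⊤)))).2 ⟨N, hNS⟩ x hx
    exact ⟨⟨c, hc⟩, hxc⟩
  have hp : ∀ c : S, ∃ x, g x = c.1 := fun c => hS c.2
  choose p hp using hp
  have hD : ∀ c : S, M.D c.1 ≤ T.W (p c) := fun c => by rw [← hp]; exact hg _
  have hm : ∀ c : S, ∃ x, x ∈ M.D c.1 := fun c => ⟨_, by rw [← hp]; exact hxg (p c)⟩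
  let τ : ∀ c : S, Sec P.alg (M.D c.1) := fun c => res P.alg (hD c) (T.τ (p c))
  have hτ : ∀ (c d : S) (Z : Opens X) (h : Z ≤ M.D c.1) (h' : Z ≤ M.D d.1),
      res P.alg h (τ c) - res P.alg h' (τ d) ∈ F Z n := fun c d Z h h' => by
    have := hF.res_mem (le_inf (h.trans (hD c)) (h'.trans (hD d))) (T.compat (p c) (p d))
    simpa only [map_sub, res_res, τ] using this
  have hl : ∀ c d : S, M.D (c.1 * d.1) ≤ M.D c.1 := fun c d => by rw [M.D_mul]; exact inf_le_left
  have hl' : ∀ c d : S, M.D (c.1 * d.1) ≤ M.D d.1 := fun c d => by rw [M.D_mul]; exact inf_le_right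
  have hσ := fun c d : S => hF.exists_hasSymbol hr (hτ c d _ (hl c d) (hl' c d))
  choose σ hσ hσr using hσ
  obtain ⟨h, hh, hhσ⟩ := exists_cobound (M := M) (κ := S) (f := f) (g := fun c => c.1)
    (fun c => (hD c).trans (T.le _)) hm hcov σ hσr fun a b c => by
      obtain ⟨x, hx⟩ := hm a
      obtain ⟨y, hy⟩ := hm b
      obtain ⟨w, hw⟩ := hm c
      obtain ⟨z, hz1, hz2⟩ := M.nonempty_inter hx hy
      obtain ⟨v, ⟨hv1, hv2⟩, hv3⟩ := M.nonempty_inter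
        (show z ∈ M.D a.1 ⊓ M.D b.1 from ⟨hz1, hz2⟩) hw
      have i1 : M.D a.1 ⊓ M.D b.1 ⊓ M.D c.1 ≤ M.D (a.1 * b.1) := by
        rw [M.D_mul]; exact inf_le_left
      have i2 : M.D a.1 ⊓ M.D b.1 ⊓ M.D c.1 ≤ M.D (b.1 * c.1) := by
        rw [M.D_mul]; exact inf_le_inf_right _ inf_le_right
      have i3 : M.D a.1 ⊓ M.D b.1 ⊓ M.D c.1 ≤ M.D (a.1 * c.1) := by
        rw [M.D_mul]; exact inf_le_inf_right _ inf_le_left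
      have s1 := hF.hasSymbol_add (hF.hasSymbol_res i1 (hσ a b)) (hF.hasSymbol_res i2 (hσ b c))
      have s3 := hF.hasSymbol_res i3 (hσ a c)
      simp only [map_sub, res_res, sub_add_sub_cancel] at s1 s3
      exact hF.hasSymbol_unique hr s1 s3 (x := v) ⟨⟨hv1, hv2⟩, hv3⟩
  choose k hk using fun x : M.D f => hcov x.1 x.2
  have ha := fun x : M.D f => hF.exists_section_local (hh (k x)) (hk x)
  choose W hW hxW a ha using ha
  have hs : ∀ x, HasSymbol M F n r (W x) (∑ j, r j • a x j) (h (k x)) := fun x =>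
    hF.hasSymbol_sum (a x) (ha x)
  have hra : ∀ x, ∑ j, r j • a x j ∈ F (W x) n := fun x => Submodule.sum_mem _ fun j _ => by
    have := hF.smul_mem (hr.mem j) (hF.mem_zero _ (a x j))
    rwa [zero_add] at this
  refine ⟨⟨W, fun x => (hW x).trans ((hD _).trans (T.le _)), hxW,
    fun x => res P.alg (hW x) (τ (k x)) - ∑ j, r j • a x j, fun x y => ?_⟩, fun x y => ?_⟩
  · refine hF.mem_of_hasSymbol_zero hr ?_
    have i1 : W x ⊓ W y ≤ M.D ((k x).1 * (k y).1) := by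
      rw [M.D_mul]; exact inf_le_inf (hW x) (hW y)
    have s1 := hF.hasSymbol_res i1 (hσ (k x) (k y))
    have s2 := hF.hasSymbol_res (inf_le_left : W x ⊓ W y ≤ W x) (hs x)
    have s3 := hF.hasSymbol_res (inf_le_right : W x ⊓ W y ≤ W y) (hs y)
    have s4 := hF.hasSymbol_sub s1 (hF.hasSymbol_sub s2 s3)
    rw [hhσ, sub_self] at s4
    convert s4 using 1
    simp only [map_sub, res_res]
    abel
  · have h1 := hF.res_mem (le_inf (inf_le_left.trans ((hW x).trans (hD _))) inf_le_right :
      W x ⊓ T.W y ≤ T.W (p (k x)) ⊓ T.W y) (T.compat (p (k x)) y)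
    have h2 := hF.res_mem (inf_le_left : W x ⊓ T.W y ≤ W x) (hra x)
    convert Submodule.sub_mem _ h1 h2 using 1
    simp only [map_sub, res_res, τ]
    abel

theorem exists_of_approx [IsNoetherianRing R] {f : O.obj (op ⊤)} (T : Approx P F (M.D f) n) :
    ∃ t : Sec P.alg (M.D f), ∀ x, res P.alg (T.le x) t - T.τ x ∈ F (T.W x) n := by
  choose L hL using fun (m : ℕ) (T : Approx P F (M.D f) m) => Approx.exists_lift hF T
  let S : ∀ m, Approx P F (M.D f) (n + m) := fun m => Nat.rec T (fun m S => L (n + m) S) m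
  let S' : ∀ m, Approx P F (M.D f) m := fun m =>
    ⟨(S m).W, (S m).le, (S m).mem, (S m).τ,
      fun x y => hF.antitone _ (Nat.le_add_left m n) ((S m).compat x y)⟩
  obtain ⟨t, ht⟩ := hF.glue (M.D f) (fun m => (S m).W) (fun m => (S m).le) (fun m => (S m).mem)
    (fun m => (S m).τ) (fun m => (S' m).compat)
    (fun m x => hF.antitone _ (Nat.le_add_left m n) (hL (n + m) (S m) x x))
  have key : ∀ m x y, res P.alg (inf_le_left : (S m).W x ⊓ T.W y ≤ _) ((S m).τ x) -
      res P.alg (inf_le_right : (S m).W x ⊓ T.W y ≤ _) (T.τ y) ∈ F ((S m).W x ⊓ T.W y) n := by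
    intro m
    induction m with
    | zero => exact T.compat
    | succ m ih =>
      intro x y
      refine hF.mem_of_local fun z hz => ?_
      have hzf : z ∈ M.D f := T.le y hz.2
      refine ⟨((S (m + 1)).W x ⊓ T.W y) ⊓ (S m).W ⟨z, hzf⟩, inf_le_left, ⟨hz, (S m).mem _⟩, ?_⟩
      have h1 := hF.res_mem (le_inf (inf_le_left.trans inf_le_left) inf_le_right :
        ((S (m + 1)).W x ⊓ T.W y) ⊓ (S m).W ⟨z, hzf⟩ ≤ (S (m + 1)).W x ⊓ (S m).W ⟨z, hzf⟩)
        (hF.antitone _ (Nat.le_add_right n m) (hL (n + m) (S m) x ⟨z, hzf⟩))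
      have h2 := hF.res_mem (le_inf inf_le_right (inf_le_left.trans inf_le_right) :
        ((S (m + 1)).W x ⊓ T.W y) ⊓ (S m).W ⟨z, hzf⟩ ≤ (S m).W ⟨z, hzf⟩ ⊓ T.W y) (ih ⟨z, hzf⟩ y)
      have h3 := Submodule.add_mem _ h1 h2
      simp only [map_sub, res_res] at h3 ⊢
      convert h3 using 1
      change _ = res P.alg _ ((S (m + 1)).τ x) - _ + _
      abel
  refine ⟨t, fun y => hF.mem_of_local fun z hz => ?_⟩
  have hzf : z ∈ M.D f := T.le y hz
  refine ⟨(S n).W ⟨z, hzf⟩ ⊓ T.W y, inf_le_right, ⟨(S n).mem _, hz⟩, ?_⟩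
  have h1 := hF.res_mem (inf_le_left : (S n).W ⟨z, hzf⟩ ⊓ T.W y ≤ _) (ht n ⟨z, hzf⟩)
  have h3 := Submodule.add_mem _ h1 (key n ⟨z, hzf⟩ y)
  simp only [map_sub, res_res] at h3 ⊢
  convert h3 using 1
  abel

theorem exists_sy [IsNoetherianRing R] {f : O.obj (op ⊤)} {σ : M.L} (h : M.IsReg (M.D f) σ) :
    ∃ t : Sec P.alg (M.D f), ∀ x (hx : x ∈ M.D f), M.sy P hx t = σ := by
  have key := fun x : M.D f => hF.exists_section_local (ι := PUnit) (fun _ => h) x.2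
  choose W hW hxW a ha using key
  obtain ⟨t, ht⟩ := hF.exists_of_approx (n := 1) (f := f) ⟨W, hW, hxW, fun x => a x ⟨⟩, fun x y => by
    rw [hF.mem_one_iff]
    intro z hz
    rw [map_sub, AffModel.sy_res, AffModel.sy_res, ha, ha, sub_self]⟩
  refine ⟨t, fun x hx => ?_⟩
  have h1 := hF.mem_one_iff.1 (ht ⟨x, hx⟩) x (hxW ⟨x, hx⟩)
  rwa [map_sub, AffModel.sy_res, ha, sub_eq_zero] at h1

theorem exists_sy_lam [IsNoetherianRing R] (c : O.obj (op ⊤)) :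
    ∃ t : Sec P.alg ⊤, ∀ V x (hx : x ∈ V), M.sy P hx (res P.alg (le_top : V ≤ ⊤) t) = M.lam c := by
  obtain ⟨t, ht⟩ := hF.exists_sy (AffModel.isReg_lam (M := M) (M.D 1) c)
  have e : ⊤ ≤ M.D 1 := M.D_one.ge
  exact ⟨res P.alg e t, fun V x hx => by rw [AffModel.sy_res, AffModel.sy_res, ht]⟩

theorem flatFilt_basic [IsNoetherianRing R] (f : O.obj (op ⊤)) : FlatFilt (F (M.D f)) where
  antitone := hF.antitone _
  sep := hF.sep _
  complete s hs := by
    obtain ⟨t, ht⟩ := hF.glue (M.D f) (fun _ _ => M.D f) (fun _ _ => le_rfl) (fun _ x => x.2)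
      (fun n _ => s n) (fun n x y => by rw [sub_self]; exact Submodule.zero_mem _)
      (fun n x => by rw [← map_sub]; exact hF.res_mem _ (hs n))
    refine ⟨t, fun n => hF.mem_of_local fun x hx => ⟨M.D f, le_rfl, hx, ?_⟩⟩
    rw [res_self]
    have := ht n ⟨x, hx⟩
    rwa [res_self] at this
  mem_zero := hF.mem_zero _
  smul_mem := hF.smul_mem
  le_sup n t ht := by
    obtain ⟨ι, _, r, hr⟩ := exists_isMinGen (R := R) n
    obtain ⟨σ, hσ, hσr⟩ := hF.exists_hasSymbol hr ht
    choose b hb using fun j => hF.exists_sy (hσr j)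
    have h1 := hF.hasSymbol_sub hσ (hF.hasSymbol_sum b fun x hx j => hb j x hx)
    rw [sub_self] at h1
    have h2 := hF.mem_of_hasSymbol_zero hr h1
    refine Submodule.mem_sup.2 ⟨∑ j, r j • b j, Submodule.sum_mem _ fun j _ =>
      Submodule.smul_mem_smul (hr.mem j) trivial, _, h2, by abel⟩
  indep n ι _ r hr a ha := hF.indep n r hr a ha

theorem flatFilt_top [IsNoetherianRing R] : FlatFilt (F ⊤) := by
  have := hF.flatFilt_basic 1
  rwa [M.D_one] at this

theorem mem_of_unit_mul [IsNoetherianRing R] {V : Opens X} {s t : Sec P.alg V}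
    (hs : ∀ x (hx : x ∈ V), IsUnit (M.sy P hx s)) (h : s * t ∈ F V n) : t ∈ F V n := by
  by_cases hV : ∃ x, x ∈ V
  swap
  · exact hF.mem_of_local fun x hx => absurd ⟨x, hx⟩ hV
  obtain ⟨x, hx⟩ := hV
  suffices H : ∀ k ≤ n, t ∈ F V k from H n le_rfl
  intro k hk
  induction k with
  | zero => exact hF.mem_zero _ _
  | succ k ih =>
    obtain ⟨ι, _, r, hr⟩ := exists_isMinGen (R := R) k
    obtain ⟨σ, hσ, -⟩ := hF.exists_hasSymbol hr (ih (by omega))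
    have h1 := hF.hasSymbol_mul s (fun y hy => AffModel.sy_const (M := M) hy hx s) hσ
    have h2 := hF.hasSymbol_unique hr h1 (hF.hasSymbol_zero hr (hF.antitone V hk h)) hx
    have h3 : σ = 0 := funext fun j => (hs x hx).mul_right_eq_zero.1 (congrFun h2 j)
    rw [h3] at hσ
    exact hF.mem_of_hasSymbol_zero hr hσ

/-- Sections over a basic open set are fractions of global sections, up to any given order. -/
theorem exists_frac [IsNoetherianRing R] {f : O.obj (op ⊤)} (t : Sec P.alg (M.D f)) (n : ℕ) :
    ∃ (N : ℕ) (s a : Sec P.alg ⊤),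
      (∀ V x (hx : x ∈ V), M.sy P hx (res P.alg (le_top : V ≤ ⊤) s) = M.lam f ^ N) ∧
      res P.alg le_top s * t - res P.alg le_top a ∈ F (M.D f) n := by
  induction n with
  | zero => exact ⟨0, 1, 0, fun V x hx => by simp, hF.mem_zero _ _⟩
  | succ n ih =>
    obtain ⟨N, s, a, hs, ha⟩ := ih
    obtain ⟨ι, _, r, hr⟩ := exists_isMinGen (R := R) n
    obtain ⟨σ, hσ, hσr⟩ := hF.exists_hasSymbol hr ha
    obtain ⟨m, hm⟩ : ∃ m : ℕ, ∀ j, ∃ c, M.lam f ^ m * σ j = M.lam c := by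
      choose m hm using fun j => (hσr j).exists_pow_mul
      exact ⟨Finset.univ.sup m, fun j => hm j _ (Finset.le_sup (Finset.mem_univ j))⟩
    choose c hc using hm
    obtain ⟨s', hs'⟩ := hF.exists_sy_lam (f ^ m)
    choose b hb using fun j => hF.exists_sy_lam (c j)
    refine ⟨m + N, s' * s, s' * a + ∑ j, r j • b j, fun V x hx => ?_, ?_⟩
    · rw [map_mul, map_mul, hs', hs, map_pow, pow_add]
    · have h1 := hF.hasSymbol_mul (res P.alg le_top s') (fun x hx => hs' _ x hx) hσ
      have h2 := hF.hasSymbol_sum (n := n) (r := r) (fun j => res P.alg (le_top : M.D f ≤ ⊤) (b j))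
        fun x hx j => hb j _ x hx
      have h3 := hF.hasSymbol_sub h1 h2
      have h4 : (fun j => M.lam (f ^ m) * σ j) - (fun j => M.lam (c j)) = 0 := funext fun j => by
        rw [Pi.sub_apply, map_pow, hc, sub_self]; rfl
      rw [h4] at h3
      convert hF.mem_of_hasSymbol_zero hr h3 using 1
      simp only [map_mul, map_add, map_sum, map_smul]
      noncomm_ring

end IsFormal

end Lift

section Deformation

variable {K R : Type u} [Field K] [CommRing R] [Algebra K R] [IsLocalRing R] {X : TopCat.{u}}
  {O : TopCat.Presheaf (CommAlgCat.{u} K) X} {M : AffModel O} {P : PreSheafDef K R O}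
  {F : ∀ V : Opens X, ℕ → Submodule R (Sec P.alg V)} {κ : DefKind}

/-- A sheaf whose sections over the sets of a basis are flat has flat stalks. -/
theorem flat_stalk (𝒜 : TopCat.Presheaf (AlgCat.{u} R) X) {ι : Type*} (B : ι → Opens X)
    (hB : ∀ {V : Opens X} {x : X}, x ∈ V → ∃ i, x ∈ B i ∧ B i ≤ V)
    (h : ∀ i, Module.Flat R (Sec 𝒜 (B i))) (x : X) : Module.Flat R (Stalk 𝒜 x) := by
  refine Module.Flat.of_forall_isTrivialRelation fun {l f a} ha => ?_
  have key : ∀ s : Finset (Fin l), ∃ (V : Opens X) (hx : x ∈ V) (b : Fin l → Sec 𝒜 V),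
      ∀ i ∈ s, germ 𝒜 hx (b i) = a i := fun s => by
    induction s using Finset.induction_on with
    | empty => exact ⟨⊤, trivial, 0, fun i hi => absurd hi (Finset.notMem_empty i)⟩
    | insert i s hi ih =>
      obtain ⟨V, hx, b, hb⟩ := ih
      obtain ⟨W, hxW, c, hc⟩ := exists_germ 𝒜 (a i)
      refine ⟨V ⊓ W, ⟨hx, hxW⟩, Function.update (fun j => res 𝒜 inf_le_left (b j)) i
        (res 𝒜 inf_le_right c), fun j hj => ?_⟩
      by_cases e : j = i
      · subst e
        rw [Function.update_self]
        exact (germ_res 𝒜 _ _ _).trans hc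
      · rw [Function.update_of_ne e]
        exact (germ_res 𝒜 _ _ _).trans (hb j (Finset.mem_of_mem_insert_of_ne hj e))
  obtain ⟨V, hx, b, hb⟩ := key Finset.univ
  have h1 : germ 𝒜 hx (∑ i, f i • b i) = germ 𝒜 hx 0 := by
    rw [map_sum, map_zero, ← ha]
    exact Finset.sum_congr rfl fun i hi => by rw [map_smul, hb i hi]
  obtain ⟨Z, hZ, _, hxZ, e⟩ := germ_eq 𝒜 hx hx h1
  obtain ⟨i, hxi, hi⟩ := hB hxZ
  have := h i
  have h2 : ∑ j, f j • res 𝒜 (hi.trans hZ) (b j) = 0 := by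
    have := congrArg (res 𝒜 hi) e
    simpa only [res_res, map_sum, map_smul, map_zero] using this
  obtain ⟨k, c, y, h3, h4⟩ := Module.Flat.isTrivialRelation_of_sum_smul_eq_zero
    (R := R) (M := Sec 𝒜 (B i)) h2
  refine ⟨k, c, fun j => germ 𝒜 hxi (y j), fun j => ?_, h4⟩
  rw [← hb j (Finset.mem_univ j), ← germ_res 𝒜 (hi.trans hZ) hxi]
  refine (congrArg _ (h3 j)).trans ?_
  rw [map_sum]
  simp only [map_smul]

theorem quotient_tensor_eq {I : Ideal R} {A : Type u} [AddCommGroup A] [Module R A]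
    (t : (R ⧸ I) ⊗[R] A) : ∃ a, t = 1 ⊗ₜ a := by
  induction t using TensorProduct.induction_on with
  | zero => exact ⟨0, by simp⟩
  | add t t' ht ht' =>
    obtain ⟨a, rfl⟩ := ht
    obtain ⟨b, rfl⟩ := ht'
    exact ⟨a + b, by rw [TensorProduct.tmul_add]⟩
  | tmul c a =>
    obtain ⟨r, rfl⟩ := Ideal.Quotient.mk_surjective c
    refine ⟨r • a, ?_⟩
    rw [← TensorProduct.smul_tmul, Algebra.smul_def, mul_one]
    rfl

namespace IsFormal

variable (hF : IsFormal M P F)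
include hF

theorem sheafFilt_eq [IsNoetherianRing R] (V : Opens X) (n : ℕ) : sheafFilt P.alg V n = F V n := by
  refine le_antisymm (fun t ht => hF.mem_of_local fun x hx => ?_) fun t ht x hx => ?_
  · obtain ⟨W, hW, hxW, h⟩ := ht x hx
    refine ⟨W, hW, hxW, ?_⟩
    refine Submodule.smul_induction_on h (fun r hr m _ => ?_) fun a b => Submodule.add_mem _
    have := hF.smul_mem hr (hF.mem_zero W m)
    rwa [zero_add] at this
  · obtain ⟨c, hxc, hc⟩ := M.D_basis hx
    exact ⟨M.D c, hc, hxc, by rw [← (hF.flatFilt_basic c).eq_adicFilt]; exact hF.res_mem hc ht⟩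

theorem mem_iff [IsNoetherianRing R] {V : Opens X} {n : ℕ} {s : Sec P.alg V} :
    s ∈ F V n ↔ ∀ (x : X) (hx : x ∈ V), (1 : R ⧸ 𝔪 R ^ n) ⊗ₜ[R] germ P.alg hx s = 0 := by
  rw [← hF.sheafFilt_eq, mem_sheafFilt_iff]

theorem bijective_toComplSheaf [IsNoetherianRing R] (V : Opens X) :
    Function.Bijective (toComplSheaf P.alg R V) := by
  constructor
  · intro s t h
    rw [← sub_eq_zero]
    refine hF.sep V _ fun n => ?_
    rcases n with _ | n
    · exact hF.mem_zero _ _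
    · rw [hF.mem_iff]
      intro x hx
      rw [map_sub, TensorProduct.tmul_sub, sub_eq_zero]
      exact congrFun (congrFun (congrArg Subtype.val h) n) ⟨x, hx⟩
  · intro f
    have key : ∀ (n : ℕ) (x : V), ∃ (W : Opens X) (hW : W ≤ V) (_ : x.1 ∈ W) (t : Sec P.alg W),
        ∀ i, n = i + 1 → ∀ (y : X) (hy : y ∈ W), f.1 i ⟨y, hW hy⟩ = 1 ⊗ₜ germ P.alg hy t := by
      intro n x
      rcases n with _ | i
      · exact ⟨V, le_rfl, x.2, 0, fun i hi => by omega⟩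
      · obtain ⟨W, hW, hx, t, ht⟩ := f.2.1 i x
        obtain ⟨a, rfl⟩ := quotient_tensor_eq t
        refine ⟨W, hW, hx, a, fun j hj y hy => ?_⟩
        obtain rfl : i = j := by omega
        exact ht y hy
    choose W hW hxW τ hτ using key
    obtain ⟨t, ht⟩ := hF.glue V W hW hxW τ (fun n x y => by
        rcases n with _ | i
        · exact hF.mem_zero _ _
        rw [hF.mem_iff]
        intro z hz
        rw [map_sub, germ_res, germ_res, TensorProduct.tmul_sub, ← hτ (i + 1) x i rfl z hz.1,
          ← hτ (i + 1) y i rfl z hz.2, sub_self]) fun n x => by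
        rcases n with _ | i
        · exact hF.mem_zero _ _
        rw [hF.mem_iff]
        intro z hz
        rw [map_sub, germ_res, germ_res, TensorProduct.tmul_sub, ← hτ (i + 1) x i rfl z hz.2,
          ← f.2.2 i, hτ (i + 2) x (i + 1) rfl z hz.1, sub_eq_zero]
        change _ = Algebra.TensorProduct.map (transition R i) (AlgHom.id R (Stalk P.alg z)) _
        rw [Algebra.TensorProduct.map_tmul, map_one]
        rfl
    refine ⟨t, Subtype.ext (funext fun i => funext fun x => ?_)⟩
    have h1 := hF.mem_iff.1 (ht (i + 1) x) x.1 (hxW (i + 1) x)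
    rw [map_sub, germ_res, TensorProduct.tmul_sub, sub_eq_zero] at h1
    exact h1.trans (hτ (i + 1) x i rfl x.1 _).symm

theorem isSheaf : P.alg.IsSheaf := by
  rw [TopCat.Presheaf.isSheaf_iff_isSheaf_comp (forget (AlgCat.{u} R))]
  refine TopCat.Presheaf.isSheaf_of_isSheafUniqueGluing_types _ fun {ι} U sf hsf => ?_
  change ∀ i, Sec P.alg (U i) at sf
  have hsf' : ∀ i j, res P.alg (inf_le_left : U i ⊓ U j ≤ U i) (sf i) =
    res P.alg (inf_le_right : U i ⊓ U j ≤ U j) (sf j) := hsf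
  have hc : ∀ x : (iSup U : Opens X), ∃ i, x.1 ∈ U i := fun x => Opens.mem_iSup.1 x.2
  choose i hi using hc
  obtain ⟨t, ht⟩ := hF.glue (iSup U) (fun _ x => U (i x)) (fun _ x => le_iSup U (i x))
    (fun _ x => hi x) (fun _ x => sf (i x)) (fun n x y => by
      rw [hsf', sub_self]; exact Submodule.zero_mem _) fun n x => by
      rw [hsf', sub_self]; exact Submodule.zero_mem _
  have ht' : ∀ x, res P.alg (le_iSup U (i x)) t = sf (i x) := fun x =>
    sub_eq_zero.1 (hF.sep _ _ fun n => ht n x)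
  refine ⟨t, fun j => ?_, fun t' h' => ?_⟩
  · change res P.alg (le_iSup U j) t = sf j
    rw [← sub_eq_zero]
    refine hF.sep _ _ fun n => hF.mem_of_local fun x hx => ?_
    refine ⟨U j ⊓ U (i ⟨x, Opens.mem_iSup.2 ⟨j, hx⟩⟩), inf_le_left, ⟨hx, hi _⟩, ?_⟩
    have := congrArg (res P.alg (inf_le_right : U j ⊓ U (i ⟨x, Opens.mem_iSup.2 ⟨j, hx⟩⟩) ≤ _))
      (ht' ⟨x, Opens.mem_iSup.2 ⟨j, hx⟩⟩)
    rw [map_sub, res_res, hsf', ← this, res_res, sub_self]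
    exact Submodule.zero_mem _
  · suffices H : ∀ t' : Sec P.alg (iSup U), (∀ j, res P.alg (le_iSup U j) t' = sf j) → t' = t from
      H t' h'
    intro t' h'
    rw [← sub_eq_zero]
    refine hF.sep _ _ fun n => hF.mem_of_local fun x hx => ⟨U (i ⟨x, hx⟩), le_iSup U _, hi _, ?_⟩
    rw [map_sub, h', ht', sub_self]
    exact Submodule.zero_mem _

theorem one_tmul_germ_eq_zero [IsNoetherianRing R] {V : Opens X} {t : Sec P.alg V}
    (ht : t ∈ F V 1) {x : X} (hx : x ∈ V) : (1 : 𝕜 R) ⊗ₜ[R] germ P.alg hx t = 0 := by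
  rw [← hF.sheafFilt_eq] at ht
  obtain ⟨W, hW, hxW, h⟩ := ht x hx
  rw [← germ_res P.alg hW hxW]
  exact one_tmul_eq_zero (map_adicFilt (germ P.alg hxW).toLinearMap h)

theorem bijective_aug [IsNoetherianRing R] (V : Opens X) : Function.Bijective (P.aug V) := by
  constructor
  · rw [injective_iff_map_eq_zero]
    intro f hf
    refine Subtype.ext (funext fun x => ?_)
    obtain ⟨W, hW, hx, t, ht⟩ := f.2 x
    obtain ⟨a, rfl⟩ := residue_tensor_eq t
    refine (ht x.1 hx).trans (hF.one_tmul_germ_eq_zero (hF.mem_one_iff.2 fun y hy => ?_) hx)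
    have e : toSheafTensor P.alg (𝕜 R) W (1 ⊗ₜ a) = sheafTensorRes P.alg (𝕜 R) hW f :=
      Subtype.ext (funext fun z => (ht z.1 z.2).symm)
    rw [AffModel.sy_eq, e, P.aug_res, hf, map_zero, map_zero]
    rfl
  · intro h
    choose W hW hxW t ht using hF.exists_sy_eq V h
    have key : ∀ x (hx : x ∈ V) y (hy : y ∈ V) (hxy : y ∈ W x hx),
        (1 : 𝕜 R) ⊗ₜ[R] germ P.alg hxy (t x hx) = 1 ⊗ₜ germ P.alg (hxW y hy) (t y hy) := by
      intro x hx y hy hxy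
      have h1 : res P.alg (inf_le_left : W x hx ⊓ W y hy ≤ W x hx) (t x hx) -
          res P.alg (inf_le_right : W x hx ⊓ W y hy ≤ W y hy) (t y hy) ∈ F _ 1 := by
        rw [hF.mem_one_iff]
        intro z hz
        rw [map_sub, AffModel.sy_res, AffModel.sy_res, AffModel.sy_const _ (hxW x hx), ht,
          AffModel.sy_const _ (hxW y hy) (t y hy), ht, M.ev_const V h _ ⟨y, hy⟩, sub_self]
      have hy' : y ∈ W x hx ⊓ W y hy := ⟨hxy, hxW y hy⟩
      have h2 := hF.one_tmul_germ_eq_zero h1 hy'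
      rwa [map_sub, germ_res, germ_res, TensorProduct.tmul_sub, sub_eq_zero] at h2
    refine ⟨⟨fun x => 1 ⊗ₜ germ P.alg (hxW x.1 x.2) (t x.1 x.2), fun x =>
      ⟨W x.1 x.2, hW x.1 x.2, hxW x.1 x.2, 1 ⊗ₜ t x.1 x.2, fun y hy =>
        (key x.1 x.2 y (hW _ _ hy) hy).symm⟩⟩, ?_⟩
    refine M.ev_injective V (funext fun x => ?_)
    rw [← ht x.1 x.2, AffModel.sy_eq]
    refine (M.ev_res (hW x.1 x.2) _ ⟨x.1, hxW x.1 x.2⟩).symm.trans ?_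
    rw [← P.aug_res]
    refine congrFun (congrArg (M.ev _) (congrArg (P.aug _) (Subtype.ext (funext fun y => ?_)))) _
    exact (key x.1 x.2 y.1 (hW _ _ y.2) y.2).symm

theorem isDeformation [IsNoetherianRing R] (kind : ∀ V, IsBracketOfKind (P.br V) κ)
    (hbr : ∀ V x (hx : x ∈ V) a b, M.sy P hx (P.br V a b) = 0) : P.IsDeformation κ where
  isSheaf := hF.isSheaf
  kind := kind
  flat := flat_stalk P.alg M.D M.D_basis fun c => (hF.flatFilt_basic c).flat
  complete := hF.bijective_toComplSheaf
  bijective_aug := hF.bijective_aug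
  aug_br V a b := M.ev_injective V (funext fun x => by
    rw [map_zero]
    exact hbr V x.1 x.2 a b)

end IsFormal

end Deformation

section FlatIndep

variable {R : Type u} [CommRing R] [IsLocalRing R]

theorem IsMinGen.mem_smul_top_of_sum_eq_zero {ι : Type u} [Fintype ι] {n : ℕ} {r : ι → R}
    (hr : IsMinGen n r) {N : Type u} [AddCommGroup N] [Module R N] [Module (R ⧸ 𝔪 R ^ (n + 1)) N]
    [IsScalarTower R (R ⧸ 𝔪 R ^ (n + 1)) N] [Module.Flat (R ⧸ 𝔪 R ^ (n + 1)) N] {b : ι → N}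
    (h : ∑ j, r j • b j = 0) (j : ι) : b j ∈ 𝔪 R • (⊤ : Submodule R N) := by
  have h1 : ∑ j, Ideal.Quotient.mk (𝔪 R ^ (n + 1)) (r j) • b j = 0 := by
    rw [← h]
    exact Finset.sum_congr rfl fun j _ => algebraMap_smul (R ⧸ 𝔪 R ^ (n + 1)) (r j) (b j)
  obtain ⟨k, Z, y, h3, h4⟩ := Module.Flat.isTrivialRelation_of_sum_smul_eq_zero h1
  choose Z' hZ' using fun j k => Ideal.Quotient.mk_surjective (Z j k)
  have h5 : ∀ l j, Z' j l ∈ 𝔪 R := fun l => hr.indep (fun j => Z' j l) (by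
    rw [← Ideal.Quotient.eq_zero_iff_mem, map_sum, ← h4 l]
    refine Finset.sum_congr rfl fun j _ => ?_
    rw [map_mul, hZ', mul_comm])
  rw [h3 j]
  refine Submodule.sum_mem _ fun l _ => ?_
  rw [← hZ']
  have h7 := Submodule.smul_mem_smul (h5 l j) (Submodule.mem_top : y l ∈ (⊤ : Submodule R N))
  rwa [← algebraMap_smul (R ⧸ 𝔪 R ^ (n + 1)) (Z' j l) (y l)] at h7

theorem IsMinGen.mem_adicFilt_of_flat {ι : Type u} [Fintype ι] {n : ℕ} {r : ι → R}
    (hr : IsMinGen n r) {N : Type u} [AddCommGroup N] [Module R N] [Module.Flat R N] {b : ι → N}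
    (h : ∑ j, r j • b j ∈ adicFilt R N (n + 1)) (j : ι) : b j ∈ adicFilt R N 1 := by
  have h1 : ∑ j, r j • ((1 : R ⧸ 𝔪 R ^ (n + 1)) ⊗ₜ[R] b j) = 0 := by
    rw [← (one_tmul_eq_zero_iff (n + 1) _).2 h, TensorProduct.tmul_sum]
    simp only [TensorProduct.tmul_smul]
  have h2 := hr.mem_smul_top_of_sum_eq_zero h1 j
  have h3 := Submodule.mem_map_of_mem
    (f := (TensorProduct.quotTensorEquivQuotSMul N (𝔪 R ^ (n + 1))).toLinearMap) h2
  rw [Submodule.map_smul''] at h3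
  have h4 := Submodule.smul_mono (le_refl (𝔪 R)) le_top h3
  rw [← (Submodule.range_mkQ (𝔪 R ^ (n + 1) • (⊤ : Submodule R N))), ← Submodule.map_top,
    ← Submodule.map_smul''] at h4
  obtain ⟨z, hz, e⟩ := h4
  have e' : Submodule.Quotient.mk z =
      (Submodule.Quotient.mk (b j) : N ⧸ (𝔪 R ^ (n + 1) • (⊤ : Submodule R N))) := by
    refine e.trans ?_
    change TensorProduct.quotTensorEquivQuotSMul N (𝔪 R ^ (n + 1))
      ((Ideal.Quotient.mk (𝔪 R ^ (n + 1)) 1) ⊗ₜ[R] b j) = _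
    rw [TensorProduct.quotTensorEquivQuotSMul_mk_tmul, one_smul]
  rw [Submodule.Quotient.eq] at e'
  have h5 : z - b j ∈ adicFilt R N 1 :=
    Submodule.smul_mono_left (Ideal.pow_le_pow_right (Nat.succ_le_succ (Nat.zero_le n))) e'
  have h6 : z ∈ adicFilt R N 1 := by rw [adicFilt, pow_one]; exact hz
  simpa using Submodule.sub_mem _ h6 h5

theorem IsMinGen.exists_sub_sum_mem {ι : Type u} [Fintype ι] {n : ℕ} {r : ι → R}
    (hr : IsMinGen n r) {N : Type u} [AddCommGroup N] [Module R N] {x : N}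
    (hx : x ∈ adicFilt R N n) : ∃ a : ι → N, x - ∑ j, r j • a j ∈ adicFilt R N (n + 1) := by
  refine Submodule.smul_induction_on hx (fun s hs m _ => ?_) fun x y hx hy => ?_
  · obtain ⟨c, hc⟩ := hr.exists_sub_mem s hs
    refine ⟨fun j => c j • m, ?_⟩
    rw [adicFilt]
    convert Submodule.smul_mem_smul hc (Submodule.mem_top : m ∈ (⊤ : Submodule R N)) using 1
    rw [sub_smul, Finset.sum_smul]
    exact congrArg _ (Finset.sum_congr rfl fun j _ => by rw [smul_smul, mul_comm])
  · obtain ⟨a, ha⟩ := hx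
    obtain ⟨b, hb⟩ := hy
    refine ⟨a + b, ?_⟩
    convert Submodule.add_mem _ ha hb using 1
    simp only [Pi.add_apply, smul_add, Finset.sum_add_distrib]
    abel

theorem one_tmul_residue_eq_zero_iff {A : Type u} [AddCommGroup A] [Module R A] {a : A} :
    (1 : 𝕜 R) ⊗ₜ[R] a = 0 ↔ a ∈ adicFilt R A 1 := by
  have h := (TensorProduct.quotTensorEquivQuotSMul A (𝔪 R)).map_eq_zero_iff
    (x := (Ideal.Quotient.mk (𝔪 R) 1) ⊗ₜ[R] a)
  rw [TensorProduct.quotTensorEquivQuotSMul_mk_tmul, one_smul, Submodule.Quotient.mk_eq_zero] at h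
  rw [adicFilt, pow_one, h]
  rfl

end FlatIndep

section SheafDefFormal

variable {K R : Type u} [Field K] [CommRing R] [Algebra K R] [IsLocalRing R] {X : TopCat.{u}}
  {O : TopCat.Presheaf (CommAlgCat.{u} K) X} (M : AffModel O) {κ : DefKind}

theorem adicFilt_le_sheafFilt (𝒜 : TopCat.Presheaf (AlgCat.{u} R) X) (V : Opens X) (n : ℕ) :
    adicFilt R (Sec 𝒜 V) n ≤ sheafFilt 𝒜 V n := fun t ht x hx =>
  ⟨V, le_rfl, hx, by rwa [res_self]⟩

theorem SheafDef.sy_eq_zero_iff (𝒜 : SheafDef K R O κ) {V : Opens X} {t : Sec 𝒜.alg V} :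
    t ∈ sheafFilt 𝒜.alg V 1 ↔ ∀ (x : X) (hx : x ∈ V), M.sy 𝒜.toPreSheafDef hx t = 0 := by
  have h1 : (∀ (x : X) (hx : x ∈ V), M.sy 𝒜.toPreSheafDef hx t = 0) ↔
      toSheafTensor 𝒜.alg (𝕜 R) V (1 ⊗ₜ t) = 0 := by
    rw [← (𝒜.isDeformation.bijective_aug V).1.eq_iff, map_zero, ← (M.ev_injective V).eq_iff,
      map_zero]
    exact ⟨fun h => funext fun x => h x.1 x.2, fun h x hx => congrFun h ⟨x, hx⟩⟩
  rw [h1, mem_sheafFilt_iff]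
  simp only [one_tmul_eq_zero_iff, ← one_tmul_residue_eq_zero_iff]
  exact ⟨fun h => Subtype.ext (funext fun x => h x.1 x.2),
    fun h x hx => congrFun (congrArg Subtype.val h) ⟨x, hx⟩⟩

theorem SheafDef.isFormal (𝒜 : SheafDef K R O κ) :
    IsFormal M 𝒜.toPreSheafDef (sheafFilt 𝒜.alg) where
  mem_zero V := (𝒜.isFiltBracket V).mem_zero
  antitone V := (𝒜.isFiltBracket V).antitone
  sep V := (𝒜.isFiltBracket V).sep
  res_mem h := res_sheafFilt 𝒜.alg h
  mem_of_local {V n t} h x hx := by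
    obtain ⟨W, hW, hxW, h1⟩ := h x hx
    obtain ⟨Z, hZ, hxZ, h2⟩ := h1 x hxW
    exact ⟨Z, hZ.trans hW, hxZ, by rwa [res_res] at h2⟩
  smul_mem {V i n r t} hr ht x hx := by
    obtain ⟨W, hW, hxW, h1⟩ := ht x hx
    refine ⟨W, hW, hxW, ?_⟩
    rw [map_smul, adicFilt, add_comm, pow_add, Submodule.mul_smul]
    exact Submodule.smul_mem_smul hr h1
  mul_mem {V n} s t ht := by
    have := sheafFilt_mul 𝒜.alg ((𝒜.isFiltBracket V).mem_zero s) ht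
    rwa [zero_add] at this
  glue V W hW hxW τ h1 h2 := by
    simp only [mem_sheafFilt_iff, map_sub, TensorProduct.tmul_sub, sub_eq_zero] at h1 h2
    have h1' : ∀ n x y z (hx : z ∈ W n x) (hy : z ∈ W n y), (1 : R ⧸ 𝔪 R ^ n) ⊗ₜ[R]
        germ 𝒜.alg hx (τ n x) = 1 ⊗ₜ germ 𝒜.alg hy (τ n y) := fun n x y z hx hy => by
      have hz : z ∈ W n x ⊓ W n y := ⟨hx, hy⟩
      have := h1 n x y z hz
      rwa [germ_res, germ_res] at this
    have h2' : ∀ n x z (hx : z ∈ W (n + 1) x) (hy : z ∈ W n x), (1 : R ⧸ 𝔪 R ^ n) ⊗ₜ[R]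
        germ 𝒜.alg hx (τ (n + 1) x) = 1 ⊗ₜ germ 𝒜.alg hy (τ n x) := fun n x z hx hy => by
      have hz : z ∈ W (n + 1) x ⊓ W n x := ⟨hx, hy⟩
      have := h2 n x z hz
      rwa [germ_res, germ_res] at this
    obtain ⟨t, ht⟩ := (𝒜.isDeformation.complete V).2
      ⟨fun i x => 1 ⊗ₜ germ 𝒜.alg (hxW (i + 1) x) (τ (i + 1) x), fun i x =>
        ⟨W (i + 1) x, hW _ _, hxW _ _, 1 ⊗ₜ τ (i + 1) x, fun y hy =>
          h1' (i + 1) ⟨y, hW _ _ hy⟩ x y (hxW _ ⟨y, hW _ _ hy⟩) hy⟩, fun i x => by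
        beta_reduce
        rw [← h2' (i + 1) x x.1 (hxW _ _) (hxW _ _)]
        change Algebra.TensorProduct.map (transition R i) (AlgHom.id R (Stalk 𝒜.alg x.1)) _ = _
        rw [Algebra.TensorProduct.map_tmul, map_one]
        rfl⟩
    refine ⟨t, fun n x => ?_⟩
    rcases n with _ | i
    · exact (𝒜.isFiltBracket _).mem_zero _
    rw [mem_sheafFilt_iff]
    intro y hy
    rw [map_sub, germ_res, TensorProduct.tmul_sub, sub_eq_zero]
    exact (congrFun (congrFun (congrArg Subtype.val ht) i) ⟨y, hW _ _ hy⟩).trans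
      (h1' (i + 1) ⟨y, hW _ _ hy⟩ x y (hxW _ ⟨y, hW _ _ hy⟩) hy)
  mem_one_iff := 𝒜.sy_eq_zero_iff M
  exists_sy_eq V h x hx := by
    obtain ⟨f, rfl⟩ := (𝒜.isDeformation.bijective_aug V).2 h
    obtain ⟨W, hW, hxW, t, ht⟩ := f.2 ⟨x, hx⟩
    obtain ⟨a, rfl⟩ := residue_tensor_eq t
    refine ⟨W, hW, hxW, a, ?_⟩
    have e : toSheafTensor 𝒜.alg (𝕜 R) W (1 ⊗ₜ a) = sheafTensorRes 𝒜.alg (𝕜 R) hW f :=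
      Subtype.ext (funext fun z => (ht z.1 z.2).symm)
    rw [AffModel.sy_eq, e, 𝒜.aug_res]
    exact M.ev_res hW _ ⟨x, hxW⟩
  gen {V n t} ht ι _ r hr x hx := by
    obtain ⟨W, hW, hxW, h1⟩ := ht x hx
    obtain ⟨a, ha⟩ := hr.exists_sub_sum_mem h1
    exact ⟨W, hW, hxW, a, adicFilt_le_sheafFilt 𝒜.alg W _ ha⟩
  indep {V} n ι _ r hr a ha j := by
    have := 𝒜.isDeformation.flat
    simp only [mem_sheafFilt_iff, one_tmul_eq_zero_iff] at ha ⊢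
    intro x hx
    have h1 := ha x hx
    rw [map_sum] at h1
    simp only [map_smul] at h1
    exact hr.mem_adicFilt_of_flat h1 j

variable [IsNoetherianRing R]
include M

theorem SheafDef.sheafFilt_top_eq (𝒜 : SheafDef K R O κ) :
    sheafFilt 𝒜.alg ⊤ = adicFilt R (Sec 𝒜.alg ⊤) :=
  funext fun n => (𝒜.isFormal M).flatFilt_top.eq_adicFilt n

theorem gammaPreserves : GammaPreserves K R O κ := fun 𝒜 => by
  have hF := 𝒜.isFormal M
  refine ⟨⟨𝒜.isDeformation.kind ⊤, hF.flatFilt_top.flat, hF.flatFilt_top.isAdicComplete,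
    ⟨?_, fun h => ?_⟩, 𝒜.isDeformation.aug_br ⊤⟩, fun a ha => by
      rwa [𝒜.sheafFilt_top_eq M] at ha⟩
  · rw [injective_iff_map_eq_zero]
    intro t ht
    obtain ⟨a, rfl⟩ := residue_tensor_eq t
    change Sec 𝒜.alg ⊤ at a
    have h1 : a ∈ sheafFilt 𝒜.alg ⊤ 1 := (𝒜.sy_eq_zero_iff M).2 fun x hx => by
      have h2 : 𝒜.aug ⊤ (toSheafTensor 𝒜.alg (𝕜 R) ⊤ (1 ⊗ₜ a)) = 0 := ht
      rw [AffModel.sy_eq, h2, map_zero]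
      rfl
    rw [𝒜.sheafFilt_top_eq M] at h1
    exact one_tmul_eq_zero h1
  · obtain ⟨t, ht⟩ := hF.exists_sy_lam h
    refine ⟨1 ⊗ₜ t, M.ev_injective ⊤ (funext fun x => ?_)⟩
    have h1 := ht ⊤ x.1 x.2
    rw [res_self] at h1
    exact h1.trans (M.ev_top h x).symm

variable [CharZero K]

theorem isMorphism_gamma (h : GammaPreserves K R O κ) : (gamma h).IsMorphism where
  map₂_mul {𝒜} a b := Subtype.ext (congrArg
    (fun F => bch K F ((SheafDef.toPreSheafDef 𝒜).br ⊤) a.1 b.1) (SheafDef.sheafFilt_top_eq M 𝒜))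
  map₂_twist g a := rfl
  map_feedback {𝒜} a := AlgGauge.ext (AlgEquiv.ext fun b => (congrArg
      (fun F => expAd K F ((SheafDef.toPreSheafDef 𝒜).br ⊤)
        (res (SheafDef.toPreSheafDef 𝒜).alg le_rfl a.1) b) (SheafDef.sheafFilt_top_eq M 𝒜)).trans
    (congrArg (fun c => expAd K (adicFilt R (Sec (SheafDef.toPreSheafDef 𝒜).alg ⊤))
      ((SheafDef.toPreSheafDef 𝒜).br ⊤) c b) (res_self _ _ _)))

theorem bijective_map₂_gamma (h : GammaPreserves K R O κ) (𝒜 : SheafDef K R O κ) :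
    Function.Bijective ((gamma h).map₂ (x := 𝒜)) := by
  constructor
  · intro a b hab
    exact Subtype.ext (congrArg (fun c => c.1) hab)
  · intro a
    exact ⟨⟨a.1, by rw [SheafDef.sheafFilt_top_eq M]; exact a.2⟩, rfl⟩

end SheafDefFormal

section Fractions

variable {K R : Type u} [Field K] [CommRing R] [Algebra K R] [IsLocalRing R] {X : TopCat.{u}}
  {O : TopCat.Presheaf (CommAlgCat.{u} K) X} {M : AffModel O} {P : PreSheafDef K R O}
  {F : ∀ V : Opens X, ℕ → Submodule R (Sec P.alg V)} [IsNoetherianRing R]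

/-- Restriction of global sections. -/
abbrev resTop (𝒜 : TopCat.Presheaf (AlgCat.{u} R) X) (V : Opens X) : Sec 𝒜 ⊤ →ₐ[R] Sec 𝒜 V :=
  res 𝒜 le_top

variable (M P) in
/-- The reduction of the global section `s` does not vanish. -/
def UnitSy (s : Sec P.alg ⊤) : Prop := ∀ (x : X) (hx : x ∈ (⊤ : Opens X)), IsUnit (M.sy P hx s)

theorem UnitSy.res {s : Sec P.alg ⊤} (h : UnitSy M P s) (V : Opens X) {x : X} (hx : x ∈ V) :
    IsUnit (M.sy P hx (resTop P.alg V s)) := by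
  rw [resTop, AffModel.sy_res]; exact h x _

theorem UnitSy.one : UnitSy M P 1 := fun x hx => by rw [map_one]; exact isUnit_one

theorem UnitSy.mul {s t : Sec P.alg ⊤} (h : UnitSy M P s) (h' : UnitSy M P t) :
    UnitSy M P (s * t) := fun x hx => by rw [map_mul]; exact (h x hx).mul (h' x hx)

theorem UnitSy.pow {s : Sec P.alg ⊤} (h : UnitSy M P s) (n : ℕ) : UnitSy M P (s ^ n) :=
  fun x hx => by rw [map_pow]; exact (h x hx).pow n

namespace IsFormal

variable (hF : IsFormal M P F)
include hF

theorem mem_of_isEmpty {V : Opens X} (h : ¬ ∃ x, x ∈ V) (n : ℕ) (t : Sec P.alg V) : t ∈ F V n :=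
  hF.mem_of_local fun x hx => absurd ⟨x, hx⟩ h

theorem mem_of_res_mem {V W : Opens X} (h : W ≤ V) {x : X} (hx : x ∈ W) {n : ℕ} {t : Sec P.alg V}
    (ht : res P.alg h t ∈ F W n) : t ∈ F V n := by
  suffices H : ∀ k ≤ n, t ∈ F V k from H n le_rfl
  intro k hk
  induction k with
  | zero => exact hF.mem_zero _ _
  | succ k ih =>
    obtain ⟨ι, _, r, hr⟩ := exists_isMinGen (R := R) k
    obtain ⟨σ, hσ, -⟩ := hF.exists_hasSymbol hr (ih (by omega))
    rw [hF.hasSymbol_unique hr (hF.hasSymbol_res h hσ)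
      (hF.hasSymbol_zero hr (hF.antitone W hk ht)) hx] at hσ
    exact hF.mem_of_hasSymbol_zero hr hσ

theorem exists_unitSy_mul {V : Opens X} (t : Sec P.alg V) (n : ℕ) :
    ∃ s a, UnitSy M P s ∧ resTop P.alg V s * t - resTop P.alg V a ∈ F V n := by
  by_cases hV : ∃ x, x ∈ V
  swap
  · exact ⟨1, 0, UnitSy.one, hF.mem_of_isEmpty hV _ _⟩
  obtain ⟨x, hx⟩ := hV
  obtain ⟨c, hxc, hc⟩ := M.D_basis hx
  obtain ⟨N, s, a, hs, ha⟩ := hF.exists_frac (res P.alg hc t) n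
  refine ⟨s, a, fun y hy => ?_, hF.mem_of_res_mem hc hxc ?_⟩
  · have := hs ⊤ y hy
    rw [res_self] at this
    rw [this]
    exact (M.isUnit_lam hxc).pow N
  · simpa only [map_sub, map_mul, res_res, resTop] using ha

/-- Division by sections with invertible reduction. -/
theorem exists_mul_sub_mem {c : O.obj (op ⊤)} {s : Sec P.alg (M.D c)} {N : ℕ}
    (hs : ∀ x (hx : x ∈ M.D c), M.sy P hx s = M.lam c ^ N) (a : Sec P.alg (M.D c)) (n : ℕ) :
    ∃ t, s * t - a ∈ F (M.D c) n := by
  by_cases hV : ∃ x, x ∈ M.D c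
  swap
  · exact ⟨0, hF.mem_of_isEmpty hV _ _⟩
  obtain ⟨x, hx⟩ := hV
  obtain ⟨v, hv⟩ := (M.isUnit_lam hx).pow N
  induction n with
  | zero => exact ⟨0, hF.mem_zero _ _⟩
  | succ n ih =>
    obtain ⟨t, ht⟩ := ih
    obtain ⟨ι, _, r, hr⟩ := exists_isMinGen (R := R) n
    obtain ⟨σ, hσ, hσr⟩ := hF.exists_hasSymbol hr ht
    have key : ∀ j, M.IsReg (M.D c) (↑v⁻¹ * σ j) := fun j y hy => by
      obtain ⟨d, e, hd, he⟩ := hσr j y hy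
      refine ⟨d * c ^ N, e, AffModel.mem_D_mul hd (AffModel.mem_D_pow hy N), ?_⟩
      rw [map_mul, map_pow, ← hv, ← he, mul_assoc, ← mul_assoc _ _ (σ j), v.mul_inv, one_mul]
    choose b hb using fun j => hF.exists_sy (key j)
    refine ⟨t - ∑ j, r j • b j, hF.mem_of_hasSymbol_zero hr ?_⟩
    have h1 := hF.hasSymbol_mul s hs (hF.hasSymbol_sum (n := n) (r := r) b fun y hy j => hb j y hy)
    have h2 := hF.hasSymbol_sub hσ h1
    have h3 : (σ - fun j => M.lam c ^ N * (↑v⁻¹ * σ j)) = 0 := funext fun j => by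
      rw [Pi.sub_apply, ← hv, ← mul_assoc, v.mul_inv, one_mul, sub_self]; rfl
    rw [h3] at h2
    convert h2 using 1
    noncomm_ring

theorem commutator_mem {n : ℕ} (s : Sec P.alg ⊤) {t : Sec P.alg ⊤} (ht : t ∈ F ⊤ n) :
    s * t - t * s ∈ F ⊤ (n + 1) := by
  rw [hF.flatFilt_top.eq_adicFilt] at ht
  refine Submodule.smul_induction_on ht (fun r hr m _ => ?_) fun x y hx hy => ?_
  · rw [mul_smul_comm, smul_mul_assoc, ← smul_sub, add_comm]
    refine hF.smul_mem hr (hF.mem_one_iff.2 fun x hx => ?_)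
    rw [map_sub, map_mul, map_mul, mul_comm, sub_self]
  · convert Submodule.add_mem _ hx hy using 1
    noncomm_ring

/-- The Ore condition, up to any given order. -/
theorem exists_ore (s y : Sec P.alg ⊤) (n : ℕ) : ∃ b, s ^ n * y - b * s ∈ F ⊤ n := by
  induction n with
  | zero => exact ⟨0, hF.mem_zero _ _⟩
  | succ n ih =>
    obtain ⟨b, hb⟩ := ih
    refine ⟨s * b + (s ^ n * y - b * s), ?_⟩
    convert hF.commutator_mem s hb using 1
    rw [pow_succ']
    noncomm_ring

end IsFormal

end Fractions

section Extend

variable {K R : Type u} [Field K] [CommRing R] [Algebra K R] [IsLocalRing R] {X : TopCat.{u}}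
  {O : TopCat.Presheaf (CommAlgCat.{u} K) X} (M : AffModel O) {κ : DefKind} [IsNoetherianRing R]
  {𝒜 ℬ : SheafDef K R O κ}

/-- `u` is the image of `t` under the extension of `φ` to fractions. -/
def IsExt (φ : Sec 𝒜.alg ⊤ ≃ₐ[R] Sec ℬ.alg ⊤) (V : Opens X) (t : Sec 𝒜.alg V) (u : Sec ℬ.alg V) :
    Prop :=
  ∀ n, ∃ s a, UnitSy M 𝒜.toPreSheafDef s ∧
    resTop 𝒜.alg V s * t - resTop 𝒜.alg V a ∈ sheafFilt 𝒜.alg V n ∧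
    resTop ℬ.alg V (φ s) * u - resTop ℬ.alg V (φ a) ∈ sheafFilt ℬ.alg V n

theorem SheafDef.mul_mem_left (𝒜 : SheafDef K R O κ) {V : Opens X} {n : ℕ} (s : Sec 𝒜.alg V)
    {t : Sec 𝒜.alg V} (ht : t ∈ sheafFilt 𝒜.alg V n) : s * t ∈ sheafFilt 𝒜.alg V n := by
  have := sheafFilt_mul 𝒜.alg ((𝒜.isFiltBracket V).mem_zero s) ht
  rwa [zero_add] at this

theorem SheafDef.mul_mem_right (𝒜 : SheafDef K R O κ) {V : Opens X} {n : ℕ} {s : Sec 𝒜.alg V}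
    (hs : s ∈ sheafFilt 𝒜.alg V n) (t : Sec 𝒜.alg V) : s * t ∈ sheafFilt 𝒜.alg V n := by
  have := sheafFilt_mul 𝒜.alg hs ((𝒜.isFiltBracket V).mem_zero t)
  rwa [add_zero] at this

variable {M} {φ : Sec 𝒜.alg ⊤ ≃ₐ[R] Sec ℬ.alg ⊤}

theorem SheafDef.eq_of_forall_mem (𝒜 : SheafDef K R O κ) {V : Opens X} {t u : Sec 𝒜.alg V}
    (h : ∀ n, t - u ∈ sheafFilt 𝒜.alg V n) : t = u :=
  sub_eq_zero.1 ((𝒜.isFiltBracket V).sep _ h)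

theorem IsExt.of_hom (g : SheafHom 𝒜.alg ℬ.alg) (hg : ∀ s, g.app ⊤ s = φ s) {V : Opens X}
    (t : Sec 𝒜.alg V) : IsExt M φ V t (g.app V t) := fun n => by
  obtain ⟨s, a, hs, ha⟩ := (𝒜.isFormal M).exists_unitSy_mul t n
  refine ⟨s, a, hs, ha, ?_⟩
  have h1 := g.map_sheafFilt ha
  rw [map_sub, map_mul] at h1
  rw [← hg, ← hg]
  have h2 : ∀ s, g.app V (resTop 𝒜.alg V s) = resTop ℬ.alg V (g.app ⊤ s) := fun s =>
    g.app_res le_top s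
  rwa [h2, h2] at h1

theorem IsExt.resTop (s : Sec 𝒜.alg ⊤) (V : Opens X) :
    IsExt M φ V (resTop 𝒜.alg V s) (resTop ℬ.alg V (φ s)) := fun n =>
  ⟨1, s, UnitSy.one, by simp, by simp⟩

theorem IsExt.of_algebraMap (r : R) (V : Opens X) :
    IsExt M φ V (algebraMap R _ r) (algebraMap R _ r) := by
  have := IsExt.resTop (M := M) (φ := φ) (algebraMap R _ r) V
  simpa only [AlgHom.commutes, AlgEquiv.commutes] using this

theorem IsExt.res {V W : Opens X} (h : W ≤ V) {t : Sec 𝒜.alg V} {u : Sec ℬ.alg V}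
    (H : IsExt M φ V t u) : IsExt M φ W (YDef.res 𝒜.alg h t) (YDef.res ℬ.alg h u) := fun n => by
  obtain ⟨s, a, hs, h1, h2⟩ := H n
  refine ⟨s, a, hs, ?_, ?_⟩
  · simpa only [map_sub, map_mul, res_res, YDef.resTop] using res_sheafFilt 𝒜.alg h h1
  · simpa only [map_sub, map_mul, res_res, YDef.resTop] using res_sheafFilt ℬ.alg h h2

variable (hφ : ∀ s (x : X) (hx : x ∈ (⊤ : Opens X)),
  M.sy ℬ.toPreSheafDef hx (φ s) = M.sy 𝒜.toPreSheafDef hx s)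

include M in
theorem map_mem_of_mem (φ : Sec 𝒜.alg ⊤ ≃ₐ[R] Sec ℬ.alg ⊤) {n : ℕ} {t : Sec 𝒜.alg ⊤}
    (ht : t ∈ sheafFilt 𝒜.alg ⊤ n) (V : Opens X) :
    YDef.resTop ℬ.alg V (φ t) ∈ sheafFilt ℬ.alg V n := by
  rw [𝒜.sheafFilt_top_eq M] at ht
  refine res_sheafFilt ℬ.alg le_top ?_
  rw [ℬ.sheafFilt_top_eq M]
  exact map_adicFilt φ.toLinearMap ht

include hφ

theorem UnitSy.map {s : Sec 𝒜.alg ⊤} (hs : UnitSy M 𝒜.toPreSheafDef s) :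
    UnitSy M ℬ.toPreSheafDef (φ s) := fun x hx => by rw [hφ]; exact hs x hx

theorem mul_sub_mem_of_mul_sub_mem {V : Opens X} {n : ℕ} {t : Sec 𝒜.alg V} {u : Sec ℬ.alg V}
    {s a s' a' : Sec 𝒜.alg ⊤} (hs : UnitSy M 𝒜.toPreSheafDef s)
    (h1 : resTop 𝒜.alg V s * t - resTop 𝒜.alg V a ∈ sheafFilt 𝒜.alg V n)
    (h1' : resTop 𝒜.alg V s' * t - resTop 𝒜.alg V a' ∈ sheafFilt 𝒜.alg V n)
    (h2 : resTop ℬ.alg V (φ s) * u - resTop ℬ.alg V (φ a) ∈ sheafFilt ℬ.alg V n) :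
    resTop ℬ.alg V (φ s') * u - resTop ℬ.alg V (φ a') ∈ sheafFilt ℬ.alg V n := by
  by_cases hV : ∃ x, x ∈ V
  swap
  · exact (ℬ.isFormal M).mem_of_isEmpty hV _ _
  obtain ⟨x, hx⟩ := hV
  obtain ⟨b, hb⟩ := (𝒜.isFormal M).exists_ore s s' n
  have h3 : s ^ n * a' - b * a ∈ sheafFilt 𝒜.alg ⊤ n := by
    refine (𝒜.isFormal M).mem_of_res_mem (le_top : V ≤ ⊤) hx ?_
    have e1 := 𝒜.mul_mem_right (res_sheafFilt 𝒜.alg (le_top : V ≤ ⊤) hb) t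
    have e2 := 𝒜.mul_mem_left (resTop 𝒜.alg V b) h1
    have e3 := 𝒜.mul_mem_left (resTop 𝒜.alg V (s ^ n)) h1'
    convert Submodule.sub_mem _ (Submodule.add_mem _ e1 e2) e3 using 1
    simp only [map_sub, map_mul]
    noncomm_ring
  have h4 := map_mem_of_mem (M := M) φ h3 V
  have h5 := ℬ.mul_mem_right (map_mem_of_mem (M := M) φ hb V) u
  have h6 := ℬ.mul_mem_left (resTop ℬ.alg V (φ b)) h2
  refine (ℬ.isFormal M).mem_of_unit_mul (s := resTop ℬ.alg V (φ (s ^ n)))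
    (fun x hx => ((hs.pow n).map hφ).res V hx) ?_
  convert Submodule.sub_mem _ (Submodule.add_mem _ h5 h6) h4 using 1
  simp only [map_sub, map_mul]
  noncomm_ring

theorem IsExt.unique {V : Opens X} {t : Sec 𝒜.alg V} {u u' : Sec ℬ.alg V} (H : IsExt M φ V t u)
    (H' : IsExt M φ V t u') : u = u' := ℬ.eq_of_forall_mem fun n => by
  obtain ⟨s, a, hs, h1, h2⟩ := H n
  obtain ⟨s', a', hs', h1', h2'⟩ := H' n
  have h3 := mul_sub_mem_of_mul_sub_mem hφ hs' h1' h1 h2'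
  refine (ℬ.isFormal M).mem_of_unit_mul (s := YDef.resTop ℬ.alg V (φ s))
    (fun x hx => (hs.map hφ).res V hx) ?_
  convert Submodule.sub_mem _ h2 h3 using 1
  noncomm_ring

theorem exists_isExt {V : Opens X} (t : Sec 𝒜.alg V) : ∃ u, IsExt M φ V t u := by
  have hF := 𝒜.isFormal M
  have hG := ℬ.isFormal M
  have key : ∀ (n : ℕ) (x : V), ∃ (W : Opens X) (h : W ≤ V) (_ : x.1 ∈ W) (τ : Sec ℬ.alg W)
      (s a : Sec 𝒜.alg ⊤), UnitSy M 𝒜.toPreSheafDef s ∧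
      resTop 𝒜.alg V s * t - resTop 𝒜.alg V a ∈ sheafFilt 𝒜.alg V n ∧
      resTop ℬ.alg W (φ s) * τ - resTop ℬ.alg W (φ a) ∈ sheafFilt ℬ.alg W n := by
    intro n x
    obtain ⟨c, hxc, hc⟩ := M.D_basis x.2
    obtain ⟨N, s, a, hs, ha⟩ := hF.exists_frac (YDef.res 𝒜.alg hc t) n
    obtain ⟨τ, hτ⟩ := hG.exists_mul_sub_mem (s := resTop ℬ.alg (M.D c) (φ s)) (N := N)
      (fun y hy => by
        rw [resTop, AffModel.sy_res, hφ, ← hs _ y hy]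
        exact (AffModel.sy_res le_top hy s).symm) (resTop ℬ.alg (M.D c) (φ a)) n
    refine ⟨M.D c, hc, hxc, τ, s, a, fun y hy => ?_, hF.mem_of_res_mem hc hxc ?_, hτ⟩
    · have := hs ⊤ y hy
      rw [res_self] at this
      rw [this]
      exact (M.isUnit_lam hxc).pow N
    · simpa only [map_sub, map_mul, res_res, resTop] using ha
  choose W hW hxW τ s a hs h1 h2 using key
  have hc : ∀ n m x y, n ≤ m → YDef.res ℬ.alg (inf_le_left : W m x ⊓ W n y ≤ W m x) (τ m x) -
      YDef.res ℬ.alg (inf_le_right : W m x ⊓ W n y ≤ W n y) (τ n y) ∈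
        sheafFilt ℬ.alg (W m x ⊓ W n y) n := by
    intro n m x y hnm
    have i : W m x ⊓ W n y ≤ V := inf_le_left.trans (hW m x)
    have a1 := res_sheafFilt 𝒜.alg i (hF.antitone V hnm (h1 m x))
    have a2 := res_sheafFilt 𝒜.alg i (h1 n y)
    have a3 := res_sheafFilt ℬ.alg (inf_le_left : W m x ⊓ W n y ≤ W m x)
      (hG.antitone _ hnm (h2 m x))
    have a4 := res_sheafFilt ℬ.alg (inf_le_right : W m x ⊓ W n y ≤ W n y) (h2 n y)
    simp only [map_sub, map_mul, res_res, resTop] at a1 a2 a3 a4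
    have a5 := mul_sub_mem_of_mul_sub_mem hφ (hs m x) a1 a2 a3
    refine hG.mem_of_unit_mul (s := resTop ℬ.alg _ (φ (s n y)))
      (fun x hx => ((hs n y).map hφ).res _ hx) ?_
    convert Submodule.sub_mem _ a5 a4 using 1
    simp only [resTop]
    noncomm_ring
  obtain ⟨u, hu⟩ := hG.glue V W hW hxW τ (fun n x y => hc n n x y le_rfl)
    (fun n x => hc n (n + 1) x x n.le_succ)
  refine ⟨u, fun n => ?_⟩
  by_cases hV : ∃ x, x ∈ V
  swap
  · exact ⟨1, 0, UnitSy.one, hF.mem_of_isEmpty hV _ _, hG.mem_of_isEmpty hV _ _⟩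
  obtain ⟨x, hx⟩ := hV
  refine ⟨s n ⟨x, hx⟩, a n ⟨x, hx⟩, hs _ _, h1 _ _,
    hG.mem_of_res_mem (hW n ⟨x, hx⟩) (hxW n ⟨x, hx⟩) ?_⟩
  have := ℬ.mul_mem_left (resTop ℬ.alg _ (φ (s n ⟨x, hx⟩))) (hu n ⟨x, hx⟩)
  convert Submodule.add_mem _ this (h2 n ⟨x, hx⟩) using 1
  simp only [map_sub, map_mul, res_res, resTop]
  noncomm_ring

omit hφ

theorem IsExt.add {V : Opens X} {t t' : Sec 𝒜.alg V} {u u' : Sec ℬ.alg V} (H : IsExt M φ V t u)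
    (H' : IsExt M φ V t' u') : IsExt M φ V (t + t') (u + u') := fun n => by
  obtain ⟨s, a, hs, h1, h2⟩ := H n
  obtain ⟨s', a', hs', h1', h2'⟩ := H' n
  obtain ⟨b, hb⟩ := (𝒜.isFormal M).exists_ore s s' n
  refine ⟨s ^ n * s', b * a + s ^ n * a', (hs.pow n).mul hs', ?_, ?_⟩
  · have e1 := 𝒜.mul_mem_right (res_sheafFilt 𝒜.alg (le_top : V ≤ ⊤) hb) t
    have e2 := 𝒜.mul_mem_left (YDef.resTop 𝒜.alg V b) h1
    have e3 := 𝒜.mul_mem_left (YDef.resTop 𝒜.alg V (s ^ n)) h1'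
    convert Submodule.add_mem _ (Submodule.add_mem _ e1 e2) e3 using 1
    simp only [map_sub, map_mul, map_add]
    noncomm_ring
  · have e1 := ℬ.mul_mem_right (map_mem_of_mem (M := M) φ hb V) u
    have e2 := ℬ.mul_mem_left (YDef.resTop ℬ.alg V (φ b)) h2
    have e3 := ℬ.mul_mem_left (YDef.resTop ℬ.alg V (φ (s ^ n))) h2'
    convert Submodule.add_mem _ (Submodule.add_mem _ e1 e2) e3 using 1
    simp only [map_sub, map_mul, map_add]
    noncomm_ring

theorem IsExt.mul {V : Opens X} {t t' : Sec 𝒜.alg V} {u u' : Sec ℬ.alg V} (H : IsExt M φ V t u)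
    (H' : IsExt M φ V t' u') : IsExt M φ V (t * t') (u * u') := fun n => by
  obtain ⟨s, a, hs, h1, h2⟩ := H n
  obtain ⟨s', a', hs', h1', h2'⟩ := H' n
  obtain ⟨b, hb⟩ := (𝒜.isFormal M).exists_ore s' a n
  refine ⟨s' ^ n * s, b * a', (hs'.pow n).mul hs, ?_, ?_⟩
  · have e1 := 𝒜.mul_mem_right (res_sheafFilt 𝒜.alg (le_top : V ≤ ⊤) hb) t'
    have e2 := 𝒜.mul_mem_left (YDef.resTop 𝒜.alg V b) h1'
    have e3 := 𝒜.mul_mem_left (YDef.resTop 𝒜.alg V (s' ^ n)) (𝒜.mul_mem_right h1 t')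
    convert Submodule.add_mem _ (Submodule.add_mem _ e1 e2) e3 using 1
    simp only [map_sub, map_mul]
    noncomm_ring
  · have e1 := ℬ.mul_mem_right (map_mem_of_mem (M := M) φ hb V) u'
    have e2 := ℬ.mul_mem_left (YDef.resTop ℬ.alg V (φ b)) h2'
    have e3 := ℬ.mul_mem_left (YDef.resTop ℬ.alg V (φ (s' ^ n))) (ℬ.mul_mem_right h2 u')
    convert Submodule.add_mem _ (Submodule.add_mem _ e1 e2) e3 using 1
    simp only [map_sub, map_mul]
    noncomm_ring

include hφ

theorem IsExt.symm {V : Opens X} {t : Sec 𝒜.alg V} {u : Sec ℬ.alg V} (H : IsExt M φ V t u) :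
    IsExt M φ.symm V u t := fun n => by
  obtain ⟨s, a, hs, h1, h2⟩ := H n
  exact ⟨φ s, φ a, hs.map hφ, h2, by simpa using h1⟩

theorem IsExt.sy_eq {V : Opens X} {t : Sec 𝒜.alg V} {u : Sec ℬ.alg V} (H : IsExt M φ V t u) {x : X}
    (hx : x ∈ V) : M.sy ℬ.toPreSheafDef hx u = M.sy 𝒜.toPreSheafDef hx t := by
  obtain ⟨s, a, hs, h1, h2⟩ := H 1
  have e1 := (𝒜.isFormal M).mem_one_iff.1 h1 x hx
  have e2 := (ℬ.isFormal M).mem_one_iff.1 h2 x hx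
  simp only [map_sub, map_mul, YDef.resTop, AffModel.sy_res, hφ, sub_eq_zero] at e1 e2
  exact (hs x trivial).mul_left_cancel (e2.trans e1.symm)

end Extend

section FullyFaithful

variable {K R : Type u} [Field K] [CommRing R] [Algebra K R] [IsLocalRing R] {X : TopCat.{u}}
  {O : TopCat.Presheaf (CommAlgCat.{u} K) X} {M : AffModel O} {κ : DefKind} [IsNoetherianRing R]
  {𝒜 ℬ : SheafDef K R O κ} {φ : Sec 𝒜.alg ⊤ ≃ₐ[R] Sec ℬ.alg ⊤}
  (hφ : ∀ s (x : X) (hx : x ∈ (⊤ : Opens X)),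
    M.sy ℬ.toPreSheafDef hx (φ s) = M.sy 𝒜.toPreSheafDef hx s)

/-- The extension of an isomorphism of the algebras of global sections. -/
def extHom : SheafHom 𝒜.alg ℬ.alg where
  app V :=
    { toFun := fun t => (exists_isExt hφ t).choose
      map_one' := (exists_isExt hφ 1).choose_spec.unique hφ (by
        simpa using IsExt.of_algebraMap (M := M) (φ := φ) 1 V)
      map_mul' := fun t t' => (exists_isExt hφ (t * t')).choose_spec.unique hφ
        ((exists_isExt hφ t).choose_spec.mul (exists_isExt hφ t').choose_spec)
      map_zero' := (exists_isExt hφ 0).choose_spec.unique hφ (by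
        simpa using IsExt.of_algebraMap (M := M) (φ := φ) 0 V)
      map_add' := fun t t' => (exists_isExt hφ (t + t')).choose_spec.unique hφ
        ((exists_isExt hφ t).choose_spec.add (exists_isExt hφ t').choose_spec)
      commutes' := fun r => (exists_isExt hφ (algebraMap R _ r)).choose_spec.unique hφ
        (IsExt.of_algebraMap r V) }
  app_res h t := (exists_isExt hφ (res 𝒜.alg h t)).choose_spec.unique hφ
    ((exists_isExt hφ t).choose_spec.res h)

theorem isExt_extHom {V : Opens X} (t : Sec 𝒜.alg V) : IsExt M φ V t ((extHom hφ).app V t) :=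
  (exists_isExt hφ t).choose_spec

theorem extHom_eq {V : Opens X} {t : Sec 𝒜.alg V} {u : Sec ℬ.alg V} (h : IsExt M φ V t u) :
    (extHom hφ).app V t = u :=
  (isExt_extHom hφ t).unique hφ h

theorem extHom_resTop (s : Sec 𝒜.alg ⊤) (V : Opens X) :
    (extHom hφ).app V (resTop 𝒜.alg V s) = resTop ℬ.alg V (φ s) :=
  extHom_eq hφ (IsExt.resTop s V)

theorem extHom_top (s : Sec 𝒜.alg ⊤) : (extHom hφ).app ⊤ s = φ s := by
  have := extHom_resTop hφ s ⊤
  rwa [resTop, res_self, resTop, res_self] at this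

/-- The extension of an isomorphism of the algebras of global sections. -/
def extEquiv (hφ' : ∀ s (x : X) (hx : x ∈ (⊤ : Opens X)),
    M.sy 𝒜.toPreSheafDef hx (φ.symm s) = M.sy ℬ.toPreSheafDef hx s) : SheafEquiv 𝒜.alg ℬ.alg where
  hom := extHom hφ
  inv := extHom hφ'
  hom_inv := SheafHom.ext (funext fun V => AlgHom.ext fun t =>
    extHom_eq hφ' ((isExt_extHom hφ t).symm hφ))
  inv_hom := SheafHom.ext (funext fun V => AlgHom.ext fun t =>
    extHom_eq hφ ((isExt_extHom hφ' t).symm hφ'))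

theorem map_br_of_forall_resTop {V : Opens X} {u : Sec 𝒜.alg V}
    (hu : ∀ s, (extHom hφ).app V (𝒜.br V u (resTop 𝒜.alg V s)) =
      ℬ.br V ((extHom hφ).app V u) ((extHom hφ).app V (resTop 𝒜.alg V s))) (t : Sec 𝒜.alg V) :
    (extHom hφ).app V (𝒜.br V u t) = ℬ.br V ((extHom hφ).app V u) ((extHom hφ).app V t) := by
  refine ℬ.eq_of_forall_mem fun n => ?_
  obtain ⟨s, a, hs, h1⟩ := (𝒜.isFormal M).exists_unitSy_mul t n
  refine (ℬ.isFormal M).mem_of_unit_mul (s := resTop ℬ.alg V (φ s))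
    (fun x hx => (hs.map hφ).res V hx) ?_
  have e1 := (𝒜.isDeformation.kind V).leibniz_mul u (resTop 𝒜.alg V s) t
  have e2 := (ℬ.isDeformation.kind V).leibniz_mul ((extHom hφ).app V u)
    ((extHom hφ).app V (resTop 𝒜.alg V s)) ((extHom hφ).app V t)
  have h2 : 𝒜.br V u (resTop 𝒜.alg V s * t - resTop 𝒜.alg V a) ∈ sheafFilt 𝒜.alg V n := by
    have := (𝒜.isFiltBracket V).bracket_mem ((𝒜.isFiltBracket V).mem_zero u) h1
    rwa [zero_add] at this
  have h3 := (extHom hφ).map_sheafFilt h2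
  have h4 : ℬ.br V ((extHom hφ).app V u)
      ((extHom hφ).app V (resTop 𝒜.alg V s * t - resTop 𝒜.alg V a)) ∈ sheafFilt ℬ.alg V n := by
    have := (ℬ.isFiltBracket V).bracket_mem ((ℬ.isFiltBracket V).mem_zero ((extHom hφ).app V u))
      ((extHom hφ).map_sheafFilt h1)
    rwa [zero_add] at this
  rw [map_sub, e1] at h3
  simp only [map_sub, map_mul, map_add, e2, hu] at h3 h4
  rw [← extHom_resTop hφ]
  convert Submodule.sub_mem _ h3 h4 using 1
  noncomm_ring

theorem extHom_br (hbr : ∀ a b, φ (𝒜.br ⊤ a b) = ℬ.br ⊤ (φ a) (φ b)) {V : Opens X}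
    (u t : Sec 𝒜.alg V) :
    (extHom hφ).app V (𝒜.br V u t) = ℬ.br V ((extHom hφ).app V u) ((extHom hφ).app V t) := by
  refine map_br_of_forall_resTop hφ (fun s => ?_) t
  have h1 : (extHom hφ).app V (𝒜.br V (resTop 𝒜.alg V s) u) =
      ℬ.br V ((extHom hφ).app V (resTop 𝒜.alg V s)) ((extHom hφ).app V u) := by
    refine map_br_of_forall_resTop hφ (fun a => ?_) u
    rw [← 𝒜.br_res, extHom_resTop, extHom_resTop, extHom_resTop, hbr, ℬ.br_res]
  rw [(𝒜.isDeformation.kind V).isLieBr.skew, map_neg, h1, ← (ℬ.isDeformation.kind V).isLieBr.skew]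

/-- The extension of a gauge transformation. -/
def extGauge (g : AlgGauge 𝒜.gamma ℬ.gamma) (hφ : ∀ s (x : X) (hx : x ∈ (⊤ : Opens X)),
    M.sy ℬ.toPreSheafDef hx (g.toEquiv s : Sec ℬ.alg ⊤) = M.sy 𝒜.toPreSheafDef hx s)
    (hφ' : ∀ s (x : X) (hx : x ∈ (⊤ : Opens X)),
    M.sy 𝒜.toPreSheafDef hx (g.toEquiv.symm s : Sec 𝒜.alg ⊤) = M.sy ℬ.toPreSheafDef hx s) :
    SheafGauge 𝒜.toPreSheafDef ℬ.toPreSheafDef where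
  toEquiv := extEquiv (φ := (g.toEquiv : Sec 𝒜.alg ⊤ ≃ₐ[R] Sec ℬ.alg ⊤)) hφ hφ'
  map_br V a b := extHom_br (φ := (g.toEquiv : Sec 𝒜.alg ⊤ ≃ₐ[R] Sec ℬ.alg ⊤)) hφ g.map_br a b
  map_aug V f := M.ev_injective V (funext fun x => by
    obtain ⟨W, hW, hx, t, ht⟩ := f.2 x
    obtain ⟨a, rfl⟩ := residue_tensor_eq t
    have h1 : sheafTensorRes 𝒜.alg (𝕜 R) hW f = toSheafTensor 𝒜.alg (𝕜 R) W (1 ⊗ₜ a) :=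
      Subtype.ext (funext fun z => ht z.1 z.2)
    have h2 : sheafTensorRes ℬ.alg (𝕜 R) hW (sheafTensorMap (𝕜 R) (extHom hφ) V f) =
        toSheafTensor ℬ.alg (𝕜 R) W (1 ⊗ₜ (extHom hφ).app W a) := by
      refine Subtype.ext (funext fun z => ?_)
      change stalkTensor (𝕜 R) (extHom hφ) z.1 (f.1 ⟨z.1, hW z.2⟩) = _
      rw [ht z.1 z.2, stalkTensor_germTensor]
      rfl
    refine (M.ev_res hW _ ⟨x.1, hx⟩).symm.trans (Eq.trans ?_ (M.ev_res hW _ ⟨x.1, hx⟩))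
    rw [← 𝒜.aug_res, ← ℬ.aug_res, h1]
    refine Eq.trans (congrFun (congrArg (M.ev W) (congrArg (ℬ.aug W) h2)) _) ?_
    exact (isExt_extHom hφ a).sy_eq hφ hx)

theorem AlgGauge.sy_eq (g : AlgGauge 𝒜.gamma ℬ.gamma) (s : Sec 𝒜.alg ⊤) (x : X)
    (hx : x ∈ (⊤ : Opens X)) :
    M.sy ℬ.toPreSheafDef hx (g.toEquiv s : Sec ℬ.alg ⊤) = M.sy 𝒜.toPreSheafDef hx s :=
  congrFun (congrArg (M.ev ⊤) (g.map_aug s)) _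

theorem AlgGauge.sy_symm_eq (g : AlgGauge 𝒜.gamma ℬ.gamma) (s : Sec ℬ.alg ⊤) (x : X)
    (hx : x ∈ (⊤ : Opens X)) :
    M.sy 𝒜.toPreSheafDef hx (g.toEquiv.symm s : Sec 𝒜.alg ⊤) = M.sy ℬ.toPreSheafDef hx s := by
  refine (g.sy_eq (M := M) _ x hx).symm.trans (congrArg _ ?_)
  exact g.toEquiv.apply_symm_apply s

variable [CharZero K]
include M

theorem full_gamma (h : GammaPreserves K R O κ) : (gamma h).functor.Full where
  map_surjective {𝒜 ℬ} g := by
    change AlgGauge (SheafDef.toPreSheafDef 𝒜).gamma (SheafDef.toPreSheafDef ℬ).gamma at g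
    refine ⟨extGauge (M := M) g g.sy_eq g.sy_symm_eq, AlgGauge.ext (AlgEquiv.ext fun s => ?_)⟩
    exact extHom_top (φ := (g.toEquiv : Sec (SheafDef.toPreSheafDef 𝒜).alg ⊤ ≃ₐ[R]
      Sec (SheafDef.toPreSheafDef ℬ).alg ⊤)) (g.sy_eq (M := M)) s

theorem faithful_gamma (h : GammaPreserves K R O κ) : (gamma h).functor.Faithful where
  map_injective {𝒜 ℬ} g g' e := by
    change SheafGauge (SheafDef.toPreSheafDef 𝒜) (SheafDef.toPreSheafDef ℬ) at g g'
    have h1 : ∀ s : Sec (SheafDef.toPreSheafDef 𝒜).alg ⊤,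
        g.toEquiv.hom.app ⊤ s = g'.toEquiv.hom.app ⊤ s := fun s =>
      DFunLike.congr_fun (congrArg AlgGauge.toEquiv e) s
    refine SheafGauge.hom_ext fun V t => ?_
    exact IsExt.unique (M := M) (φ := g.toEquiv.toAlgEquiv ⊤) (g.gamma.sy_eq (M := M))
      (IsExt.of_hom g.toEquiv.hom (fun _ => rfl) t)
      (IsExt.of_hom g'.toEquiv.hom (fun s => (h1 s).symm) t)

end FullyFaithful

section Vanishing

variable {R : Type u} [CommRing R] {X : TopCat.{u}} (𝒜 : TopCat.Presheaf (AlgCat.{u} R) X)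
  (B : Type u) [CommRing B] [Algebra R B]

/-- The presheaf `V ↦ B ⊗_R 𝒜(V)`. -/
def tensorPresheaf : TopCat.Presheaf (AlgCat.{u} R) X where
  obj V := AlgCat.of R (B ⊗[R] Sec 𝒜 V.unop)
  map h := AlgCat.ofHom ((resTensor 𝒜 B h.unop.le).restrictScalars R)
  map_id V := by
    refine AlgCat.hom_ext _ (Algebra.TensorProduct.ext (AlgHom.ext fun b => ?_) (AlgHom.ext fun a => ?_))
    · change b ⊗ₜ[R] res 𝒜 le_rfl (1 : Sec 𝒜 V.unop) = b ⊗ₜ 1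
      rw [res_self]
    · change (1 : B) ⊗ₜ[R] res 𝒜 le_rfl (a : Sec 𝒜 V.unop) = 1 ⊗ₜ a
      rw [res_self]
  map_comp {U V W} f g := by
    refine AlgCat.hom_ext _ (Algebra.TensorProduct.ext (AlgHom.ext fun b => ?_) (AlgHom.ext fun a => ?_))
    · change b ⊗ₜ[R] res 𝒜 (f ≫ g).unop.le (1 : Sec 𝒜 U.unop) =
        b ⊗ₜ res 𝒜 g.unop.le (res 𝒜 f.unop.le (1 : Sec 𝒜 U.unop))
      rw [res_res]
    · change (1 : B) ⊗ₜ[R] res 𝒜 (f ≫ g).unop.le (a : Sec 𝒜 U.unop) =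
        1 ⊗ₜ res 𝒜 g.unop.le (res 𝒜 f.unop.le (a : Sec 𝒜 U.unop))
      rw [res_res]

theorem germ_tensorPresheaf_res {V W : Opens X} (h : W ≤ V) {x : X} (hx : x ∈ W)
    (b : B) (a : Sec 𝒜 V) :
    germ (tensorPresheaf 𝒜 B) hx (b ⊗ₜ[R] res 𝒜 h a : B ⊗[R] Sec 𝒜 W) =
      germ (tensorPresheaf 𝒜 B) (h hx) (b ⊗ₜ[R] a : B ⊗[R] Sec 𝒜 V) :=
  germ_res (tensorPresheaf 𝒜 B) h hx (b ⊗ₜ[R] a : B ⊗[R] Sec 𝒜 V)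

/-- The map from `B ⊗_R 𝒜_x` to the stalk of `V ↦ B ⊗_R 𝒜(V)`. -/
def tensorStalkHom (x : X) : B ⊗[R] Stalk 𝒜 x →ₐ[R] Stalk (tensorPresheaf 𝒜 B) x :=
  Algebra.TensorProduct.lift
    ((germ (tensorPresheaf 𝒜 B) (V := ⊤) (Opens.mem_top x)).comp
      (Algebra.TensorProduct.includeLeft : B →ₐ[R] B ⊗[R] Sec 𝒜 ⊤))
    (stalkLift 𝒜 x (fun V hx => (germ (tensorPresheaf 𝒜 B) hx).comp
      (Algebra.TensorProduct.includeRight : Sec 𝒜 V →ₐ[R] B ⊗[R] Sec 𝒜 V))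
      fun V W h hx s => germ_tensorPresheaf_res 𝒜 B h hx 1 s)
    fun b a => by
      obtain ⟨V, hx, s, rfl⟩ := exists_germ 𝒜 a
      have h1 : germ (tensorPresheaf 𝒜 B) (Opens.mem_top x) (b ⊗ₜ[R] 1 : B ⊗[R] Sec 𝒜 ⊤) =
          germ (tensorPresheaf 𝒜 B) hx (b ⊗ₜ[R] 1 : B ⊗[R] Sec 𝒜 V) := by
        have := germ_tensorPresheaf_res 𝒜 B (le_top : V ≤ ⊤) hx b 1
        rw [map_one] at this
        exact this.symm
      have h2 : germ (tensorPresheaf 𝒜 B) hx (b ⊗ₜ[R] 1 : B ⊗[R] Sec 𝒜 V) *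
          germ (tensorPresheaf 𝒜 B) hx (1 ⊗ₜ[R] s : B ⊗[R] Sec 𝒜 V) =
          germ (tensorPresheaf 𝒜 B) hx (1 ⊗ₜ[R] s : B ⊗[R] Sec 𝒜 V) *
          germ (tensorPresheaf 𝒜 B) hx (b ⊗ₜ[R] 1 : B ⊗[R] Sec 𝒜 V) := by
        have h : (b ⊗ₜ[R] 1 : B ⊗[R] Sec 𝒜 V) * (1 ⊗ₜ s) = (1 ⊗ₜ s) * (b ⊗ₜ[R] 1) := by simp
        exact (map_mul (germ (tensorPresheaf 𝒜 B) hx) _ _).symm.trans ((congrArg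
          (fun z : Sec (tensorPresheaf 𝒜 B) V => germ (tensorPresheaf 𝒜 B) hx z) h).trans
          (map_mul (germ (tensorPresheaf 𝒜 B) hx) _ _))
      exact (congrArg (· * germ (tensorPresheaf 𝒜 B) hx (1 ⊗ₜ[R] s : B ⊗[R] Sec 𝒜 V)) h1).trans
        (h2.trans (congrArg (germ (tensorPresheaf 𝒜 B) hx (1 ⊗ₜ[R] s : B ⊗[R] Sec 𝒜 V) * ·)
          h1.symm))

theorem tensorStalkHom_germTensor {V : Opens X} {x : X} (hx : x ∈ V) (t : B ⊗[R] Sec 𝒜 V) :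
    tensorStalkHom 𝒜 B x (germTensor 𝒜 B hx t) = germ (tensorPresheaf 𝒜 B) hx t := by
  induction t using TensorProduct.induction_on with
  | zero => rw [map_zero, map_zero]; exact (map_zero _).symm
  | add t t' ht ht' =>
    rw [map_add, map_add, ht, ht']
    exact (map_add (germ (tensorPresheaf 𝒜 B) hx) _ _).symm
  | tmul b a =>
    have h1 : germTensor 𝒜 B hx (b ⊗ₜ a) = b ⊗ₜ germ 𝒜 hx a := rfl
    rw [h1, tensorStalkHom, Algebra.TensorProduct.lift_tmul]
    have h2 := germ_tensorPresheaf_res 𝒜 B (le_top : V ≤ ⊤) hx b 1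
    rw [map_one] at h2
    refine (congrArg (· * _) h2.symm).trans ?_
    have h : (b ⊗ₜ[R] 1 : B ⊗[R] Sec 𝒜 V) * (1 ⊗ₜ a) = b ⊗ₜ a := by simp
    exact (map_mul (germ (tensorPresheaf 𝒜 B) hx) _ _).symm.trans (congrArg
      (fun z : Sec (tensorPresheaf 𝒜 B) V => germ (tensorPresheaf 𝒜 B) hx z) h)

/-- A section of `B ⊗_R 𝒜(V)` with vanishing germ vanishes on a neighbourhood. -/
theorem exists_resTensor_eq_zero {V : Opens X} {x : X} (hx : x ∈ V) {t : B ⊗[R] Sec 𝒜 V}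
    (h : germTensor 𝒜 B hx t = 0) :
    ∃ (W : Opens X) (hW : W ≤ V) (_ : x ∈ W), resTensor 𝒜 B hW t = 0 := by
  have h1 : germ (tensorPresheaf 𝒜 B) hx t = germ (tensorPresheaf 𝒜 B) hx 0 := by
    rw [← tensorStalkHom_germTensor, h, map_zero]
    exact (map_zero (germ (tensorPresheaf 𝒜 B) hx)).symm
  obtain ⟨Z, hZ, hZ', hxZ, e⟩ := germ_eq _ hx hx h1
  exact ⟨Z, hZ, hxZ, e.trans (map_zero (res (tensorPresheaf 𝒜 B) hZ'))⟩

end Vanishing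

section CompAt

variable {R : Type u} (R' : Type u) [CommRing R] [IsLocalRing R] [CommRing R'] [IsLocalRing R']
  [Algebra R R'] {X : TopCat.{u}} (𝒜 : TopCat.Presheaf (AlgCat.{u} R) X)

/-- The value at a point of a section of `R' ⊗̂_R 𝒜`. -/
def compAt {V : Opens X} {x : X} (hx : x ∈ V) :
    Sec (complPresheaf 𝒜 R') V →ₐ[R'] complTensor R R' (Stalk 𝒜 x) where
  toFun := fun f : complSheaf 𝒜 R' V => ⟨fun i => f.1 i ⟨x, hx⟩, fun i => f.2.2 i ⟨x, hx⟩⟩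
  map_one' := rfl
  map_mul' _ _ := rfl
  map_zero' := rfl
  map_add' _ _ := rfl
  commutes' _ := rfl

variable {R' 𝒜}

theorem compAt_ext {V : Opens X} {f g : Sec (complPresheaf 𝒜 R') V}
    (h : ∀ x (hx : x ∈ V), compAt R' 𝒜 hx f = compAt R' 𝒜 hx g) : f = g :=
  Subtype.ext (funext fun i => funext fun x =>
    congrFun (congrArg Subtype.val (h x.1 x.2)) i)

theorem exists_germTensor_eq {V : Opens X} (f : Sec (complPresheaf 𝒜 R') V) (i : ℕ) {x : X}
    (hx : x ∈ V) : ∃ (W : Opens X) (hW : W ≤ V) (_ : x ∈ W) (t : (R' ⧸ 𝔪 R' ^ (i + 1)) ⊗[R] Sec 𝒜 W),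
      ∀ y (hy : y ∈ W), (compAt R' 𝒜 (hW hy) f).1 i = germTensor 𝒜 _ hy t := by
  obtain ⟨W, hW, hxW, t, ht⟩ := (show complSheaf 𝒜 R' V from f).2.1 i ⟨x, hx⟩
  exact ⟨W, hW, hxW, t, ht⟩

theorem exists_compAt_eq {V : Opens X} (g : ∀ x, x ∈ V → complTensor R R' (Stalk 𝒜 x))
    (h : ∀ i x (_ : x ∈ V), ∃ (W : Opens X) (hW : W ≤ V) (_ : x ∈ W)
      (t : (R' ⧸ 𝔪 R' ^ (i + 1)) ⊗[R] Sec 𝒜 W),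
      ∀ y (hy : y ∈ W), (g y (hW hy)).1 i = germTensor 𝒜 _ hy t) :
    ∃ f : Sec (complPresheaf 𝒜 R') V, ∀ x (hx : x ∈ V), compAt R' 𝒜 hx f = g x hx :=
  ⟨(⟨fun i x => (g x.1 x.2).1 i, fun i x => h i x.1 x.2, fun i x => (g x.1 x.2).2 i⟩ :
    complSheaf 𝒜 R' V), fun _ _ => rfl⟩

variable (R' 𝒜) in
/-- The sections of `R' ⊗̂_R 𝒜` whose first `n` components vanish. -/
def baseFilt (V : Opens X) (n : ℕ) : Submodule R' (Sec (complPresheaf 𝒜 R') V) where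
  carrier := {f | ∀ x (hx : x ∈ V), compAt R' 𝒜 hx f ∈ complFilt R R' (Stalk 𝒜 x) n}
  zero_mem' x hx := by rw [map_zero]; exact Submodule.zero_mem _
  add_mem' ha hb x hx := by rw [map_add]; exact Submodule.add_mem _ (ha x hx) (hb x hx)
  smul_mem' r a ha x hx := by rw [map_smul]; exact Submodule.smul_mem _ r (ha x hx)

theorem mem_baseFilt {V : Opens X} {n : ℕ} {f : Sec (complPresheaf 𝒜 R') V} :
    f ∈ baseFilt R' 𝒜 V n ↔ ∀ x (hx : x ∈ V), compAt R' 𝒜 hx f ∈ complFilt R R' (Stalk 𝒜 x) n :=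
  Iff.rfl

theorem mem_baseFilt_succ {V : Opens X} {n : ℕ} {f : Sec (complPresheaf 𝒜 R') V} :
    f ∈ baseFilt R' 𝒜 V (n + 1) ↔ ∀ x (hx : x ∈ V), (compAt R' 𝒜 hx f).1 n = 0 := by
  simp only [mem_baseFilt, mem_complFilt_succ]

theorem mul_mem_complFilt {A : Type u} [Ring A] [Algebra R A] {n : ℕ} (s : complTensor R R' A)
    {t : complTensor R R' A} (ht : t ∈ complFilt R R' A n) : s * t ∈ complFilt R R' A n :=
  fun i hi => by
    change s.1 i * t.1 i = 0
    rw [ht i hi, mul_zero]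

theorem baseFilt_glue {V : Opens X} {W : ℕ → V → Opens X} {hW : ∀ n x, W n x ≤ V}
    {hxW : ∀ n x, x.1 ∈ W n x} {τ : ∀ n x, Sec (complPresheaf 𝒜 R') (W n x)}
    (h1 : ∀ n x y, res (complPresheaf 𝒜 R') (inf_le_left : W n x ⊓ W n y ≤ W n x) (τ n x) -
      res (complPresheaf 𝒜 R') (inf_le_right : W n x ⊓ W n y ≤ W n y) (τ n y) ∈
        baseFilt R' 𝒜 (W n x ⊓ W n y) n)
    (h2 : ∀ n x, res (complPresheaf 𝒜 R') (inf_le_left : W (n + 1) x ⊓ W n x ≤ W (n + 1) x)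
      (τ (n + 1) x) - res (complPresheaf 𝒜 R') (inf_le_right : W (n + 1) x ⊓ W n x ≤ W n x)
        (τ n x) ∈ baseFilt R' 𝒜 (W (n + 1) x ⊓ W n x) n) :
    ∃ t : Sec (complPresheaf 𝒜 R') V, ∀ n x,
      res (complPresheaf 𝒜 R') (hW n x) t - τ n x ∈ baseFilt R' 𝒜 (W n x) n := by
  have h1' : ∀ i x y z (hx : z ∈ W (i + 1) x) (hy : z ∈ W (i + 1) y),
      (compAt R' 𝒜 hx (τ (i + 1) x)).1 i = (compAt R' 𝒜 hy (τ (i + 1) y)).1 i :=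
    fun i x y z hx hy => by
      have hz : z ∈ W (i + 1) x ⊓ W (i + 1) y := ⟨hx, hy⟩
      exact sub_eq_zero.1 (mem_baseFilt_succ.1 (h1 (i + 1) x y) z hz)
  have h2' : ∀ i x z (hx : z ∈ W (i + 2) x) (hy : z ∈ W (i + 1) x),
      (compAt R' 𝒜 hx (τ (i + 2) x)).1 i = (compAt R' 𝒜 hy (τ (i + 1) x)).1 i :=
    fun i x z hx hy => by
      have hz : z ∈ W (i + 2) x ⊓ W (i + 1) x := ⟨hx, hy⟩
      exact sub_eq_zero.1 (mem_baseFilt_succ.1 (h2 (i + 1) x) z hz)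
  obtain ⟨t, ht⟩ := exists_compAt_eq (R' := R') (𝒜 := 𝒜) (V := V)
    (fun x hx => ⟨fun i => (compAt R' 𝒜 (hxW (i + 1) ⟨x, hx⟩) (τ (i + 1) ⟨x, hx⟩)).1 i, fun i => by
      beta_reduce
      rw [← h2' i ⟨x, hx⟩ x (hxW (i + 2) ⟨x, hx⟩) (hxW (i + 1) ⟨x, hx⟩)]
      exact (compAt R' 𝒜 (hxW (i + 2) ⟨x, hx⟩) (τ (i + 2) ⟨x, hx⟩)).2 i⟩) fun i x hx => by
    obtain ⟨Z, hZ, hxZ, u, hu⟩ := exists_germTensor_eq (τ (i + 1) ⟨x, hx⟩) i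
      (hxW (i + 1) ⟨x, hx⟩)
    exact ⟨Z, hZ.trans (hW _ _), hxZ, u, fun y hy => (h1' i _ _ y _ (hZ hy)).trans (hu y hy)⟩
  refine ⟨t, fun n x => ?_⟩
  rcases n with _ | i
  · exact fun y hy i hi => absurd hi (Nat.not_lt_zero i)
  · rw [mem_baseFilt_succ]
    intro y hy
    exact sub_eq_zero.2 ((congrFun (congrArg Subtype.val (ht y (hW _ _ hy))) i).trans
      (h1' i _ _ y _ hy))

theorem complTensor_sub_sum {A : Type u} [Ring A] [Algebra R A] {ι : Type u} [Fintype ι]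
    (f : complTensor R R' A) (r : ι → R') (b : ι → complTensor R R' A) (n : ℕ) :
    (f - ∑ j, r j • b j).1 n = f.1 n - ∑ j, r j • (b j).1 n := by
  refine (map_sub (complEval R R' A n) f (∑ j, r j • b j)).trans (congrArg (f.1 n - ·) ?_)
  exact (map_sum (complEval R R' A n) _ _).trans
    (Finset.sum_congr rfl fun j _ => map_smul (complEval R R' A n) _ _)

theorem compAt_sub_sum {V : Opens X} {x : X} (hx : x ∈ V) {ι : Type u} [Fintype ι]
    (f : Sec (complPresheaf 𝒜 R') V) (r : ι → R') (b : ι → Sec (complPresheaf 𝒜 R') V) :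
    compAt R' 𝒜 hx (f - ∑ j, r j • b j) = compAt R' 𝒜 hx f - ∑ j, r j • compAt R' 𝒜 hx (b j) := by
  rw [map_sub, map_sum]
  exact congrArg _ (Finset.sum_congr rfl fun j _ => map_smul _ _ _)

theorem exists_sub_sum_mem_baseFilt [∀ x, Module.Flat R (Stalk 𝒜 x)] {V : Opens X} {n : ℕ}
    {f : Sec (complPresheaf 𝒜 R') V} (hf : f ∈ baseFilt R' 𝒜 V n) {ι : Type u} [Fintype ι]
    {r : ι → R'} (hr : IsMinGen n r) {x : X} (hx : x ∈ V) :
    ∃ (W : Opens X) (h : W ≤ V) (_ : x ∈ W) (a : ι → Sec (complPresheaf 𝒜 R') W),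
      res (complPresheaf 𝒜 R') h f - ∑ j, r j • a j ∈ baseFilt R' 𝒜 W (n + 1) := by
  obtain ⟨b, hb⟩ := (flatFilt_complFilt (R := R) (R' := R') (A := Stalk 𝒜 x)).exists_sub_sum_mem hr
    (hf x hx)
  rw [mem_complFilt_succ] at hb
  obtain ⟨W, hW, hxW, t, ht⟩ := exists_germTensor_eq f n hx
  have key : ∀ j, ∃ (Z : Opens X) (hZ : Z ≤ W) (hx : x ∈ Z) (v : (R' ⧸ 𝔪 R' ^ (n + 1)) ⊗[R] Sec 𝒜 Z),
      germTensor 𝒜 _ hx v = (b j).1 n := fun j => by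
    generalize (b j).1 n = c
    induction c using TensorProduct.induction_on with
    | zero => exact ⟨W, le_rfl, hxW, 0, map_zero _⟩
    | add c c' hc hc' =>
      obtain ⟨Z, hZ, hxZ, v, rfl⟩ := hc
      obtain ⟨Z', hZ', hxZ', v', rfl⟩ := hc'
      have hz : x ∈ Z ⊓ Z' := ⟨hxZ, hxZ'⟩
      refine ⟨Z ⊓ Z', inf_le_left.trans hZ, hz,
        resTensor 𝒜 _ inf_le_left v + resTensor 𝒜 _ inf_le_right v', ?_⟩
      rw [map_add, germTensor_resTensor, germTensor_resTensor]
    | tmul c a =>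
      obtain ⟨Z, hxZ, s, rfl⟩ := exists_germ 𝒜 a
      have hz : x ∈ W ⊓ Z := ⟨hxW, hxZ⟩
      refine ⟨W ⊓ Z, inf_le_left, hz, c ⊗ₜ res 𝒜 inf_le_right s, ?_⟩
      change c ⊗ₜ germ 𝒜 hz (res 𝒜 inf_le_right s) = _
      rw [germ_res]
  choose Z hZ hxZ v hv using key
  have hxY : x ∈ W ⊓ Finset.univ.inf Z := by
    refine ⟨hxW, ?_⟩
    have : ∀ s : Finset ι, x ∈ s.inf Z := fun s => by
      classical
      induction s using Finset.induction_on with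
      | empty => rw [Finset.inf_empty]; trivial
      | insert a s _ ih => rw [Finset.inf_insert]; exact ⟨hxZ a, ih⟩
    exact this _
  have hY : ∀ j, W ⊓ Finset.univ.inf Z ≤ Z j := fun j =>
    inf_le_right.trans (Finset.inf_le (Finset.mem_univ j))
  have hYW : W ⊓ Finset.univ.inf Z ≤ W := inf_le_left
  generalize W ⊓ Finset.univ.inf Z = Y at hxY hY hYW
  have h0 : germTensor 𝒜 _ hxY (resTensor 𝒜 _ hYW t -
      ∑ j, r j • resTensor 𝒜 (R' ⧸ 𝔪 R' ^ (n + 1)) (hY j) (v j)) = 0 := by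
    rw [complTensor_sub_sum] at hb
    rw [map_sub, map_sum, germTensor_resTensor, ← ht _ hxW]
    refine (congrArg _ (Finset.sum_congr rfl fun j _ => ?_)).trans hb
    rw [LinearMapClass.map_smul_of_tower, germTensor_resTensor, hv]
  obtain ⟨Y', hY', hxY', e⟩ := exists_resTensor_eq_zero 𝒜 _ hxY h0
  choose a ha using fun j => complEval_surjective (R := R) (R' := R') (A := Sec 𝒜 Y') n
    (resTensor 𝒜 _ (hY'.trans (hY j)) (v j))
  refine ⟨Y', (hY'.trans hYW).trans hW, hxY', fun j => complToSheaf 𝒜 R' Y' (a j), ?_⟩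
  rw [mem_baseFilt_succ]
  intro y hy
  have h2 := congrArg (germTensor 𝒜 (R' ⧸ 𝔪 R' ^ (n + 1)) hy) e
  rw [germTensor_resTensor, map_sub, map_sum, germTensor_resTensor, map_zero] at h2
  have h1 := compAt_sub_sum hy (res (complPresheaf 𝒜 R') ((hY'.trans hYW).trans hW) f) r
    (fun j => (complToSheaf 𝒜 R' Y' (a j) : complSheaf 𝒜 R' Y'))
  refine (congrFun (congrArg Subtype.val h1) n).trans ((complTensor_sub_sum _ r _ n).trans
    (Eq.trans (congrArg₂ (· - ·) (ht y _) (Finset.sum_congr rfl fun j _ => ?_)) h2))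
  rw [LinearMapClass.map_smul_of_tower, germTensor_resTensor]
  exact congrArg (r j • ·)
    ((congrArg (germTensor 𝒜 _ hy) (ha j)).trans (germTensor_resTensor 𝒜 _ _ hy _))

end CompAt

section BaseChangeFormal

variable (K : Type u) {R : Type u} (R' : Type u) [Field K] [CommRing R] [Algebra K R]
  [IsLocalRing R] [CommRing R'] [Algebra K R'] [IsLocalRing R'] [ParameterAlgebra K R']
  [Algebra R R'] [IsScalarTower K R R'] {X : TopCat.{u}}

section Stalks

variable (𝒜 : TopCat.Presheaf (AlgCat.{u} R) X)

theorem germ_mem_adicFilt {V : Opens X} {n : ℕ} {a : Sec 𝒜 V} (ha : a ∈ sheafFilt 𝒜 V n) {x : X}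
    (hx : x ∈ V) : germ 𝒜 hx a ∈ adicFilt R (Stalk 𝒜 x) n :=
  (one_tmul_eq_zero_iff n _).1 ((mem_sheafFilt_iff 𝒜).1 ha x hx)

include K in
theorem toComplSheaf_mem_baseFilt [∀ x, Module.Flat R (Stalk 𝒜 x)] {V : Opens X} {n : ℕ}
    {a : Sec 𝒜 V} (ha : a ∈ sheafFilt 𝒜 V n) :
    (toComplSheaf 𝒜 R' V a : Sec (complPresheaf 𝒜 R') V) ∈ baseFilt R' 𝒜 V n := fun _ hx =>
  FlatFilt.adicFilt_le (flatFilt_complFilt (R := R) (R' := R')) n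
    (toCompl_mem_adicFilt K R' (germ_mem_adicFilt 𝒜 ha hx))

include K in
theorem quotient_one_tensor_eq {A : Type u} [Ring A] [Algebra R A]
    (t : (R' ⧸ 𝔪 R' ^ (0 + 1)) ⊗[R] A) : ∃ a, t = 1 ⊗ₜ a := by
  obtain ⟨a, ha⟩ := residue_tensor_eq (Algebra.TensorProduct.map
    (residueEquiv K R R' : 𝕜 R' →ₐ[R] 𝕜 R) (AlgHom.id R A)
    (Algebra.TensorProduct.map (toResidue R') (AlgHom.id R A) t))
  refine ⟨a, (map_toResidue_bijective R' A).1 ((map_residueEquiv_injective K A).1 (ha.trans ?_))⟩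
  rw [Algebra.TensorProduct.map_tmul, map_one, Algebra.TensorProduct.map_tmul, map_one]
  rfl

include K in
/-- Sections of `R' ⊗̂_R 𝒜` locally reduce to sections of `𝒜`. -/
theorem exists_compAt_zero_eq {V : Opens X} (f : Sec (complPresheaf 𝒜 R') V) {x : X} (hx : x ∈ V) :
    ∃ (W : Opens X) (hW : W ≤ V) (_ : x ∈ W) (a : Sec 𝒜 W), ∀ y (hy : y ∈ W),
      (compAt R' 𝒜 hy (res (complPresheaf 𝒜 R') hW f)).1 0 = 1 ⊗ₜ germ 𝒜 hy a := by
  obtain ⟨W, hW, hxW, t, ht⟩ := exists_germTensor_eq f 0 hx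
  obtain ⟨a, rfl⟩ := quotient_one_tensor_eq K R' t
  exact ⟨W, hW, hxW, a, ht⟩

theorem toComplSheaf_res {V W : Opens X} (h : W ≤ V) (a : Sec 𝒜 V) :
    (toComplSheaf 𝒜 R' W (res 𝒜 h a) : Sec (complPresheaf 𝒜 R') W) =
      res (complPresheaf 𝒜 R') h (toComplSheaf 𝒜 R' V a : Sec (complPresheaf 𝒜 R') V) :=
  compAt_ext fun x hx => congrArg (toCompl R') (germ_res 𝒜 h hx a)

/-- The map `𝒜 → R' ⊗̂_R 𝒜` on sections. -/
def toComplSheafHom (V : Opens X) : Sec 𝒜 V →+ Sec (complPresheaf 𝒜 R') V where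
  toFun a := (toComplSheaf 𝒜 R' V a : complSheaf 𝒜 R' V)
  map_zero' := compAt_ext fun x hx => ((congrArg (toCompl R') (map_zero (germ 𝒜 hx))).trans
    (map_zero (toComplHom R' (Stalk 𝒜 x)))).trans (map_zero (compAt R' 𝒜 hx)).symm
  map_add' a b := compAt_ext fun x hx => ((congrArg (toCompl R') (map_add (germ 𝒜 hx) a b)).trans
    (map_add (toComplHom R' (Stalk 𝒜 x)) _ _)).trans (map_add (compAt R' 𝒜 hx)
      (toComplSheaf 𝒜 R' V a : complSheaf 𝒜 R' V) (toComplSheaf 𝒜 R' V b : complSheaf 𝒜 R' V)).symm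

theorem toComplSheafHom_algebraMap_smul (V : Opens X) (c : K) (a : Sec 𝒜 V) :
    toComplSheafHom R' 𝒜 V (algebraMap K R c • a) =
      algebraMap K R' c • toComplSheafHom R' 𝒜 V a :=
  compAt_ext fun x hx => by
    have h : compAt R' 𝒜 hx (algebraMap K R' c • toComplSheafHom R' 𝒜 V a) =
        algebraMap K R' c • toCompl R' (germ 𝒜 hx a) := map_smul (compAt R' 𝒜 hx) _ _
    rw [h]
    exact (congrArg (toCompl R') (map_smul (germ 𝒜 hx) _ a)).trans
      (toCompl_algebraMap_smul K R' c (germ 𝒜 hx a))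

theorem baseFilt_smul_mem [∀ x, Module.Flat R (Stalk 𝒜 x)] {V : Opens X} {i n : ℕ} {r : R'}
    {t : Sec (complPresheaf 𝒜 R') V} (hr : r ∈ 𝔪 R' ^ i) (ht : t ∈ baseFilt R' 𝒜 V n) :
    r • t ∈ baseFilt R' 𝒜 V (n + i) := fun x h => by
  rw [map_smul]
  exact (flatFilt_complFilt (R := R) (R' := R') (A := Stalk 𝒜 x)).smul_mem hr (ht x h)

theorem baseFilt_mul_mem {V : Opens X} {n : ℕ} (s : Sec (complPresheaf 𝒜 R') V)
    {t : Sec (complPresheaf 𝒜 R') V} (ht : t ∈ baseFilt R' 𝒜 V n) : s * t ∈ baseFilt R' 𝒜 V n :=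
  fun x h => by
    rw [map_mul]
    exact mul_mem_complFilt (compAt R' 𝒜 h s) (ht x h)

theorem baseFilt_indep [∀ x, Module.Flat R (Stalk 𝒜 x)] {V : Opens X} {n : ℕ} {ι : Type u}
    [Fintype ι] {r : ι → R'} (hr : IsMinGen n r) {a : ι → Sec (complPresheaf 𝒜 R') V}
    (h : ∑ j, r j • a j ∈ baseFilt R' 𝒜 V (n + 1)) (j : ι) : a j ∈ baseFilt R' 𝒜 V 1 :=
  fun x hx => (flatFilt_complFilt (R := R) (R' := R') (A := Stalk 𝒜 x)).indep n r hr
    (fun j => compAt R' 𝒜 hx (a j)) (by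
      have h1 := h x hx
      rw [map_sum] at h1
      refine (congrArg (· ∈ complFilt R R' (Stalk 𝒜 x) (n + 1)) ?_).mp h1
      exact Finset.sum_congr rfl fun j _ => map_smul _ _ _) j

end Stalks

variable {O : TopCat.Presheaf (CommAlgCat.{u} K) X} {M : AffModel O} {κ : DefKind}

theorem baseChange_sy_eq (𝒜 : PreSheafDef K R O) {V : Opens X}
    {f : Sec (complPresheaf 𝒜.alg R') V} {a : Sec 𝒜.alg V}
    (h : ∀ y (hy : y ∈ V), (compAt R' 𝒜.alg hy f).1 0 = 1 ⊗ₜ germ 𝒜.alg hy a) {x : X} (hx : x ∈ V) :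
    M.sy (𝒜.baseChange K R') hx f = M.sy 𝒜 hx a := by
  refine (AffModel.sy_eq M (𝒜.baseChange K R') hx f).trans (Eq.trans ?_ (AffModel.sy_eq M 𝒜 hx a).symm)
  refine congrFun (congrArg (M.ev V) (congrArg (𝒜.aug V) (Subtype.ext (funext fun y => ?_)))) _
  change residueLift K R' (stalkProj R' 𝒜.alg y.1) (1 ⊗ₜ germ (complPresheaf 𝒜.alg R') y.2 f) =
    1 ⊗ₜ germ 𝒜.alg y.2 a
  rw [residueLift_one_tmul]
  refine (congrArg _ ((stalkProj_germ R' 𝒜.alg y.2 f).trans (congrArg _ (h y.1 y.2)))).trans ?_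
  rw [Algebra.TensorProduct.map_tmul, map_one, Algebra.TensorProduct.map_tmul, map_one]
  rfl

theorem baseChange_sy_toComplSheaf (𝒜 : PreSheafDef K R O) {V : Opens X} (a : Sec 𝒜.alg V) {x : X}
    (hx : x ∈ V) : M.sy (𝒜.baseChange K R') hx (toComplSheaf 𝒜.alg R' V a : complSheaf 𝒜.alg R' V) =
      M.sy 𝒜 hx a :=
  baseChange_sy_eq K R' 𝒜 (fun _ _ => rfl) hx

theorem SheafDef.mem_baseFilt_one_iff (𝒜 : SheafDef K R O κ) {V : Opens X}
    {f : Sec (complPresheaf 𝒜.alg R') V} : f ∈ baseFilt R' 𝒜.alg V 1 ↔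
      ∀ (x : X) (hx : x ∈ V), M.sy (𝒜.toPreSheafDef.baseChange K R') hx f = 0 := by
  have hfl := 𝒜.isDeformation.flat
  constructor
  · intro h x hx
    rw [baseChange_sy_eq K R' 𝒜.toPreSheafDef (a := 0) (fun y hy => ?_) hx, map_zero]
    rw [map_zero, TensorProduct.tmul_zero]
    exact mem_baseFilt_succ.1 h y hy
  · intro h
    rw [mem_baseFilt_succ]
    intro x hx
    obtain ⟨W, hW, hxW, a, ha⟩ := exists_compAt_zero_eq K R' 𝒜.alg f hx
    have h1 : a ∈ sheafFilt 𝒜.alg W 1 := (𝒜.sy_eq_zero_iff M).2 fun y hy => by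
      rw [← baseChange_sy_eq K R' 𝒜.toPreSheafDef ha hy]
      exact (AffModel.sy_res (P := 𝒜.toPreSheafDef.baseChange K R') hW hy f).trans (h y (hW hy))
    exact (ha x hxW).trans (mem_baseFilt_succ.1 (toComplSheaf_mem_baseFilt K R' 𝒜.alg h1) x hxW)

theorem SheafDef.isFormal_baseChange (𝒜 : SheafDef K R O κ) :
    IsFormal M (𝒜.toPreSheafDef.baseChange K R') (baseFilt R' 𝒜.alg) := by
  have hfl := 𝒜.isDeformation.flat
  have hx (x : X) := flatFilt_complFilt (R := R) (R' := R') (A := Stalk 𝒜.alg x)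
  exact
  { mem_zero := fun V t x _ => (hx x).mem_zero _
    antitone := fun V i j hij t ht x h => (hx x).antitone hij (ht x h)
    sep := fun V t ht => compAt_ext fun x h => ((hx x).sep _ fun n => ht n x h).trans
      (map_zero (compAt R' 𝒜.alg h)).symm
    res_mem := fun h n t ht x hx => ht x (h hx)
    mem_of_local := fun {V n t} h x hx => by
      obtain ⟨W, hW, hxW, h1⟩ := h x hx
      exact h1 x hxW
    smul_mem := baseFilt_smul_mem R' 𝒜.alg
    mul_mem := baseFilt_mul_mem R' 𝒜.alg
    glue := fun V W hW hxW τ h1 h2 => baseFilt_glue (hW := hW) (hxW := hxW) h1 h2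
    mem_one_iff := 𝒜.mem_baseFilt_one_iff K R'
    exists_sy_eq := fun V h x hx => by
      obtain ⟨W, hW, hxW, t, ht⟩ := (𝒜.isFormal M).exists_sy_eq V h x hx
      exact ⟨W, hW, hxW, (toComplSheaf 𝒜.alg R' W t : complSheaf 𝒜.alg R' W),
        (baseChange_sy_toComplSheaf K R' 𝒜.toPreSheafDef t hxW).trans ht⟩
    gen := fun {V n t} ht ι _ r hr x hx => exists_sub_sum_mem_baseFilt ht hr hx
    indep := fun n ι _ r hr a h j => baseFilt_indep R' 𝒜.alg hr h j }

theorem stalkBr_kind {𝒜 : PreSheafDef K R O} (h : ∀ V, IsBracketOfKind (𝒜.br V) κ) (x : X) :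
    IsBracketOfKind (stalkBr 𝒜.alg 𝒜.br 𝒜.br_res x) κ := by
  cases κ with
  | assoc =>
    intro a b
    obtain ⟨V, hx, s, t, -, rfl, rfl, -⟩ := exists_germ₃ 𝒜.alg a b 0
    rw [← stalkBr_germ, h V, map_sub, map_mul, map_mul]
  | poisson =>
    refine ⟨fun a b => ?_, fun a => ?_, fun a b c => ?_, fun a b c => ?_, fun a b c => ?_⟩
    · obtain ⟨V, hx, s, t, -, rfl, rfl, -⟩ := exists_germ₃ 𝒜.alg a b 0
      rw [← map_mul, (h V).1, map_mul]
    · obtain ⟨V, hx, s, rfl⟩ := exists_germ 𝒜.alg a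
      rw [← stalkBr_germ, (h V).2.1, map_zero]
    · obtain ⟨V, hx, s, t, r, rfl, rfl, rfl⟩ := exists_germ₃ 𝒜.alg a b c
      simp only [← stalkBr_germ, ← map_add, (h V).2.2.1, map_zero]
    · obtain ⟨V, hx, s, t, r, rfl, rfl, rfl⟩ := exists_germ₃ 𝒜.alg a b c
      simp only [← stalkBr_germ, ← map_add, ← map_mul, (h V).2.2.2.1]
    · obtain ⟨V, hx, s, t, r, rfl, rfl, rfl⟩ := exists_germ₃ 𝒜.alg a b c
      simp only [← stalkBr_germ, ← map_add, ← map_mul, (h V).2.2.2.2]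

theorem baseChange_br_kind {𝒜 : PreSheafDef K R O} (h : ∀ V, IsBracketOfKind (𝒜.br V) κ)
    (V : Opens X) : IsBracketOfKind ((𝒜.baseChange K R').br V) κ :=
  IsBracketOfKind.of_maps (A := complSheaf 𝒜.alg R' V) (ι := ULift.{u} ℕ × V)
    (fun i => (stalkBr_kind K h i.2.1).baseChange (R' ⧸ 𝔪 R' ^ (i.1.down + 1)))
    (fun i => ((Pi.evalRingHom _ i.2).comp ((Pi.evalRingHom _ i.1.down).comp
      (complSheaf 𝒜.alg R' V).val.toRingHom) :
      complSheaf 𝒜.alg R' V →+* (R' ⧸ 𝔪 R' ^ (i.1.down + 1)) ⊗[R] Stalk 𝒜.alg i.2.1))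
    (fun i f g => rfl) fun f g h => Subtype.ext (funext fun i => funext fun x => h ⟨⟨i⟩, x⟩)

theorem SheafDef.baseChange_sy_br (𝒜 : SheafDef K R O κ) {V : Opens X} {x : X} (hx : x ∈ V)
    (f g : Sec (complPresheaf 𝒜.alg R') V) :
    M.sy (𝒜.toPreSheafDef.baseChange K R') hx ((𝒜.toPreSheafDef.baseChange K R').br V f g) = 0 := by
  obtain ⟨W, hW, hxW, a, ha⟩ := exists_compAt_zero_eq K R' 𝒜.alg f hx
  obtain ⟨Z, hZ, hxZ, b, hb⟩ := exists_compAt_zero_eq K R' 𝒜.alg g hx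
  have hz : x ∈ W ⊓ Z := ⟨hxW, hxZ⟩
  refine (AffModel.sy_res (P := 𝒜.toPreSheafDef.baseChange K R') (inf_le_left.trans hW : W ⊓ Z ≤ V)
    hz _).symm.trans ((baseChange_sy_eq K R' 𝒜.toPreSheafDef (a := 𝒜.br (W ⊓ Z)
      (res 𝒜.alg inf_le_left a) (res 𝒜.alg inf_le_right b)) (fun y hy => ?_) hz).trans ?_)
  · have hyW : y ∈ W := hy.1
    have hyZ : y ∈ Z := hy.2
    refine (congrArg₂ (fun s t => LinearMap.BilinMap.baseChange (R' ⧸ 𝔪 R' ^ (0 + 1))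
      (stalkBr 𝒜.alg 𝒜.br 𝒜.br_res y) s t) (ha y hyW) (hb y hyZ)).trans ?_
    rw [stalkBr_germ 𝒜.alg 𝒜.br 𝒜.br_res, germ_res, germ_res]
    simp
  · rw [AffModel.sy_eq, 𝒜.isDeformation.aug_br, map_zero]
    rfl

theorem SheafDef.isDeformation_baseChange (M : AffModel O) (𝒜 : SheafDef K R O κ) :
    (𝒜.toPreSheafDef.baseChange K R').IsDeformation κ :=
  have : IsNoetherianRing R' := ParameterAlgebra.isNoetherianRing K
  (𝒜.isFormal_baseChange K R' (M := M)).isDeformation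
    (baseChange_br_kind K R' 𝒜.isDeformation.kind) fun _ _ hx f g => 𝒜.baseChange_sy_br K R' hx f g

end BaseChangeFormal

section BaseChangeGamma

variable (K : Type u) {R : Type u} (R' : Type u) [Field K] [CommRing R] [Algebra K R]
  [IsLocalRing R] [CommRing R'] [Algebra K R'] [IsLocalRing R'] [ParameterAlgebra K R']
  [Algebra R R'] [IsScalarTower K R R'] {X : TopCat.{u}}
  {O : TopCat.Presheaf (CommAlgCat.{u} K) X} (M : AffModel O) {κ : DefKind} [IsNoetherianRing R]

include K M

theorem SheafDef.exists_sub_toComplSheafHom_mem (𝒜 : SheafDef K R O κ)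
    (y : Sec (complPresheaf 𝒜.alg R') ⊤) :
    ∃ t, y - toComplSheafHom R' 𝒜.alg ⊤ t ∈ baseFilt R' 𝒜.alg ⊤ 1 := by
  by_cases hX : ∃ x : X, x ∈ (⊤ : Opens X)
  · obtain ⟨x, hx⟩ := hX
    have hr := AffModel.isReg_sy (P := 𝒜.toPreSheafDef.baseChange K R') (M := M) hx y
    obtain ⟨t, ht⟩ := (𝒜.isFormal M).exists_sy (f := 1) (hr.mono le_top)
    have hD : (⊤ : Opens X) ≤ M.D 1 := M.D_one.ge
    refine ⟨res 𝒜.alg hD t, (𝒜.mem_baseFilt_one_iff K R' (M := M)).2 fun z hz => ?_⟩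
    have h1 := baseChange_sy_toComplSheaf K R' (M := M) 𝒜.toPreSheafDef (res 𝒜.alg hD t) hz
    have h2 := AffModel.sy_res (M := M) (P := 𝒜.toPreSheafDef) hD hz t
    have h3 := AffModel.sy_const (M := M) (P := 𝒜.toPreSheafDef.baseChange K R') hz hx y
    refine (map_sub (M.sy (𝒜.toPreSheafDef.baseChange K R') hz) y
      (toComplSheaf 𝒜.alg R' ⊤ (res 𝒜.alg hD t) : complSheaf 𝒜.alg R' ⊤)).trans ?_
    exact sub_eq_zero.2 (h3.trans ((h1.trans h2).trans (ht z (hD hz))).symm)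
  · refine ⟨0, ?_⟩
    rw [mem_baseFilt]
    intro x hx
    exact (hX ⟨x, hx⟩).elim

theorem SheafDef.complToSheaf_bijective (𝒜 : SheafDef K R O κ) :
    Function.Bijective (complToSheaf 𝒜.alg R' ⊤) := by
  have hN : IsNoetherianRing R' := ParameterAlgebra.isNoetherianRing K
  have hA := 𝒜.isFormal M
  have hA' := 𝒜.isFormal_baseChange K R' (M := M)
  have hfl : Module.Flat R (Sec 𝒜.alg ⊤) := hA.flatFilt_top.flat
  have hG : FlatFilt (R := R') (M := complSheaf 𝒜.alg R' ⊤) (baseFilt R' 𝒜.alg ⊤) :=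
    hA'.flatFilt_top
  refine (flatFilt_complFilt (R := R) (R' := R') (A := Sec 𝒜.alg ⊤)).bijective hG
    (complToSheaf 𝒜.alg R' ⊤).toLinearMap (fun f hf => ?_) fun y => ?_
  · obtain ⟨a, ha⟩ := quotient_one_tensor_eq K R' (f.1 0)
    rw [mem_complFilt_succ, ha]
    have h0 : ∀ y (hy : y ∈ (⊤ : Opens X)), (compAt R' 𝒜.alg hy
        (complToSheaf 𝒜.alg R' ⊤ f : complSheaf 𝒜.alg R' ⊤)).1 0 = 1 ⊗ₜ germ 𝒜.alg hy a :=
      fun y hy => congrArg (germTensor 𝒜.alg _ hy) ha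
    have h1 : a ∈ sheafFilt 𝒜.alg ⊤ 1 := (𝒜.sy_eq_zero_iff M).2 fun y hy => by
      rw [← baseChange_sy_eq K R' 𝒜.toPreSheafDef h0 hy]
      exact (𝒜.mem_baseFilt_one_iff K R' (M := M)).1 hf y hy
    rw [𝒜.sheafFilt_top_eq M] at h1
    exact mem_complFilt_succ.1 (FlatFilt.adicFilt_le (flatFilt_complFilt (R := R) (R' := R')) 1
      (toCompl_mem_adicFilt K R' h1))
  · obtain ⟨t, ht⟩ := 𝒜.exists_sub_toComplSheafHom_mem K R' M y
    exact ⟨toCompl R' t, ht⟩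

theorem SheafDef.sheafFilt_baseChange (𝒜 : SheafDef K R O κ) (V : Opens X) (n : ℕ) :
    sheafFilt (complPresheaf 𝒜.alg R') V n = baseFilt R' 𝒜.alg V n :=
  have : IsNoetherianRing R' := ParameterAlgebra.isNoetherianRing K
  (𝒜.isFormal_baseChange K R' (M := M)).sheafFilt_eq V n

/-- Homomorphisms out of `R' ⊗̂_R 𝒜` are determined by the sections of `𝒜`. -/
theorem SheafDef.baseChange_hom_ext (𝒜 : SheafDef K R O κ)
    {φ ψ : SheafHom (complPresheaf 𝒜.alg R') (complPresheaf 𝒜.alg R')}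
    (h : ∀ V a, φ.app V (toComplSheaf 𝒜.alg R' V a : complSheaf 𝒜.alg R' V) =
      ψ.app V (toComplSheaf 𝒜.alg R' V a : complSheaf 𝒜.alg R' V)) (V : Opens X)
    (f : Sec (complPresheaf 𝒜.alg R') V) : φ.app V f = ψ.app V f := by
  have hA' := 𝒜.isFormal_baseChange K R' (M := M)
  have hl : ∀ W, ∀ c ∈ Submodule.span R' (Set.range (toCompl (R := R) (A := Sec 𝒜.alg W) R')),
      φ.app W (complToSheaf 𝒜.alg R' W c : complSheaf 𝒜.alg R' W) =
        ψ.app W (complToSheaf 𝒜.alg R' W c : complSheaf 𝒜.alg R' W) := fun W c hc => by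
    have hle : Submodule.span R' (Set.range (toCompl (R := R) (A := Sec 𝒜.alg W) R')) ≤
        LinearMap.eqLocus ((φ.app W).toLinearMap.comp (complToSheaf 𝒜.alg R' W).toLinearMap)
          ((ψ.app W).toLinearMap.comp (complToSheaf 𝒜.alg R' W).toLinearMap) :=
      Submodule.span_le.2 (by rintro _ ⟨a, rfl⟩; exact h W a)
    exact hle hc
  rw [← sub_eq_zero]
  refine hA'.sep V _ fun n => hA'.antitone V (Nat.le_succ n) (hA'.mem_of_local fun x hx => ?_)
  obtain ⟨W, hW, hxW, t, ht⟩ := exists_germTensor_eq f n hx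
  obtain ⟨c, hc, hct⟩ := exists_span_toCompl n t
  refine ⟨W, hW, hxW, ?_⟩
  obtain ⟨d, hd⟩ : ∃ d : Sec (complPresheaf 𝒜.alg R') W, d = complToSheaf 𝒜.alg R' W c := ⟨_, rfl⟩
  have h1 : res (complPresheaf 𝒜.alg R') hW f - d ∈ baseFilt R' 𝒜.alg W (n + 1) := mem_baseFilt_succ.2 fun y hy =>
    sub_eq_zero.2 ((ht y hy).trans ((congrArg (germTensor 𝒜.alg _ hy) hct.symm).trans
      (congrArg (fun z => (compAt R' 𝒜.alg hy z).1 n) hd.symm)))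
  rw [← 𝒜.sheafFilt_baseChange K R' M] at h1
  have h2 := Submodule.sub_mem _ (φ.map_sheafFilt h1) (ψ.map_sheafFilt h1)
  have h3 : φ.app W d = ψ.app W d := by rw [hd]; exact hl W c hc
  rw [map_sub, map_sub, h3, sub_sub_sub_cancel_right, φ.app_res, ψ.app_res, ← map_sub,
    𝒜.sheafFilt_baseChange K R' M] at h2
  exact h2

omit M [IsNoetherianRing R] in
theorem toComplSheafHom_br (𝒜 : PreSheafDef K R O) (V : Opens X) (a b : Sec 𝒜.alg V) :
    toComplSheafHom R' 𝒜.alg V (𝒜.br V a b) = (𝒜.baseChange K R').br V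
      (toComplSheafHom R' 𝒜.alg V a) (toComplSheafHom R' 𝒜.alg V b) :=
  compAt_ext fun x hx => (congrArg (toCompl R') (stalkBr_germ 𝒜.alg 𝒜.br 𝒜.br_res hx a b)).trans
    (toCompl_br R' (stalkBr 𝒜.alg 𝒜.br 𝒜.br_res x) _ _)

omit M [IsNoetherianRing R] in
theorem complSheafMap_toComplSheaf {𝒜 ℬ : TopCat.Presheaf (AlgCat.{u} R) X} (g : SheafHom 𝒜 ℬ)
    (V : Opens X) (a : Sec 𝒜 V) :
    (complSheafMap R' g).app V (toComplSheaf 𝒜 R' V a : complSheaf 𝒜 R' V) =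
      (toComplSheaf ℬ R' V (g.app V a) : complSheaf ℬ R' V) :=
  compAt_ext fun x hx => Subtype.ext (funext fun i => by
    change stalkTensor (R' ⧸ 𝔪 R' ^ (i + 1)) g x (1 ⊗ₜ germ 𝒜 hx a) = 1 ⊗ₜ germ ℬ hx (g.app V a)
    rw [stalkTensor, Algebra.TensorProduct.map_tmul, map_one, stalkMap_germ])

theorem SheafDef.toComplSheafHom_mem (𝒜 : SheafDef K R O κ) {V : Opens X} {n : ℕ}
    {a : Sec 𝒜.alg V} (ha : a ∈ sheafFilt 𝒜.alg V n) :
    toComplSheafHom R' 𝒜.alg V a ∈ sheafFilt (complPresheaf 𝒜.alg R') V n := by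
  have hfl := 𝒜.isDeformation.flat
  rw [𝒜.sheafFilt_baseChange K R' M]
  exact toComplSheaf_mem_baseFilt K R' 𝒜.alg ha

variable [CharZero K]

theorem isMorphism_sheafBaseChange
    (h : ∀ 𝒜 : SheafDef K R O κ, (𝒜.toPreSheafDef.baseChange K R').IsDeformation κ) :
    (sheafBaseChange K R' h).IsMorphism where
  map₂_mul {𝒜} a b := Subtype.ext <|
    map_bch K (toComplSheafHom R' (SheafDef.toPreSheafDef 𝒜).alg ⊤)
      (toComplSheafHom_algebraMap_smul K R' _ ⊤) (SheafDef.isFiltBracket 𝒜 ⊤)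
      (SheafDef.isFiltBracket ((sheafBaseChange K R' h).functor.obj 𝒜) ⊤)
      (SheafDef.toComplSheafHom_mem K R' M 𝒜) (fun x _ y _ => toComplSheafHom_br K R' _ ⊤ x y)
      a.2 b.2
  map₂_twist {𝒜 ℬ} g a := Subtype.ext
    (complSheafMap_toComplSheaf K R' (SheafGauge.toEquiv g).hom ⊤ a.1).symm
  map_feedback {𝒜} a := SheafGauge.hom_ext (SheafDef.baseChange_hom_ext K R' M 𝒜 fun V s => by
    refine (complSheafMap_toComplSheaf K R' _ V s).trans ?_
    refine (congrArg (fun z : Sec (SheafDef.toPreSheafDef 𝒜).alg V =>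
      toComplSheafHom R' (SheafDef.toPreSheafDef 𝒜).alg V z) (SheafDef.ig_app 𝒜 a V s)).trans ?_
    have h1 := map_expAd K (toComplSheafHom R' (SheafDef.toPreSheafDef 𝒜).alg V)
      (toComplSheafHom_algebraMap_smul K R' _ V) (SheafDef.isFiltBracket 𝒜 V)
      (SheafDef.isFiltBracket ((sheafBaseChange K R' h).functor.obj 𝒜) V)
      (SheafDef.toComplSheafHom_mem K R' M 𝒜) (res_sheafFilt _ (le_top : V ≤ ⊤) a.2) Set.univ
      (fun b _ => ⟨trivial, toComplSheafHom_br K R' _ V _ b⟩) (Set.mem_univ s)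
    refine h1.trans ?_
    refine Eq.trans ?_ (SheafDef.ig_app ((sheafBaseChange K R' h).functor.obj 𝒜)
      ((sheafBaseChange K R' h).map₂ a) V _).symm
    exact congrArg (fun z => expAd K _ _ z _) (toComplSheaf_res R' _ _ a.1))

omit M [CharZero K] [IsNoetherianRing R] in
theorem gamma_baseChange_aug (𝒜 : PreSheafDef K R O) (f : complTensor R R' (Sec 𝒜.alg ⊤)) :
    (𝒜.baseChange K R').gamma.aug (1 ⊗ₜ (complToSheaf 𝒜.alg R' ⊤ f : complSheaf 𝒜.alg R' ⊤)) =
      (𝒜.gamma.baseChange K R').aug (1 ⊗ₜ f) := by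
  refine congrArg (𝒜.aug ⊤) (Subtype.ext (funext fun y => ?_))
  change residueLift K R' (stalkProj R' 𝒜.alg y.1) (1 ⊗ₜ germ (complPresheaf 𝒜.alg R') y.2
      (complToSheaf 𝒜.alg R' ⊤ f : complSheaf 𝒜.alg R' ⊤)) =
    germTensor 𝒜.alg (𝕜 R) y.2 (residueLift K R' (complProj R' (Sec 𝒜.alg ⊤)) (1 ⊗ₜ f))
  rw [residueLift_one_tmul, residueLift_one_tmul]
  refine (congrArg _ (stalkProj_germ R' 𝒜.alg y.2 (complToSheaf 𝒜.alg R' ⊤ f))).trans ?_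
  refine (congrArg _ (map_germTensor 𝒜.alg (toResidue R') y.2 (f.1 0))).trans ?_
  exact map_germTensor 𝒜.alg (residueEquiv K R R' : 𝕜 R' →ₐ[R] 𝕜 R) y.2 _

/-- The gauge transformation `R' ⊗̂_R Γ(X, 𝒜) → Γ(X, R' ⊗̂_R 𝒜)`. -/
def SheafDef.complGauge (𝒜 : SheafDef K R O κ) :
    AlgGauge (𝒜.gamma.baseChange K R') (𝒜.toPreSheafDef.baseChange K R').gamma where
  toEquiv := AlgEquiv.ofBijective
    (complToSheaf 𝒜.alg R' ⊤ : complTensor R R' (Sec 𝒜.alg ⊤) →ₐ[R'] complSheaf 𝒜.alg R' ⊤)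
    (𝒜.complToSheaf_bijective K R' M)
  map_br (a b : complTensor R R' (Sec 𝒜.alg ⊤)) := compAt_ext fun x hx =>
    Subtype.ext (funext fun i =>
      germTensor_baseChange 𝒜.br 𝒜.br_res (R' ⧸ 𝔪 R' ^ (i + 1)) hx (a.1 i) (b.1 i))
  map_aug f := gamma_baseChange_aug K R' 𝒜.toPreSheafDef f

/-- The natural isomorphism `R' ⊗̂_R Γ(X, -) ≅ Γ(X, R' ⊗̂_R -)`. -/
def complNatIso (hΓ : GammaPreserves K R O κ) (hΓ' : GammaPreserves K R' O κ)
    (hs : ∀ 𝒜 : SheafDef K R O κ, (𝒜.toPreSheafDef.baseChange K R').IsDeformation κ)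
    (ha : ∀ A : AlgDef K R (O.obj (op ⊤)) κ, (A.toPreAlgDef.baseChange K R').IsDeformation κ) :
    ((gamma hΓ).comp (algBaseChange K R' ha)).NatIso
      ((sheafBaseChange K R' hs).comp (gamma hΓ')) where
  iso := NatIso.ofComponents
    (fun 𝒜 => (Groupoid.isoEquivHom _ _).symm (SheafDef.complGauge K R' M 𝒜))
    fun {𝒜 ℬ} g => AlgGauge.ext (AlgEquiv.ext
      fun f : complTensor R R' (Sec (SheafDef.toPreSheafDef 𝒜).alg ⊤) =>
        compAt_ext fun x hx => Subtype.ext (funext fun i =>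
          (stalkTensor_germTensor (R' ⧸ 𝔪 R' ^ (i + 1)) (SheafGauge.toEquiv g).hom hx (f.1 i)).symm))
  twist a := rfl

end BaseChangeGamma

/-! ### Brackets on rings of fractions -/

section Fractions

variable {B Q : Type u} [Ring B] [Ring Q]

/-- `Q` is the ring of left fractions of `B` with denominators in `S`. -/
structure IsFrac (S : Submonoid B) (ι : B →+* Q) : Prop where
  isUnit : ∀ s ∈ S, IsUnit (ι s)
  exists_mul_eq : ∀ q, ∃ s ∈ S, ∃ a, ι s * q = ι a
  exists_lift : ∀ {T : Type u} [Ring T] (f : B →+* T), (∀ s ∈ S, IsUnit (f s)) →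
    ∃ g : Q →+* T, ∀ b, g (ι b) = f b

variable {S : Submonoid B} {ι : B →+* Q} (hι : IsFrac S ι)
include hι

theorem IsFrac.hom_ext {T : Type u} [Ring T] {f g : Q →+* T} (h : ∀ b, f (ι b) = g (ι b)) (q : Q) :
    f q = g q := by
  obtain ⟨s, hs, a, e⟩ := hι.exists_mul_eq q
  refine ((hι.isUnit s hs).map f).mul_left_cancel ?_
  rw [← map_mul, e, h a, ← e, map_mul, h s]

theorem IsFrac.derivation_eq_zero {D : Q → Q} (h : ∀ p q, D (p * q) = D p * q + p * D q)
    (h0 : ∀ b, D (ι b) = 0) (q : Q) : D q = 0 := by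
  obtain ⟨s, hs, a, e⟩ := hι.exists_mul_eq q
  have h1 := h (ι s) q
  rw [e, h0, h0, zero_mul, zero_add] at h1
  exact (hι.isUnit s hs).mul_left_cancel (h1.symm.trans (mul_zero _).symm)

/-- Derivations extend to rings of fractions. -/
theorem IsFrac.exists_derivation (d : B →+ Q) (hd : ∀ a b, d (a * b) = d a * ι b + ι a * d b) :
    ∃ D : Q →+ Q, (∀ p q, D (p * q) = D p * q + p * D q) ∧ ∀ b, D (ι b) = d b := by
  have h1 : d 1 = 0 := by
    have := hd 1 1
    rw [mul_one, ι.map_one, mul_one, one_mul] at this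
    exact left_eq_add.1 this
  let f : B →+* TrivSqZeroExt Q Q :=
    { toFun := fun b => TrivSqZeroExt.inl (ι b) + TrivSqZeroExt.inr (d b)
      map_one' := by rw [h1, map_one, TrivSqZeroExt.inr_zero, add_zero, TrivSqZeroExt.inl_one]
      map_zero' := by simp
      map_add' := fun a b => by ext <;> simp
      map_mul' := fun a b => by
        ext
        · simp
        · simp [hd, add_comm] }
  obtain ⟨g, hg⟩ := hι.exists_lift f fun s hs =>
    TrivSqZeroExt.isUnit_iff_isUnit_fst.2 (by simpa [f] using hι.isUnit s hs)
  have hfst : ∀ q, (g q).fst = q := fun q => hι.hom_ext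
    (f := (TrivSqZeroExt.fstHom ℤ Q Q : TrivSqZeroExt Q Q →+* Q).comp g) (g := RingHom.id Q)
    (fun b => by simp [hg, f]) q
  refine ⟨(TrivSqZeroExt.sndHom Q Q).toAddMonoidHom.comp g.toAddMonoidHom, fun p q => ?_,
    fun b => ?_⟩
  · change (g (p * q)).snd = (g p).snd * q + p * (g q).snd
    rw [map_mul, TrivSqZeroExt.snd_mul, hfst, hfst, add_comm]
    rfl
  · change (g (ι b)).snd = d b
    simp [hg, f]

end Fractions

section Poisson

variable {R B Q : Type u} [CommRing R] [Ring B] [Algebra R B] [CommRing Q] [Algebra R Q]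
  {S : Submonoid B} {ι : B →ₐ[R] Q} {br : B →ₗ[R] B →ₗ[R] B}

/-- Poisson brackets extend to rings of fractions. -/
theorem IsFrac.exists_poisson (hι : IsFrac S (ι : B →+* Q)) (h : IsBracketOfKind br .poisson) :
    ∃ br' : Q →ₗ[R] Q →ₗ[R] Q, IsBracketOfKind br' .poisson ∧
      ∀ a b, br' (ι a) (ι b) = ι (br a b) := by
  obtain ⟨-, h1, h2, h3, h4⟩ := h
  have h1' : ∀ a b, br a b = -br b a := fun a b => by
    have := h1 (a + b)
    simp only [map_add, LinearMap.add_apply, h1, zero_add, add_zero] at this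
    rw [eq_neg_iff_add_eq_zero, add_comm]; exact this
  have key : ∃ P : Q → Q → Q, (∀ p p' q, P (p + p') q = P p q + P p' q) ∧
      (∀ p q q', P p (q + q') = P p q + P p q') ∧
      (∀ p p' q, P (p * p') q = P p q * p' + p * P p' q) ∧
      (∀ p q q', P p (q * q') = P p q * q' + q * P p q') ∧
      ∀ a b, P (ι a) (ι b) = ι (br a b) := by
    choose D hD1 hD2 using fun b : B => hι.exists_derivation
      ((ι : B →+* Q).toAddMonoidHom.comp (br b).toAddMonoidHom) fun x y => by
        change ι (br b (x * y)) = ι (br b x) * ι y + ι x * ι (br b y)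
        rw [h3, map_add, map_mul, map_mul]
    have hD2' : ∀ a b, D a (ι b) = ι (br a b) := hD2
    have hD3 : ∀ a b q, D (a + b) q = D a q + D b q := fun a b q => sub_eq_zero.1 <|
      hι.derivation_eq_zero (D := fun q => D (a + b) q - (D a q + D b q))
        (fun p q => by simp only [hD1]; ring) (fun c => by
          change D (a + b) (ι c) - (D a (ι c) + D b (ι c)) = 0
          rw [hD2', hD2', hD2', map_add, LinearMap.add_apply, map_add, sub_self]) q
    have hD4 : ∀ a b q, D (a * b) q = D a q * ι b + ι a * D b q := fun a b q => sub_eq_zero.1 <|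
      hι.derivation_eq_zero (D := fun q => D (a * b) q - (D a q * ι b + ι a * D b q))
        (fun p q => by simp only [hD1]; ring) (fun c => by
          change D (a * b) (ι c) - (D a (ι c) * ι b + ι a * D b (ι c)) = 0
          rw [hD2', hD2', hD2', h4, map_add, map_mul, map_mul, sub_self]) q
    choose E hE1 hE2 using fun q : Q => hι.exists_derivation
      (AddMonoidHom.mk' (fun b => D b q) fun a b => hD3 a b q) fun a b => hD4 a b q
    have hE2' : ∀ q b, E q (ι b) = D b q := hE2
    refine ⟨fun p q => E q p, fun p p' q => map_add _ _ _, fun p q q' => ?_, fun p p' q => hE1 q p p',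
      fun p q q' => ?_, fun a b => (hE2' _ _).trans (hD2' _ _)⟩
    · refine sub_eq_zero.1 (hι.derivation_eq_zero (D := fun p => E (q + q') p - (E q p + E q' p))
        (fun p p' => by simp only [hE1]; ring) (fun c => ?_) p)
      change E (q + q') (ι c) - (E q (ι c) + E q' (ι c)) = 0
      rw [hE2', hE2', hE2', map_add, sub_self]
    · refine sub_eq_zero.1 (hι.derivation_eq_zero
        (D := fun p => E (q * q') p - (E q p * q' + q * E q' p))
        (fun p p' => by simp only [hE1]; ring) (fun c => ?_) p)
      change E (q * q') (ι c) - (E q (ι c) * q' + q * E q' (ι c)) = 0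
      rw [hE2', hE2', hE2', hD1, sub_self]
  obtain ⟨P, hPl, hPr, hml, hmr, hP⟩ := key
  have hskew : ∀ p q, P p q + P q p = 0 := fun p q => by
    have h5 : ∀ a q, P (ι a) q + P q (ι a) = 0 := fun a q =>
      hι.derivation_eq_zero (D := fun q => P (ι a) q + P q (ι a))
        (fun p q => by simp only [hml, hmr]; ring) (fun c => by
          change P (ι a) (ι c) + P (ι c) (ι a) = 0
          rw [hP, hP, h1' a c, map_neg, neg_add_cancel]) q
    exact hι.derivation_eq_zero (D := fun q => P p q + P q p)
      (fun p q => by simp only [hml, hmr]; ring) (fun c => by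
        change P p (ι c) + P (ι c) p = 0
        rw [add_comm]; exact h5 c p) q
  have halt : ∀ q, P q q = 0 := fun q => by
    obtain ⟨s, hs, a, e⟩ := hι.exists_mul_eq q
    have e1 : P (ι s * q) (ι s * q) = 0 := by
      have e' : ι s * q = ι a := e
      rw [e', hP, h1, map_zero]
    have e2 : P (ι s) (ι s) = 0 := by rw [hP, h1, map_zero]
    have hu : IsUnit (ι s) := hι.isUnit s hs
    refine (hu.mul hu).mul_left_cancel ?_
    rw [hml, hmr, hmr] at e1
    linear_combination e1 - q * q * e2 - ι s * q * hskew q (ι s)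
  have hJ : ∀ p q r, P p (P q r) + P q (P r p) + P r (P p q) = 0 := by
    have hd : ∀ p q r r', P p (P q (r * r')) + P q (P (r * r') p) + P (r * r') (P p q) =
        (P p (P q r) + P q (P r p) + P r (P p q)) * r' +
          r * (P p (P q r') + P q (P r' p) + P r' (P p q)) := fun p q r r' => by
      rw [hmr q, hml r, hml r r' (P p q), hPr, hPr, hmr, hmr, hmr, hmr]
      linear_combination P q r * hskew p r' + P q r' * hskew p r
    have hJ1 : ∀ a b r, P (ι a) (P (ι b) r) + P (ι b) (P r (ι a)) + P r (P (ι a) (ι b)) = 0 :=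
      fun a b r => hι.derivation_eq_zero
        (D := fun r => P (ι a) (P (ι b) r) + P (ι b) (P r (ι a)) + P r (P (ι a) (ι b)))
        (fun r r' => hd _ _ r r') (fun c => by
          change P (ι a) (P (ι b) (ι c)) + P (ι b) (P (ι c) (ι a)) + P (ι c) (P (ι a) (ι b)) = 0
          simp only [hP, ← map_add, h2, map_zero]) r
    have hJ2 : ∀ a q r, P (ι a) (P q r) + P q (P r (ι a)) + P r (P (ι a) q) = 0 :=
      fun a q r => hι.derivation_eq_zero
        (D := fun r => P (ι a) (P q r) + P q (P r (ι a)) + P r (P (ι a) q))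
        (fun r r' => hd _ _ r r') (fun c => by
          change P (ι a) (P q (ι c)) + P q (P (ι c) (ι a)) + P (ι c) (P (ι a) q) = 0
          linear_combination hJ1 c a q) r
    exact fun p q r => hι.derivation_eq_zero
        (D := fun r => P p (P q r) + P q (P r p) + P r (P p q))
        (fun r r' => hd _ _ r r') (fun c => by
          change P p (P q (ι c)) + P q (P (ι c) p) + P (ι c) (P p q) = 0
          linear_combination hJ2 c p q) r
  have hbr1 : ∀ b, br 1 b = 0 := fun b => by
    have := h4 1 1 b
    rw [mul_one, mul_one, one_mul] at this
    exact left_eq_add.1 this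
  have hc : ∀ r q, P (algebraMap R Q r) q = 0 := fun r q =>
    hι.derivation_eq_zero (D := fun q => P (algebraMap R Q r) q)
      (fun p q => hmr _ p q) (fun c => by
        change P (algebraMap R Q r) (ι c) = 0
        rw [← ι.commutes, hP, Algebra.algebraMap_eq_smul_one, map_smul, LinearMap.smul_apply,
          hbr1, smul_zero, map_zero]) q
  have hc' : ∀ r q, P q (algebraMap R Q r) = 0 := fun r q => by
    have := hskew q (algebraMap R Q r)
    rwa [hc, add_zero] at this
  refine ⟨LinearMap.mk₂ R P hPl (fun r p q => ?_) hPr (fun r p q => ?_),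
    ⟨mul_comm, halt, hJ, hmr, hml⟩, hP⟩
  · rw [Algebra.smul_def, hml, hc, zero_mul, zero_add, Algebra.smul_def]
  · rw [Algebra.smul_def, hmr, hc', zero_mul, zero_add, Algebra.smul_def]

end Poisson

section Bracket

variable {R B Q : Type u} [CommRing R] [Ring B] [Algebra R B] [Ring Q] [Algebra R Q]
  {S : Submonoid B} {ι : B →ₐ[R] Q} {br : B →ₗ[R] B →ₗ[R] B} {κ : DefKind}

theorem IsFrac.mul_comm (hι : IsFrac S (ι : B →+* Q)) (h : ∀ a b : B, a * b = b * a) (p q : Q) :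
    p * q = q * p := by
  have h1 : ∀ a q, ι a * q = q * ι a := fun a q => by
    obtain ⟨s, hs, b, e⟩ := hι.exists_mul_eq q
    have e' : ι s * q = ι b := e
    have hu : IsUnit (ι s) := hι.isUnit s hs
    refine hu.mul_left_cancel ?_
    rw [← mul_assoc, ← map_mul, h, map_mul, mul_assoc, e', ← mul_assoc, e', ← map_mul, h, map_mul]
  obtain ⟨s, hs, b, e⟩ := hι.exists_mul_eq q
  have e' : ι s * q = ι b := e
  have hu : IsUnit (ι s) := hι.isUnit s hs
  refine hu.mul_left_cancel ?_
  rw [← mul_assoc, h1 s p, mul_assoc, e', ← h1, ← mul_assoc, e']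

/-- Brackets extend to rings of fractions. -/
theorem IsFrac.exists_bracket (hι : IsFrac S (ι : B →+* Q)) (h : IsBracketOfKind br κ) :
    ∃ br' : Q →ₗ[R] Q →ₗ[R] Q, IsBracketOfKind br' κ ∧ ∀ a b, br' (ι a) (ι b) = ι (br a b) := by
  cases κ with
  | assoc =>
    refine ⟨LinearMap.mul R Q - (LinearMap.mul R Q).flip, fun a b => rfl, fun a b => ?_⟩
    rw [h, map_sub, map_mul, map_mul]
    rfl
  | poisson =>
    let _ : CommRing Q := { ‹Ring Q› with mul_comm := hι.mul_comm h.1 }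
    exact IsFrac.exists_poisson hι h

end Bracket

/-! ### Rings of fractions of a deformation -/

section OreFrac

open OreLocalization

variable {B : Type u} [Ring B] {S : Submonoid B} [OreSet S]

theorem isFrac_numerator :
    IsFrac S (numeratorRingHom : B →+* OreLocalization S B) where
  isUnit s hs := numerator_isUnit (⟨s, hs⟩ : S)
  exists_mul_eq q := by
    induction q using OreLocalization.ind with | _ r s
    exact ⟨s, s.2, r, OreLocalization.mul_cancel⟩
  exists_lift {T} _ f hf := by
    let f' : S →* T := (f : B →* T).comp S.subtype
    have hf' : ∀ s, IsUnit (f' s) := fun s => hf s.1 s.2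
    exact ⟨universalHom f (IsUnit.liftRight f' hf')
      fun s => (IsUnit.coe_liftRight f' hf' s).symm, fun b => universalHom_commutes _ _ _⟩

end OreFrac

/-- A ring of fractions of `A` modulo `𝔪 ^ (m + 1)`, inverting the elements whose symbol is
invertible. -/
structure FracModel {R A L : Type u} [CommRing R] [IsLocalRing R] [Ring A] [Algebra R A] [CommRing L]
    (sym : A →+* L) (br : A →ₗ[R] A →ₗ[R] A) (κ : DefKind) (m : ℕ) where
  Q : Type u
  [ring : Ring Q]
  [algebra : Algebra R Q]
  ι : A →ₐ[R] Q
  bracket : Q →ₗ[R] Q →ₗ[R] Q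
  ε : Q →+* L
  kind : IsBracketOfKind bracket κ
  bracket_ι : ∀ a b, bracket (ι a) (ι b) = ι (br a b)
  ι_eq_zero_iff : ∀ a, ι a = 0 ↔ a ∈ adicFilt R A (m + 1)
  isUnit_ι : ∀ s, IsUnit (sym s) → IsUnit (ι s)
  exists_mul_eq : ∀ q, ∃ s a, IsUnit (sym s) ∧ ι s * q = ι a
  ε_ι : ∀ a, ε (ι a) = sym a

attribute [instance] FracModel.ring FracModel.algebra

section Exists

variable {R A L : Type u} [CommRing R] [IsLocalRing R] [Ring A] [Algebra R A] [CommRing L]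
  {sym : A →+* L} {br : A →ₗ[R] A →ₗ[R] A} {κ : DefKind}
  (hsym : ∀ a, sym a = 0 ↔ a ∈ adicFilt R A 1)
include hsym

theorem mul_sub_mul_mem_adicFilt {n : ℕ} (s : A) {t : A} (ht : t ∈ adicFilt R A n) :
    s * t - t * s ∈ adicFilt R A (n + 1) := by
  refine Submodule.smul_induction_on ht (fun r hr m _ => ?_) fun x y hx hy => ?_
  · rw [mul_smul_comm, smul_mul_assoc, ← smul_sub, adicFilt, pow_add, Submodule.mul_smul]
    refine Submodule.smul_mem_smul hr ((hsym _).1 ?_)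
    rw [map_sub, map_mul, map_mul, mul_comm, sub_self]
  · convert Submodule.add_mem _ hx hy using 1
    noncomm_ring

theorem exists_pow_mul_sub_mem_adicFilt (s y : A) (n : ℕ) :
    ∃ b, s ^ n * y - b * s ∈ adicFilt R A n := by
  induction n with
  | zero => exact ⟨0, by rw [adicFilt, pow_zero, Ideal.one_eq_top, Submodule.top_smul]; trivial⟩
  | succ n ih =>
    obtain ⟨b, hb⟩ := ih
    refine ⟨s * b + (s ^ n * y - b * s), ?_⟩
    convert mul_sub_mul_mem_adicFilt hsym s hb using 1
    rw [pow_succ']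
    noncomm_ring

variable [IsNoetherianRing R] [Module.Flat R A]

theorem mem_adicFilt_of_symbol {n : ℕ} (φ : A →ₗ[R] A)
    (hφ : ∀ a, sym (φ a) = 0 → sym a = 0) {a : A} (h : φ a ∈ adicFilt R A n) :
    a ∈ adicFilt R A n := by
  suffices H : ∀ k ≤ n, a ∈ adicFilt R A k from H n le_rfl
  intro k hk
  induction k with
  | zero => rw [adicFilt, pow_zero, Ideal.one_eq_top, Submodule.top_smul]; trivial
  | succ k ih =>
    obtain ⟨ι, _, r, hr⟩ := exists_isMinGen (R := R) k
    obtain ⟨b, hb⟩ := hr.exists_sub_sum_mem (ih (by omega))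
    have h1 : ∑ j, r j • φ (b j) ∈ adicFilt R A (k + 1) := by
      have h2 := Submodule.sub_mem _ (Submodule.smul_mono_left (Ideal.pow_le_pow_right hk) h) (map_adicFilt φ hb)
      rw [map_sub, sub_sub_cancel, map_sum] at h2
      simpa only [map_smul, adicFilt] using h2
    have h3 : ∑ j, r j • b j ∈ adicFilt R A (k + 1) := Submodule.sum_mem _ fun j _ => by
      rw [adicFilt, pow_add, Submodule.mul_smul]
      refine Submodule.smul_mem_smul (hr.mem j) ((hsym _).1 (hφ _ ((hsym _).2 ?_)))
      exact hr.mem_adicFilt_of_flat h1 j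
    simpa using Submodule.add_mem _ hb h3

open OreLocalization in
theorem nonempty_fracModel_of_surjective {B : Type u} [Ring B] [Algebra R B] {m : ℕ}
    (p : A →ₐ[R] B) (hps : Function.Surjective p) (hp : ∀ a, p a = 0 ↔ a ∈ adicFilt R A (m + 1))
    {brB : B →ₗ[R] B →ₗ[R] B} (hbr : IsBracketOfKind brB κ)
    (hbrp : ∀ a b, brB (p a) (p b) = p (br a b)) : Nonempty (FracModel sym br κ m) := by
  have hp' : ∀ a b, p a = p b ↔ a - b ∈ adicFilt R A (m + 1) := fun a b => by
    rw [← sub_eq_zero, ← map_sub, hp]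
  let S₀ : Submonoid A := (IsUnit.submonoid L).comap sym
  let S : Submonoid B := S₀.map p
  have hS : ∀ s : S, ∃ s', IsUnit (sym s') ∧ p s' = s := fun s => s.2
  have hleft : ∀ (s : S) (b : B), s * b = 0 → b = 0 := fun s b h => by
    obtain ⟨s', hs', e⟩ := hS s
    obtain ⟨a, rfl⟩ := hps b
    rw [← e, ← map_mul, hp] at h
    refine (hp a).2 (mem_adicFilt_of_symbol hsym (LinearMap.mulLeft R s') (fun a ha => ?_) h)
    rw [LinearMap.mulLeft_apply, map_mul] at ha
    exact (hs'.mul_right_eq_zero).1 ha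
  have hright : ∀ (s : S) (b : B), b * s = 0 → b = 0 := fun s b h => by
    obtain ⟨s', hs', e⟩ := hS s
    obtain ⟨a, rfl⟩ := hps b
    rw [← e, ← map_mul, hp] at h
    refine (hp a).2 (mem_adicFilt_of_symbol hsym (LinearMap.mulRight R s') (fun a ha => ?_) h)
    rw [LinearMap.mulRight_apply, map_mul] at ha
    exact (hs'.mul_left_eq_zero).1 ha
  obtain ⟨_⟩ : Nonempty (OreSet S) := nonempty_oreSet_iff.2
    ⟨fun b b' s h => ⟨1, by
      rw [sub_eq_zero.1 (hright s (b - b') (by rw [sub_mul, h, sub_self]))]⟩, fun b s => by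
      obtain ⟨s', hs', e⟩ := hS s
      obtain ⟨a, rfl⟩ := hps b
      obtain ⟨c, hc⟩ := exists_pow_mul_sub_mem_adicFilt hsym s' a (m + 1)
      refine ⟨p c, s ^ (m + 1), ?_⟩
      rw [SubmonoidClass.coe_pow, ← e, ← map_pow, ← map_mul, ← map_mul, hp']
      exact hc⟩
  let ι : B →ₐ[R] OreLocalization S B :=
    { (numeratorRingHom : B →+* OreLocalization S B) with commutes' := fun r => rfl }
  have hι : IsFrac S (ι : B →+* OreLocalization S B) := isFrac_numerator (S := S)
  have hιi : Function.Injective ι := numeratorHom_inj fun s hs => by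
    rw [mem_nonZeroDivisorsLeft_iff]
    exact fun x hx => hleft ⟨s, hs⟩ x hx
  obtain ⟨br', hk, hbr'⟩ := hι.exists_bracket hbr
  obtain ⟨ε, hε⟩ : ∃ ε : B →+* L, ∀ a, ε (p a) = sym a := by
    have h : RingHom.ker (p : A →+* B) ≤ RingHom.ker sym := fun a ha => (hsym a).2
      (Submodule.smul_mono_left (Ideal.pow_le_pow_right (Nat.le_add_left 1 m)) ((hp a).1 ha))
    have hps' : Function.Surjective (p : A →+* B) := hps
    exact ⟨RingHom.liftOfSurjective (p : A →+* B) hps' ⟨sym, h⟩, fun a =>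
      RingHom.liftOfRightInverse_comp_apply (p : A →+* B) _ _ ⟨sym, h⟩ a⟩
  obtain ⟨ε', hε'⟩ := hι.exists_lift ε (by
    rintro _ ⟨s, hs, rfl⟩
    exact (hε s).symm ▸ hs)
  exact ⟨{
    Q := OreLocalization S B
    ι := ι.comp p
    bracket := br'
    ε := ε'
    kind := hk
    bracket_ι := fun a b => by
      exact (hbr' _ _).trans (congrArg ι (hbrp a b))
    ι_eq_zero_iff := fun a => (map_eq_zero_iff ι hιi).trans (hp a)
    isUnit_ι := fun s hs => hι.isUnit (p s) ⟨s, hs, rfl⟩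
    exists_mul_eq := fun q => by
      obtain ⟨_, ⟨s, hs, rfl⟩, b, e⟩ := hι.exists_mul_eq q
      obtain ⟨a, rfl⟩ := hps b
      exact ⟨s, a, hs, e⟩
    ε_ι := fun a => (hε' _).trans (hε a) }⟩

theorem nonempty_fracModel (hbr : IsBracketOfKind br κ) (m : ℕ) :
    Nonempty (FracModel sym br κ m) :=
  nonempty_fracModel_of_surjective hsym
    (Algebra.TensorProduct.includeRight : A →ₐ[R] (R ⧸ 𝔪 R ^ (m + 1)) ⊗[R] A)
    (fun t => by
      obtain ⟨a, rfl⟩ := quotient_tensor_eq t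
      exact ⟨a, rfl⟩)
    (one_tmul_eq_zero_iff (m + 1))
    (brB := (LinearMap.BilinMap.baseChange (R ⧸ 𝔪 R ^ (m + 1)) br).restrictScalars₁₂ R R)
    (by cases κ <;> exact hbr.baseChange (R ⧸ 𝔪 R ^ (m + 1)))
    fun a b => (LinearMap.BilinMap.baseChange_tmul br 1 a 1 b).trans (by rw [mul_one]; rfl)

end Exists

/-! ### Fractions up to a given order -/

section FracAt

variable {R A L : Type u} [CommRing R] [IsLocalRing R] [Ring A] [Algebra R A] [CommRing L]
  {sym : A →+* L} {br : A →ₗ[R] A →ₗ[R] A} {κ : DefKind} (T : ∀ m, FracModel sym br κ m)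
  (U : Submonoid A)

/-- Up to order `n`, `f` is a fraction with denominator in `U`. -/
def IsFracAt (n : ℕ) (f : ∀ m, (T m).Q) : Prop :=
  ∃ s a, s ∈ U ∧ ∀ m ≤ n, (T m).ι s * f m = (T m).ι a

variable {T U}

theorem FracModel.eq_zero_of_le {m n : ℕ} (h : n ≤ m) {a : A} (ha : (T m).ι a = 0) :
    (T n).ι a = 0 :=
  ((T n).ι_eq_zero_iff a).2 (Submodule.smul_mono_left
    (Ideal.pow_le_pow_right (Nat.succ_le_succ h)) (((T m).ι_eq_zero_iff a).1 ha))

theorem FracModel.eq_of_le {m n : ℕ} (h : n ≤ m) {a b : A} (hab : (T m).ι a = (T m).ι b) :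
    (T n).ι a = (T n).ι b := by
  rw [← sub_eq_zero, ← map_sub] at hab ⊢
  exact FracModel.eq_zero_of_le h hab

theorem FracModel.ε_eq_zero {q : (T 0).Q} (hsym : ∀ a, sym a = 0 ↔ a ∈ adicFilt R A 1)
    (h : (T 0).ε q = 0) : q = 0 := by
  obtain ⟨s, a, hs, e⟩ := (T 0).exists_mul_eq q
  have h1 := congrArg (T 0).ε e
  rw [map_mul, h, mul_zero, (T 0).ε_ι] at h1
  rw [((T 0).ι_eq_zero_iff a).2 ((hsym a).1 h1.symm)] at e
  exact ((T 0).isUnit_ι s hs).mul_left_cancel (e.trans (mul_zero _).symm)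

theorem FracModel.bracket_mul_left {m : ℕ} (p q r : (T m).Q) :
    (T m).bracket (p * q) r = (T m).bracket p r * q + p * (T m).bracket q r := by
  have h := (T m).kind
  cases κ with
  | assoc =>
    simp only [IsBracketOfKind] at h
    simp only [h]
    noncomm_ring
  | poisson => exact h.2.2.2.2 p q r

theorem IsFracAt.congr {n : ℕ} {f g : ∀ m, (T m).Q} (hf : IsFracAt T U n f)
    (h : ∀ m ≤ n, f m = g m) : IsFracAt T U n g := by
  obtain ⟨s, a, hs, e⟩ := hf
  exact ⟨s, a, hs, fun m hm => by rw [← h m hm, e m hm]⟩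

theorem isFracAt_ι (n : ℕ) (a : A) : IsFracAt T U n fun m => (T m).ι a :=
  ⟨1, a, U.one_mem, fun m _ => by rw [map_one, one_mul]⟩

theorem IsFracAt.of_mul {n : ℕ} {f : ∀ m, (T m).Q} {s : A} (hs : s ∈ U)
    (h : IsFracAt T U n fun m => (T m).ι s * f m) : IsFracAt T U n f := by
  obtain ⟨t, a, ht, e⟩ := h
  exact ⟨t * s, a, U.mul_mem ht hs, fun m hm => by rw [map_mul, mul_assoc, e m hm]⟩

variable (hsym : ∀ a, sym a = 0 ↔ a ∈ adicFilt R A 1)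
include hsym

theorem exists_ore_ι (s y : A) (n : ℕ) :
    ∃ b, ∀ m ≤ n, (T m).ι (s ^ (n + 1)) * (T m).ι y = (T m).ι b * (T m).ι s := by
  obtain ⟨b, hb⟩ := exists_pow_mul_sub_mem_adicFilt hsym s y (n + 1)
  refine ⟨b, fun m hm => ?_⟩
  rw [← map_mul, ← map_mul]
  refine FracModel.eq_of_le hm ?_
  rw [← sub_eq_zero, ← map_sub, (T n).ι_eq_zero_iff]
  exact hb

/-- Common denominators. -/
theorem exists_common_den {ι : Type*} (S : Finset ι) {n : ℕ} {f : ι → ∀ m, (T m).Q}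
    (hf : ∀ j ∈ S, IsFracAt T U n (f j)) :
    ∃ (s : A) (a : ι → A), s ∈ U ∧ ∀ j ∈ S, ∀ m ≤ n, (T m).ι s * f j m = (T m).ι (a j) := by
  classical
  induction S using Finset.induction_on with
  | empty => exact ⟨1, 0, U.one_mem, fun j hj => absurd hj (Finset.notMem_empty j)⟩
  | insert i S hi ih =>
    obtain ⟨s, a, hs, e⟩ := ih fun j hj => hf j (Finset.mem_insert_of_mem hj)
    obtain ⟨t, c, ht, e'⟩ := hf i (Finset.mem_insert_self i S)
    obtain ⟨b, hb⟩ := exists_ore_ι (T := T) hsym s t n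
    refine ⟨s ^ (n + 1) * t, fun j => if j = i then s ^ (n + 1) * c else b * a j,
      U.mul_mem (U.pow_mem hs _) ht, fun j hj m hm => ?_⟩
    by_cases h : j = i
    · subst h
      beta_reduce
      rw [if_pos rfl, map_mul, map_mul, mul_assoc, e' m hm]
    · beta_reduce
      rw [if_neg h, map_mul, hb m hm, map_mul, mul_assoc,
        e j (Finset.mem_of_mem_insert_of_ne hj h) m hm]

theorem IsFracAt.add {n : ℕ} {f g : ∀ m, (T m).Q} (hf : IsFracAt T U n f)
    (hg : IsFracAt T U n g) : IsFracAt T U n (f + g) := by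
  obtain ⟨s, a, hs, e⟩ := exists_common_den (T := T) (f := ![f, g]) hsym Finset.univ fun j _ => by
    fin_cases j
    exacts [hf, hg]
  exact ⟨s, a 0 + a 1, hs, fun m hm => by
    rw [Pi.add_apply, mul_add, map_add, ← e 0 (Finset.mem_univ _) m hm,
      ← e 1 (Finset.mem_univ _) m hm]
    rfl⟩

theorem IsFracAt.mul {n : ℕ} {f g : ∀ m, (T m).Q} (hf : IsFracAt T U n f)
    (hg : IsFracAt T U n g) : IsFracAt T U n (f * g) := by
  obtain ⟨s, a, hs, e⟩ := hf
  obtain ⟨t, c, ht, e'⟩ := hg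
  obtain ⟨b, hb⟩ := exists_ore_ι (T := T) hsym t a n
  refine ⟨t ^ (n + 1) * s, b * c, U.mul_mem (U.pow_mem ht _) hs, fun m hm => ?_⟩
  rw [Pi.mul_apply, map_mul, map_mul, mul_assoc, ← mul_assoc _ (f m), e m hm, ← mul_assoc, hb m hm,
    mul_assoc, e' m hm]

theorem IsFracAt.sub {n : ℕ} {f g : ∀ m, (T m).Q} (hf : IsFracAt T U n f)
    (hg : IsFracAt T U n g) : IsFracAt T U n (f - g) := by
  refine (hf.add hsym ((isFracAt_ι n (-1)).mul hsym hg)).congr fun m hm => ?_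
  rw [Pi.add_apply, Pi.mul_apply, Pi.sub_apply, map_neg, map_one, neg_one_mul, sub_eq_add_neg]

theorem IsFracAt.bracket {n : ℕ} {f g : ∀ m, (T m).Q} (hf : IsFracAt T U n f)
    (hg : IsFracAt T U n g) : IsFracAt T U n fun m => (T m).bracket (f m) (g m) := by
  have key : ∀ c, IsFracAt T U n fun m => (T m).bracket (f m) ((T m).ι c) := fun c => by
    obtain ⟨s, a, hs, e⟩ := id hf
    refine IsFracAt.of_mul hs (((isFracAt_ι n (br a c)).sub hsym
      ((isFracAt_ι n (br s c)).mul hsym hf)).congr fun m hm => ?_)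
    rw [Pi.sub_apply, Pi.mul_apply, ← (T m).bracket_ι, ← (T m).bracket_ι, ← e m hm,
      FracModel.bracket_mul_left, add_sub_cancel_left]
  obtain ⟨s, a, hs, e⟩ := id hg
  refine IsFracAt.of_mul hs (((key a).sub hsym ((key s).mul hsym hg)).congr fun m hm => ?_)
  rw [Pi.sub_apply, Pi.mul_apply, ← e m hm, (T m).kind.leibniz_mul, add_sub_cancel_left]

end FracAt

/-! ### The sheaf of fractions of a deformation -/

section Tilde

variable {K R : Type u} [Field K] [CommRing R] [Algebra K R] [IsLocalRing R] [ParameterAlgebra K R]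
  {X : TopCat.{u}} {O : TopCat.Presheaf (CommAlgCat.{u} K) X} (M : AffModel O) {κ : DefKind}
  (A : AlgDef K R (O.obj (op ⊤)) κ)

/-- The reduction `A → K ⊗_R A → C`. -/
def AlgDef.red {C : Type u} [CommRing C] [Algebra K C] (A : AlgDef K R C κ) : A.carrier →+* C :=
  (A.aug : 𝕜 R ⊗[R] A.carrier →+* C).comp
    (Algebra.TensorProduct.includeRight : A.carrier →ₐ[R] 𝕜 R ⊗[R] A.carrier)

theorem AlgDef.red_apply {C : Type u} [CommRing C] [Algebra K C] (A : AlgDef K R C κ)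
    (a : A.carrier) : A.red a = A.aug (1 ⊗ₜ a) := rfl

theorem AlgDef.red_surjective {C : Type u} [CommRing C] [Algebra K C] (A : AlgDef K R C κ) :
    Function.Surjective A.red := fun c => by
  obtain ⟨t, rfl⟩ := A.isDeformation.bijective_aug.2 c
  obtain ⟨a, rfl⟩ := residue_tensor_eq t
  exact ⟨a, rfl⟩

theorem AlgDef.red_eq_zero_iff {C : Type u} [CommRing C] [Algebra K C] (A : AlgDef K R C κ)
    {a : A.carrier} : A.red a = 0 ↔ a ∈ adicFilt R A.carrier 1 := by
  rw [← one_tmul_residue_eq_zero_iff, A.red_apply,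
    map_eq_zero_iff A.aug A.isDeformation.bijective_aug.1]

variable (K R) in
/-- The map `R → K` with kernel the maximal ideal. -/
def residueHom : R →+* K :=
  (RingEquiv.ofBijective (algebraMap K (𝕜 R))
    (ParameterAlgebra.bijective_residue (K := K) (R := R))).symm.toRingHom.comp
    (IsLocalRing.residue R)

theorem algebraMap_residueHom (r : R) :
    algebraMap K (𝕜 R) (residueHom K R r) = IsLocalRing.residue R r :=
  (RingEquiv.ofBijective (algebraMap K (𝕜 R))
    (ParameterAlgebra.bijective_residue (K := K) (R := R))).apply_symm_apply _

theorem AlgDef.red_algebraMap {C : Type u} [CommRing C] [Algebra K C] (A : AlgDef K R C κ) (r : R) :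
    A.red (algebraMap R A.carrier r) = algebraMap K C (residueHom K R r) := by
  rw [A.red_apply, ← A.aug.commutes, Algebra.algebraMap_eq_smul_one, TensorProduct.tmul_smul,
    TensorProduct.smul_tmul', Algebra.TensorProduct.algebraMap_apply, algebraMap_residueHom,
    Algebra.smul_def, mul_one]
  rfl

theorem exists_residue_lift {N L : Type u} [Ring N] [Algebra R N] [CommRing L] [Algebra K L]
    (v : N →+* L) (hv : ∀ r, v (algebraMap R N r) = algebraMap K L (residueHom K R r)) :
    ∃ w : 𝕜 R ⊗[R] N →ₐ[K] L, ∀ a, w (1 ⊗ₜ a) = v a := by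
  let _ : Algebra R L := ((algebraMap K L).comp (residueHom K R)).toAlgebra
  let v' : N →ₐ[R] L := { v with commutes' := hv }
  let e : 𝕜 R →+* K := (RingEquiv.ofBijective (algebraMap K (𝕜 R))
    (ParameterAlgebra.bijective_residue (K := K) (R := R))).symm.toRingHom
  have he : ∀ c, e (algebraMap K (𝕜 R) c) = c := fun c => (RingEquiv.ofBijective
    (algebraMap K (𝕜 R)) (ParameterAlgebra.bijective_residue (K := K) (R := R))).symm_apply_apply c
  let u : 𝕜 R →ₐ[R] L := { (algebraMap K L).comp e with commutes' := fun r => rfl }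
  let w : 𝕜 R ⊗[R] N →ₐ[R] L := Algebra.TensorProduct.lift u v' fun _ _ => mul_comm _ _
  have hw : ∀ c a, w (c ⊗ₜ a) = u c * v' a := fun c a => Algebra.TensorProduct.lift_tmul _ _ _ c a
  exact ⟨{ (w : 𝕜 R ⊗[R] N →+* L) with
    commutes' := fun c => by
      change w (algebraMap K (𝕜 R) c ⊗ₜ 1) = _
      rw [hw, map_one, mul_one]
      exact congrArg (algebraMap K L) (he c) }, fun a => (hw 1 a).trans (by rw [map_one, one_mul]; rfl)⟩

/-- The symbol of an element of `A`. -/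
def symbol : A.carrier →+* M.L := (M.lam : O.obj (op ⊤) →+* M.L).comp A.red

theorem symbol_apply (a : A.carrier) : symbol M A a = M.lam (A.red a) := rfl

theorem symbol_eq_zero_iff (a : A.carrier) :
    symbol M A a = 0 ↔ a ∈ adicFilt R A.carrier 1 := by
  rw [← A.red_eq_zero_iff, symbol_apply, map_eq_zero_iff M.lam M.lam_injective]

/-- The elements whose reduction does not vanish at `x`. -/
def den (x : X) : Submonoid A.carrier where
  carrier := {s | x ∈ M.D (A.red s)}
  one_mem' := by
    change x ∈ M.D (A.red 1)
    rw [map_one, M.D_one]; trivial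
  mul_mem' {s t} hs ht := by
    change x ∈ M.D (A.red (s * t))
    rw [map_mul]; exact AffModel.mem_D_mul hs ht

variable {M A}

theorem isUnit_symbol {x : X} {s : A.carrier} (hs : s ∈ den M A x) : IsUnit (symbol M A s) :=
  M.isUnit_lam hs

variable (T : ∀ m, FracModel (symbol M A) A.br κ m)

theorem isUnit_ι {x : X} {s : A.carrier} (hs : s ∈ den M A x) (m : ℕ) : IsUnit ((T m).ι s) :=
  (T m).isUnit_ι s (isUnit_symbol hs)

/-- The sections over `V` of the sheaf of fractions. -/
def tilde (V : Opens X) : Subalgebra R (V → ∀ m, (T m).Q) where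
  carrier := {f | (∀ x y, f x = f y) ∧ ∀ (x : V) n, IsFracAt T (den M A x.1) n (f x)}
  mul_mem' {f g} hf hg := ⟨fun x y => by rw [Pi.mul_apply, Pi.mul_apply, hf.1 x y, hg.1 x y],
    fun x n => (hf.2 x n).mul (symbol_eq_zero_iff M A) (hg.2 x n)⟩
  add_mem' {f g} hf hg := ⟨fun x y => by rw [Pi.add_apply, Pi.add_apply, hf.1 x y, hg.1 x y],
    fun x n => (hf.2 x n).add (symbol_eq_zero_iff M A) (hg.2 x n)⟩
  algebraMap_mem' r := ⟨fun x y => rfl, fun x n =>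
    (isFracAt_ι n (algebraMap R A.carrier r)).congr fun m _ => (T m).ι.commutes r⟩

/-- The sheaf of fractions. -/
def tildePresheaf : TopCat.Presheaf (AlgCat.{u} R) X where
  obj V := AlgCat.of R (tilde T V.unop)
  map {V W} h := AlgCat.ofHom
    { toFun := fun f : tilde T V.unop =>
        (⟨fun x => f.1 ⟨x.1, h.unop.le x.2⟩, fun x y => f.2.1 _ _, fun x n => f.2.2 ⟨x.1, h.unop.le x.2⟩ n⟩ :
          tilde T W.unop)
      map_one' := rfl
      map_mul' := fun _ _ => rfl
      map_zero' := rfl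
      map_add' := fun _ _ => rfl
      commutes' := fun _ => rfl }
  map_id _ := rfl
  map_comp _ _ := rfl

/-- The components of a section. -/
def comp {V : Opens X} (f : Sec (tildePresheaf T) V) (x : V) (m : ℕ) : (T m).Q :=
  Subtype.val (p := (· ∈ tilde T V)) f x m

variable {T}

theorem comp_ext {V : Opens X} {f g : Sec (tildePresheaf T) V}
    (h : ∀ x m, comp T f x m = comp T g x m) : f = g :=
  Subtype.ext (funext fun x => funext fun m => h x m)

theorem comp_const {V : Opens X} (f : Sec (tildePresheaf T) V) (x y : V) (m : ℕ) :
    comp T f x m = comp T f y m :=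
  congrFun ((Subtype.prop (p := (· ∈ tilde T V)) f).1 x y) m

theorem comp_frac {V : Opens X} (f : Sec (tildePresheaf T) V) (x : V) (n : ℕ) :
    IsFracAt T (den M A x.1) n (comp T f x) :=
  (Subtype.prop (p := (· ∈ tilde T V)) f).2 x n

theorem comp_add {V : Opens X} (f g : Sec (tildePresheaf T) V) (x : V) (m : ℕ) :
    comp T (f + g) x m = comp T f x m + comp T g x m := rfl

theorem comp_sub {V : Opens X} (f g : Sec (tildePresheaf T) V) (x : V) (m : ℕ) :
    comp T (f - g) x m = comp T f x m - comp T g x m := rfl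

theorem comp_mul {V : Opens X} (f g : Sec (tildePresheaf T) V) (x : V) (m : ℕ) :
    comp T (f * g) x m = comp T f x m * comp T g x m := rfl

theorem comp_smul {V : Opens X} (r : R) (f : Sec (tildePresheaf T) V) (x : V) (m : ℕ) :
    comp T (r • f) x m = r • comp T f x m := rfl

theorem comp_algebraMap {V : Opens X} (r : R) (x : V) (m : ℕ) :
    comp T (algebraMap R (Sec (tildePresheaf T) V) r) x m = algebraMap R (T m).Q r := rfl

theorem comp_sum {V : Opens X} {ι : Type*} (s : Finset ι) (f : ι → Sec (tildePresheaf T) V) (x : V)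
    (m : ℕ) : comp T (∑ j ∈ s, f j) x m = ∑ j ∈ s, comp T (f j) x m :=
  map_sum (AddMonoidHom.mk' (fun f : Sec (tildePresheaf T) V => comp T f x m) fun _ _ => rfl) f s

variable (T)

/-- The sections given by a constant family. -/
def constSec {V : Opens X} (q : ∀ m, (T m).Q) (h : ∀ x ∈ V, ∀ n, IsFracAt T (den M A x) n q) :
    Sec (tildePresheaf T) V :=
  (⟨fun _ => q, fun _ _ => rfl, fun x n => h x.1 x.2 n⟩ : tilde T V)

variable {T}

/-- Sections with a given denominator. -/
theorem exists_section_frac {W : Opens X} {s : A.carrier} (hs : W ≤ M.D (A.red s)) (a : A.carrier) :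
    ∃ t : Sec (tildePresheaf T) W, ∀ x m, (T m).ι s * comp T t x m = (T m).ι a := by
  by_cases hW : ∃ x, x ∈ W
  · obtain ⟨x, hx⟩ := hW
    choose u hu using fun m => isUnit_ι T (x := x) (s := s) (hs hx) m
    have h : ∀ m, (T m).ι s * (↑(u m)⁻¹ * (T m).ι a) = (T m).ι a := fun m => by
      rw [← hu, Units.mul_inv_cancel_left]
    exact ⟨constSec T (fun m => (↑(u m)⁻¹ : (T m).Q) * (T m).ι a)
      fun y hy n => ⟨s, a, hs hy, fun m _ => h m⟩, fun _ m => h m⟩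
  · exact ⟨0, fun x => absurd ⟨x.1, x.2⟩ hW⟩

variable (T)

/-- The bracket on the sheaf of fractions. -/
def tildeBr (V : Opens X) :
    Sec (tildePresheaf T) V →ₗ[R] Sec (tildePresheaf T) V →ₗ[R] Sec (tildePresheaf T) V :=
  LinearMap.mk₂ R (fun f g => (⟨fun x m => (T m).bracket (comp T f x m) (comp T g x m),
      fun x y => funext fun m => by
        beta_reduce
        rw [comp_const f x y, comp_const g x y],
      fun x n => (comp_frac f x n).bracket (symbol_eq_zero_iff M A) (comp_frac g x n)⟩ : tilde T V))
    (fun f f' g => comp_ext fun x m =>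
      LinearMap.map_add₂ (T m).bracket (comp T f x m) (comp T f' x m) (comp T g x m))
    (fun r f g => comp_ext fun x m =>
      LinearMap.map_smul₂ (T m).bracket r (comp T f x m) (comp T g x m))
    (fun f g g' => comp_ext fun x m => map_add ((T m).bracket (comp T f x m)) _ _)
    (fun r f g => comp_ext fun x m => map_smul ((T m).bracket (comp T f x m)) _ _)

variable {T}

theorem tildeBr_kind (V : Opens X) : IsBracketOfKind (tildeBr T V) κ := by
  have h := fun m => (T m).kind
  cases κ with
  | assoc => exact fun f g => comp_ext fun x m => h m _ _
  | poisson =>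
    exact ⟨fun f g => comp_ext fun x m => (h m).1 _ _, fun f => comp_ext fun x m => (h m).2.1 _,
      fun f g k => comp_ext fun x m => (h m).2.2.1 _ _ _,
      fun f g k => comp_ext fun x m => (h m).2.2.2.1 _ _ _,
      fun f g k => comp_ext fun x m => (h m).2.2.2.2 _ _ _⟩

end Tilde

section Aug

variable {K R : Type u} [Field K] [CommRing R] [Algebra K R] [IsLocalRing R] [ParameterAlgebra K R]
  {X : TopCat.{u}} {O : TopCat.Presheaf (CommAlgCat.{u} K) X} {M : AffModel O} {κ : DefKind}
  {A : AlgDef K R (O.obj (op ⊤)) κ} (T : ∀ m, FracModel (symbol M A) A.br κ m)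

/-- The evaluation `A~_x → L`. -/
def stalkEv (x : X) : Stalk (tildePresheaf T) x →+* M.L :=
  let _ : Algebra R M.L := ((algebraMap K M.L).comp (residueHom K R)).toAlgebra
  (stalkLift (tildePresheaf T) x (fun V hx =>
    { toFun := fun f => (T 0).ε (comp T f ⟨x, hx⟩ 0)
      map_one' := map_one (T 0).ε
      map_mul' := fun f g => map_mul (T 0).ε _ _
      map_zero' := map_zero (T 0).ε
      map_add' := fun f g => map_add (T 0).ε _ _
      commutes' := fun r => by
        rw [comp_algebraMap, ← (T 0).ι.commutes, (T 0).ε_ι, symbol_apply, A.red_algebraMap,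
          AlgHom.commutes]
        rfl }) fun V W h hx s => rfl).toRingHom

theorem stalkEv_germ {V : Opens X} {x : X} (hx : x ∈ V) (f : Sec (tildePresheaf T) V) :
    stalkEv T x (germ (tildePresheaf T) hx f) = (T 0).ε (comp T f ⟨x, hx⟩ 0) := rfl

theorem stalkEv_algebraMap (x : X) (r : R) :
    stalkEv T x (algebraMap R (Stalk (tildePresheaf T) x) r) =
      algebraMap K M.L (residueHom K R r) := by
  have hx : x ∈ (⊤ : Opens X) := Opens.mem_top x
  rw [← (germ (tildePresheaf T) hx).commutes, stalkEv_germ, comp_algebraMap, ← (T 0).ι.commutes,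
    (T 0).ε_ι, symbol_apply, A.red_algebraMap, AlgHom.commutes]

/-- The evaluation `K ⊗_R A~_x → L`. -/
def tensorEv (x : X) : 𝕜 R ⊗[R] Stalk (tildePresheaf T) x →ₐ[K] M.L :=
  (exists_residue_lift (stalkEv T x) (stalkEv_algebraMap T x)).choose

theorem tensorEv_one_tmul (x : X) (a : Stalk (tildePresheaf T) x) :
    tensorEv T x (1 ⊗ₜ a) = stalkEv T x a :=
  (exists_residue_lift (stalkEv T x) (stalkEv_algebraMap T x)).choose_spec a

/-- The values of a section of `K ⊗_R A~`. -/
def sheafEv (V : Opens X) : sheafTensor (tildePresheaf T) (𝕜 R) V →ₐ[K] (V → M.L) where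
  toFun f x := tensorEv T x.1 (f.1 x)
  map_one' := funext fun x => map_one (tensorEv T x.1)
  map_mul' f g := funext fun x => map_mul (tensorEv T x.1) (f.1 x) (g.1 x)
  map_zero' := funext fun x => map_zero (tensorEv T x.1)
  map_add' f g := funext fun x => map_add (tensorEv T x.1) (f.1 x) (g.1 x)
  commutes' c := funext fun x => (tensorEv T x.1).commutes c

theorem exists_sheafEv {V : Opens X} (f : sheafTensor (tildePresheaf T) (𝕜 R) V) (x : V) :
    ∃ (W : Opens X) (hW : W ≤ V) (hx : x.1 ∈ W) (s : Sec (tildePresheaf T) W),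
      ∀ y (hy : y ∈ W), sheafEv T V f ⟨y, hW hy⟩ = (T 0).ε (comp T s ⟨y, hy⟩ 0) := by
  obtain ⟨W, hW, hx, t, ht⟩ := f.2 x
  obtain ⟨s, rfl⟩ := residue_tensor_eq t
  refine ⟨W, hW, hx, s, fun y hy => ?_⟩
  change tensorEv T y (f.1 ⟨y, hW hy⟩) = _
  rw [ht y hy, ← stalkEv_germ, ← tensorEv_one_tmul]
  rfl

theorem sheafEv_const {V : Opens X} (f : sheafTensor (tildePresheaf T) (𝕜 R) V) (x y : V) :
    sheafEv T V f x = sheafEv T V f y := by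
  obtain ⟨W, hW, hx, s, hs⟩ := exists_sheafEv T f x
  obtain ⟨W', hW', hy, s', hs'⟩ := exists_sheafEv T f y
  obtain ⟨z, hz, hz'⟩ := M.nonempty_inter hx hy
  have h1 := hs x.1 hx
  have h2 := hs' y.1 hy
  rw [comp_const s _ ⟨z, hz⟩, ← hs z hz] at h1
  rw [comp_const s' _ ⟨z, hz'⟩, ← hs' z hz'] at h2
  exact h1.trans h2.symm

theorem sheafEv_mem_range {V : Opens X} (f : sheafTensor (tildePresheaf T) (𝕜 R) V) :
    sheafEv T V f ∈ (M.ev V).range := by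
  by_cases hV : ∃ x, x ∈ V
  · obtain ⟨x, hx⟩ := hV
    obtain ⟨h, hh⟩ := M.exists_section V (sheafEv T V f ⟨x, hx⟩) fun y hy => by
      rw [sheafEv_const T f ⟨x, hx⟩ ⟨y, hy⟩]
      obtain ⟨W, hW, hyW, s, hs⟩ := exists_sheafEv T f ⟨y, hy⟩
      obtain ⟨t, a, ht, e⟩ := comp_frac s ⟨y, hyW⟩ 0
      refine ⟨A.red t, A.red a, ht, ?_⟩
      have h1 := congrArg (T 0).ε (e 0 le_rfl)
      rw [map_mul, (T 0).ε_ι, (T 0).ε_ι, ← hs y hyW] at h1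
      exact h1
    exact ⟨h, funext fun y => (hh y).trans (sheafEv_const T f _ _)⟩
  · exact ⟨0, funext fun y => absurd ⟨y.1, y.2⟩ hV⟩

/-- The augmentation `K ⊗_R A~ → O`. -/
def tildeAug (V : Opens X) : sheafTensor (tildePresheaf T) (𝕜 R) V →ₐ[K] O.obj (op V) :=
  ((AlgEquiv.ofInjective (M.ev V) (M.ev_injective V)).symm : (M.ev V).range →ₐ[K] O.obj (op V)).comp
    ((sheafEv T V).codRestrict (M.ev V).range (sheafEv_mem_range T))

theorem ev_tildeAug {V : Opens X} (f : sheafTensor (tildePresheaf T) (𝕜 R) V) :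
    M.ev V (tildeAug T V f) = sheafEv T V f :=
  congrArg Subtype.val ((AlgEquiv.ofInjective (M.ev V) (M.ev_injective V)).apply_symm_apply
    ⟨sheafEv T V f, sheafEv_mem_range T f⟩)

/-- The sheaf of fractions of a deformation of algebras. -/
def tildePre : PreSheafDef K R O where
  alg := tildePresheaf T
  br := tildeBr T
  br_res h a b := rfl
  aug := tildeAug T
  aug_res {V W} h f := M.ev_injective W (funext fun x => by
    rw [ev_tildeAug, M.ev_res, ev_tildeAug]
    rfl)

theorem sy_tilde {V : Opens X} {x : X} (hx : x ∈ V) (t : Sec (tildePre T).alg V) :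
    M.sy (tildePre T) hx t = (T 0).ε (comp T t ⟨x, hx⟩ 0) := by
  rw [AffModel.sy_eq]
  refine (congrFun (ev_tildeAug T _) ⟨x, hx⟩).trans ?_
  exact tensorEv_one_tmul T x (germ (tildePresheaf T) hx t)

end Aug

section TildeFormal

variable {K R : Type u} [Field K] [CommRing R] [Algebra K R] [IsLocalRing R] [ParameterAlgebra K R]
  {X : TopCat.{u}} {O : TopCat.Presheaf (CommAlgCat.{u} K) X} {M : AffModel O} {κ : DefKind}
  {A : AlgDef K R (O.obj (op ⊤)) κ} (T : ∀ m, FracModel (symbol M A) A.br κ m)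

/-- The sections which vanish up to a given order. -/
def tildeFilt (V : Opens X) (n : ℕ) : Submodule R (Sec (tildePresheaf T) V) where
  carrier := {f | ∀ x, ∀ m < n, comp T f x m = 0}
  zero_mem' _ _ _ := rfl
  add_mem' {f g} hf hg x m hm := by rw [comp_add, hf x m hm, hg x m hm, add_zero]
  smul_mem' r f hf x m hm := by rw [comp_smul, hf x m hm, smul_zero]

variable {T}

/-- The numerator of a fraction which vanishes up to a given order. -/
theorem mem_adicFilt_of_frac {n N : ℕ} {f : ∀ m, (T m).Q} {s a : A.carrier}
    (e : ∀ m ≤ N, (T m).ι s * f m = (T m).ι a) (hn : n ≤ N + 1) (hf : ∀ m < n, f m = 0) :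
    a ∈ adicFilt R A.carrier n := by
  cases n with
  | zero => rw [adicFilt, pow_zero, Ideal.one_eq_top, Submodule.top_smul]; trivial
  | succ n =>
    rw [← (T n).ι_eq_zero_iff, ← e n (by omega), hf n (by omega), mul_zero]

theorem eq_zero_of_frac {x : X} {m n : ℕ} {q : (T m).Q} {s a : A.carrier} (hs : s ∈ den M A x)
    (e : (T m).ι s * q = (T m).ι a) (ha : a ∈ adicFilt R A.carrier n) (hm : m < n) : q = 0 := by
  have h : (T m).ι a = 0 := ((T m).ι_eq_zero_iff a).2
    (Submodule.smul_mono_left (Ideal.pow_le_pow_right hm) ha)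
  exact (isUnit_ι T hs m).mul_left_cancel (by rw [e, h, mul_zero])

theorem smul_mem_adicFilt {N : Type u} [AddCommGroup N] [Module R N] {i n : ℕ} {r : R} {a : N}
    (hr : r ∈ 𝔪 R ^ i) (ha : a ∈ adicFilt R N n) : r • a ∈ adicFilt R N (n + i) := by
  rw [adicFilt, add_comm, pow_add, Submodule.mul_smul]
  exact Submodule.smul_mem_smul hr ha

theorem isFormal_tilde [IsNoetherianRing R] : IsFormal M (tildePre T) (tildeFilt T) where
  mem_zero V t x m hm := absurd hm (Nat.not_lt_zero m)
  antitone V n n' h t ht x m hm := ht x m (hm.trans_le h)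
  sep V t ht := comp_ext fun x m => ht (m + 1) x m m.lt_succ_self
  res_mem h n t ht x m hm := ht ⟨x.1, h x.2⟩ m hm
  mem_of_local H x m hm := by
    obtain ⟨W, hW, hx, h⟩ := H x.1 x.2
    exact h ⟨x.1, hx⟩ m hm
  smul_mem {V i n r t} hr ht x m hm := by
    by_cases h : m < n
    · exact (comp_smul r t x m).trans (by rw [ht x m h, smul_zero])
    · obtain ⟨s, a, hs, e⟩ := comp_frac t x m
      have ha := mem_adicFilt_of_frac e (by omega : n ≤ m + 1) (ht x)
      refine eq_zero_of_frac (a := r • a) hs ?_ (smul_mem_adicFilt hr ha) hm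
      refine (congrArg ((T m).ι s * ·) (comp_smul r t x m)).trans ?_
      rw [mul_smul_comm, e m le_rfl, map_smul]
  mul_mem s t ht x m hm := (comp_mul s t x m).trans (by rw [ht x m hm, mul_zero])
  glue V W hW hx τ h1 h2 := by
    have h1' : ∀ n x y z (hz : z ∈ W n x) (hz' : z ∈ W n y) m, m < n →
        comp T (τ n x) ⟨z, hz⟩ m = comp T (τ n y) ⟨z, hz'⟩ m := fun n x y z hz hz' m hm => by
      have hz2 : z ∈ W n x ⊓ W n y := ⟨hz, hz'⟩
      exact sub_eq_zero.1 (h1 n x y ⟨z, hz2⟩ m hm)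
    have h2' : ∀ m x k, comp T (τ (m + 1 + k) x) ⟨x.1, hx _ x⟩ m =
        comp T (τ (m + 1) x) ⟨x.1, hx _ x⟩ m := fun m x k => by
      induction k with
      | zero => rfl
      | succ k ih =>
        have hz : x.1 ∈ W (m + 1 + k + 1) x ⊓ W (m + 1 + k) x := ⟨hx _ x, hx _ x⟩
        rw [← ih]
        exact sub_eq_zero.1 (h2 (m + 1 + k) x ⟨x.1, hz⟩ m (by omega))
    have h3 : ∀ m n x, m < n → comp T (τ n x) ⟨x.1, hx _ x⟩ m =
        comp T (τ (m + 1) x) ⟨x.1, hx _ x⟩ m := fun m n x hm => by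
      obtain ⟨k, rfl⟩ := Nat.exists_eq_add_of_le (Nat.succ_le_of_lt hm)
      exact h2' m x k
    let t : tilde T V := ⟨fun x m => comp T (τ (m + 1) x) ⟨x.1, hx _ x⟩ m, fun x y => funext fun m => by
        obtain ⟨z, hz, hz'⟩ := M.nonempty_inter (hx (m + 1) x) (hx (m + 1) y)
        exact (comp_const (τ (m + 1) x) _ ⟨z, hz⟩ m).trans
          ((h1' _ x y z hz hz' m m.lt_succ_self).trans (comp_const (τ (m + 1) y) _ _ m)),
      fun x n => (comp_frac (τ (n + 1) x) ⟨x.1, hx _ x⟩ n).congr fun m hm => h3 m _ x (by omega)⟩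
    refine ⟨t, fun n x y m hm => ?_⟩
    refine sub_eq_zero.2 ?_
    change comp T (τ (m + 1) ⟨y.1, hW n x y.2⟩) _ m = comp T (τ n x) y m
    rw [← h3 m n _ hm]
    exact h1' n _ x y.1 _ y.2 m hm
  mem_one_iff {V t} := by
    refine ⟨fun h x hx => ?_, fun h x m hm => ?_⟩
    · rw [sy_tilde, h ⟨x, hx⟩ 0 one_pos, map_zero]
    · obtain rfl : m = 0 := by omega
      have := h x.1 x.2
      rw [sy_tilde] at this
      exact FracModel.ε_eq_zero (symbol_eq_zero_iff M A) this
  exists_sy_eq V h x hx := by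
    obtain ⟨s, c, hs, e⟩ := M.exists_frac V h ⟨x, hx⟩
    obtain ⟨s, rfl⟩ := A.red_surjective s
    obtain ⟨a, rfl⟩ := A.red_surjective c
    obtain ⟨t, ht⟩ := exists_section_frac (T := T) (W := V ⊓ M.D (A.red s)) inf_le_right a
    have hx' : x ∈ V ⊓ M.D (A.red s) := ⟨hx, hs⟩
    refine ⟨V ⊓ M.D (A.red s), inf_le_left, hx', t, ?_⟩
    have h1 := congrArg (T 0).ε (ht ⟨x, hx'⟩ 0)
    rw [map_mul, (T 0).ε_ι, (T 0).ε_ι] at h1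
    exact (sy_tilde T hx' t).trans ((M.isUnit_lam hs).mul_left_cancel (h1.trans e.symm))
  gen {V n t} ht ι _ r hr x hx := by
    obtain ⟨s, a, hs, e⟩ := comp_frac t ⟨x, hx⟩ n
    have ha := mem_adicFilt_of_frac e (Nat.le_succ n) (ht ⟨x, hx⟩)
    obtain ⟨b, hb⟩ := hr.exists_sub_sum_mem ha
    choose u hu using fun j => exists_section_frac (T := T) (W := V ⊓ M.D (A.red s)) (s := s)
      inf_le_right (b j)
    have hx' : x ∈ V ⊓ M.D (A.red s) := ⟨hx, hs⟩
    refine ⟨V ⊓ M.D (A.red s), inf_le_left, hx', u, fun y m hm => ?_⟩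
    refine eq_zero_of_frac (x := x) (a := a - ∑ j, r j • b j) hs ?_ hb hm
    refine (congrArg ((T m).ι s * ·) ((comp_sub _ _ y m).trans
      (congrArg (comp T t ⟨y.1, y.2.1⟩ m - ·) (comp_sum _ _ y m)))).trans ?_
    rw [mul_sub, comp_const t _ ⟨x, hx⟩, e m (by omega), Finset.mul_sum, map_sub, map_sum]
    refine congrArg _ (Finset.sum_congr rfl fun j _ => ?_)
    refine (congrArg ((T m).ι s * ·) (comp_smul (r j) (u j) y m)).trans ?_
    rw [mul_smul_comm, hu, map_smul]
  indep {V} n ι _ r hr a h j x m hm := by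
    obtain rfl : m = 0 := by omega
    obtain ⟨s, b, hs, e⟩ := exists_common_den (T := T) (U := den M A x.1) (n := n)
      (f := fun j => comp T (a j) x) (symbol_eq_zero_iff M A) Finset.univ
      fun j _ => comp_frac (a j) x n
    have h1 : ∑ j, r j • b j ∈ adicFilt R A.carrier (n + 1) := by
      rw [← (T n).ι_eq_zero_iff, map_sum]
      have h2 := (comp_sum Finset.univ (fun j => r j • a j) x n).symm.trans (h x n n.lt_succ_self)
      refine Eq.trans (Finset.sum_congr rfl fun j _ => ?_)
        ((Finset.mul_sum Finset.univ _ ((T n).ι s)).symm.trans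
          ((congrArg ((T n).ι s * ·) h2).trans (mul_zero _)))
      refine Eq.trans ?_ (congrArg ((T n).ι s * ·) (comp_smul (r j) (a j) x n).symm)
      rw [mul_smul_comm, e j (Finset.mem_univ j) n le_rfl, map_smul]
    have := A.isDeformation.flat
    exact eq_zero_of_frac hs (e j (Finset.mem_univ j) 0 (Nat.zero_le n))
      (hr.mem_adicFilt_of_flat h1 j) one_pos

end TildeFormal

section EssSurj

variable {K R : Type u} [Field K] [CommRing R] [Algebra K R] [IsLocalRing R] [ParameterAlgebra K R]
  {X : TopCat.{u}} {O : TopCat.Presheaf (CommAlgCat.{u} K) X} {M : AffModel O} {κ : DefKind}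
  {A : AlgDef K R (O.obj (op ⊤)) κ} (T : ∀ m, FracModel (symbol M A) A.br κ m)

/-- The map `A → Γ(X, A~)`. -/
def toTilde : A.carrier →ₐ[R] Sec (tildePresheaf T) ⊤ where
  toFun a := constSec T (fun m => (T m).ι a) fun _ _ n => isFracAt_ι n a
  map_one' := comp_ext fun x m => map_one (T m).ι
  map_mul' a b := comp_ext fun x m => map_mul (T m).ι a b
  map_zero' := comp_ext fun x m => map_zero (T m).ι
  map_add' a b := comp_ext fun x m => map_add (T m).ι a b
  commutes' r := comp_ext fun x m => (T m).ι.commutes r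

theorem comp_toTilde (a : A.carrier) (x : (⊤ : Opens X)) (m : ℕ) :
    comp T (toTilde T a) x m = (T m).ι a := rfl

theorem toTilde_br (a b : A.carrier) :
    toTilde T (A.br a b) = tildeBr T ⊤ (toTilde T a) (toTilde T b) :=
  comp_ext fun x m => ((T m).bracket_ι a b).symm

variable {T}

theorem ev_aug_gamma (t : Sec (tildePresheaf T) ⊤) (x : (⊤ : Opens X)) :
    M.ev ⊤ ((tildePre T).gamma.aug (1 ⊗ₜ t)) x = (T 0).ε (comp T t x 0) :=
  sy_tilde T x.2 t

theorem aug_toTilde (a : A.carrier) :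
    (tildePre T).gamma.aug (1 ⊗ₜ toTilde T a) = A.aug (1 ⊗ₜ a) :=
  M.ev_injective ⊤ (funext fun x => by
    refine (ev_aug_gamma (toTilde T a) x).trans ?_
    rw [comp_toTilde, (T 0).ε_ι, M.ev_top]
    rfl)

variable [IsNoetherianRing R]

theorem flatFilt_adicFilt {N : Type u} [AddCommGroup N] [Module R N] [Module.Flat R N]
    (h : IsAdicComplete (𝔪 R) N) : FlatFilt (adicFilt R N) where
  toIsCompleteFilt := isCompleteFilt_adicFilt h
  mem_zero a := by rw [adicFilt, pow_zero, Ideal.one_eq_top, Submodule.top_smul]; trivial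
  smul_mem := smul_mem_adicFilt
  le_sup n := le_sup_left
  indep n ι _ r hr a ha j := hr.mem_adicFilt_of_flat ha j

theorem mem_tildeFilt_one_iff {t : Sec (tildePresheaf T) ⊤} :
    t ∈ tildeFilt T ⊤ 1 ↔ (tildePre T).gamma.aug (1 ⊗ₜ t) = 0 := by
  refine (isFormal_tilde (T := T)).mem_one_iff.trans
    ⟨fun h => M.ev_injective ⊤ (funext fun x => ?_), fun h x hx => ?_⟩
  · rw [map_zero]
    exact h x.1 x.2
  · have : M.ev ⊤ ((tildePre T).gamma.aug (1 ⊗ₜ t)) ⟨x, hx⟩ = 0 := by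
      rw [h, map_zero]; rfl
    exact this

theorem bijective_toTilde : Function.Bijective (toTilde T) := by
  have := A.isDeformation.flat
  have h1 := flatFilt_adicFilt A.isDeformation.complete
  have h2 := (isFormal_tilde (T := T)).flatFilt_top
  refine FlatFilt.bijective (R := R) (M := A.carrier) (N := Sec (tildePre T).alg ⊤) h1 h2
    (toTilde T).toLinearMap (fun a ha => ?_) fun y => ?_
  · have h3 := mem_tildeFilt_one_iff.1 ha
    exact A.red_eq_zero_iff.1 ((aug_toTilde a).symm.trans h3)
  · obtain ⟨a, ha⟩ := A.red_surjective ((tildePre T).gamma.aug (1 ⊗ₜ y))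
    refine ⟨a, mem_tildeFilt_one_iff.2 ?_⟩
    have h3 := aug_toTilde (T := T) a
    refine (congrArg (tildePre T).gamma.aug
      (TensorProduct.tmul_sub (1 : 𝕜 R) y (toTilde T a))).trans ?_
    exact (map_sub (tildePre T).gamma.aug _ _).trans (sub_eq_zero.2 (ha.symm.trans h3.symm))

omit [IsNoetherianRing R] in
theorem ε_bracket (p q : (T 0).Q) : (T 0).ε ((T 0).bracket p q) = 0 := by
  have h1 : ∀ a b, (T 0).ε ((T 0).bracket ((T 0).ι a) ((T 0).ι b)) = 0 := fun a b => by
    rw [(T 0).bracket_ι, (T 0).ε_ι, symbol_apply, A.red_apply, A.isDeformation.aug_br, map_zero]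
  have h2 : ∀ a q, (T 0).ε ((T 0).bracket ((T 0).ι a) q) = 0 := fun a q => by
    obtain ⟨s, c, hs, e⟩ := (T 0).exists_mul_eq q
    have h3 := h1 a c
    rw [← e, (T 0).kind.leibniz_mul, map_add, map_mul, map_mul, h1, zero_mul, zero_add,
      (T 0).ε_ι] at h3
    exact hs.mul_right_eq_zero.1 h3
  obtain ⟨s, c, hs, e⟩ := (T 0).exists_mul_eq p
  have h3 := h2 c q
  rw [← e, FracModel.bracket_mul_left, map_add, map_mul, map_mul, h2, zero_mul, zero_add,
    (T 0).ε_ι] at h3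
  exact hs.mul_right_eq_zero.1 h3

theorem isDeformation_tilde : (tildePre T).IsDeformation κ :=
  isFormal_tilde.isDeformation tildeBr_kind fun V x hx a b => (sy_tilde T hx _).trans (ε_bracket _ _)

include M in
theorem essSurj_gamma [CharZero K] (h : GammaPreserves K R O κ) : (gamma h).functor.EssSurj where
  mem_essImage A := by
    have := A.isDeformation.flat
    let T := fun m => (nonempty_fracModel (symbol_eq_zero_iff M A) A.isDeformation.kind m).some
    let 𝒜 : SheafDef K R O κ := ⟨tildePre T, isDeformation_tilde⟩
    let e : AlgGauge A.toPreAlgDef 𝒜.gamma :=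
      { toEquiv := AlgEquiv.ofBijective (toTilde T) bijective_toTilde
        map_br := toTilde_br T
        map_aug := aug_toTilde }
    exact ⟨𝒜, ⟨(Groupoid.isoEquivHom _ _).symm (Groupoid.inv (show A ⟶ (gamma h).functor.obj 𝒜 from e))⟩⟩

end EssSurj

/-! ### Affine models of affine schemes -/

section AffineScheme

variable {K : Type u} [Field K] {Y : Scheme.{u}} (g : Y ⟶ Spec (.of K))

theorem genericPoint_mem [IrreducibleSpace Y] {V : Y.Opens} {x : Y} (hx : x ∈ V) :
    genericPoint Y ∈ V :=
  (genericPoint_specializes x).mem_open V.2 hx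

theorem forall_mem_basicOpen_iff [IsAffine Y] (f : Γ(Y, ⊤)) (T : Set Γ(Y, ⊤)) :
    (∀ x ∈ Y.basicOpen f, ∃ t ∈ T, x ∈ Y.basicOpen t) ↔ ∃ N : ℕ, f ^ N ∈ Ideal.span T := by
  have h : ∀ (t : Γ(Y, ⊤)) (x : Y),
      x ∈ Y.basicOpen t ↔ t ∉ (Y.toSpecΓ x : PrimeSpectrum Γ(Y, ⊤)).asIdeal := fun t x => by
    rw [← Scheme.toSpecΓ_preimage_basicOpen]
    rfl
  have h1 := PrimeSpectrum.zeroLocus_subset_zeroLocus_iff (Ideal.span T) (Ideal.span {f})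
  rw [Ideal.span_singleton_le_iff_mem] at h1
  refine Iff.trans ?_ h1
  rw [PrimeSpectrum.zeroLocus_span, PrimeSpectrum.zeroLocus_span]
  constructor
  · intro H p hp
    obtain ⟨x, hx⟩ := Scheme.Hom.surjective Y.toSpecΓ p
    rw [PrimeSpectrum.mem_zeroLocus, Set.singleton_subset_iff]
    by_contra hf
    obtain ⟨t, ht, hxt⟩ := H x ((h f x).2 (by rw [hx]; exact hf))
    rw [h, hx] at hxt
    exact hxt ((PrimeSpectrum.mem_zeroLocus _ _).1 hp ht)
  · intro H x hx
    by_contra! hT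
    refine (h f x).1 hx ?_
    have h2 : (Y.toSpecΓ x : PrimeSpectrum Γ(Y, ⊤)) ∈ PrimeSpectrum.zeroLocus T := fun t ht => by
      by_contra hxt
      exact hT t ht ((h t x).2 hxt)
    exact H h2 rfl

/-- The germ at the generic point of a section over a nonempty open set. -/
def germGeneric [IrreducibleSpace Y] {V : Y.Opens} (hV : genericPoint Y ∈ V) :
    Γ(Y, V) →+* Y.presheaf.stalk (genericPoint Y) :=
  (Y.presheaf.germ V _ hV).hom

theorem germGeneric_res [IrreducibleSpace Y] {V W : Y.Opens} (h : W ≤ V)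
    (hW : genericPoint Y ∈ W) (s : Γ(Y, V)) :
    germGeneric hW ((Y.presheaf.map (homOfLE h).op).hom s) = germGeneric (h hW) s :=
  TopCat.Presheaf.germ_res_apply Y.presheaf (homOfLE h) _ hW s

theorem germGeneric_structureMap [IrreducibleSpace Y] {V : Y.Opens} (hV : genericPoint Y ∈ V)
    (c : K) : germGeneric hV (structureMap g V c) =
      germGeneric (Opens.mem_top (genericPoint Y)) (structureMap g ⊤ c) := by
  rw [← map_structureMap g (homOfLE (le_top : V ≤ ⊤)).op c, germGeneric_res le_top]

theorem eq_of_germGeneric [AlgebraicGeometry.IsIntegral Y] {V : Y.Opens} {s t : Γ(Y, V)}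
    (h : ∀ x (hx : x ∈ V), germGeneric (genericPoint_mem hx) s = germGeneric (genericPoint_mem hx) t) :
    s = t := by
  by_cases hV : ∃ x, x ∈ V
  · obtain ⟨x, hx⟩ := hV
    exact germ_injective_of_isIntegral Y _ (genericPoint_mem hx) (h x hx)
  · obtain rfl : V = ⊥ := Opens.ext (Set.eq_empty_of_forall_notMem fun x hx => hV ⟨x, hx⟩)
    exact Subsingleton.elim s t

theorem exists_section_of_germGeneric [AlgebraicGeometry.IsIntegral Y] {V : Y.Opens}
    {σ : Y.presheaf.stalk (genericPoint Y)}
    (H : ∀ x ∈ V, ∃ s c : Γ(Y, ⊤), x ∈ Y.basicOpen s ∧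
      germGeneric (Opens.mem_top (genericPoint Y)) s * σ =
        germGeneric (Opens.mem_top (genericPoint Y)) c) :
    ∃ h : Γ(Y, V), ∀ x (hx : x ∈ V), germGeneric (genericPoint_mem hx) h = σ := by
  have key : ∀ x : V, ∃ (W : Y.Opens) (_ : W ≤ V) (_ : x.1 ∈ W) (t : Γ(Y, W)),
      ∀ y (hy : y ∈ W), germGeneric (genericPoint_mem hy) t = σ := fun x => by
    obtain ⟨s, c, hx, e⟩ := H x.1 x.2
    have hu : IsUnit ((Y.presheaf.map (homOfLE (Y.basicOpen_le s)).op).hom s) :=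
      RingedSpace.isUnit_res_basicOpen Y.toRingedSpace s
    obtain ⟨v, hv⟩ := hu
    let t : Γ(Y, Y.basicOpen s) := ↑v⁻¹ * (Y.presheaf.map (homOfLE (Y.basicOpen_le s)).op).hom c
    have ht : (Y.presheaf.map (homOfLE (Y.basicOpen_le s)).op).hom s * t =
        (Y.presheaf.map (homOfLE (Y.basicOpen_le s)).op).hom c := by
      rw [← hv]
      exact Units.mul_inv_cancel_left v _
    refine ⟨V ⊓ Y.basicOpen s, inf_le_left, ⟨x.2, hx⟩,
      (Y.presheaf.map (homOfLE inf_le_right).op).hom t, fun y hy => ?_⟩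
    rw [germGeneric_res inf_le_right]
    have h1 := congrArg (germGeneric (genericPoint_mem hy.2)) ht
    rw [map_mul, germGeneric_res, germGeneric_res] at h1
    exact ((Y.mem_basicOpen_top s _).1 (genericPoint_mem hx)).mul_left_cancel (h1.trans e.symm)
  choose W hW hxW t ht using key
  obtain ⟨h, hh, -⟩ := Y.sheaf.existsUnique_gluing' W V (fun x => homOfLE (hW x))
    (fun x hx => Opens.mem_iSup.2 ⟨⟨x, hx⟩, hxW _⟩) t fun x y => eq_of_germGeneric fun z hz => by
      have h1 := germGeneric_res (inf_le_left : W x ⊓ W y ≤ W x) (genericPoint_mem hz) (t x)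
      have h2 := germGeneric_res (inf_le_right : W x ⊓ W y ≤ W y) (genericPoint_mem hz) (t y)
      exact (h1.trans (ht x z hz.1)).trans (h2.trans (ht y z hz.2)).symm
  refine ⟨h, fun x hx => ?_⟩
  have h1 := germGeneric_res (hW ⟨x, hx⟩) (genericPoint_mem (hxW ⟨x, hx⟩)) h
  rw [← h1, ← ht ⟨x, hx⟩ x (hxW _)]
  exact congrArg _ (hh ⟨x, hx⟩)

/-- The affine model of an integral affine scheme. -/
def affModelOfIsIntegral [IsAffine Y] [AlgebraicGeometry.IsIntegral Y] :
    AffModel (structurePresheaf g) :=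
  letI : Algebra K (Y.presheaf.stalk (genericPoint Y)) :=
    ((germGeneric (Opens.mem_top (genericPoint Y))).comp (structureMap g ⊤)).toAlgebra
  have hfrac : ∀ (V : Y.Opens) (h : Γ(Y, V)) (x : V), ∃ s c : Γ(Y, ⊤), x.1 ∈ Y.basicOpen s ∧
      germGeneric (Opens.mem_top (genericPoint Y)) s * germGeneric (genericPoint_mem x.2) h =
        germGeneric (Opens.mem_top (genericPoint Y)) c := fun V h x => by
    obtain ⟨s, hs, hx⟩ := (isAffineOpen_top Y).exists_basicOpen_le x (Opens.mem_top x.1)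
    have := (isAffineOpen_top Y).isLocalization_basicOpen s
    have hg := genericPoint_mem hx
    obtain ⟨⟨c, t⟩, e⟩ := IsLocalization.surj (Submonoid.powers s)
      ((Y.presheaf.map (homOfLE hs).op).hom h)
    obtain ⟨n, hn⟩ := t.2
    refine ⟨s ^ (n + 1), s * c, ?_, ?_⟩
    · rw [Scheme.basicOpen_pow _ _ (Nat.succ_pos n)]
      exact hx
    · have e' := congrArg (germGeneric hg) e
      rw [map_mul, germGeneric_res] at e'
      have h1 : ∀ a : Γ(Y, ⊤), germGeneric hg (algebraMap Γ(Y, ⊤) Γ(Y, Y.basicOpen s) a) =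
          germGeneric (Opens.mem_top (genericPoint Y)) a := fun a =>
        germGeneric_res (Y.basicOpen_le s) hg a
      rw [h1, h1, ← hn, map_pow] at e'
      rw [map_pow, map_mul, ← e', pow_succ]
      ring
  { L := Y.presheaf.stalk (genericPoint Y)
    ev := fun V =>
      { toFun := fun (s : Γ(Y, V)) (x : V) => germGeneric (genericPoint_mem x.2) s
        map_one' := funext fun x => map_one (germGeneric (genericPoint_mem x.2))
        map_mul' := fun s t => funext fun x => map_mul (germGeneric (genericPoint_mem x.2)) s t
        map_zero' := funext fun x => map_zero (germGeneric (genericPoint_mem x.2))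
        map_add' := fun s t => funext fun x => map_add (germGeneric (genericPoint_mem x.2)) s t
        commutes' := fun c => funext fun x =>
          germGeneric_structureMap g (genericPoint_mem x.2) c }
    ev_res := fun h s x => germGeneric_res h (genericPoint_mem x.2) s
    ev_const := fun V s x y => rfl
    ev_injective := fun V s t h => eq_of_germGeneric fun x hx => congrFun h ⟨x, hx⟩
    lam :=
      { germGeneric (Opens.mem_top (genericPoint Y)) with
        commutes' := fun c => rfl }
    lam_injective := germ_injective_of_isIntegral Y _ (Opens.mem_top (genericPoint Y))
    ev_top := fun c x => rfl
    D := fun c => Y.basicOpen (U := ⊤) c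
    isUnit_lam := fun {x c} hx => (Y.mem_basicOpen_top c _).1 (genericPoint_mem hx)
    exists_frac := hfrac
    exists_section := fun V σ H => by
      obtain ⟨h, hh⟩ := exists_section_of_germGeneric H
      exact ⟨h, fun x => hh x.1 x.2⟩
    D_mul := Y.basicOpen_mul (U := ⊤)
    D_one := Y.basicOpen_one (U := ⊤)
    D_basis := fun {V x} hx => by
      obtain ⟨s, hs, hx⟩ := (isAffineOpen_top Y).exists_basicOpen_le ⟨x, hx⟩ (Opens.mem_top x)
      exact ⟨s, hx, hs⟩
    D_le_iff := forall_mem_basicOpen_iff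
    nonempty_inter := fun hx hy => ⟨_, genericPoint_mem hx, genericPoint_mem hy⟩ }

/-- The affine model of the empty scheme. -/
def affModelOfIsEmpty [IsEmpty Y] : AffModel (structurePresheaf g) :=
  have hs : ∀ V : Y.Opens, Subsingleton ((structurePresheaf g).obj (op V)) := fun V =>
    inferInstanceAs (Subsingleton Γ(Y, V))
  letI : Algebra K PUnit.{u + 1} := RingHom.toAlgebra
    { toFun := 0, map_one' := rfl, map_mul' := fun _ _ => rfl, map_zero' := rfl,
      map_add' := fun _ _ => rfl }
  { L := PUnit
    ev := fun V =>
      { toFun := 0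
        map_one' := rfl
        map_mul' := fun _ _ => rfl
        map_zero' := rfl
        map_add' := fun _ _ => rfl
        commutes' := fun _ => rfl }
    ev_res := fun _ _ _ => rfl
    ev_const := fun _ _ _ _ => rfl
    ev_injective := fun V s t _ => Subsingleton.elim (h := hs V) s t
    lam :=
      { toFun := 0
        map_one' := rfl
        map_mul' := fun _ _ => rfl
        map_zero' := rfl
        map_add' := fun _ _ => rfl
        commutes' := fun _ => rfl }
    lam_injective := fun s t _ => Subsingleton.elim (h := hs ⊤) s t
    ev_top := fun _ _ => rfl
    D := fun _ => ⊤
    isUnit_lam := fun {x} => isEmptyElim (α := Y) x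
    exists_frac := fun V h x => isEmptyElim (α := Y) x.1
    exists_section := fun V σ _ => ⟨0, fun x => rfl⟩
    D_mul := fun _ _ => (inf_idem _).symm
    D_one := rfl
    D_basis := fun {V x} => isEmptyElim (α := Y) x
    D_le_iff := fun f T => ⟨fun _ => ⟨0, by
      rw [Subsingleton.elim (h := hs ⊤) (f ^ 0) 0]; exact Ideal.zero_mem _⟩,
      fun _ x => isEmptyElim (α := Y) x⟩
    nonempty_inter := fun {V W x} => isEmptyElim (α := Y) x }

theorem nonempty_affModel {X : Scheme.{u}} [AlgebraicGeometry.IsIntegral X] (f : X ⟶ Spec (.of K))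
    {U : X.Opens} (hU : IsAffineOpen U) : Nonempty (AffModel (structurePresheaf (U.ι ≫ f))) := by
  have : IsAffine U := hU
  cases isEmpty_or_nonempty U
  · exact ⟨affModelOfIsEmpty _⟩
  · have := isIntegral_of_isOpenImmersion U.ι
    exact ⟨affModelOfIsIntegral _⟩

end AffineScheme

end YDef

end

theorem mainTheorem5 (K : Type u) [Field K] [CharZero K]
    (X : Scheme.{u}) (f : X ⟶ Spec (.of K)) [IsIntegral X] [IsSeparated f]
    [LocallyOfFiniteType f] [QuasiCompact f] [Smooth f]
    (U : X.Opens) (hU : IsAffineOpen U)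
    (R : Type u) [CommRing R] [Algebra K R] [IsLocalRing R] [YDef.ParameterAlgebra K R]
    (κ : YDef.DefKind) :
    let O := YDef.structurePresheaf (U.ι ≫ f)
    let C := O.obj (op ⊤)
    (YDef.sheafDef K R O κ).IsCrossedGroupoid ∧ (YDef.algDef K R C κ).IsCrossedGroupoid ∧
    ∃ hΓ : YDef.GammaPreserves K R O κ, (YDef.gamma hΓ).IsEquivalence ∧
      ∀ (R' : Type u) [CommRing R'] [Algebra K R'] [IsLocalRing R'] [YDef.ParameterAlgebra K R']
        [Algebra R R'] [IsScalarTower K R R'],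
        ∃ (hΓ' : YDef.GammaPreserves K R' O κ)
          (hs : ∀ 𝒜 : YDef.SheafDef K R O κ,
            (𝒜.toPreSheafDef.baseChange K R').IsDeformation κ)
          (ha : ∀ A : YDef.AlgDef K R C κ, (A.toPreAlgDef.baseChange K R').IsDeformation κ),
          (YDef.sheafBaseChange K R' hs).IsMorphism ∧ (YDef.algBaseChange K R' ha).IsMorphism ∧
          ∃ θ : ((YDef.gamma hΓ).comp (YDef.algBaseChange K R' ha)).NatIso
              ((YDef.sheafBaseChange K R' hs).comp (YDef.gamma hΓ')),
            ∀ (𝒜 : YDef.SheafDef K R O κ) (a : YDef.complTensor R R' (YDef.Sec 𝒜.alg ⊤)),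
              YDef.AlgGauge.toEquiv (θ.iso.hom.app 𝒜) a = YDef.complToSheaf 𝒜.alg R' ⊤ a := by
  intro O C
  obtain ⟨M⟩ := YDef.nonempty_affModel f hU
  have hR : IsNoetherianRing R := YDef.ParameterAlgebra.isNoetherianRing K
  have hΓ : YDef.GammaPreserves K R O κ := YDef.gammaPreserves M
  refine ⟨YDef.isCrossedGroupoid_sheafDef, YDef.isCrossedGroupoid_algDef C, hΓ,
    { YDef.isMorphism_gamma M hΓ with
      isEquivalence :=
        { faithful := YDef.faithful_gamma (M := M) hΓ
          full := YDef.full_gamma (M := M) hΓ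
          essSurj := YDef.essSurj_gamma (M := M) hΓ }
      bijective_map₂ := YDef.bijective_map₂_gamma M hΓ }, fun R' => ?_⟩
  intro _ _ _ _ _ _
  have hR' : IsNoetherianRing R' := YDef.ParameterAlgebra.isNoetherianRing K
  have hΓ' : YDef.GammaPreserves K R' O κ := YDef.gammaPreserves M
  have hs := fun 𝒜 : YDef.SheafDef K R O κ => 𝒜.isDeformation_baseChange K R' M
  have ha := fun A : YDef.AlgDef K R C κ => A.isDeformation.baseChange K R'
  exact ⟨hΓ', hs, ha, YDef.isMorphism_sheafBaseChange K R' M hs, YDef.isMorphism_algBaseChange K R' ha,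
    YDef.complNatIso K R' M hΓ hΓ' hs ha, fun _ _ => rfl⟩
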